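/- **Notation.** Let $d\ge 1$. For $n\in\mathbb Z$ put $\square_n=(-\tfrac{9^n}{2},\tfrac{9^n}{2})\times(-\tfrac{3^n}{2},\tfrac{3^n}{2})^d\subset\mathbb R\times\mathbb R^d$ and $\mathcal Z_n=9^n\mathbb Z\times 3^n\mathbb Z^d$. $(g)_V=\frac1{|V|}\int_V g$ is the average of $g$ over $V$, and $\|\cdot\|_{\underline L^2(V)}$ is the volume-normalised norm, $\|g\|_{\underline L^2(V)}^2=\frac1{|V|}\int_V|g|^2$. $\nabla$ is the gradient in $x$. *Coefficients.* $\mathbf a:\mathbb R\times\mathbb R^d\to\mathbb R^{d\times d}$ is measurable with $e\cdot\mathbf a e>0$ for $e\ne0$; with $\mathbf s=\frac12(\mathbf a+\mathbf a^t)$, $\mathbf k=\frac12(\mathbf a-\mathbf a^t)$ we assume only $\mathbf s,\mathbf s^{-1}\in L^1_{\rm loc}$ and $\mathbf s^{-1/2}\mathbf k\mathbf s^{-1/2}\in L^\infty_{\rm loc}$. *Energy spaces.* For a cylinder $Q$, $\|u\|_{W^1_{\mathbf s}(Q)}^2=\int_Q|u|^2+\int_Q\nabla u\cdot\mathbf s\nabla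 u$; $W^1_{\mathbf s}(Q)$ and $W^1_{\mathbf s,0}(Q)$ are the closures, in this norm, of the functions smooth in $Q$ and of $C_c^\infty(Q)$, and $W^{-1}_{\mathbf s}(Q)$ is the dual of $W^1_{\mathbf s,0}(Q)$. $\mathcal Y_{\mathbf s,0}((0,T)\times U)$ denotes the space of $v\in W^1_{\mathbf s,0}$ with $\partial_tv\in W^{-1}_{\mathbf s}$, understood as the completion of smooth functions: there are $\varphi_n\in C_c^\infty(\mathbb R\times U)$ with $\varphi_n\to v$ in $W^1_{\mathbf s}((0,T)\times U)$ and $\partial_t\varphi_n\to\partial_tv$ in $W_{\mathbf s}^{-1}((0,T)\times U)$. *Coarse-grained ellipticity.* Let $\mathcal A(Q)$ be the set of $u\in L^1(Q)$ of mean zero with weak gradient $\nabla u\in L^1(Q)$, $\int_Q\nabla u\cdot\mathbf s\nabla u<\infty$, $\partial_tu\in W^{-1}_{\mathbf s}(Q)$ and $\partial_tu=\nabla\cdot\mathbf a\nabla u$ in $Q$, and let $$J(Q,p,q)=\sup_{u\in\mathcal A(Q)}\frac1{|Q|}\int_Q\bigl(-\tfrac12\nabla u\cdot\mathbf s\nabla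 u-p\cdot\mathbf a\nabla u+q\cdot\nabla u\bigr).$$ The symmetric matrices $\mathbf s_*^{-1}(Q)$ and $\mathbf b(Q)$ are given by $J(Q,0,q)=\frac12q\cdot\mathbf s_*^{-1}(Q)q$ and $J(Q,p,0)=\frac12p\cdot\mathbf b(Q)p$. With $|\cdot|$ the spectral norm, $$\Lambda_{s,2}(\square_n)=\sum_{k\le n}3^{2s(k-n)}\max_{z\in\mathcal Z_k\cap\square_n}|\mathbf b(z+\square_k)|,\qquad \lambda_{s,2}(\square_n)=\Bigl(\sum_{k\le n}3^{2s(k-n)}\max_{z\in\mathcal Z_k\cap\square_n}|\mathbf s_*^{-1}(z+\square_k)|\Bigr)^{-1}.$$ *Norms of the data.* Let $I=(0,T)$ with $0<T<\infty$, let $U\subset\mathbb R^d$ be a bounded Lipschitz domain, and let $m$ be the smallest integer with $I\times U\subseteq\square_m$. With $\mathcal Z_j^*=\{z\in\mathcal Z_j:(z+\square_j)\cap(I\times U)\neq\emptyset\}$, $$\|g\|_{\underline B^s_{2,2}(I\times U)}=3^{-sm}|(g)_{I\times U}|+\Bigl(\sum_{j\le m}3^{-2sj}\,\operatorname*{avg}_{z\in\mathcal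 Z^*_{j-1}}\|g-(g)_{(z+\square_j)\cap(I\times U)}\|^2_{\underline L^2((z+\square_j)\cap(I\times U))}\Bigr)^{1/2}.$$ $\|\psi\|_{\underline H^1(U)}=|U|^{-1/d}\|\psi\|_{\underline L^2(U)}+\|\nabla\psi\|_{\underline L^2(U)}$, $\underline H^{-1}(U)$ carries the dual norm of $\underline H^1$ on $H^1_0(U)$ with respect to the pairing $\frac1{|U|}\int_U$, and $\underline L^2(I;\underline H^{-1}(U))$ is normalised in time. $\Delta_U^{-1}$ inverts the Laplacian of $U$ with zero Dirichlet data. Suprema over $t\in I$ are essential suprema. **Proposition (coarse-grained energy estimate).** Let $s\in(0,\frac12)$ and $\varepsilon\in(0,s)$. There is a constant $C=C(I,U,s,\varepsilon,d)<\infty$, which depends on $(I,U)$ only up to the triadic parabolic dilations $(T,U)\mapsto(9^kT,3^kU)$, $k\in\mathbb Z$, such that the following holds for every $\mathbf a$ as above with $\lambda_{s-\varepsilon,2}(\square_m)>0$ and $\Lambda_{s,2}(\square_m)<\infty$. Let $\mathbf f\in B^s_{2,2}(I\times U)^d$, $u_0\in L^2(U)$, and let $g$ be such that all norms of $g$ on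 the right-hand side below are finite. If $u\in W^1_{\mathbf s}(I\times U)$ solves $$\partial_tu-\nabla\cdot\mathbf a\nabla u=\nabla\cdot\mathbf f\ \text{ in } I\times U,\qquad u=g\ \text{ on } I\times\partial U,\qquad u=u_0\ \text{ on }\{0\}\times U,$$ that is, the equation holds in the sense of distributions, $u-g\in\mathcal Y_{\mathbf s,0}(I\times U)$, and $u(t)\to u_0$ in $L^2(U)$ as $t\downarrow0$ (up to a null set of times), then $$\begin{aligned} &|I|^{-1/2}\sup_{t\in I}\|u(t)\|_{\underline L^2(U)}+\|\mathbf s^{1/2}\nabla u\|_{\underline L^2(I\times U)}\\ &\quad\le C3^{sm}\lambda_{s-\varepsilon,2}^{-1/2}(\square_m)\|\mathbf f\|_{\underline B^s_{2,2}(I\times U)}+C|I|^{-1/2}\|u_0\|_{\underline L^2(U)}+C|I|^{-1/2}\sup_{t\in I}\|g(t)\|_{\underline L^2(U)}\\ &\qquad+C3^{sm}\Lambda_{s,2}^{1/2}(\square_m)\|\nabla g\|_{\underline B^s_{2,2}(I\times U)}+C3^{sm}\lambda_{s,2}^{-1/2}(\square_m)\|\nabla\Delta_U^{-1}\partial_tg\|_{\underline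 B^s_{2,2}(I\times U)}\\ &\qquad+C\|\nabla g\|_{\underline L^2(I\times U)}^{1/2}\|\partial_tg\|_{\underline L^2(I;\underline H^{-1}(U))}^{1/2}. \end{aligned}$$ -/

import Mathlib

open MeasureTheory Filter Topology Set
open scoped ENNReal NNReal Pointwise ContDiff Matrix

noncomputable section

namespace CGParabolic

/-! ### Space-time, domains, triadic parabolic cubes -/

/-- Space `ℝ^d` with its Euclidean norm. -/
abbrev Space (d : ℕ) : Type := EuclideanSpace ℝ (Fin d)

/-- Space-time `ℝ × ℝ^d`; a point is `(t, x)`. -/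
abbrev SpaceTime (d : ℕ) : Type := ℝ × Space d

/-- A bounded Lipschitz domain: open, connected, bounded, and near every boundary point the set is,
in some direction `e`, the strict epigraph of a Lipschitz function of the variables
orthogonal to `e`. -/
structure IsLipschitzDomain {d : ℕ} (U : Set (Space d)) : Prop where
  isOpen : IsOpen U
  isConnected : IsConnected U
  isBounded : Bornology.IsBounded U
  boundary : ∀ x ∈ frontier U, ∃ e : Space d, ‖e‖ = 1 ∧ ∃ r : ℝ, 0 < r ∧
    ∃ (K : ℝ≥0) (γ : Space d → ℝ), LipschitzWith K γ ∧ (∀ y (t : ℝ), γ (y + t • e) = γ y) ∧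
      ∀ y ∈ Metric.ball x r, (y ∈ U ↔ γ y < inner ℝ e y)

/-- The cylinder `(0,T) × U`. -/
def cyl {d : ℕ} (T : ℝ) (U : Set (Space d)) : Set (SpaceTime d) := Ioo 0 T ×ˢ U

/-- The parabolic cube `z + (-9^n/2, 9^n/2) × (-3^n/2, 3^n/2)^d`. -/
def cube {d : ℕ} (z : SpaceTime d) (n : ℤ) : Set (SpaceTime d) :=
  {p | |p.1 - z.1| < (3 : ℝ) ^ (2 * n) / 2 ∧ ∀ i, |p.2 i - z.2 i| < (3 : ℝ) ^ n / 2}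

/-- The lattice `9^n ℤ × 3^n ℤ^d`. -/
def lattice (d : ℕ) (n : ℤ) : Set (SpaceTime d) :=
  {z | (∃ i : ℤ, z.1 = (3 : ℝ) ^ (2 * n) * i) ∧ ∀ j, ∃ i : ℤ, z.2 j = (3 : ℝ) ^ n * i}

/-! ### Averages and smooth functions -/

/-- Normalised Lebesgue measure on `V`; integrals against it are averages over `V`, and `eLpNorm`
with respect to it is the volume-normalised `L^p` norm. -/
def avgMeasure {X : Type*} [MeasureSpace X] (V : Set X) : Measure X :=
  (volume V)⁻¹ • volume.restrict V

/-- The average of a non-negative quantity over a set `S` of indices (used for finite `S`). -/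
def avgSum {X : Type*} (S : Set X) (F : X → ℝ≥0∞) : ℝ≥0∞ :=
  (∑' z : S, F z) / (S.encard : ℝ≥0∞)

/-- Time derivative of a smooth function. -/
def dt {d : ℕ} (φ : SpaceTime d → ℝ) (p : SpaceTime d) : ℝ := deriv (fun t => φ (t, p.2)) p.1

/-- Spatial gradient of a smooth function. -/
def dx {d : ℕ} (φ : SpaceTime d → ℝ) (p : SpaceTime d) : Space d :=
  gradient (fun y => φ (p.1, y)) p.2

/-- `φ ∈ C_c^∞(Q)`. -/
structure IsTest {d : ℕ} (Q : Set (SpaceTime d)) (φ : SpaceTime d → ℝ) : Prop where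
  smooth : ContDiff ℝ ∞ φ
  compact : HasCompactSupport φ
  support : tsupport φ ⊆ Q

/-- `Du` is the weak spatial gradient of `u` in `Q`. -/
def HasWeakGradient {d : ℕ} (Q : Set (SpaceTime d)) (u : SpaceTime d → ℝ)
    (Du : SpaceTime d → Space d) : Prop :=
  ∀ φ, IsTest Q φ → ∫ p in Q, u p • dx φ p = - ∫ p in Q, φ p • Du p

/-! ### Coefficient fields -/

/-- The number `v · A w`. -/
def bil {d : ℕ} (A : Matrix (Fin d) (Fin d) ℝ) (v w : Space d) : ℝ := v.ofLp ⬝ᵥ (A *ᵥ w.ofLp)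

/-- Symmetric part of a matrix. -/
def symPart {d : ℕ} (A : Matrix (Fin d) (Fin d) ℝ) : Matrix (Fin d) (Fin d) ℝ :=
  (1 / 2 : ℝ) • (A + Aᵀ)

/-- Skew-symmetric part of a matrix. -/
def skewPart {d : ℕ} (A : Matrix (Fin d) (Fin d) ℝ) : Matrix (Fin d) (Fin d) ℝ :=
  (1 / 2 : ℝ) • (A - Aᵀ)

/-- Space-time matrix fields. -/
abbrev MatField (d : ℕ) : Type := SpaceTime d → Matrix (Fin d) (Fin d) ℝ

/-- The class of admissible coefficient fields: measurable, with `e · a e > 0` for `e ≠ 0`, with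
`s, s⁻¹ ∈ L¹_loc` and `s^{-1/2} k s^{-1/2} ∈ L^∞_loc`, where `s` and `k` are the symmetric and the
skew-symmetric part of `a`. The last condition is written in terms of bilinear forms: the spectral
norm of `s^{-1/2} k s^{-1/2}` is at most `M` if and only if
`|v · k w| ≤ M (v · s v)^{1/2} (w · s w)^{1/2}` for all `v, w`. -/
structure IsCoefficientField {d : ℕ} (a : MatField d) : Prop where
  measurable : ∀ i j, Measurable fun p => a p i j
  pos : ∀ p (e : Space d), e ≠ 0 → 0 < bil (a p) e e
  sym_locInt : ∀ i j, LocallyIntegrable fun p => symPart (a p) i j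
  inv_locInt : ∀ i j, LocallyIntegrable fun p => (symPart (a p))⁻¹ i j
  skew_locBdd : ∀ K : Set (SpaceTime d), IsCompact K → ∃ M : ℝ, ∀ᵐ p ∂(volume.restrict K),
    ∀ v w : Space d, |bil (skewPart (a p)) v w| ≤
      M * √(bil (symPart (a p)) v v) * √(bil (symPart (a p)) w w)

/-! ### The weighted energy spaces -/

/-- `∫_Q |u|² + ∫_Q ∇u · s ∇u`, the square of the norm of `W_s^1(Q)`. -/
def wNormSq {d : ℕ} (a : MatField d) (Q : Set (SpaceTime d)) (u : SpaceTime d → ℝ)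
    (Du : SpaceTime d → Space d) : ℝ≥0∞ :=
  (∫⁻ p in Q, ENNReal.ofReal (u p ^ 2)) +
    ∫⁻ p in Q, ENNReal.ofReal (bil (symPart (a p)) (Du p) (Du p))

/-- `u ∈ W_s^1(Q)` with gradient `Du`: `(u, Du)` is the limit, in the norm of `W_s^1(Q)`, of
functions that are smooth in `Q`. -/
structure MemW {d : ℕ} (a : MatField d) (Q : Set (SpaceTime d)) (u : SpaceTime d → ℝ)
    (Du : SpaceTime d → Space d) : Prop where
  meas : AEStronglyMeasurable u (volume.restrict Q)
  meas_grad : AEStronglyMeasurable Du (volume.restrict Q)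
  finite : wNormSq a Q u Du < ⊤
  approx : ∃ φ : ℕ → SpaceTime d → ℝ, (∀ n, ContDiffOn ℝ ∞ (φ n) Q) ∧
    Tendsto (fun n => wNormSq a Q (fun p => u p - φ n p) (fun p => Du p - dx (φ n) p)) atTop (𝓝 0)

/-- `u ∈ W_{s,0}^1(Q)` with gradient `Du`: the same with approximations in `C_c^∞(Q)`. -/
structure MemW0 {d : ℕ} (a : MatField d) (Q : Set (SpaceTime d)) (u : SpaceTime d → ℝ)
    (Du : SpaceTime d → Space d) : Prop where
  meas : AEStronglyMeasurable u (volume.restrict Q)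
  meas_grad : AEStronglyMeasurable Du (volume.restrict Q)
  approx : ∃ φ : ℕ → SpaceTime d → ℝ, (∀ n, IsTest Q (φ n)) ∧
    Tendsto (fun n => wNormSq a Q (fun p => u p - φ n p) (fun p => Du p - dx (φ n) p)) atTop (𝓝 0)

/-- The norm of the distribution `∂_t v` in `W_s^{-1}(Q)`, the dual of `W_{s,0}^1(Q)`
(`C_c^∞(Q)` is dense in the latter); it is `∞` when `∂_t v` does not belong to `W_s^{-1}(Q)`. -/
def dtDualNorm {d : ℕ} (a : MatField d) (Q : Set (SpaceTime d)) (v : SpaceTime d → ℝ) : ℝ≥0∞ :=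
  ⨆ (φ : SpaceTime d → ℝ) (_ : IsTest Q φ) (_ : wNormSq a Q φ (dx φ) ≤ 1),
    ENNReal.ofReal |∫ p in Q, v p * dt φ p|

/-- The parabolic energy space of functions `v ∈ W_{s,0}^1((0,T) × U)`, with gradient `Dv`, such that
`∂_t v ∈ W_s^{-1}((0,T) × U)`, as the completion of smooth functions: the functions `φ n` below are
smooth up to the times `0` and `T` and vanish near the lateral boundary; they converge to `v` in
`W_s^1` and `∂_t (φ n)` converges to `∂_t v` in `W_s^{-1}`. -/
structure MemParabolic0 {d : ℕ} (a : MatField d) (T : ℝ) (U : Set (Space d)) (v : SpaceTime d → ℝ)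
    (Dv : SpaceTime d → Space d) : Prop where
  meas : AEStronglyMeasurable v (volume.restrict (cyl T U))
  meas_grad : AEStronglyMeasurable Dv (volume.restrict (cyl T U))
  approx : ∃ φ : ℕ → SpaceTime d → ℝ, (∀ n, IsTest ((univ : Set ℝ) ×ˢ U) (φ n)) ∧
    Tendsto (fun n => wNormSq a (cyl T U) (fun p => v p - φ n p) (fun p => Dv p - dx (φ n) p))
      atTop (𝓝 0) ∧
    Tendsto (fun n => dtDualNorm a (cyl T U) (fun p => v p - φ n p)) atTop (𝓝 0)

/-! ### Coarse-grained matrices and ellipticity constants -/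

/-- The space of solutions of `∂_t u = ∇ · a ∇u` in `Q` with finite energy, zero mean and
`∂_t u ∈ W_s^{-1}(Q)`; `Du` is the spatial gradient of `u`. -/
structure IsFreeSolution {d : ℕ} (a : MatField d) (Q : Set (SpaceTime d)) (u : SpaceTime d → ℝ)
    (Du : SpaceTime d → Space d) : Prop where
  integrable : IntegrableOn u Q
  integrable_grad : IntegrableOn Du Q
  weakGradient : HasWeakGradient Q u Du
  energy : IntegrableOn (fun p => bil (symPart (a p)) (Du p) (Du p)) Q
  mean : ∫ p in Q, u p = 0
  dt_mem : dtDualNorm a Q u < ⊤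
  eqn : ∀ φ, IsTest Q φ → ∫ p in Q, u p * dt φ p = ∫ p in Q, bil (a p) (dx φ p) (Du p)

/-- The variational quantity
`J(Q,p,q) = sup_u ⨍_Q (-½ ∇u · s ∇u - p · a ∇u + q · ∇u)`, over the solutions `u` above. -/
def J {d : ℕ} (a : MatField d) (Q : Set (SpaceTime d)) (p q : Space d) : ℝ :=
  sSup {r | ∃ u Du, IsFreeSolution a Q u Du ∧
    r = ∫ y, (-(1 / 2) * bil (symPart (a y)) (Du y) (Du y) - bil (a y) p (Du y)
      + inner ℝ q (Du y)) ∂(avgMeasure Q)}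

/-- Standard basis vectors of `ℝ^d`. -/
def stdVec {d : ℕ} (i : Fin d) : Space d := EuclideanSpace.single i 1

/-- The coarse-grained matrix `s_*^{-1}(Q)`. The coarse-grained matrices `s, s_*, k` are read off from
`J(p,q) = ½ p·s p + ½ (q + k p)·s_*^{-1} (q + k p) - p·q`. So `J(0,q) = ½ q·s_*^{-1} q`, and the
symmetric matrix `s_*^{-1}` is recovered by polarisation. -/
def sStarInv {d : ℕ} (a : MatField d) (Q : Set (SpaceTime d)) : Matrix (Fin d) (Fin d) ℝ :=
  Matrix.of fun i j =>
    J a Q 0 (stdVec i + stdVec j) - J a Q 0 (stdVec i) - J a Q 0 (stdVec j)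

/-- The coarse-grained matrix `b(Q) = (s + kᵗ s_*^{-1} k)(Q)`: the same formula
gives `J(p,0) = ½ p·b p`. -/
def bMat {d : ℕ} (a : MatField d) (Q : Set (SpaceTime d)) : Matrix (Fin d) (Fin d) ℝ :=
  Matrix.of fun i j =>
    J a Q (stdVec i + stdVec j) 0 - J a Q (stdVec i) 0 - J a Q (stdVec j) 0

/-- The spectral norm of a matrix. -/
def specNorm {d : ℕ} (A : Matrix (Fin d) (Fin d) ℝ) : ℝ≥0∞ :=
  ‖Matrix.toEuclideanCLM (n := Fin d) (𝕜 := ℝ) A‖ₑ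

/-- The coarse-grained upper ellipticity constant of the cube of scale `n` at the origin,
`Λ_{s,q} = (∑_{k ≤ n} 3^{sq(k-n)} max_z |b(z + cube_k)|^{q/2})^{2/q}`; here `k = n - j`. -/
def upperEll {d : ℕ} (a : MatField d) (s q : ℝ) (n : ℤ) : ℝ≥0∞ :=
  (∑' j : ℕ, ENNReal.ofReal ((3 : ℝ) ^ (-(s * q * j))) *
    ⨆ z ∈ lattice d (n - j) ∩ cube 0 n, specNorm (bMat a (cube z (n - j))) ^ (q / 2)) ^ (2 / q)

/-- The coarse-grained lower ellipticity constant,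
`λ_{s,q} = (∑_{k ≤ n} 3^{sq(k-n)} max_z |s_*^{-1}(z + cube_k)|^{q/2})^{-2/q}`; here `k = n - j`. -/
def lowerEll {d : ℕ} (a : MatField d) (s q : ℝ) (n : ℤ) : ℝ≥0∞ :=
  (∑' j : ℕ, ENNReal.ofReal ((3 : ℝ) ^ (-(s * q * j))) *
    ⨆ z ∈ lattice d (n - j) ∩ cube 0 n,
      specNorm (sStarInv a (cube z (n - j))) ^ (q / 2)) ^ (-(2 / q))

/-! ### Norms of the data -/

/-- The volume-normalised Besov seminorm `[g]_{B^s_{2,2}(Q)}` of a vector field, where `m` is the scale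
of `Q`: the square root of the sum over `j ≤ m` of `3^{-2sj}` times the average of
`‖g - (g)_V‖²_{L²(V)}`, over `V = (z + cube_j) ∩ Q` with `z` in the lattice of scale `j - 1` such
that `z + cube_{j-1}` meets `Q`. Here `j = m - k`. -/
def besovSemi {d : ℕ} (s : ℝ) (m : ℤ) (Q : Set (SpaceTime d)) (g : SpaceTime d → Space d) : ℝ≥0∞ :=
  (∑' k : ℕ, ENNReal.ofReal ((3 : ℝ) ^ (-(2 * s * ((m - k : ℤ) : ℝ)))) *
    avgSum {z ∈ lattice d (m - k - 1) | (cube z (m - k - 1) ∩ Q).Nonempty} (fun z =>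
      eLpNorm (fun p => g p - ∫ y, g y ∂(avgMeasure (cube z (m - k) ∩ Q))) 2
        (avgMeasure (cube z (m - k) ∩ Q)) ^ 2)) ^ (1 / 2 : ℝ)

/-- The volume-normalised Besov norm `‖g‖_{B^s_{2,2}(Q)} = 3^{-sm} |(g)_Q| + [g]_{B^s_{2,2}(Q)}`. -/
def besovNorm {d : ℕ} (s : ℝ) (m : ℤ) (Q : Set (SpaceTime d)) (g : SpaceTime d → Space d) : ℝ≥0∞ :=
  ENNReal.ofReal ((3 : ℝ) ^ (-(s * m))) * ‖∫ y, g y ∂(avgMeasure Q)‖ₑ + besovSemi s m Q g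

/-- `sup_{t ∈ (0,T)} ‖u(t)‖_{L²(U)}` with the volume-normalised norm. The supremum is the essential one,
so that it does not depend on the representative of `u`. -/
def supL2 {d : ℕ} (T : ℝ) (U : Set (Space d)) (u : SpaceTime d → ℝ) : ℝ≥0∞ :=
  essSup (fun t => eLpNorm (fun x => u (t, x)) 2 (avgMeasure U)) (volume.restrict (Ioo 0 T))

/-- `‖s^{1/2} ∇u‖_{L²(Q)} = (⨍_Q ∇u · s ∇u)^{1/2}`. -/
def energyNorm {d : ℕ} (a : MatField d) (Q : Set (SpaceTime d)) (Du : SpaceTime d → Space d) : ℝ≥0∞ :=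
  (∫⁻ p, ENNReal.ofReal (bil (symPart (a p)) (Du p) (Du p)) ∂(avgMeasure Q)) ^ (1 / 2 : ℝ)

/-- The square of the norm of `L²((0,T); H^1(U))` of a smooth function, with volume normalisation and
`‖ψ‖_{H^1(U)} = |U|^{-1/d} ‖ψ‖_{L²(U)} + ‖∇ψ‖_{L²(U)}`. -/
def l2H1NormSq {d : ℕ} (T : ℝ) (U : Set (Space d)) (φ : SpaceTime d → ℝ) : ℝ≥0∞ :=
  ∫⁻ t, ((volume U) ^ (-(1 / (d : ℝ))) * eLpNorm (fun x => φ (t, x)) 2 (avgMeasure U)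
    + eLpNorm (fun x => dx φ (t, x)) 2 (avgMeasure U)) ^ 2 ∂(avgMeasure (Ioo 0 T))

/-- `‖∂_t g‖_{L²((0,T); H^{-1}(U))}`, volume-normalised: the norm of the distribution `∂_t g` in the
dual of `L²((0,T); H_0^1(U))`, in which `C_c^∞((0,T) × U)` is dense. -/
def dtL2Hm1Norm {d : ℕ} (T : ℝ) (U : Set (Space d)) (g : SpaceTime d → ℝ) : ℝ≥0∞ :=
  ⨆ (φ : SpaceTime d → ℝ) (_ : IsTest (cyl T U) φ) (_ : l2H1NormSq T U φ ≤ 1),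
    ENNReal.ofReal |∫ p, g p * dt φ p ∂(avgMeasure (cyl T U))|

/-- `ψ = Δ_U^{-1} ∂_t g` with gradient `Dψ`, where `Δ_U^{-1}` inverts the Laplacian of `U` with zero
Dirichlet data: `ψ ∈ L²((0,T); H_0^1(U))` (the closure of `C_c^∞((0,T) × U)` in the norm
`(∫ |ψ|² + ∫ |∇ψ|²)^{1/2}`) and `Δψ = ∂_t g` in the sense of distributions in `(0,T) × U`.
These conditions determine `ψ` and `Dψ`. -/
def IsInvLaplacianDt {d : ℕ} (T : ℝ) (U : Set (Space d)) (g : SpaceTime d → ℝ)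
    (ψ : SpaceTime d → ℝ) (Dψ : SpaceTime d → Space d) : Prop :=
  MemW0 (fun _ => (1 : Matrix (Fin d) (Fin d) ℝ)) (cyl T U) ψ Dψ ∧
    ∀ φ, IsTest (cyl T U) φ →
      ∫ p in cyl T U, inner ℝ (Dψ p) (dx φ p) = ∫ p in cyl T U, g p * dt φ p

/-! ### The Cauchy-Dirichlet problem -/

/-- `u ∈ W_s^1((0,T) × U)`, with gradient `Du`, solves `∂_t u - ∇ · a ∇u = ∇ · f` in `(0,T) × U`, with
`u = g` on `(0,T) × ∂U` and `u = u₀` on `{0} × U`. -/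
structure IsSolution {d : ℕ} (a : MatField d) (T : ℝ) (U : Set (Space d))
    (f : SpaceTime d → Space d) (u₀ : Space d → ℝ) (g : SpaceTime d → ℝ)
    (Dg : SpaceTime d → Space d) (u : SpaceTime d → ℝ) (Du : SpaceTime d → Space d) : Prop where
  mem : MemW a (cyl T U) u Du
  /-- the lateral boundary condition -/
  lateral : MemParabolic0 a T U (fun p => u p - g p) (fun p => Du p - Dg p)
  eqn : ∀ φ, IsTest (cyl T U) φ → ∫ p in cyl T U, u p * dt φ p =
    ∫ p in cyl T U, (bil (a p) (dx φ p) (Du p) + inner ℝ (f p) (dx φ p))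
  /-- the initial condition, as a limit in `L²(U)` as `t ↓ 0`, up to a null set of times -/
  initial : Tendsto (fun t => eLpNorm (fun x => u (t, x) - u₀ x) 2 (volume.restrict U))
    (𝓝[>] 0 ⊓ ae volume) (𝓝 0)

end CGParabolic

end

open CGParabolic

/-!
# The coarse-grained energy estimate

Testing the equation of `u` with `u - g` gives an energy inequality between almost all pairs of
times (`IsRegularCylinder.energy_inequality`): the energy of `u` is bounded by the `L²(U)` norm of
`u - g` at the earlier time, by the pairings of `f` and of `∇ψ`, where `ψ = Δ_U⁻¹ ∂_t g`, with `∇u`,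
by that of `∇g` with the flux `a∇u`, and by those of `f` and `∇ψ` with `∇g`.

Since `a` is degenerate, the pairings with `∇u` and `a∇u` are not controlled by `L²` norms. They are
bounded by duality over the triadic scales. The integral of `F · η` is the limit of the pairings of
the averages of `F` and `η` over the cubes of scale `k` inside the cylinder (`tendsto_pairing_l1`),
and from one scale to the next the pairing changes by at most the change of the averages of `F`
times the averages of `η` (`abs_le_of_tendsto_pairing`).

* The changes of the averages of `F` are summable against `3 ^ (-2 s k)` if `F` has finite Besov norm
  (`exists_oscBound`). At the boundary, where the cubes of the next scale leave the cylinder, this is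
  a Hardy inequality, and there `s < 1/2` and the regularity of Lipschitz domains at all scales enter.
* The averages of `∇u` and `a∇u` are controlled by the coarse-grained matrices. By definition
  `s_*⁻¹(Q)` and `b(Q)` bound the average gradients and fluxes in `Q` of solutions of the homogeneous
  equation by their energies (`gradBound_sStarInv`, `fluxBound_bMat`). For `u`, one first subtracts, on
  each cube of scale `k`, a solution with the same right-hand side whose average gradient (for
  Dirichlet data), or whose average flux (for Neumann data), vanishes (`sum_grad_le`, `sum_flux_le`).

These correctors come from a Lions type existence lemma (`lions_exists`), which bounds their energy
by the norm of the right-hand side relative to the parabolic operator. That norm is estimated by the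
same duality (`abs_integral_fluct_le`): the averages of a competitor over smaller cubes are
controlled because it nearly solves the adjoint equation, to which the bound for average gradients
passes (`gradBound_adjoint`).

Of the two remaining terms, the pairing of `∇ψ` with `∇g` is estimated in `L²`
(`l2_invLaplacian_le`) and gives the last term of the estimate; that of `f` with `∇g` is absorbed because
the product of the bounds for gradients and fluxes is bounded below (`one_le_mul_bounds`).

The domain enters only through `IsRegularCylinder`, which is invariant under triadic parabolic
dilations; so is, therefore, the constant.
-/

open Bornology (IsBounded)
open Real (sqrt_sq norm_eq_abs sq_sqrt sqrt_mul sqrt_le_iff rpow_natCast rpow_mul sqrt_nonneg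
  norm_of_nonneg dist_eq volume_Ioo sqrt_pos sqrt_le_sqrt rpow_add)
open ENNReal (toReal_nonneg toReal_ofReal toReal_mono ofReal ofReal_toReal ofReal_le_ofReal
  ofReal_lt_top ofReal_ne_top ofReal_mul ofReal_pow ofReal_natCast toReal_pos toReal_mul ofReal_add
  rpow_one pow_lt_top toReal_pow zero_ne_top ofReal_inv_of_pos ofReal_one zero_lt_top)
open Finset (mul_sum sum_mul sum_le_sum sum_nonneg abs_sum_le_sum_abs mem_filter sum_congr
  sum_eq_zero sum_sub_distrib sum_const sum_image sum_add_distrib sum_singleton sum_filter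
  single_le_sum sum_empty)
open MeasureTheory.Measure (restrict_mono volume_eq_prod prod_prod pi_pi prod_restrict)
open EuclideanSpace (norm_sq_eq inner_single_left)
open Metric (isBounded_Ioo ball mem_ball)

noncomputable section

namespace CGParabolic

/-- Vector fields on space-time. -/
abbrev VecField (d : ℕ) : Type := SpaceTime d → Space d

/-- Labels of the cubes of one scale. -/
abbrev Idx (d : ℕ) : Type := ℤ × (Fin d → ℤ)

/-- `𝓛 V` is Lebesgue measure restricted to `V`. -/
notation "𝓛" => Measure.restrict volume

variable {d : ℕ} {a : MatField d} {O O' X Q V : Set (SpaceTime d)}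
  {ξ η F Du Dy f Dψ Dg Dw : VecField d} {φ ψ u g : SpaceTime d → ℝ} {k j m l : ℤ}
  {σ b S M T C s t₁ t₂ c Y A D γ H R r : ℝ} {w : ℤ → ℝ} {U : Set (Space d)} {u₀ : Space d → ℝ}
  {p z : SpaceTime d} {i i' : Idx d}

/-! ### An abstract existence lemma of Lions type -/

lemma lions_exists {W : Type*} [AddCommGroup W] [Module ℝ W] (N B : W →ₗ[ℝ] W →ₗ[ℝ] ℝ)
    (hsymm : ∀ v w, N v w = N w v) (hnonneg : ∀ v, 0 ≤ N v v) (ℓ : W →ₗ[ℝ] ℝ) (K : ℝ)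
    (hK : 0 ≤ K) (hB : ∀ χ, ∃ C, ∀ v, |B v χ| ≤ C * √(N v v))
    (hℓ : ∀ χ c, 0 ≤ c → (∀ v, |B v χ| ≤ c * √(N v v)) → |ℓ χ| ≤ K * c) :
    ∃ v : ℕ → W, (∀ δ > 0, ∃ n₀, ∀ n ≥ n₀, ∀ k ≥ n₀, N (v n - v k) (v n - v k) < δ) ∧
      (∀ χ, Tendsto (fun n => B (v n) χ) atTop (𝓝 (ℓ χ))) ∧
      (∀ δ > 0, ∃ n₀, ∀ n ≥ n₀, N (v n) (v n) ≤ K ^ 2 + δ) := by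
  classical
  let core : PreInnerProductSpace.Core ℝ W :=
    { inner := fun v w => N v w
      conj_inner_symm := fun v w => by simp_all
      re_inner_nonneg := fun v => by simp_all
      add_left := fun x y z => by simp
      smul_left := fun x y r => by simp }
  let _ := InnerProductSpace.Core.toSeminormedAddCommGroup (c := core)
  let _ := InnerProductSpace.ofCore core
  have hinner : ∀ v w : W, inner ℝ v w = N v w := fun v w => rfl
  have hnorm : ∀ v : W, ‖v‖ = √(N v v) := fun v => by
    rw [← hinner, real_inner_self_eq_norm_sq, sqrt_sq (norm_nonneg _)]
  let H := UniformSpace.Completion W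
  -- the Riesz representative of `B (·) χ`
  have hT : ∀ χ, ∃ t : H, ∀ v : W, inner ℝ t v = B v χ := fun χ => by
    obtain ⟨C, hC⟩ := hB χ
    let g := LinearMap.mkContinuous (B.flip χ) C (fun v => by simp_all)
    let G := g.extend (UniformSpace.Completion.toComplL)
    refine ⟨(InnerProductSpace.toDual ℝ H).symm G, fun v => ?_⟩
    rw [InnerProductSpace.toDual_symm_apply]
    have := ContinuousLinearMap.extend_eq g (e := UniformSpace.Completion.toComplL)
      (by simpa using UniformSpace.Completion.denseRange_coe)
      (by simpa using UniformSpace.Completion.isUniformInducing_coe W) v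
    exact this.trans rfl
  choose T hT using hT
  have hdense : DenseRange ((↑) : W → H) := UniformSpace.Completion.denseRange_coe
  have hTunique := fun x y hxy => by
    have h1 := fun z => by
      refine hdense.induction_on (p := fun z => inner ℝ x z = inner ℝ y z) z ?_ hxy
      exact isClosed_eq (by fun_prop) (by fun_prop)
    exact ext_inner_right ℝ h1
  let TL : W →ₗ[ℝ] H :=
    { toFun := T
      map_add' := fun x y => hTunique _ _ fun v => by rw [inner_add_left, hT, hT, hT, map_add]
      map_smul' := fun r x => hTunique _ _ fun v => by rw [inner_smul_left, hT, hT]; simp }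
  have hℓT := fun χ => by
    refine hℓ χ ‖T χ‖ (norm_nonneg _) fun v => ?_
    rw [← hT, ← hnorm, ← UniformSpace.Completion.norm_coe v]
    exact abs_real_inner_le_norm _ _
  have hker : LinearMap.ker TL ≤ LinearMap.ker ℓ := fun χ hχ => by
    have : T χ = 0 := hχ
    have h2 := hℓT χ
    rw [this] at h2
    simpa using h2
  let R := LinearMap.range TL
  -- `T χ ↦ ℓ χ` is bounded by `K` on the range of `T`, and is extended by the Hahn–Banach theorem
  let f₀ := ((LinearMap.ker TL).liftQ ℓ hker).comp TL.quotKerEquivRange.symm.toLinearMap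
  have hf₀ : ∀ χ, f₀ ⟨T χ, ⟨χ, rfl⟩⟩ = ℓ χ := fun χ => by
    have : TL.quotKerEquivRange.symm ⟨T χ, ⟨χ, rfl⟩⟩ = (LinearMap.ker TL).mkQ χ := by
      rw [LinearEquiv.symm_apply_eq]
      rfl
    simp [f₀, LinearMap.comp_apply, LinearEquiv.coe_coe]
    rw [this]
    simp
  let f : StrongDual ℝ R := f₀.mkContinuous K (by
    rintro ⟨_, χ, rfl⟩
    have := hf₀ χ
    have h3 := hℓT χ
    rwa [← this] at h3)
  obtain ⟨g, hg, hgn⟩ := exists_extension_norm_eq R f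
  let h := (InnerProductSpace.toDual ℝ H).symm g
  have hh : ‖h‖ ≤ K := by
    simp [h, LinearIsometryEquiv.norm_map]; rw [hgn]; exact (LinearMap.mkContinuous_norm_le _ hK _)
  have hhT : ∀ χ, inner ℝ (T χ) h = ℓ χ := by
    intro χ
    rw [real_inner_comm, InnerProductSpace.toDual_symm_apply]
    have := hg ⟨T χ, ⟨χ, rfl⟩⟩
    rw [this]
    exact hf₀ χ
  obtain ⟨x, hx, hxh⟩ := mem_closure_iff_seq_limit.1 (hdense h)
  choose v hv using hx
  have hvh : Tendsto (fun n => (v n : H)) atTop (𝓝 h) := by simpa [hv] using hxh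
  refine ⟨v, ?_, ?_, ?_⟩
  · intro δ hδ
    have hc := hvh.cauchySeq
    rw [Metric.cauchySeq_iff] at hc
    obtain ⟨n₀, h₀⟩ := hc (√δ) (by positivity)
    refine ⟨n₀, fun n hn k hk => ?_⟩
    have := h₀ n hn k hk
    rw [dist_eq_norm, ← UniformSpace.Completion.coe_sub, UniformSpace.Completion.norm_coe, hnorm] at this
    exact (Real.sqrt_lt_sqrt_iff (hnonneg _)).1 this
  · intro χ
    have : Tendsto (fun n => inner ℝ (T χ) (v n)) atTop (𝓝 (inner ℝ (T χ) h)) := tendsto_const_nhds.inner hvh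
    rw [hhT] at this
    simpa [hT] using this
  · intro δ hδ
    have h2 : ‖h‖ ^ 2 < K ^ 2 + δ := by
      have := pow_le_pow_left₀ (norm_nonneg h) hh 2
      linarith
    obtain ⟨n₀, h₀⟩ := eventually_atTop.1 ((hvh.norm.pow 2).eventually (eventually_lt_nhds h2))
    refine ⟨n₀, fun n hn => ?_⟩
    have := h₀ n hn
    rw [UniformSpace.Completion.norm_coe, hnorm, sq_sqrt (hnonneg _)] at this
    exact this.le

/-! ### Linear algebra of the coefficients -/

section bil
variable {d : ℕ} (A : Matrix (Fin d) (Fin d) ℝ)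

lemma bil_add_left (v v' w : Space d) : bil A (v + v') w = bil A v w + bil A v' w := by
  simp [bil, add_dotProduct]

lemma bil_add_right (v w w' : Space d) : bil A v (w + w') = bil A v w + bil A v w' := by
  simp [bil, Matrix.mulVec_add, dotProduct_add]

lemma bil_smul_left (r : ℝ) (v w : Space d) : bil A (r • v) w = r * bil A v w := by simp [bil]

lemma bil_smul_right (r : ℝ) (v w : Space d) : bil A v (r • w) = r * bil A v w := by
  simp [bil, Matrix.mulVec_smul]

@[simp] theorem bil_zero_left (w : Space d) : bil A 0 w = 0 := by simp [bil]

@[simp] theorem bil_zero_right (w : Space d) : bil A w 0 = 0 := by simp [bil]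

lemma bil_neg_left (v w : Space d) : bil A (-v) w = -bil A v w := by simp [bil]

lemma bil_neg_right (v w : Space d) : bil A v (-w) = -bil A v w := by simp [bil, Matrix.mulVec_neg]

lemma bil_sub_left (v v' w : Space d) : bil A (v - v') w = bil A v w - bil A v' w := by
  rw [sub_eq_add_neg, bil_add_left, bil_neg_left]; ring

lemma bil_sub_right (v w w' : Space d) : bil A v (w - w') = bil A v w - bil A v w' := by
  rw [sub_eq_add_neg, bil_add_right, bil_neg_right]; ring

lemma bil_transpose (v w : Space d) : bil Aᵀ v w = bil A w v := by
  simp [bil]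
  rw [Matrix.mulVec_transpose, Matrix.dotProduct_mulVec, dotProduct_comm]

lemma bil_symPart (v w : Space d) : bil (symPart A) v w = (bil A v w + bil A w v) / 2 := by
  have : bil (symPart A) v w = (bil A v w + bil Aᵀ v w) / 2 := by
    simp [bil, symPart, Matrix.smul_mulVec, Matrix.add_mulVec, dotProduct_smul, dotProduct_add, smul_eq_mul]
    ring
  rw [this, bil_transpose]

lemma bil_skewPart (v w : Space d) : bil (skewPart A) v w = (bil A v w - bil A w v) / 2 := by
  have : bil (skewPart A) v w = (bil A v w - bil Aᵀ v w) / 2 := by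
    simp [bil, skewPart, Matrix.smul_mulVec, Matrix.sub_mulVec, dotProduct_smul, dotProduct_sub, smul_eq_mul]
    ring
  rw [this, bil_transpose]

lemma bil_eq_sym_add_skew (v w : Space d) : bil A v w = bil (symPart A) v w + bil (skewPart A) v w := by
  rw [bil_symPart, bil_skewPart]; ring

lemma bil_symPart_comm (v w : Space d) : bil (symPart A) v w = bil (symPart A) w v := by
  rw [bil_symPart, bil_symPart]; ring

lemma bil_symPart_self (v : Space d) : bil (symPart A) v v = bil A v v := by rw [bil_symPart]; ring

lemma symPart_transpose : symPart Aᵀ = symPart A := by simp [symPart, add_comm]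

variable {A}

/-- Cauchy–Schwarz for the symmetric part of a matrix with non-negative quadratic form. -/
lemma abs_bil_symPart_le (hA : ∀ e : Space d, 0 ≤ bil A e e) (v w : Space d) :
    |bil (symPart A) v w| ≤ √(bil (symPart A) v v) * √(bil (symPart A) w w) := by
  let B := LinearMap.mk₂ ℝ (bil (symPart A)) (fun x y z => bil_add_left _ x y z) (fun r x y => bil_smul_left _ r x y)
    (fun x y z => bil_add_right _ x y z) (fun r x y => bil_smul_right _ r x y)
  have h1 : ∀ x, 0 ≤ B x x := fun x => by
    simp [B, LinearMap.mk₂_apply]; rw [bil_symPart_self]; exact hA x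
  have h2 := LinearMap.BilinForm.apply_mul_apply_le_of_forall_zero_le B h1 v w
  simp [B, LinearMap.mk₂_apply] at h2
  rw [bil_symPart_comm A w v] at h2
  rw [← sqrt_mul (by rw [bil_symPart_self]; exact hA v)]
  apply Real.abs_le_sqrt
  nlinarith

lemma sqrt_bil_add_le (hA : ∀ e : Space d, 0 ≤ bil A e e) (v w : Space d) :
    √(bil (symPart A) (v + w) (v + w)) ≤ √(bil (symPart A) v v) + √(bil (symPart A) w w) := by
  have hv : 0 ≤ bil (symPart A) v v := by rw [bil_symPart_self]; exact hA v
  have hw : 0 ≤ bil (symPart A) w w := by rw [bil_symPart_self]; exact hA w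
  apply sqrt_le_iff.2
  refine ⟨by positivity, ?_⟩
  have h := (abs_le.1 (abs_bil_symPart_le hA v w)).2
  rw [bil_add_left, bil_add_right, bil_add_right, bil_symPart_comm A w v, add_sq, sq_sqrt hv, sq_sqrt hw]
  linarith

lemma sqrt_bil_smul (r : ℝ) (v : Space d) : √(bil (symPart A) (r • v) (r • v)) = |r| * √(bil (symPart A) v v) := by
  rw [bil_smul_left, bil_smul_right, ← mul_assoc, sqrt_mul (mul_self_nonneg r), Real.sqrt_mul_self_eq_abs]

lemma isUnit_det_symPart (hA : ∀ e : Space d, e ≠ 0 → 0 < bil A e e) : IsUnit (symPart A).det := by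
  rw [← Matrix.isUnit_iff_isUnit_det, ← Matrix.mulVec_injective_iff_isUnit]
  intro x y hxy
  by_contra hne
  have h := hA (WithLp.toLp 2 (x - y)) (fun h0 => by
    apply hne
    exact sub_eq_zero.1 (congrArg WithLp.ofLp h0))
  rw [← bil_symPart_self] at h
  simp [bil, Matrix.mulVec_sub] at h
  simp_all

lemma coord_sq_le (hA : ∀ e : Space d, e ≠ 0 → 0 < bil A e e) (ξ : Space d) (i : Fin d) :
    (ξ i) ^ 2 ≤ (symPart A)⁻¹ i i * bil (symPart A) ξ ξ := by
  have hA' : ∀ e : Space d, 0 ≤ bil A e e := fun e => by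
    by_cases h : e = 0
    · simp [h]
    grind
  set η : Space d := WithLp.toLp 2 ((symPart A)⁻¹ *ᵥ (stdVec i).ofLp) with hη
  have h1 : symPart A *ᵥ η.ofLp = (stdVec i).ofLp := by
    rw [hη]
    simp
    rw [Matrix.mul_nonsing_inv _ (isUnit_det_symPart hA), Matrix.one_mulVec]
  have h2 : bil (symPart A) ξ η = ξ i := by simp [bil, h1]; simp [stdVec]
  have h3 : bil (symPart A) η η = (symPart A)⁻¹ i i := by simp [bil, h1]; simp [hη, stdVec]
  have h4 := abs_bil_symPart_le hA' ξ η
  rw [h2, h3] at h4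
  have h5 : 0 ≤ (symPart A)⁻¹ i i := by rw [← h3, bil_symPart_self]; exact hA' _
  have h6 : 0 ≤ bil (symPart A) ξ ξ := by rw [bil_symPart_self]; exact hA' _
  calc (ξ i) ^ 2 = |ξ i| ^ 2 := (sq_abs _).symm
    _ ≤ (√(bil (symPart A) ξ ξ) * √((symPart A)⁻¹ i i)) ^ 2 := by gcongr
    _ = _ := by grind

end bil

lemma IsCoefficientField.nonneg (h : IsCoefficientField a)
    (p : SpaceTime d) (e : Space d) : 0 ≤ bil (a p) e e := by
  by_cases h0 : e = 0
  · simp [h0]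
  · exact (h.pos p e h0).le

lemma IsCoefficientField.transpose (h : IsCoefficientField a) :
    IsCoefficientField (fun p => (a p)ᵀ) where
  measurable i j := h.measurable j i
  pos p e he := by rw [bil_transpose]; exact h.pos p e he
  sym_locInt i j := by simpa only [symPart_transpose] using h.sym_locInt i j
  inv_locInt i j := by simpa only [symPart_transpose] using h.inv_locInt i j
  skew_locBdd K hK := by
    obtain ⟨M, hM⟩ := h.skew_locBdd K hK
    refine ⟨M, ?_⟩
    filter_upwards [hM] with p hp v w
    rw [symPart_transpose, bil_skewPart, bil_transpose, bil_transpose]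
    have := hp v w
    rw [bil_skewPart] at this
    grind

/-! ### The `L²` norm as a real number -/

section l2
variable {X E F : Type*} [MeasurableSpace X] [NormedAddCommGroup E] [NormedAddCommGroup F]
  {μ : Measure X}

/-- The `L²(μ)` norm as a real number. -/
def l2 (μ : Measure X) (f : X → E) : ℝ := (eLpNorm f 2 μ).toReal

lemma l2_nonneg (f : X → E) : 0 ≤ l2 μ f := toReal_nonneg

lemma l2_sq {f : X → E} (hf : MemLp f 2 μ) : l2 μ f ^ 2 = ∫ x, ‖f x‖ ^ 2 ∂μ := by
  have h := hf.eLpNorm_eq_integral_rpow_norm (by norm_num) (by norm_num)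
  simp at h
  have h0 : 0 ≤ ∫ x, ‖f x‖ ^ 2 ∂μ := integral_nonneg fun x => by positivity
  rw [l2, h, toReal_ofReal (by positivity), ← rpow_natCast, ← rpow_mul h0]
  norm_num

lemma l2_eq_sqrt {f : X → E} (hf : MemLp f 2 μ) : l2 μ f = √(∫ x, ‖f x‖ ^ 2 ∂μ) := by
  rw [← l2_sq hf, sqrt_sq (l2_nonneg f)]

lemma l2_add_le {f g : X → E} (hf : MemLp f 2 μ) (hg : MemLp g 2 μ) : l2 μ (f + g) ≤ l2 μ f + l2 μ g := by
  rw [l2, l2, l2, ← ENNReal.toReal_add hf.2.ne hg.2.ne]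
  exact toReal_mono (by simp [hf.2.ne, hg.2.ne]) (eLpNorm_add_le hf.1 hg.1 (by norm_num))

lemma l2_mono {f : X → E} {g : X → F} (hg : MemLp g 2 μ) (h : ∀ᵐ x ∂μ, ‖f x‖ ≤ ‖g x‖) : l2 μ f ≤ l2 μ g :=
  toReal_mono hg.2.ne (eLpNorm_mono_ae h)

lemma l2_mono_measure {ν : Measure X} {f : X → E} (hf : MemLp f 2 μ) (h : ν ≤ μ) : l2 ν f ≤ l2 μ f :=
  toReal_mono hf.2.ne (eLpNorm_mono_measure f h)

lemma l2_const_mul (r : ℝ) (f : X → ℝ) : l2 μ (fun x => r * f x) = |r| * l2 μ f := by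
  rw [l2, l2, show (fun x => r * f x) = r • f from rfl, eLpNorm_const_smul]
  simp

lemma integrable_norm_mul_norm {f : X → E} {g : X → F} (hf : MemLp f 2 μ) (hg : MemLp g 2 μ) :
    Integrable (fun x => ‖f x‖ * ‖g x‖) μ := MemLp.integrable_mul hf.norm hg.norm

lemma integral_norm_mul_norm_le {f : X → E} {g : X → F} (hf : MemLp f 2 μ) (hg : MemLp g 2 μ) :
    ∫ x, ‖f x‖ * ‖g x‖ ∂μ ≤ l2 μ f * l2 μ g := by
  have hf' := hf.norm
  have hg' := hg.norm
  have h1 : ∫ x, ‖f x‖ * ‖g x‖ ∂μ = inner ℝ (hf'.toLp _) (hg'.toLp _) := by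
    apply integral_congr_ae
    filter_upwards [hf'.coeFn_toLp, hg'.coeFn_toLp] with x h1 h2
    rw [h1, h2]
    simp [mul_comm]
  rw [h1]
  refine (real_inner_le_norm _ _).trans ?_
  rw [Lp.norm_toLp, Lp.norm_toLp, eLpNorm_norm, eLpNorm_norm]
  rfl

end l2

/-! ### Energies of vector fields -/

/-- The pointwise length `|s^{1/2} ξ|`. -/
def nrm (a : MatField d) (ξ : VecField d) (p : SpaceTime d) : ℝ :=
  √(bil (symPart (a p)) (ξ p) (ξ p))

lemma nrm_nonneg (p : SpaceTime d) : 0 ≤ nrm a ξ p := sqrt_nonneg _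

lemma norm_nrm (p : SpaceTime d) : ‖nrm a ξ p‖ = nrm a ξ p := by
  rw [norm_eq_abs, abs_of_nonneg (nrm_nonneg p)]

/-- Measurable fields of finite energy on `O`. -/
structure FinE (a : MatField d) (O : Set (SpaceTime d)) (ξ : VecField d) : Prop where
  meas : AEStronglyMeasurable ξ (𝓛 O)
  mem : MemLp (nrm a ξ) 2 (𝓛 O)

/-- The energy norm `(∫_O ξ · s ξ)^{1/2}`. -/
def eN (a : MatField d) (O : Set (SpaceTime d)) (ξ : VecField d) : ℝ :=
  l2 (𝓛 O) (nrm a ξ)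

lemma eN_nonneg : 0 ≤ eN a O ξ := l2_nonneg _

lemma aestronglyMeasurable_coord {μ : Measure (SpaceTime d)} (h : AEStronglyMeasurable ξ μ)
    (i : Fin d) : AEStronglyMeasurable (fun p => ξ p i) μ :=
  (EuclideanSpace.proj i).continuous.comp_aestronglyMeasurable h

lemma bil_eq_sum (A : Matrix (Fin d) (Fin d) ℝ) (v w : Space d) : bil A v w = ∑ i, ∑ j, v i * (A i j * w j) := by
  simp [bil, dotProduct, Matrix.mulVec, mul_sum]

lemma aestronglyMeasurable_bil {μ : Measure (SpaceTime d)} {A : MatField d} (hA : ∀ i j, Measurable fun p => A p i j)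
    (hξ : AEStronglyMeasurable ξ μ) (hη : AEStronglyMeasurable η μ) :
    AEStronglyMeasurable (fun p => bil (A p) (ξ p) (η p)) μ := by
  simp [bil_eq_sum]
  refine Finset.aestronglyMeasurable_fun_sum _ fun i _ => Finset.aestronglyMeasurable_fun_sum _ fun j _ => ?_
  exact (aestronglyMeasurable_coord hξ i).mul ((hA i j).aestronglyMeasurable.mul (aestronglyMeasurable_coord hη j))

namespace IsCoefficientField
variable (h : IsCoefficientField a)
include h

lemma measurable_sym (i j : Fin d) : Measurable fun p => symPart (a p) i j := by
  exact ((h.measurable i j).add (h.measurable j i)).const_smul (1 / 2 : ℝ)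

lemma sym_nonneg (p : SpaceTime d) (e : Space d) : 0 ≤ bil (symPart (a p)) e e := by
  rw [bil_symPart_self]; exact h.nonneg p e

lemma nrm_sq (p : SpaceTime d) : nrm a ξ p ^ 2 = bil (symPart (a p)) (ξ p) (ξ p) := sq_sqrt (h.sym_nonneg _ _)

lemma aesm_nrm {μ : Measure (SpaceTime d)} (hξ : AEStronglyMeasurable ξ μ) : AEStronglyMeasurable (nrm a ξ) μ :=
  Real.continuous_sqrt.comp_aestronglyMeasurable (aestronglyMeasurable_bil h.measurable_sym hξ hξ)

lemma nrm_add_le (p : SpaceTime d) : nrm a (fun p => ξ p + η p) p ≤ nrm a ξ p + nrm a η p :=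
  sqrt_bil_add_le (h.nonneg p) _ _

omit h in
lemma nrm_smul (c : ℝ) (p : SpaceTime d) : nrm a (fun p => c • ξ p) p = |c| * nrm a ξ p := sqrt_bil_smul c _

lemma finE_add (hξ : FinE a O ξ) (hη : FinE a O η) : FinE a O (fun p => ξ p + η p) where
  meas := hξ.meas.add hη.meas
  mem := (hξ.mem.add hη.mem).mono (h.aesm_nrm (hξ.meas.add hη.meas)) (ae_of_all _ fun p => by
    rw [norm_nrm]
    exact (h.nrm_add_le p).trans (le_abs_self _))

lemma eN_add_le (hξ : FinE a O ξ) (hη : FinE a O η) : eN a O (fun p => ξ p + η p) ≤ eN a O ξ + eN a O η := by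
  refine le_trans (l2_mono (hξ.mem.add hη.mem) (ae_of_all _ fun p => ?_)) (l2_add_le hξ.mem hη.mem)
  rw [norm_nrm]
  exact (h.nrm_add_le p).trans (le_abs_self _)

omit h in
lemma finE_smul (c : ℝ) (hξ : FinE a O ξ) : FinE a O (fun p => c • ξ p) where
  meas := hξ.meas.const_smul c
  mem := by
    have : nrm a (fun p => c • ξ p) = fun p => |c| * nrm a ξ p := funext fun p => nrm_smul c p
    rw [this]
    exact hξ.mem.const_mul _

omit h in
lemma eN_smul (c : ℝ) : eN a O (fun p => c • ξ p) = |c| * eN a O ξ := by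
  have : nrm a (fun p => c • ξ p) = fun p => |c| * nrm a ξ p := funext fun p => nrm_smul c p
  rw [eN, this, l2_const_mul, abs_abs, eN]

lemma finE_sub (hξ : FinE a O ξ) (hη : FinE a O η) : FinE a O (fun p => ξ p - η p) := by
  simpa [sub_eq_add_neg] using h.finE_add hξ (finE_smul (-1) hη)

lemma eN_sub_le (hξ : FinE a O ξ) (hη : FinE a O η) : eN a O (fun p => ξ p - η p) ≤ eN a O ξ + eN a O η := by
  have := h.eN_add_le hξ (finE_smul (-1) hη)
  rw [eN_smul] at this
  simpa [sub_eq_add_neg] using this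

lemma eN_sq (hξ : FinE a O ξ) : eN a O ξ ^ 2 = ∫ p in O, bil (symPart (a p)) (ξ p) (ξ p) := by
  rw [eN, l2_sq hξ.mem]
  congr 1
  ext p
  rw [norm_nrm, h.nrm_sq]

lemma integrable_en (hξ : FinE a O ξ) : IntegrableOn (fun p => bil (symPart (a p)) (ξ p) (ξ p)) O := by
  have := hξ.mem.integrable_sq
  exact this.congr (ae_of_all _ fun p => h.nrm_sq p)

lemma finE_of_integrable (hm : AEStronglyMeasurable ξ (𝓛 O))
    (hi : IntegrableOn (fun p => bil (symPart (a p)) (ξ p) (ξ p)) O) : FinE a O ξ where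
  meas := hm
  mem := by
    rw [memLp_two_iff_integrable_sq (h.aesm_nrm hm)]
    exact hi.congr (ae_of_all _ fun p => (h.nrm_sq p).symm)

end IsCoefficientField

lemma FinE.mono (hξ : FinE a O ξ) (hO : O' ⊆ O) : FinE a O' ξ where
  meas := hξ.meas.mono_measure (restrict_mono hO le_rfl)
  mem := hξ.mem.mono_measure (restrict_mono hO le_rfl)

lemma eN_mono (hξ : FinE a O ξ) (hO : O' ⊆ O) : eN a O' ξ ≤ eN a O ξ :=
  l2_mono_measure hξ.mem (restrict_mono hO le_rfl)

lemma eN_transpose : eN (fun p => (a p)ᵀ) O ξ = eN a O ξ := by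
  simp [eN]
  congr 1
  ext p
  simp [nrm, symPart_transpose]

lemma finE_transpose : FinE (fun p => (a p)ᵀ) O ξ ↔ FinE a O ξ := by
  have : nrm (fun p => (a p)ᵀ) ξ = nrm a ξ := by
    ext p
    simp [nrm, symPart_transpose]
  constructor
  · rintro ⟨h1, h2⟩; exact ⟨h1, this ▸ h2⟩
  · rintro ⟨h1, h2⟩; exact ⟨h1, this ▸ h2⟩

/-- The trace of `s⁻¹`, which controls `|ξ|²` by the energy density. -/
def tau (a : MatField d) (p : SpaceTime d) : ℝ := ∑ i, (symPart (a p))⁻¹ i i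

/-- Almost everywhere in `O`, the form of `a` is bounded by `M` times the energy lengths. -/
def EllBdd (a : MatField d) (O : Set (SpaceTime d)) (M : ℝ) : Prop :=
  ∀ᵐ p ∂(𝓛 O), ∀ v w : Space d, |bil (a p) v w| ≤
    M * √(bil (symPart (a p)) v v) * √(bil (symPart (a p)) w w)

namespace IsCoefficientField
variable (h : IsCoefficientField a)
include h

lemma inv_diag_nonneg (p : SpaceTime d) (i : Fin d) : 0 ≤ (symPart (a p))⁻¹ i i := by
  by_contra hneg
  push Not at hneg
  have h1 := coord_sq_le (h.pos p) (stdVec i) i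
  have h2 : (stdVec i : Space d) i = 1 := by simp [stdVec]
  nlinarith [h.sym_nonneg p (stdVec i)]

lemma norm_sq_le (p : SpaceTime d) (v : Space d) : ‖v‖ ^ 2 ≤ tau a p * bil (symPart (a p)) v v := by
  rw [norm_sq_eq, tau, sum_mul]
  refine sum_le_sum fun i _ => ?_
  rw [norm_eq_abs, sq_abs]
  exact coord_sq_le (h.pos p) v i

lemma tau_nonneg (p : SpaceTime d) : 0 ≤ tau a p := sum_nonneg fun i _ => h.inv_diag_nonneg p i

lemma norm_le (p : SpaceTime d) : ‖ξ p‖ ≤ √(tau a p) * nrm a ξ p := by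
  rw [nrm, ← sqrt_mul (h.tau_nonneg p)]
  exact Real.le_sqrt_of_sq_le (h.norm_sq_le p (ξ p))

lemma integrableOn_tau (hO : IsBounded O) : IntegrableOn (tau a) O := by
  refine IntegrableOn.mono_set ?_ subset_closure
  exact integrable_finsetSum _ fun i _ => (h.inv_locInt i i).integrableOn_isCompact hO.isCompact_closure

lemma memLp_sqrt_tau (hO : IsBounded O) : MemLp (fun p => √(tau a p)) 2 (𝓛 O) := by
  have hi := h.integrableOn_tau hO
  rw [memLp_two_iff_integrable_sq (Real.continuous_sqrt.comp_aestronglyMeasurable hi.1)]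
  exact hi.congr (ae_of_all _ fun p => (sq_sqrt (h.tau_nonneg p)).symm)

lemma integrableOn (hO : IsBounded O) (hξ : FinE a O ξ) : IntegrableOn ξ O := by
  refine (integrable_norm_mul_norm (h.memLp_sqrt_tau hO) hξ.mem).mono hξ.meas (ae_of_all _ fun p => ?_)
  refine (h.norm_le p).trans ?_
  rw [norm_nrm, (norm_of_nonneg (sqrt_nonneg _))]
  exact Real.le_norm_self _

/-- The `L¹` norm is controlled by the energy norm. -/
lemma integral_norm_le (hO : IsBounded O) : ∃ C, 0 ≤ C ∧ ∀ ξ, FinE a O ξ → ∫ p in O, ‖ξ p‖ ≤ C * eN a O ξ := by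
  refine ⟨l2 (𝓛 O) (fun p => √(tau a p)), l2_nonneg _, fun ξ hξ => ?_⟩
  refine le_trans ?_ (integral_norm_mul_norm_le (h.memLp_sqrt_tau hO) hξ.mem)
  refine integral_mono (h.integrableOn hO hξ).norm (integrable_norm_mul_norm (h.memLp_sqrt_tau hO) hξ.mem) fun p => ?_
  refine (h.norm_le p).trans ?_
  rw [norm_nrm, norm_eq_abs, abs_of_nonneg (sqrt_nonneg _)]

lemma ellBdd (hO : IsBounded O) : ∃ M, 0 ≤ M ∧ EllBdd a O M := by
  obtain ⟨M, hM⟩ := h.skew_locBdd (closure O) hO.isCompact_closure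
  refine ⟨1 + |M|, by positivity, ?_⟩
  filter_upwards [(ae_mono (restrict_mono (subset_closure) le_rfl) hM)] with p hp v w
  rw [bil_eq_sym_add_skew]
  have h1 := abs_bil_symPart_le (h.nonneg p) v w
  have h3 : M * √(bil (symPart (a p)) v v) * √(bil (symPart (a p)) w w) ≤
      |M| * (√(bil (symPart (a p)) v v) * √(bil (symPart (a p)) w w)) := by
    rw [mul_assoc]
    exact mul_le_mul_of_nonneg_right (le_abs_self M) (by positivity)
  grind

omit h in
lemma ellBdd_mono (hM : EllBdd a O M) (hO : O' ⊆ O) : EllBdd a O' M :=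
  ae_mono (restrict_mono hO le_rfl) hM

lemma integrable_bil (hM : EllBdd a O M) (hξ : FinE a O ξ) (hη : FinE a O η) :
    IntegrableOn (fun p => bil (a p) (ξ p) (η p)) O := by
  have h1 := (integrable_norm_mul_norm hξ.mem hη.mem).const_mul M
  refine h1.mono (aestronglyMeasurable_bil h.measurable hξ.meas hη.meas) ?_
  filter_upwards [hM] with p hp
  refine (hp _ _).trans ?_
  rw [norm_nrm, norm_nrm, ← mul_assoc]
  exact le_abs_self _

lemma abs_integral_bil_le (hM0 : 0 ≤ M) (hM : EllBdd a O M) (hξ : FinE a O ξ) (hη : FinE a O η) :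
    |∫ p in O, bil (a p) (ξ p) (η p)| ≤ M * (eN a O ξ * eN a O η) := by
  refine (abs_integral_le_integral_abs).trans ?_
  refine le_trans ?_ (mul_le_mul_of_nonneg_left (integral_norm_mul_norm_le hξ.mem hη.mem) hM0)
  rw [← integral_const_mul]
  refine integral_mono_ae (h.integrable_bil hM hξ hη).abs ((integrable_norm_mul_norm hξ.mem hη.mem).const_mul M) ?_
  filter_upwards [hM] with p hp
  refine (hp _ _).trans ?_
  rw [norm_nrm, norm_nrm, ← mul_assoc]
  rfl

lemma integrable_bil_sym (hξ : FinE a O ξ) (hη : FinE a O η) :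
    IntegrableOn (fun p => bil (symPart (a p)) (ξ p) (η p)) O := by
  have h1 := (integrable_norm_mul_norm hξ.mem hη.mem)
  refine h1.mono (aestronglyMeasurable_bil h.measurable_sym hξ.meas hη.meas) (ae_of_all _ fun p => ?_)
  refine (abs_bil_symPart_le (h.nonneg p) _ _).trans ?_
  rw [norm_nrm, norm_nrm]
  exact le_abs_self _

lemma abs_integral_bil_sym_le (hξ : FinE a O ξ) (hη : FinE a O η) :
    |∫ p in O, bil (symPart (a p)) (ξ p) (η p)| ≤ eN a O ξ * eN a O η := by
  refine (abs_integral_le_integral_abs).trans ?_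
  refine le_trans ?_ (integral_norm_mul_norm_le hξ.mem hη.mem)
  refine integral_mono (h.integrable_bil_sym hξ hη).abs (integrable_norm_mul_norm hξ.mem hη.mem) fun p => ?_
  refine (abs_bil_symPart_le (h.nonneg p) _ _).trans ?_
  rw [norm_nrm, norm_nrm]
  rfl

/-- Bounded measurable fields have finite energy on bounded sets. -/
lemma finE_of_bounded (hO : IsBounded O) (hm : AEStronglyMeasurable ξ (𝓛 O)) (hC : ∀ p, ‖ξ p‖ ≤ C) :
    FinE a O ξ := by
  refine h.finE_of_integrable hm ?_
  have hi : IntegrableOn (fun p => ∑ i, ∑ j, C ^ 2 * |symPart (a p) i j|) O := by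
    refine IntegrableOn.mono_set ?_ subset_closure
    exact integrable_finsetSum _ fun i _ => integrable_finsetSum _ fun j _ =>
      ((h.sym_locInt i j).integrableOn_isCompact hO.isCompact_closure).abs.const_mul _
  refine Integrable.mono hi (aestronglyMeasurable_bil h.measurable_sym hm hm) (ae_of_all _ fun p => ?_)
  rw [bil_eq_sum]
  refine le_trans ?_ (le_abs_self _)
  refine (abs_sum_le_sum_abs _ _).trans (sum_le_sum fun i _ => ?_)
  refine (abs_sum_le_sum_abs _ _).trans (sum_le_sum fun j _ => ?_)
  have h1 := (PiLp.norm_apply_le (ξ p) i).trans (hC p)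
  have h2 := (PiLp.norm_apply_le (ξ p) j).trans (hC p)
  rw [abs_mul, abs_mul]
  have h3 : |ξ p i| * |ξ p j| ≤ C * C := mul_le_mul h1 h2 (abs_nonneg _) ((abs_nonneg _).trans h1)
  nlinarith [abs_nonneg (symPart (a p) i j)]

end IsCoefficientField

section
/-! ### Test functions -/

variable {f : SpaceTime d → ℝ}

instance : (volume : Measure (SpaceTime d)).IsAddHaarMeasure :=
  inferInstanceAs (((volume : Measure ℝ).prod (volume : Measure (Space d))).IsAddHaarMeasure)

lemma dt_eq_fderiv (h : DifferentiableAt ℝ φ p) : dt φ p = fderiv ℝ φ p (1, 0) := by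
  exact (h.hasFDerivAt.comp_hasDerivAt p.1 ((hasDerivAt_id p.1).prodMk (hasDerivAt_const p.1 p.2))).deriv

lemma inner_dx (h : DifferentiableAt ℝ φ p) (v : Space d) :
    inner ℝ (dx φ p) v = fderiv ℝ φ p (0, v) := by
  have h2 : fderiv ℝ (fun y => φ (p.1, y)) p.2 = (fderiv ℝ φ p).comp
      (ContinuousLinearMap.inr ℝ ℝ (Space d)) := (h.hasFDerivAt.comp p.2 (hasFDerivAt_prodMk_right p.1 p.2)).fderiv
  simp only [dx, gradient, h2, InnerProductSpace.toDual_symm_apply]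
  simp

lemma dx_apply (h : DifferentiableAt ℝ φ p) (i : Fin d) :
    dx φ p i = fderiv ℝ φ p (0, stdVec i) := by
  rw [← inner_dx h, stdVec, EuclideanSpace.inner_single_right]
  simp

lemma dx_add (h : DifferentiableAt ℝ φ p) (h' : DifferentiableAt ℝ ψ p) :
    dx (fun q => φ q + ψ q) p = dx φ p + dx ψ p := by
  ext i
  rw [dx_apply (h.fun_add h'), fderiv_fun_add h h', PiLp.add_apply, dx_apply h, dx_apply h']
  rfl

lemma dx_const_mul (c : ℝ) (h : DifferentiableAt ℝ φ p) : dx (fun q => c * φ q) p = c • dx φ p := by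
  ext i
  rw [dx_apply (h.const_mul c), fderiv_const_mul h, PiLp.smul_apply, dx_apply h]
  rfl

lemma dx_mul (h : DifferentiableAt ℝ φ p) (h' : DifferentiableAt ℝ ψ p) :
    dx (fun q => φ q * ψ q) p = φ p • dx ψ p + ψ p • dx φ p := by
  ext i
  rw [dx_apply (h.fun_mul h'), fderiv_fun_mul h h', PiLp.add_apply, PiLp.smul_apply, PiLp.smul_apply,
    dx_apply h, dx_apply h']
  rfl

lemma dt_add (h : DifferentiableAt ℝ φ p) (h' : DifferentiableAt ℝ ψ p) :
    dt (fun q => φ q + ψ q) p = dt φ p + dt ψ p := by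
  rw [dt_eq_fderiv (h.fun_add h'), fderiv_fun_add h h', dt_eq_fderiv h, dt_eq_fderiv h']
  rfl

lemma dt_const_mul (c : ℝ) (h : DifferentiableAt ℝ φ p) : dt (fun q => c * φ q) p = c * dt φ p := by
  rw [dt_eq_fderiv (h.const_mul c), fderiv_const_mul h, dt_eq_fderiv h]
  rfl

lemma dt_mul (h : DifferentiableAt ℝ φ p) (h' : DifferentiableAt ℝ ψ p) :
    dt (fun q => φ q * ψ q) p = φ p * dt ψ p + ψ p * dt φ p := by
  rw [dt_eq_fderiv (h.fun_mul h'), fderiv_fun_mul h h', dt_eq_fderiv h, dt_eq_fderiv h']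
  rfl

lemma dx_comp_fst (w : ℝ → ℝ) (p : SpaceTime d) :
    dx (fun q : SpaceTime d => w q.1) p = 0 := by
  simp [dx, gradient]

namespace IsTest

lemma differentiable (h : IsTest O φ) : Differentiable ℝ φ := h.smooth.differentiable (by simp)

lemma continuous (h : IsTest O φ) : Continuous φ := h.smooth.continuous

lemma mono (h : IsTest O φ) (hO : O ⊆ O') : IsTest O' φ := ⟨h.smooth, h.compact, h.support.trans hO⟩

lemma zero : IsTest O (fun _ => 0 : SpaceTime d → ℝ) where
  smooth := contDiff_const
  compact := HasCompactSupport.zero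
  support := by simp [tsupport]

lemma add (h : IsTest O φ) (h' : IsTest O ψ) : IsTest O (fun p => φ p + ψ p) where
  smooth := h.smooth.add h'.smooth
  compact := h.compact.add h'.compact
  support := (tsupport_add φ ψ).trans (union_subset h.support h'.support)

lemma const_mul (c : ℝ) (h : IsTest O φ) : IsTest O (fun p => c * φ p) where
  smooth := contDiff_const.mul h.smooth
  compact := h.compact.mul_left
  support := (tsupport_mul_subset_right (f := fun _ => c)).trans h.support

lemma zero_off (h : IsTest O φ) (hp : p ∉ O) : φ p = 0 :=
  image_eq_zero_of_notMem_tsupport fun hp' => hp (h.support hp')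

/-- The product of a test function with a function that is smooth near its support. -/
lemma mul_contDiffOn (h : IsTest O φ) (hO : IsOpen O) (hf : ContDiffOn ℝ ∞ f O) : IsTest O (fun p => f p * φ p) where
  smooth := by
    rw [contDiff_iff_contDiffAt]
    intro p
    by_cases hp : p ∈ O
    · exact (hf.contDiffAt (hO.mem_nhds hp)).mul h.smooth.contDiffAt
    · have h1 : φ =ᶠ[𝓝 p] 0 := notMem_tsupport_iff_eventuallyEq.1 fun hp' => hp (h.support hp')
      have h2 : (fun p => f p * φ p) =ᶠ[𝓝 p] fun _ => 0 := by
        filter_upwards [h1] with q hq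
        simp [hq]
      exact contDiffAt_const.congr_of_eventuallyEq h2
  compact := h.compact.mul_left
  support := (tsupport_mul_subset_right (f := f)).trans h.support

lemma mul_contDiff (h : IsTest O φ) (hf : ContDiff ℝ ∞ f) : IsTest O (fun p => f p * φ p) where
  smooth := hf.mul h.smooth
  compact := h.compact.mul_left
  support := (tsupport_mul_subset_right (f := f)).trans h.support

lemma comp_zero {g : ℝ → ℝ} (h : IsTest O φ) (hg : ContDiff ℝ ∞ g) (h0 : g 0 = 0) : IsTest O (fun p => g (φ p)) where
  smooth := hg.comp h.smooth
  compact := h.compact.comp_left h0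
  support := (closure_mono (Function.support_comp_subset h0 φ)).trans h.support

lemma fderiv_apply (h : IsTest O φ) (v : SpaceTime d) : IsTest O (fun p => fderiv ℝ φ p v) where
  smooth := (h.smooth.fderiv_right (m := ∞) (by simp)).clm_apply contDiff_const
  compact := h.compact.fderiv_apply ℝ v
  support := (tsupport_fderiv_apply_subset ℝ v).trans h.support

lemma dt (h : IsTest O φ) : IsTest O (CGParabolic.dt φ) := by
  have : CGParabolic.dt φ = fun p => fderiv ℝ φ p (1, 0) := funext fun p => dt_eq_fderiv (h.differentiable p)
  rw [this]; exact h.fderiv_apply _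

lemma dx_coord (h : IsTest O φ) (i : Fin d) : IsTest O (fun p => dx φ p i) := by
  have  := funext fun p => dx_apply (h.differentiable p) i
  rw [this]; exact h.fderiv_apply _

lemma integrable (h : IsTest O φ) : Integrable φ := h.continuous.integrable_of_hasCompactSupport h.compact

lemma bounded (h : IsTest O φ) : ∃ C, ∀ p, |φ p| ≤ C := by
  obtain ⟨C, hC⟩ := h.compact.exists_bound_of_continuous h.continuous
  exact ⟨C, hC⟩

lemma continuous_dx (h : IsTest O φ) : Continuous (dx φ) := by
  exact (PiLp.continuous_toLp 2 _).comp (continuous_pi fun i => (h.dx_coord i).continuous)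

lemma dx_zero_off (h : IsTest O φ) (hp : p ∉ O) : dx φ p = 0 := by
  ext i; exact (h.dx_coord i).zero_off hp

lemma hasCompactSupport_dx (h : IsTest O φ) : HasCompactSupport (dx φ) := by
  refine HasCompactSupport.intro h.compact fun p hp => ?_
  ext i
  have h1 : IsTest (tsupport φ) φ := ⟨h.smooth, h.compact, le_rfl⟩
  exact (h1.dx_coord i).zero_off hp

lemma bounded_dx (h : IsTest O φ) : ∃ C, 0 ≤ C ∧ ∀ p, ‖dx φ p‖ ≤ C := by
  obtain ⟨C, hC⟩ := h.hasCompactSupport_dx.exists_bound_of_continuous h.continuous_dx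
  exact ⟨C, (norm_nonneg _).trans (hC 0), hC⟩

lemma integrable_dx (h : IsTest O φ) : Integrable (dx φ) :=
  h.continuous_dx.integrable_of_hasCompactSupport h.hasCompactSupport_dx

lemma integral_fderiv (h : IsTest O φ) (v : SpaceTime d) : ∫ p, fderiv ℝ φ p v = 0 := by
  have := integral_mul_fderiv_eq_neg_fderiv_mul_of_integrable (f := fun _ => 1) (by simp)
    (by simpa using (h.fderiv_apply v).integrable) (by simpa using h.integrable)
    (fun _ _ => by fun_prop) (fun x _ => h.differentiable x)
  simp_all

lemma integral_dt (h : IsTest O φ) : ∫ p, CGParabolic.dt φ p = 0 := by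
  simp [dt_eq_fderiv (h.differentiable _)]
  exact h.integral_fderiv _

lemma integral_dx (h : IsTest O φ) : ∫ p, dx φ p = 0 := by
  ext i
  have h1 := (EuclideanSpace.proj i).integral_comp_comm h.integrable_dx
  have h2 : ∫ p, dx φ p i = 0 := by
    simp [dx_apply (h.differentiable _)]
    exact h.integral_fderiv _
  simp_all

/-- Integrals over the domain of a test function may be extended to any larger set. -/
lemma setIntegral_eq {E : Type*} [NormedAddCommGroup E] [NormedSpace ℝ E] {F : SpaceTime d → E}
    (hF : ∀ p ∉ O, F p = 0) (hO : O ⊆ O') : ∫ p in O', F p = ∫ p in O, F p := by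
  rw [setIntegral_eq_integral_of_forall_compl_eq_zero hF,
    setIntegral_eq_integral_of_forall_compl_eq_zero fun p hp => hF p fun h => hp (hO h)]

end IsTest

/-- The space of test functions. -/
def TestSpace (O : Set (SpaceTime d)) : Submodule ℝ (SpaceTime d → ℝ) where
  carrier := {φ | IsTest O φ}
  add_mem' h h' := h.add h'
  zero_mem' := IsTest.zero
  smul_mem' c _ h := h.const_mul c

/-- Integration by parts in time. -/
lemma integral_mul_dt (hφ : IsTest O φ) (hf : ContDiff ℝ ∞ f) : ∫ p, f p * dt φ p = -∫ p, φ p * dt f p := by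
  have h1 := (hφ.mul_contDiff hf).integral_dt
  have h2 := fun p => dt_mul ((hf.differentiable (by simp)) p) (hφ.differentiable p)
  simp [h2] at h1
  have hi1 := (hφ.dt.mul_contDiff hf).integrable
  have hi2 : Integrable fun p => φ p * dt f p := by
    have : (fun p => φ p * dt f p) = fun p => dt (fun q => f q * φ q) p - f p * dt φ p := by
      ext p; rw [h2]; ring
    rw [this]; exact ((hφ.mul_contDiff hf).dt.integrable).sub hi1
  rw [integral_add hi1 hi2] at h1
  linarith

/-- Smooth functions have their gradient as weak gradient. -/
lemma integral_mul_dx_coord (hφ : IsTest O φ) (hO : IsOpen O) (hf : ContDiffOn ℝ ∞ f O) (i : Fin d) :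
    ∫ p in O, f p * dx φ p i = -∫ p in O, φ p * dx f p i := by
  have ht := hφ.mul_contDiffOn hO hf
  have h2 : ∀ p ∈ O, dx (fun q => f q * φ q) p i = f p * dx φ p i + φ p * dx f p i := fun p hp => by
    rw [dx_mul ((hf.contDiffAt (hO.mem_nhds hp)).differentiableAt (by simp)) (hφ.differentiable p)]
    simp
  have h1 : ∫ p in O, dx (fun q => f q * φ q) p i = 0 := by
    rw [← IsTest.setIntegral_eq (fun p hp => (ht.dx_coord i).zero_off hp) (subset_univ _), setIntegral_univ]
    simp [dx_apply (ht.differentiable _)]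
    exact ht.integral_fderiv _
  have hi1 : IntegrableOn (fun p => f p * dx φ p i) O := ((hφ.dx_coord i).mul_contDiffOn hO hf).integrable.integrableOn
  have hi2 : IntegrableOn (fun p => φ p * dx f p i) O := by
    refine (((ht.dx_coord i).integrable.integrableOn).sub hi1).congr_fun (fun p hp => ?_) hO.measurableSet
    rw [Pi.sub_apply, h2 p hp]; ring
  rw [setIntegral_congr_fun hO.measurableSet (fun p hp => h2 p hp), integral_add hi1 hi2] at h1
  linarith

lemma integral_coord_mul_dx (hφ : IsTest O φ) (i : Fin d) : ∫ p, p.2 i * dx φ p i = -∫ p, φ p := by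
  have hc : ContDiff ℝ ∞ (fun p : SpaceTime d => p.2 i) := (EuclideanSpace.proj (𝕜 := ℝ) i).contDiff.comp contDiff_snd
  have h := integral_mul_dx_coord (hφ.mono (subset_univ _)) isOpen_univ hc.contDiffOn i
  rw [setIntegral_univ, setIntegral_univ] at h
  rw [h]
  congr 2
  ext p
  have h1 : dx (fun p : SpaceTime d => p.2 i) p i = 1 := by
    rw [dx_apply (hc.differentiable (by simp) p)]
    have : HasFDerivAt (fun p : SpaceTime d => p.2 i) ((EuclideanSpace.proj i).comp
      (ContinuousLinearMap.snd ℝ ℝ (Space d))) p :=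
      ((EuclideanSpace.proj i).comp (ContinuousLinearMap.snd ℝ ℝ (Space d))).hasFDerivAt
    rw [this.fderiv]
    simp [stdVec]
  simp_all

/-- The Poincaré inequality in `L¹` for test functions. -/
lemma integral_abs_le_dx (i : Fin d) (hR : 0 ≤ R) (hO : ∀ p ∈ O, |p.2 i| ≤ R)
    (hOv : volume O ≠ ⊤) (hφ : IsTest O φ) : ∫ p in O, |φ p| ≤ R * ∫ p in O, ‖dx φ p‖ := by
  refine le_of_forall_pos_le_add fun δ hδ => ?_
  set ε : ℝ := δ / ((volume O).toReal + 1) with hε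
  have hεpos : 0 < ε := by positivity
  set g : ℝ → ℝ := fun s => √(s ^ 2 + ε ^ 2) - ε with hg
  have hgs : ContDiff ℝ ∞ g := by
    refine ContDiff.sub (ContDiff.sqrt (by fun_prop) fun x => ?_) contDiff_const
    positivity
  have hg0 : g 0 = 0 := by simp [hg, sqrt_sq hεpos.le]
  have hgd : ∀ s, |deriv g s| ≤ 1 := fun s => by
    have h1 : HasDerivAt g ((2 * s) / (2 * √(s ^ 2 + ε ^ 2))) s := by
      have : HasDerivAt (fun s => s ^ 2 + ε ^ 2) (2 * s) s := by
        simpa using (hasDerivAt_pow 2 s).add_const (ε ^ 2)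
      exact (this.sqrt (by positivity)).sub_const ε
    rw [h1.deriv, mul_div_mul_left _ _ (by norm_num), abs_div, abs_of_nonneg (sqrt_nonneg _)]
    apply div_le_one_of_le₀ _ (sqrt_nonneg _)
    exact Real.abs_le_sqrt (by nlinarith)
  have hgφ := hφ.comp_zero hgs hg0
  have hgdx : ∀ p, dx (fun q => g (φ q)) p i = deriv g (φ p) * dx φ p i := fun p => by
    rw [dx_apply (hgφ.differentiable p), dx_apply (hφ.differentiable p)]
    have h2 : HasFDerivAt (fun q => g (φ q)) (deriv g (φ p) • fderiv ℝ φ p) p :=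
      (hgs.differentiable (by simp) _).hasDerivAt.comp_hasFDerivAt p (hφ.differentiable p).hasFDerivAt
    rw [h2.fderiv]
    rfl
  have hle : ∫ p in O, g (φ p) ≤ R * ∫ p in O, ‖dx φ p‖ := by
    have e1 : ∫ p, g (φ p) = ∫ p in O, g (φ p) := by
      rw [← IsTest.setIntegral_eq (fun p hp => hgφ.zero_off hp) (subset_univ _), setIntegral_univ]
    have e2 : ∫ p, p.2 i * dx (fun q => g (φ q)) p i = ∫ p in O, p.2 i * dx (fun q => g (φ q)) p i := by
      rw [← IsTest.setIntegral_eq (fun p hp => by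
        rw [(hgφ.dx_coord i).zero_off hp, mul_zero]) (subset_univ _), setIntegral_univ]
    rw [← e1, ← neg_le_neg_iff, ← (integral_coord_mul_dx hgφ i), e2, ← integral_const_mul, ← integral_neg]
    refine integral_mono_ae (hφ.integrable_dx.norm.const_mul R).neg.integrableOn ?_ ?_
    · have hc : ContDiff ℝ ∞ (fun p : SpaceTime d => p.2 i) :=
        (EuclideanSpace.proj (𝕜 := ℝ) i).contDiff.comp contDiff_snd
      exact ((hgφ.dx_coord i).mul_contDiff hc).integrable.integrableOn
    · refine (ae_of_all _ fun p => ?_)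
      by_cases hp : p ∈ O
      · simp only
        rw [hgdx]
        have h1 : |p.2 i * (deriv g (φ p) * dx φ p i)| ≤ R * ‖dx φ p‖ := by
          rw [abs_mul, abs_mul]
          have h3 := PiLp.norm_apply_le (dx φ p) i
          have h4 : |deriv g (φ p)| * |dx φ p i| ≤ 1 * ‖dx φ p‖ := mul_le_mul (hgd _) h3 (abs_nonneg _) zero_le_one
          rw [one_mul] at h4
          exact mul_le_mul (hO p hp) h4 (by positivity) hR
        linarith [(abs_le.1 h1).1]
      · simp only
        rw [(hgφ.dx_coord i).zero_off hp, hφ.dx_zero_off hp]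
        simp
  have h5 : ∫ p in O, |φ p| ≤ ∫ p in O, (g (φ p) + ε) := by
    refine integral_mono hφ.integrable.abs.integrableOn
      (hgφ.integrable.integrableOn.add (integrableOn_const hOv)) fun p => ?_
    rw [sub_add_cancel]
    exact Real.abs_le_sqrt (by nlinarith)
  have h6 : ∫ p in O, (g (φ p) + ε) = (∫ p in O, g (φ p)) + (volume O).toReal * ε := by
    rw [integral_add hgφ.integrable.integrableOn (integrableOn_const hOv), setIntegral_const, smul_eq_mul]
    rfl
  have h7 : (volume O).toReal * ε ≤ δ := by
    rw [hε, mul_div_assoc', div_le_iff₀ (by positivity)]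
    nlinarith
  linarith

/-- The Poincaré inequality in `L²` for test functions. -/
lemma integral_sq_le_dx (i : Fin d) (hO : ∀ p ∈ O, |p.2 i| ≤ R)
    (hφ : IsTest O φ) : ∫ p, φ p ^ 2 ≤ 4 * R ^ 2 * ∫ p, (dx φ p i) ^ 2 := by
  have hsq := hφ.mul_contDiff hφ.smooth
  have hdsq := (hφ.dx_coord i).mul_contDiff (hφ.dx_coord i).smooth
  have h1 : ∫ p, φ p ^ 2 ≤ ∫ p, (1 / 2 * (φ p * φ p) + 2 * R ^ 2 * (dx φ p i * dx φ p i)) := by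
    simp [sq (φ _)]
    rw [← neg_neg (∫ p, φ p * φ p), ← (integral_coord_mul_dx hsq i), ← integral_neg]
    have hc : ContDiff ℝ ∞ (fun p : SpaceTime d => p.2 i) :=
      (EuclideanSpace.proj (𝕜 := ℝ) i).contDiff.comp contDiff_snd
    refine integral_mono ((hsq.dx_coord i).mul_contDiff hc).integrable.neg
      ((hsq.integrable.const_mul _).add (hdsq.integrable.const_mul _)) fun p => ?_
    rw [dx_mul (hφ.differentiable p) (hφ.differentiable p)]
    simp
    by_cases hp : p ∈ O
    · have h2 := hO p hp
      have h3 := sq_le_sq' (abs_le.1 h2).1 (abs_le.1 h2).2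
      nlinarith [sq_nonneg (φ p + 2 * p.2 i * dx φ p i), mul_le_mul_of_nonneg_right h3 (sq_nonneg (dx φ p i))]
    · rw [hφ.zero_off hp, (hφ.dx_coord i).zero_off hp]; simp
  rw [integral_add (hsq.integrable.const_mul _) (hdsq.integrable.const_mul _), integral_const_mul,
    integral_const_mul] at h1
  simp [← sq] at h1
  linarith
end

/-! ### Completeness of the energy norm -/

section limits

variable {X E F : Type*} [MeasurableSpace X] {μ : Measure X} [NormedAddCommGroup E]
  [NormedAddCommGroup F] [NormedSpace ℝ F]

lemma exists_l1_limit [CompleteSpace E] {f : ℕ → X → E} (hf : ∀ n, Integrable (f n) μ)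
    (hc : ∀ δ > 0, ∃ n₀, ∀ n ≥ n₀, ∀ k ≥ n₀, ∫ x, ‖f n x - f k x‖ ∂μ < δ) :
    ∃ w, Integrable w μ ∧ Tendsto (fun n => ∫ x, ‖f n x - w x‖ ∂μ) atTop (𝓝 0) := by
  have hd : ∀ {g h : X → E} (hg : Integrable g μ) (hh : Integrable h μ),
      dist (hg.toL1 g) (hh.toL1 h) = ∫ x, ‖g x - h x‖ ∂μ := by
    intro g h hg hh
    rw [dist_eq_norm, ← Integrable.toL1_sub, L1.norm_of_fun_eq_integral_norm]
    rfl
  have hcs : CauchySeq fun n => (hf n).toL1 (f n) := by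
    rw [Metric.cauchySeq_iff]
    intro δ hδ
    obtain ⟨n₀, h⟩ := hc δ hδ
    exact ⟨n₀, fun n hn k hk => by simp_all⟩
  obtain ⟨w, hw⟩ := cauchySeq_tendsto_of_complete hcs
  have hwi := L1.integrable_coeFn w
  refine ⟨w, hwi, ?_⟩
  rw [tendsto_iff_dist_tendsto_zero] at hw
  refine hw.congr fun n => ?_
  conv_lhs => rw [← Integrable.toL1_coeFn w hwi]
  exact hd _ _

lemma tendsto_integral_of_norm_sub_le {f : ℕ → X → E} {w : X → E} (hf : ∀ n, Integrable (f n) μ)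
    (hw : Integrable w μ) (h : Tendsto (fun n => ∫ x, ‖f n x - w x‖ ∂μ) atTop (𝓝 0))
    {Φ : ℕ → X → F} {Ψ : X → F} (hΦ : ∀ n, Integrable (Φ n) μ) (hΨ : Integrable Ψ μ) (C : ℝ)
    (hC : ∀ n x, ‖Φ n x - Ψ x‖ ≤ C * ‖f n x - w x‖) :
    Tendsto (fun n => ∫ x, Φ n x ∂μ) atTop (𝓝 (∫ x, Ψ x ∂μ)) := by
  rw [tendsto_iff_norm_sub_tendsto_zero]
  refine squeeze_zero (fun n => norm_nonneg _) (fun n => ?_) (by simpa using h.const_mul C)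
  rw [← integral_sub (hΦ n) hΨ, ← integral_const_mul]
  refine (norm_integral_le_integral_norm _).trans ?_
  exact integral_mono ((hΦ n).sub hΨ).norm (((hf n).sub hw).norm.const_mul C) fun x => hC n x

lemma tendsto_integral_mul_of_l1 {f : ℕ → X → ℝ} {w g : X → ℝ} (hf : ∀ n, Integrable (f n) μ)
    (hw : Integrable w μ) (h : Tendsto (fun n => ∫ x, ‖f n x - w x‖ ∂μ) atTop (𝓝 0))
    (hg : AEStronglyMeasurable g μ) (hC : ∀ x, |g x| ≤ C) :
    Tendsto (fun n => ∫ x, f n x * g x ∂μ) atTop (𝓝 (∫ x, w x * g x ∂μ)) := by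
  refine tendsto_integral_of_norm_sub_le hf hw h (fun n => (hf n).mul_bdd hg (ae_of_all _ hC))
    (hw.mul_bdd hg (ae_of_all _ hC)) C fun n x => ?_
  rw [← sub_mul, norm_mul, mul_comm]
  exact mul_le_mul_of_nonneg_right (hC x) (norm_nonneg _)

end limits

lemma continuous_nrm_field (A : Matrix (Fin d) (Fin d) ℝ) : Continuous fun v : Space d => √(bil A v v) := by
  simp [bil_eq_sum]
  fun_prop

lemma eN_neg : eN a O (fun p => -ξ p) = eN a O ξ := by
  have := IsCoefficientField.eN_smul (a := a) (O := O) (ξ := ξ) (-1)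
  simp_all

lemma eN_sub_comm : eN a O (fun p => ξ p - η p) = eN a O (fun p => η p - ξ p) := by
  rw [← eN_neg]; simp

namespace IsCoefficientField
variable (h : IsCoefficientField a)
include h

lemma eN_le_add (hξ : FinE a O ξ) (hη : FinE a O η) : eN a O ξ ≤ eN a O η + eN a O (fun p => ξ p - η p) := by
  have := h.eN_add_le hη (h.finE_sub hξ hη)
  simp_all

lemma exists_energy_limit (hO : IsBounded O) {η : ℕ → VecField d} (hη : ∀ n, FinE a O (η n))
    (hc : ∀ δ > 0, ∃ n₀, ∀ n ≥ n₀, ∀ k ≥ n₀, eN a O (fun p => η n p - η k p) < δ) :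
    ∃ Dw, FinE a O Dw ∧ Tendsto (fun n => eN a O (fun p => η n p - Dw p)) atTop (𝓝 0) := by
  obtain ⟨C, hC0, hC⟩ := h.integral_norm_le hO
  have hi := fun n => h.integrableOn hO (hη n)
  obtain ⟨Dw, hDw, hlim⟩ := exists_l1_limit hi (fun δ hδ => by
    obtain ⟨n₀, hn⟩ := hc (δ / (C + 1)) (by positivity)
    refine ⟨n₀, fun n hn1 k hk => ?_⟩
    have h2 := hn n hn1 k hk
    calc _ ≤ _ := (hC _ (h.finE_sub (hη n) (hη k)))
      _ ≤ C * (δ / (C + 1)) := by gcongr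
      _ < δ := by
        rw [mul_div_assoc', div_lt_iff₀ (by positivity)]
        nlinarith)
  have hm : TendstoInMeasure (𝓛 O) η atTop Dw := by
    refine tendstoInMeasure_of_tendsto_eLpNorm one_ne_zero (fun n => (hi n).1) hDw.1 ?_
    have h1 : ∀ n, eLpNorm (η n - Dw) 1 (𝓛 O) = ofReal (∫ p in O, ‖η n p - Dw p‖) := fun n => by
      rw [eLpNorm_one_eq_lintegral_enorm, ← (ofReal_integral_norm_eq_lintegral_enorm ((hi n).sub hDw))]
      rfl
    simp [h1]
    have h3 := (ENNReal.continuous_ofReal.tendsto 0).comp hlim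
    rwa [ENNReal.ofReal_zero] at h3
  obtain ⟨ns, hns, hae⟩ := hm.exists_seq_tendsto_ae
  have hmem : ∀ n k, MemLp (nrm a fun p => η n p - η k p) 2 (𝓛 O) := fun n k => (h.finE_sub (hη n) (hη k)).mem
  have key : ∀ δ > 0, ∃ n₀, ∀ n ≥ n₀,
      eLpNorm (nrm a fun p => η n p - Dw p) 2 (𝓛 O) ≤ ofReal δ := fun δ hδ => by
    obtain ⟨n₀, hn⟩ := hc δ hδ
    refine ⟨n₀, fun n hn1 => ?_⟩
    refine (Lp.eLpNorm_lim_le_liminf_eLpNorm (fun k => (hmem n (ns k)).1) _ ?_).trans ?_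
    · filter_upwards [hae] with p hp
      exact ((continuous_nrm_field (symPart (a p))).tendsto _).comp (tendsto_const_nhds.sub hp)
    · refine liminf_le_of_frequently_le' (Eventually.frequently ?_)
      filter_upwards [eventually_ge_atTop n₀] with k hk
      have := hn n hn1 (ns k) (hk.trans (hns.id_le k))
      rw [← ofReal_toReal (hmem n (ns k)).2.ne]
      exact ofReal_le_ofReal this.le
  have hfin : ∃ n, FinE a O (fun p => η n p - Dw p) := by
    obtain ⟨n₀, hn⟩ := key 1 one_pos
    have hms := (hi n₀).1.sub hDw.1
    exact ⟨n₀, hms, h.aesm_nrm hms, (hn n₀ le_rfl).trans_lt ofReal_lt_top⟩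
  obtain ⟨n₁, hn₁⟩ := hfin
  have hDwF : FinE a O Dw := by simpa using (h.finE_sub (hη n₁) hn₁)
  refine ⟨Dw, hDwF, ?_⟩
  rw [Metric.tendsto_atTop]
  intro δ hδ
  obtain ⟨n₀, hn⟩ := key (δ / 2) (by positivity)
  refine ⟨n₀, fun n hn1 => ?_⟩
  rw [dist_eq, sub_zero, abs_of_nonneg eN_nonneg]
  have := toReal_mono ofReal_ne_top (hn n hn1)
  rw [toReal_ofReal (by positivity)] at this
  exact this.trans_lt (by linarith)

lemma tendsto_integral_bil (hO : IsBounded O) {η : ℕ → VecField d} (hη : ∀ n, FinE a O (η n)) (hDw : FinE a O Dw)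
    (hlim : Tendsto (fun n => eN a O (fun p => η n p - Dw p)) atTop (𝓝 0)) (hξ : FinE a O ξ) :
    Tendsto (fun n => ∫ p in O, bil (a p) (ξ p) (η n p)) atTop (𝓝 (∫ p in O, bil (a p) (ξ p) (Dw p))) := by
  obtain ⟨M, hM0, hM⟩ := h.ellBdd hO
  rw [tendsto_iff_norm_sub_tendsto_zero]
  refine squeeze_zero (fun n => norm_nonneg _) (fun n => ?_) (by simpa using hlim.const_mul (M * eN a O ξ))
  rw [← integral_sub (h.integrable_bil hM hξ (hη n)) (h.integrable_bil hM hξ hDw)]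
  have := h.abs_integral_bil_le hM0 hM hξ (h.finE_sub (hη n) hDw)
  simp [bil_sub_right] at this
  rw [norm_eq_abs]
  linarith

lemma tendsto_eN {η : ℕ → VecField d} (hη : ∀ n, FinE a O (η n)) (hDw : FinE a O Dw)
    (hlim : Tendsto (fun n => eN a O (fun p => η n p - Dw p)) atTop (𝓝 0)) :
    Tendsto (fun n => eN a O (η n)) atTop (𝓝 (eN a O Dw)) := by
  rw [tendsto_iff_norm_sub_tendsto_zero]
  refine squeeze_zero (fun n => norm_nonneg _) (fun n => ?_) hlim
  rw [norm_eq_abs, abs_le]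
  have h1 := h.eN_le_add (hη n) hDw
  have h2 := h.eN_le_add hDw (hη n)
  rw [eN_sub_comm] at h2
  grind

lemma tendsto_integral_norm_sub (hO : IsBounded O) {η : ℕ → VecField d} (hη : ∀ n, FinE a O (η n)) (hDw : FinE a O Dw)
    (hlim : Tendsto (fun n => eN a O (fun p => η n p - Dw p)) atTop (𝓝 0)) :
    Tendsto (fun n => ∫ p in O, ‖η n p - Dw p‖) atTop (𝓝 0) := by
  obtain ⟨C, hC0, hC⟩ := h.integral_norm_le hO
  exact squeeze_zero (fun n => integral_nonneg fun p => norm_nonneg _)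
    (fun n => hC _ (h.finE_sub (hη n) hDw)) (by simpa using hlim.const_mul C)

end IsCoefficientField

section
/-! ### The abstract Cauchy problem -/

variable {W : Type*} [AddCommGroup W] [Module ℝ W] {val : W →ₗ[ℝ] SpaceTime d → ℝ} {grd : W →ₗ[ℝ] VecField d}

/-- A space of pairs (test function, vector field of finite energy) with an `L¹` Poincaré inequality.
It is the space of variations of a Dirichlet problem when the field is the gradient, and of a Neumann
problem when the field is the gradient plus a piecewise constant field. -/
structure IsPair (a : MatField d) (O : Set (SpaceTime d)) (val : W →ₗ[ℝ] SpaceTime d → ℝ)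
    (grd : W →ₗ[ℝ] VecField d) : Prop where
  test : ∀ v, IsTest O (val v)
  finE : ∀ v, FinE a O (grd v)
  poincare : ∃ C, 0 ≤ C ∧ ∀ v, ∫ p in O, |val v p| ≤ C * ∫ p in O, ‖grd v p‖

lemma IsTest.integral_mul_dt_comm (hφ : IsTest O φ) (hψ : IsTest O ψ) :
    ∫ p in O, φ p * CGParabolic.dt ψ p = -∫ p in O, ψ p * CGParabolic.dt φ p := by
  rw [setIntegral_eq_integral_of_forall_compl_eq_zero fun p hp => by rw [hφ.zero_off hp, zero_mul],
    setIntegral_eq_integral_of_forall_compl_eq_zero fun p hp => by rw [hψ.zero_off hp, zero_mul]]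
  exact integral_mul_dt hψ hφ.smooth

lemma IsTest.integral_mul_dt_self (hφ : IsTest O φ) : ∫ p in O, φ p * CGParabolic.dt φ p = 0 := by
  have := hφ.integral_mul_dt_comm hφ
  linarith

lemma IsTest.integrable_mul_test (hφ : IsTest O φ) (hψ : IsTest O' ψ) :
    Integrable (fun p => φ p * ψ p) :=
  (hψ.mul_contDiff hφ.smooth).integrable

/-- Well-posedness of `σ ∂_t w - ∇ · a ∇w + μ w = ℓ` in a space of pairs: the solution is a limit of
elements of the space, and its energy is at most `K` when the functional `ℓ` has norm at most `K`
relative to the test elements `χ` seen through the operator. -/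
lemma IsPair.solve (h : IsCoefficientField a) (hO : IsBounded O)
    (hp : IsPair a O val grd) (σ μ : ℝ) (hμ : 0 ≤ μ) (ℓ : W →ₗ[ℝ] ℝ) (K : ℝ) (hK : 0 ≤ K)
    (hℓ : ∀ χ c, 0 ≤ c → (∀ v, |-(σ * ∫ p in O, val v p * dt (val χ) p)
        + μ * (∫ p in O, val v p * val χ p) + ∫ p in O, bil (a p) (grd χ p) (grd v p)|
      ≤ c * √(μ * (∫ p in O, val v p * val v p) + eN a O (grd v) ^ 2)) → |ℓ χ| ≤ K * c) :
    ∃ (w : SpaceTime d → ℝ) (Dw : VecField d) (v : ℕ → W), IntegrableOn w O ∧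
      FinE a O Dw ∧ Tendsto (fun n => ∫ p in O, ‖val (v n) p - w p‖) atTop (𝓝 0) ∧
      Tendsto (fun n => eN a O (fun p => grd (v n) p - Dw p)) atTop (𝓝 0) ∧
      (∀ χ, -(σ * ∫ p in O, w p * dt (val χ) p) + μ * (∫ p in O, w p * val χ p)
        + ∫ p in O, bil (a p) (grd χ p) (Dw p) = ℓ χ) ∧ eN a O Dw ≤ K := by
  obtain ⟨M, hM0, hM⟩ := h.ellBdd hO
  obtain ⟨CP, hCP0, hCP⟩ := hp.poincare
  obtain ⟨C1, hC10, hC1⟩ := h.integral_norm_le hO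
  have hval : ∀ v w, IntegrableOn (fun p => val v p * val w p) O := fun v w =>
    ((hp.test v).integrable_mul_test (hp.test w)).integrableOn
  have hdt : ∀ v w, IntegrableOn (fun p => val v p * dt (val w) p) O := fun v w =>
    ((hp.test v).integrable_mul_test (hp.test w).dt).integrableOn
  have hen := fun v w => h.integrable_bil_sym (hp.finE v) (hp.finE w)
  have hb := fun v w => h.integrable_bil hM (hp.finE v) (hp.finE w)
  -- `N` is the energy and `B` the form of the equation
  let N := LinearMap.mk₂ ℝ (fun v w => μ * (∫ p in O, val v p * val w p) +
      ∫ p in O, bil (symPart (a p)) (grd v p) (grd w p))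
    (fun v v' w => by
      simp [map_add, Pi.add_apply, add_mul, bil_add_left]
      rw [integral_add (hval v w) (hval v' w), integral_add (hen v w) (hen v' w)]; ring)
    (fun c v w => by
      simp [map_smul, Pi.smul_apply, smul_eq_mul, mul_assoc, bil_smul_left]
      rw [integral_const_mul, integral_const_mul]; ring)
    (fun v w w' => by
      simp [map_add, Pi.add_apply, mul_add, bil_add_right]
      rw [integral_add (hval v w) (hval v w'), integral_add (hen v w) (hen v w')]; ring)
    (fun c v w => by
      simp [map_smul, Pi.smul_apply, smul_eq_mul, mul_left_comm, bil_smul_right]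
      rw [integral_const_mul, integral_const_mul]; ring)
  have hdt_add : ∀ w w' p, dt (val (w + w')) p = dt (val w) p + dt (val w') p := fun w w' p => by
    rw [map_add]; exact dt_add ((hp.test w).differentiable p) ((hp.test w').differentiable p)
  have hdt_smul : ∀ (c : ℝ) w p, dt (val (c • w)) p = c * dt (val w) p := fun c w p => by
    rw [map_smul]; exact dt_const_mul c ((hp.test w).differentiable p)
  let B := LinearMap.mk₂ ℝ (fun v w => -(σ * ∫ p in O, val v p * dt (val w) p) + μ * (∫ p in O, val v p * val w p) +
      ∫ p in O, bil (a p) (grd w p) (grd v p))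
    (fun v v' w => by
      simp [map_add, Pi.add_apply, add_mul, bil_add_right]
      rw [integral_add (hdt v w) (hdt v' w), integral_add (hval v w) (hval v' w),
        integral_add (hb w v) (hb w v')]; ring)
    (fun c v w => by
      simp [map_smul, Pi.smul_apply, smul_eq_mul, mul_assoc, bil_smul_right]
      rw [integral_const_mul, integral_const_mul, integral_const_mul]; ring)
    (fun v w w' => by
      simp only [hdt_add]
      simp [map_add, Pi.add_apply, mul_add, bil_add_left]
      rw [integral_add (hdt v w) (hdt v w'), integral_add (hval v w) (hval v w'),
        integral_add (hb w v) (hb w' v)]; ring)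
    (fun c v w => by
      simp only [hdt_smul]
      simp [map_smul, Pi.smul_apply, smul_eq_mul, mul_left_comm _ c, bil_smul_left]
      rw [integral_const_mul, integral_const_mul, integral_const_mul]; ring)
  have hNapp : ∀ v w, N v w = μ * (∫ p in O, val v p * val w p) +
      ∫ p in O, bil (symPart (a p)) (grd v p) (grd w p) := fun v w => rfl
  have hBapp : ∀ v w, B v w = -(σ * ∫ p in O, val v p * dt (val w) p) +
      μ * (∫ p in O, val v p * val w p) + ∫ p in O, bil (a p) (grd w p) (grd v p) := fun v w => rfl
  have hNself : ∀ v, N v v = μ * (∫ p in O, val v p * val v p) + eN a O (grd v) ^ 2 := fun v => by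
    rw [hNapp, h.eN_sq (hp.finE v)]
  have hsq0 : ∀ v, 0 ≤ μ * ∫ p in O, val v p * val v p := fun v =>
    mul_nonneg hμ (integral_nonneg fun p => mul_self_nonneg _)
  have hNnn : ∀ v, 0 ≤ N v v := fun v => by rw [hNself]; exact add_nonneg (hsq0 v) (sq_nonneg _)
  have heN : ∀ v, eN a O (grd v) ≤ √(N v v) := fun v => by
    refine Real.le_sqrt_of_sq_le ?_
    rw [hNself]; linarith [hsq0 v]
  have hl1 := fun v => (hCP v).trans (mul_le_mul_of_nonneg_left
      ((hC1 _ (hp.finE v)).trans (mul_le_mul_of_nonneg_left (heN v) hC10)) hCP0)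
  have hmulbd : ∀ (v : W) (g : SpaceTime d → ℝ) (G : ℝ), Continuous g → (∀ p, |g p| ≤ G) →
      |∫ p in O, val v p * g p| ≤ G * (CP * (C1 * √(N v v))) := fun v g G hgc hg => by
    refine le_trans ?_ (mul_le_mul_of_nonneg_left (hl1 v) ((abs_nonneg _).trans (hg 0)))
    rw [← integral_const_mul]
    refine (abs_integral_le_integral_abs).trans (integral_mono_of_nonneg
      (ae_of_all _ fun p => abs_nonneg _) ((hp.test v).integrable.integrableOn.abs.const_mul G)
      (ae_of_all _ fun p => ?_))
    simp
    rw [mul_comm]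
    exact mul_le_mul_of_nonneg_right (hg p) (abs_nonneg _)
  obtain ⟨v, hcau, hconv, hbd⟩ := lions_exists N B
    (fun v w => by simp [hNapp, mul_comm (val v _), bil_symPart_comm _ (grd v _)]) hNnn ℓ K hK
    (fun χ => by
      obtain ⟨G1, hG1⟩ := (hp.test χ).dt.bounded
      obtain ⟨G2, hG2⟩ := (hp.test χ).bounded
      refine ⟨|σ| * (G1 * (CP * C1)) + μ * (G2 * (CP * C1)) + M * eN a O (grd χ), fun v => ?_⟩
      refine (abs_add_three _ _ _).trans ?_
      have e3 := h.abs_integral_bil_le hM0 hM (hp.finE χ) (hp.finE v)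
      have e4 : M * (eN a O (grd χ) * eN a O (grd v)) ≤ M * (eN a O (grd χ) * √(N v v)) := by
        have := heN v
        have := eN_nonneg (a := a) (O := O) (ξ := grd χ)
        gcongr
      rw [abs_neg, abs_mul, abs_mul, abs_of_nonneg hμ]
      have e5 := mul_le_mul_of_nonneg_left (hmulbd v _ G1 (hp.test χ).dt.continuous hG1) (abs_nonneg σ)
      have e6 := mul_le_mul_of_nonneg_left (hmulbd v _ G2 (hp.test χ).continuous hG2) hμ
      linarith)
    (fun χ c hc hb => by
      refine hℓ χ c hc fun v => ?_
      have := hb v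
      rwa [hBapp, hNself] at this)
  have hcauE : ∀ δ > 0, ∃ n₀, ∀ n ≥ n₀, ∀ k ≥ n₀, √(N (v n - v k) (v n - v k)) < δ := fun δ hδ => by
    obtain ⟨n₀, hn⟩ := hcau (δ ^ 2) (by positivity)
    exact ⟨n₀, fun n hn1 k hk => (Real.sqrt_lt' hδ).2 (hn n hn1 k hk)⟩
  obtain ⟨Dw, hDw, hlimE⟩ := h.exists_energy_limit hO (fun n => hp.finE (v n)) (fun δ hδ => by
    obtain ⟨n₀, hn⟩ := hcauE δ hδ
    refine ⟨n₀, fun n hn1 k hk => lt_of_le_of_lt ?_ (hn n hn1 k hk)⟩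
    have := heN (v n - v k)
    rwa [map_sub] at this)
  have hvi : ∀ n, IntegrableOn (val (v n)) O := fun n => (hp.test _).integrable.integrableOn
  obtain ⟨w, hw, hlim1⟩ := exists_l1_limit hvi (fun δ hδ => by
    obtain ⟨n₀, hn⟩ := hcauE (δ / (CP * C1 + 1)) (by positivity)
    refine ⟨n₀, fun n hn1 k hk => ?_⟩
    have h1 := hl1 (v n - v k)
    have h2 := hn n hn1 k hk
    rw [lt_div_iff₀ (by positivity)] at h2
    have h0 := sqrt_nonneg (N (v n - v k) (v n - v k))
    rw [map_sub] at h1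
    refine lt_of_le_of_lt h1 ?_
    nlinarith)
  refine ⟨w, Dw, v, hw, hDw, hlim1, hlimE, fun χ => ?_, ?_⟩
  · refine tendsto_nhds_unique ?_ (hconv χ)
    obtain ⟨G1, hG1⟩ := (hp.test χ).dt.bounded
    obtain ⟨G2, hG2⟩ := (hp.test χ).bounded
    have t1 := tendsto_integral_mul_of_l1 hvi hw hlim1 (hp.test χ).dt.continuous.aestronglyMeasurable hG1
    have t2 := tendsto_integral_mul_of_l1 hvi hw hlim1 (hp.test χ).continuous.aestronglyMeasurable hG2
    have t3 := h.tendsto_integral_bil hO (fun n => hp.finE (v n)) hDw hlimE (hp.finE χ)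
    exact ((t1.const_mul σ).neg.add (t2.const_mul μ)).add t3
  · refine le_of_forall_pos_le_add fun δ hδ => ?_
    refine le_of_tendsto (h.tendsto_eN (fun n => hp.finE (v n)) hDw hlimE) ?_
    obtain ⟨n₀, hn⟩ := hbd (δ ^ 2) (by positivity)
    filter_upwards [eventually_ge_atTop n₀] with n hn1
    refine (heN _).trans (sqrt_le_iff.2 ⟨by positivity, (hn n hn1).trans ?_⟩)
    nlinarith

/-- The hypothesis of `IsPair.solve` for functionals bounded by the energy. -/
lemma IsPair.dual_of_le (h : IsCoefficientField a) (hp : IsPair a O val grd) {μ : ℝ} (hμ : 0 ≤ μ)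
    {χ : W} {K : ℝ} (hK : 0 ≤ K) (hc : 0 ≤ c) (hr : |r| ≤ K * √(μ * (∫ p in O, val χ p * val χ p) +
    eN a O (grd χ) ^ 2)) (hb : ∀ v, |-(σ * ∫ p in O, val v p * dt (val χ) p) +
    μ * (∫ p in O, val v p * val χ p) + ∫ p in O, bil (a p) (grd χ p) (grd v p)| ≤
    c * √(μ * (∫ p in O, val v p * val v p) + eN a O (grd v) ^ 2)) : |r| ≤ K * c := by
  refine hr.trans (mul_le_mul_of_nonneg_left ?_ hK)
  have h1 := hb χ
  have hnn : 0 ≤ μ * (∫ p in O, val χ p * val χ p) + eN a O (grd χ) ^ 2 :=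
    add_nonneg (mul_nonneg hμ (integral_nonneg fun p => mul_self_nonneg _)) (sq_nonneg _)
  have h2 : ∫ p in O, bil (a p) (grd χ p) (grd χ p) = eN a O (grd χ) ^ 2 := by
    rw [h.eN_sq (hp.finE χ)]
    simp [bil_symPart_self]
  rw [(hp.test χ).integral_mul_dt_self, mul_zero, neg_zero, zero_add, h2, abs_of_nonneg hnn] at h1
  set X := √(μ * (∫ p in O, val χ p * val χ p) + eN a O (grd χ) ^ 2) with hX
  have h3 : X ^ 2 ≤ c * X := by rw [hX, sq_sqrt hnn]; exact h1
  by_contra hlt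
  push Not at hlt
  nlinarith
end

section
/-! ### The triadic grid -/

lemma exists_int_near {h : ℝ} (hh : 0 < h) {t : ℝ} (ht : ∀ n : ℤ, t ≠ h * (n - 1 / 2)) :
    ∃ n : ℤ, |t - h * n| < h / 2 := by
  set n := ⌊t / h + 1 / 2⌋ with hn
  have h1 : n ≤ t / h + 1 / 2 := Int.floor_le _
  have h2 : t / h + 1 / 2 < n + 1 := Int.lt_floor_add_one _
  have h3 := div_mul_cancel₀ t hh.ne'
  have h4 : h * (n - 1 / 2) ≤ t := by nlinarith
  have h6 : t < h * (n + 1 / 2) := by nlinarith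
  grind

lemma int_eq_of_near {h : ℝ} (hh : 0 < h) {t : ℝ} {n n' : ℤ} (h1 : |t - h * n| < h / 2)
    (h2 : |t - h * n'| < h / 2) : n = n' := by
  rw [abs_lt] at h1 h2
  have e1 : h * (n - n') < h * 1 := by nlinarith
  have e2 : h * (n' - n) < h * 1 := by nlinarith
  have e3 : n - n' < 1 := by exact_mod_cast (lt_of_mul_lt_mul_left e1 hh.le)
  have e4 : n' - n < 1 := by exact_mod_cast (lt_of_mul_lt_mul_left e2 hh.le)
  omega

lemma near_nine {h : ℝ} (hh : 0 < h) {t : ℝ} {n : ℤ} (h1 : |t - h * n| < h / 2) :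
    |t - 9 * h * ((n + 4) / 9 : ℤ)| < 9 * h / 2 := by
  set q := (n + 4) / 9 with hq
  have e1 : n - 9 * q ≤ 4 := by omega
  have e2 : -4 ≤ n - 9 * q := by omega
  have e1' : (n : ℝ) - 9 * q ≤ 4 := by exact_mod_cast e1
  have e2' : (-4 : ℝ) ≤ n - 9 * q := by exact_mod_cast e2
  rw [abs_lt] at h1 ⊢
  constructor <;> nlinarith

lemma near_three {h : ℝ} (hh : 0 < h) {t : ℝ} {n : ℤ} (h1 : |t - h * n| < h / 2) :
    |t - 3 * h * ((n + 1) / 3 : ℤ)| < 3 * h / 2 := by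
  set q := (n + 1) / 3 with hq
  have e1 : n - 3 * q ≤ 1 := by omega
  have e2 : -1 ≤ n - 3 * q := by omega
  have e1' : (n : ℝ) - 3 * q ≤ 1 := by exact_mod_cast e1
  have e2' : (-1 : ℝ) ≤ n - 3 * q := by exact_mod_cast e2
  rw [abs_lt] at h1 ⊢
  constructor <;> nlinarith

/-- The centre of the cube of scale `k` with label `i`, a point of the lattice of scale `k`. -/
def ctr (k : ℤ) (i : Idx d) : SpaceTime d :=
  ((3 : ℝ) ^ (2 * k) * i.1, WithLp.toLp 2 fun j => (3 : ℝ) ^ k * i.2 j)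

/-- The triadic cube of scale `k` with label `i`. -/
def cell (k : ℤ) (i : Idx d) : Set (SpaceTime d) := cube (ctr k i) k

/-- The label of the cube of the next larger scale that contains a given cube. -/
def par (i : Idx d) : Idx d := ((i.1 + 4) / 9, fun j => (i.2 j + 1) / 3)

/-- The volume of a cube of scale `k`. -/
def vol (d : ℕ) (k : ℤ) : ℝ := (3 : ℝ) ^ (2 * k) * ((3 : ℝ) ^ k) ^ d

lemma vol_pos (k : ℤ) : 0 < vol d k := by unfold vol; positivity

lemma three_zpow_pos (k : ℤ) : (0 : ℝ) < 3 ^ k := by positivity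

lemma mem_cell : p ∈ cell k i ↔
    |p.1 - (3 : ℝ) ^ (2 * k) * i.1| < (3 : ℝ) ^ (2 * k) / 2 ∧
      ∀ j, |p.2 j - (3 : ℝ) ^ k * i.2 j| < (3 : ℝ) ^ k / 2 := Iff.rfl

lemma ctr_mem_lattice (k : ℤ) (i : Idx d) : ctr k i ∈ lattice d k := ⟨⟨i.1, rfl⟩, fun j => ⟨i.2 j, rfl⟩⟩

lemma mem_cube_self (z : SpaceTime d) (k : ℤ) : z ∈ cube z k := by
  have h1 := three_zpow_pos (2 * k)
  have h2 := three_zpow_pos k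
  simp [cube, mem_ofPred_eq, sub_self, abs_zero]
  simp_all

lemma cube_eq_prod (z : SpaceTime d) (k : ℤ) : cube z k =
    Ioo (z.1 - (3 : ℝ) ^ (2 * k) / 2) (z.1 + (3 : ℝ) ^ (2 * k) / 2) ×ˢ
      (WithLp.ofLp ⁻¹' (univ.pi fun j => Ioo (z.2 j - (3 : ℝ) ^ k / 2) (z.2 j + (3 : ℝ) ^ k / 2))) := by
  ext p
  simp [cube, mem_ofPred_eq, mem_prod, mem_Ioo, mem_preimage, abs_lt]
  grind

lemma isOpen_cube (z : SpaceTime d) (k : ℤ) : IsOpen (cube z k) := by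
  rw [cube_eq_prod]
  exact isOpen_Ioo.prod ((isOpen_set_pi finite_univ fun _ _ => isOpen_Ioo).preimage (PiLp.continuous_ofLp 2 _))

lemma volume_cube (z : SpaceTime d) (k : ℤ) : volume (cube z k) = ofReal (vol d k) := by
  rw [cube_eq_prod, volume_eq_prod, prod_prod, (PiLp.volume_preserving_ofLp (Fin d)).measure_preimage
      (MeasurableSet.univ_pi fun _ => measurableSet_Ioo).nullMeasurableSet, volume_Ioo, volume_pi, pi_pi]
  rw [vol, ofReal_mul (by positivity), ofReal_pow (by positivity)]
  simp

lemma isBounded_cube (z : SpaceTime d) (k : ℤ) : IsBounded (cube z k) := by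
  rw [cube_eq_prod]
  refine (isBounded_Ioo _ _).prod ?_
  have h1 : IsBounded (univ.pi fun j => Ioo (z.2 j - 3 ^ k / 2) (z.2 j + 3 ^ k / 2)) :=
    IsBounded.pi fun _ => isBounded_Ioo _ _
  exact (PiLp.antilipschitzWith_ofLp 2 (fun _ : Fin d => ℝ)).isBounded_preimage h1

lemma isOpen_cell (k : ℤ) (i : Idx d) : IsOpen (cell k i) := isOpen_cube _ _

lemma measurableSet_cell (k : ℤ) (i : Idx d) : MeasurableSet (cell k i) := (isOpen_cell k i).measurableSet

lemma isBounded_cell (k : ℤ) (i : Idx d) : IsBounded (cell k i) := isBounded_cube _ _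

lemma volume_cell (k : ℤ) (i : Idx d) : volume (cell k i) = ofReal (vol d k) := volume_cube _ _

lemma volume_real_cell (k : ℤ) (i : Idx d) : volume.real (cell k i) = vol d k := by
  rw [measureReal_def, volume_cell, toReal_ofReal (vol_pos k).le]

lemma ctr_mem_cell (k : ℤ) (i : Idx d) : ctr k i ∈ cell k i := mem_cube_self _ _

lemma idx_eq_of_mem (h : p ∈ cell k i) (h' : p ∈ cell k i') : i = i' := by
  ext
  · exact int_eq_of_near (three_zpow_pos _) h.1 h'.1
  · exact int_eq_of_near (three_zpow_pos _) (h.2 _) (h'.2 _)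

lemma disjoint_cell (h : i ≠ i') : Disjoint (cell k i) (cell k i') :=
  Set.disjoint_left.2 fun _ hp hp' => h (idx_eq_of_mem hp hp')

lemma cell_subset_par (k : ℤ) (i : Idx d) : cell k i ⊆ cell (k + 1) (par i) := fun p hp => by
  rw [mem_cell] at hp ⊢
  have h1 : (3 : ℝ) ^ (2 * (k + 1)) = 9 * 3 ^ (2 * k) := by
    rw [mul_add, zpow_add₀ (by norm_num)]; ring
  have h2 : (3 : ℝ) ^ (k + 1) = 3 * 3 ^ k := by rw [zpow_add₀ (by norm_num)]; ring
  rw [h1, h2]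
  exact ⟨near_nine (three_zpow_pos _) hp.1, fun j => near_three (three_zpow_pos _) (hp.2 j)⟩

lemma cell_subset_iterate (k : ℤ) (i : Idx d) (n : ℕ) : cell k i ⊆ cell (k + n) (par^[n] i) := by
  induction n with
  | zero => simp
  | succ n ih =>
    rw [Function.iterate_succ_apply']
    refine (ih.trans (cell_subset_par _ _)).trans ?_
    grind

lemma ae_exists_mem_cell (k : ℤ) : ∀ᵐ p : SpaceTime d, ∃ i, p ∈ cell k i := by
  have hc : ∀ h : ℝ, volume (range fun n : ℤ => h * (n - 1 / 2)) = 0 := fun h => (countable_range _).measure_zero _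
  have q1 : Measure.QuasiMeasurePreserving (Prod.fst : SpaceTime d → ℝ) := Measure.quasiMeasurePreserving_fst
  have q2 := fun j => by
    have e1 : Measure.QuasiMeasurePreserving (Prod.snd : VecField d) := Measure.quasiMeasurePreserving_snd
    have e2 := (EuclideanSpace.volume_preserving_symm_measurableEquiv_toLp (Fin d)).quasiMeasurePreserving
    exact (Measure.quasiMeasurePreserving_eval (fun _ : Fin d => volume) j).comp (e2.comp e1)
  have a1 : ∀ᵐ p : SpaceTime d, p.1 ∉ range fun n : ℤ => 3 ^ (2 * k) * ((n : ℝ) - 1 / 2) := by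
    have := q1.preimage_null (hc (3 ^ (2 * k)))
    exact measure_eq_zero_iff_ae_notMem.1 this
  have a2 : ∀ᵐ p : SpaceTime d, ∀ j, p.2 j ∉ range fun n : ℤ => 3 ^ k * ((n : ℝ) - 1 / 2) := by
    rw [ae_all_iff]
    intro j
    have := (q2 j).preimage_null (hc (3 ^ k))
    exact measure_eq_zero_iff_ae_notMem.1 this
  filter_upwards [a1, a2] with p h1 h2
  obtain ⟨n, hn⟩ := exists_int_near (three_zpow_pos (2 * k)) fun n hn => h1 ⟨n, hn.symm⟩
  have h3 := fun j => exists_int_near (three_zpow_pos k) fun n hn => h2 j ⟨n, hn.symm⟩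
  choose m hm using h3
  exact ⟨(n, m), hn, hm⟩

/-! ### Cubes inside a given set -/

variable {Y : Set (SpaceTime d)}

lemma finite_cells (hX : IsBounded X) (k : ℤ) : {i : Idx d | cell k i ⊆ X}.Finite := by
  have h2 := Measure.finite_const_le_meas_of_disjoint_iUnion volume
    (ε := ofReal (vol d k)) (by simpa using vol_pos k)
    (As := fun i : {i : Idx d // cell k i ⊆ X} => cell k i.1)
    (fun i => measurableSet_cell k i.1)
    (fun i j hij => disjoint_cell fun h => hij (Subtype.ext h))
    (ne_top_of_le_ne_top hX.measure_lt_top.ne (measure_mono (iUnion_subset fun i => i.2)))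
  have h3 : {i : {i : Idx d // cell k i ⊆ X} | ofReal (vol d k) ≤ volume (cell k i.1)} = univ := by
    ext i; simp [volume_cell]
  rwa [h3, finite_univ_iff] at h2

open Classical in
/-- The labels of the cubes of scale `k` inside the bounded set `X`. -/
def cells (X : Set (SpaceTime d)) (k : ℤ) : Finset (Idx d) :=
  if h : {i : Idx d | cell k i ⊆ X}.Finite then h.toFinset else ∅

lemma mem_cells (hX : IsBounded X) : i ∈ cells X k ↔ cell k i ⊆ X := by
  rw [cells, dif_pos (finite_cells hX k)]; simp

/-- The union of the cubes of scale `k` inside `X`. -/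
def cellUnion (X : Set (SpaceTime d)) (k : ℤ) : Set (SpaceTime d) := ⋃ i ∈ cells X k, cell k i

lemma cellUnion_subset (hX : IsBounded X) : cellUnion X k ⊆ X := iUnion₂_subset fun _ hi => (mem_cells hX).1 hi

lemma cell_subset_cellUnion (hi : i ∈ cells X k) : cell k i ⊆ cellUnion X k := subset_biUnion_of_mem hi

lemma isOpen_cellUnion : IsOpen (cellUnion X k) := isOpen_biUnion fun i _ => isOpen_cell k i

lemma isBounded_cellUnion (hX : IsBounded X) : IsBounded (cellUnion X k) := hX.subset (cellUnion_subset hX)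

lemma mem_cellUnion : p ∈ cellUnion X k ↔ ∃ i ∈ cells X k, p ∈ cell k i := by simp [cellUnion]

section integrals

variable {E : Type*} [NormedAddCommGroup E] [NormedSpace ℝ E]

lemma setIntegral_eq_sum_cells {A : Finset (Idx d)}
    (hA : ∀ i ∈ A, cell k i ⊆ V) (hV' : ∀ i, (cell k i ∩ V).Nonempty → i ∈ A)
    {f : SpaceTime d → E} (hf : IntegrableOn f V) :
    ∫ p in V, f p = ∑ i ∈ A, ∫ p in cell k i, f p := by
  rw [← integral_biUnion_finset A (fun i _ => measurableSet_cell k i)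
    (fun i _ j _ hij => disjoint_cell hij) fun i hi => hf.mono_set (hA i hi)]
  refine setIntegral_congr_set ?_
  filter_upwards [ae_exists_mem_cell k] with p hp
  obtain ⟨i, hi⟩ := hp
  apply propext
  constructor
  · intro hpV
    exact mem_biUnion (hV' i ⟨p, hi, hpV⟩) hi
  · intro h
    obtain ⟨j, hj, hpj⟩ := mem_iUnion₂.1 h
    exact hA j hj hpj

lemma setIntegral_cellUnion {f : SpaceTime d → E} (hf : IntegrableOn f (cellUnion X k)) :
    ∫ p in cellUnion X k, f p = ∑ i ∈ cells X k, ∫ p in cell k i, f p := by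
  refine setIntegral_eq_sum_cells (fun i hi => cell_subset_cellUnion hi) (fun i ⟨p, hp, hp'⟩ => ?_) hf
  obtain ⟨j, hj, hpj⟩ := mem_cellUnion.1 hp'
  rwa [idx_eq_of_mem hp hpj]

end integrals

lemma cells_cellUnion (hX : IsBounded X) : cells (cellUnion X k) k = cells X k := by
  ext i
  rw [mem_cells (isBounded_cellUnion hX)]
  refine ⟨fun h => ?_, fun h => cell_subset_cellUnion h⟩
  obtain ⟨j, hj, hpj⟩ := mem_cellUnion.1 (h (ctr_mem_cell k i))
  rwa [idx_eq_of_mem (ctr_mem_cell k i) hpj]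

lemma cells_mono (hX : IsBounded X) (hY : Y ⊆ X) : cells Y k ⊆ cells X k := fun i hi => by
  rw [mem_cells hX]
  rw [mem_cells (hX.subset hY)] at hi
  grind

lemma par_mem_cells_cellUnion (hX : IsBounded X) (hj : j < k)
    (hi : i ∈ cells (cellUnion X k) j) : par i ∈ cells (cellUnion X k) (j + 1) := by
  rw [mem_cells (isBounded_cellUnion hX)] at hi ⊢
  obtain ⟨i', hi', hp⟩ := mem_cellUnion.1 (hi (ctr_mem_cell j i))
  obtain ⟨n, hn⟩ : ∃ n : ℕ, k = j + 1 + n := ⟨(k - j - 1).toNat, by omega⟩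
  have h1 := cell_subset_iterate (j + 1) (par i) n
  rw [← hn] at h1
  rw [← (idx_eq_of_mem hp (h1 (cell_subset_par j i (ctr_mem_cell j i))))] at h1
  exact h1.trans (cell_subset_cellUnion hi')
end

section
/-! ### Duality between cube averages at all scales -/

variable {g : VecField d}

/-- The average over the cube of scale `k` with label `i`. -/
def cavg (k : ℤ) (i : Idx d) (F : VecField d) : Space d :=
  (vol d k)⁻¹ • ∫ p in cell k i, F p

open Classical in
/-- The average over the next larger cube, set to zero when that cube is not contained in `X`. -/
def pavg (X : Set (SpaceTime d)) (k : ℤ) (i : Idx d) (F : VecField d) : Space d :=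
  if par i ∈ cells X (k + 1) then cavg (k + 1) (par i) F else 0

/-- The pairing of the cube averages of two fields at scale `k`. -/
def pairing (X : Set (SpaceTime d)) (k : ℤ) (F η : VecField d) : ℝ :=
  ∑ i ∈ cells X k, inner ℝ (cavg k i F) (∫ p in cell k i, η p)

/-- The squared `L²` norm of the change of the cube averages from scale `k + 1` to scale `k`. -/
def oscSq (X : Set (SpaceTime d)) (k : ℤ) (F : VecField d) : ℝ :=
  ∑ i ∈ cells X k, vol d k * ‖cavg k i F - pavg X k i F‖ ^ 2

lemma oscSq_nonneg : 0 ≤ oscSq X k F := sum_nonneg fun _ _ => mul_nonneg (vol_pos k).le (sq_nonneg _)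

lemma sum_le_sqrt_mul_sqrt {ι : Type*} (A : Finset ι) (f g : ι → ℝ) :
    ∑ i ∈ A, f i * g i ≤ √(∑ i ∈ A, f i ^ 2) * √(∑ i ∈ A, g i ^ 2) :=
  Real.sum_mul_le_sqrt_mul_sqrt A f g

lemma mem_cells_of_par (hX : IsBounded X) (hi : par i ∈ cells X (k + 1)) : i ∈ cells X k :=
  (mem_cells hX).2 ((cell_subset_par k i).trans ((mem_cells hX).1 hi))

lemma setIntegral_cell_eq_sum (hX : IsBounded X) (hi' : i' ∈ cells X (k + 1)) (hη : IntegrableOn η X) :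
    ∫ p in cell (k + 1) i', η p = ∑ i ∈ cells X k with par i = i', ∫ p in cell k i, η p := by
  refine setIntegral_eq_sum_cells (fun i hi => ?_) (fun i ⟨p, hp, hp'⟩ => ?_) (hη.mono_set ((mem_cells hX).1 hi'))
  · rw [mem_filter] at hi
    rw [← hi.2]; exact cell_subset_par k i
  · have h1 := idx_eq_of_mem (cell_subset_par k i hp) hp'
    rw [mem_filter]
    exact ⟨mem_cells_of_par hX (h1 ▸ hi'), h1⟩

lemma pairing_sub_pairing (hX : IsBounded X) (hη : IntegrableOn η X) : pairing X k F η - pairing X (k + 1) F η =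
      ∑ i ∈ cells X k, inner ℝ (cavg k i F - pavg X k i F) (∫ p in cell k i, η p) := by
  classical
  have h1 : pairing X (k + 1) F η = ∑ i ∈ cells X k, inner ℝ (pavg X k i F) (∫ p in cell k i, η p) := by
    have h2 : ∀ i' ∈ cells X (k + 1), inner ℝ (cavg (k + 1) i' F) (∫ p in cell (k + 1) i', η p) =
        ∑ i ∈ cells X k with par i = i', inner ℝ (pavg X k i F) (∫ p in cell k i, η p) := fun i' hi' => by
      rw [setIntegral_cell_eq_sum hX hi' hη, inner_sum]
      refine sum_congr rfl fun i hi => ?_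
      rw [mem_filter] at hi
      rw [pavg, if_pos (hi.2 ▸ hi'), hi.2]
    rw [pairing, sum_congr rfl h2]
    rw [← Finset.sum_filter_add_sum_filter_not (cells X k) (fun i => par i ∈ cells X (k + 1))]
    have h3 : ∑ i ∈ cells X k with ¬ par i ∈ cells X (k + 1), inner ℝ (pavg X k i F) (∫ p in cell k i, η p) = 0 := by
      refine sum_eq_zero fun i hi => ?_
      rw [pavg, if_neg (mem_filter.1 hi).2, inner_zero_left]
    rw [h3, add_zero, ← Finset.sum_fiberwise_of_maps_to (fun i hi => (mem_filter.1 hi).2)]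
    refine sum_congr rfl fun i' hi' => sum_congr ?_ fun _ _ => rfl
    ext i
    constructor
    · simp_all
    · simp_all
  rw [h1, pairing, ← sum_sub_distrib]
  simp [inner_sub_left]

lemma abs_pairing_sub_le (hX : IsBounded X) (hη : IntegrableOn η X) {β : ℝ} (hβ : 0 ≤ β) (hR : 0 ≤ R)
    (hb : ∑ i ∈ cells X k, ‖∫ p in cell k i, η p‖ ^ 2 ≤ vol d k * β * R ^ 2) :
    |pairing X k F η - pairing X (k + 1) F η| ≤ √(oscSq X k F) * √β * R := by
  have hv := vol_pos (d := d) k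
  rw [pairing_sub_pairing hX hη]
  have h1 : |∑ i ∈ cells X k, inner ℝ (cavg k i F - pavg X k i F) (∫ p in cell k i, η p)| ≤
      ∑ i ∈ cells X k, (√(vol d k) * ‖cavg k i F - pavg X k i F‖) * ((√(vol d k))⁻¹ * ‖∫ p in cell k i, η p‖) := by
    refine (abs_sum_le_sum_abs _ _).trans (sum_le_sum fun i _ => ?_)
    refine (abs_real_inner_le_norm _ _).trans (le_of_eq ?_)
    field_simp
  refine h1.trans ((sum_le_sqrt_mul_sqrt _ _ _).trans ?_)
  rw [mul_assoc]
  have e1 : ∑ i ∈ cells X k, (√(vol d k) * ‖cavg k i F - pavg X k i F‖) ^ 2 = oscSq X k F := by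
    simp [mul_pow, sq_sqrt hv.le, oscSq]
  rw [e1]
  refine mul_le_mul_of_nonneg_left ?_ (sqrt_nonneg _)
  rw [← sqrt_sq hR, ← sqrt_mul hβ]
  refine sqrt_le_sqrt ?_
  simp [mul_pow, inv_pow, sq_sqrt hv.le]
  rw [← mul_sum, inv_mul_le_iff₀ hv]
  linarith

/-! ### The pairings converge to the integral -/

lemma pairing_sub_right (hX : IsBounded X) (hη : IntegrableOn η X) (hg : IntegrableOn g X) :
    pairing X k F (fun p => η p - g p) = pairing X k F η - pairing X k F g := by
  rw [pairing, pairing, pairing, ← sum_sub_distrib]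
  refine sum_congr rfl fun i hi => ?_
  have hs := (mem_cells hX).1 hi
  rw [integral_sub (hη.mono_set hs) (hg.mono_set hs), inner_sub_right]

lemma norm_setIntegral_sq_le (hV : volume V ≠ ⊤) (hF : MemLp F 2 (𝓛 V)) :
    ‖∫ p in V, F p‖ ^ 2 ≤ volume.real V * ∫ p in V, ‖F p‖ ^ 2 := by
  have := isFiniteMeasure_restrict.2 hV
  have h1 : MemLp (fun _ : SpaceTime d => (1 : ℝ)) 2 (𝓛 V) := memLp_const 1
  have h2 := integral_norm_mul_norm_le h1 hF
  simp at h2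
  have h4 := pow_le_pow_left₀ (norm_nonneg _) ((norm_integral_le_integral_norm F).trans h2) 2
  rw [mul_pow, l2_sq h1, l2_sq hF] at h4
  simp_all

lemma sum_norm_sq_le (hX : IsBounded X) (hη : MemLp η 2 (𝓛 X)) :
    ∑ i ∈ cells X k, ‖∫ p in cell k i, η p‖ ^ 2 ≤ vol d k * ∫ p in X, ‖η p‖ ^ 2 := by
  have hi : IntegrableOn (fun p => ‖η p‖ ^ 2) X := hη.integrable_norm_pow (by norm_num)
  have h1 : ∀ i ∈ cells X k, ‖∫ p in cell k i, η p‖ ^ 2 ≤ vol d k * ∫ p in cell k i, ‖η p‖ ^ 2 := fun i hi => by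
    rw [← volume_real_cell k i]
    exact norm_setIntegral_sq_le (isBounded_cell k i).measure_lt_top.ne
      (hη.mono_measure (restrict_mono ((mem_cells hX).1 hi) le_rfl))
  refine (sum_le_sum h1).trans ?_
  rw [← mul_sum, ← setIntegral_cellUnion (hi.mono_set (cellUnion_subset hX))]
  exact mul_le_mul_of_nonneg_left (setIntegral_mono_set hi (ae_of_all _ fun p => sq_nonneg _)
    (cellUnion_subset hX).eventuallyLE) (vol_pos k).le

lemma abs_pairing_le_l2 (hX : IsBounded X) (hF : MemLp F 2 (𝓛 X)) (hη : MemLp η 2 (𝓛 X)) :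
    |pairing X k F η| ≤ l2 (𝓛 X) F * l2 (𝓛 X) η := by
  have hv := vol_pos (d := d) k
  have h1 : |pairing X k F η| ≤ (vol d k)⁻¹ * ∑ i ∈ cells X k, ‖∫ p in cell k i, F p‖ * ‖∫ p in cell k i, η p‖ := by
    rw [mul_sum]
    refine (abs_sum_le_sum_abs _ _).trans (sum_le_sum fun i _ => ?_)
    refine (abs_real_inner_le_norm _ _).trans (le_of_eq ?_)
    rw [cavg, norm_smul, norm_of_nonneg (inv_nonneg.2 hv.le)]; ring
  refine h1.trans ?_
  rw [inv_mul_le_iff₀ hv]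
  refine (sum_le_sqrt_mul_sqrt _ _ _).trans ?_
  have e1 := sqrt_le_sqrt (sum_norm_sq_le (k := k) hX hF)
  have e2 := sqrt_le_sqrt (sum_norm_sq_le (k := k) hX hη)
  refine (mul_le_mul e1 e2 (sqrt_nonneg _) (sqrt_nonneg _)).trans (le_of_eq ?_)
  rw [sqrt_mul hv.le, sqrt_mul hv.le, l2_eq_sqrt hF, l2_eq_sqrt hη, mul_mul_mul_comm,
    Real.mul_self_sqrt hv.le]

lemma norm_cavg_le (hF : ∀ p, ‖F p‖ ≤ C) (i : Idx d) : ‖cavg k i F‖ ≤ C := by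
  have hv := vol_pos (d := d) k
  have h1 := norm_setIntegral_le_of_norm_le_const (μ := volume) (isBounded_cell k i).measure_lt_top (fun p _ => hF p)
  rw [volume_real_cell] at h1
  rw [cavg, norm_smul, norm_of_nonneg (inv_nonneg.2 hv.le), inv_mul_le_iff₀ hv]
  linarith

lemma abs_pairing_le_l1 (hX : IsBounded X) (hF : ∀ p, ‖F p‖ ≤ C)
    (hη : IntegrableOn η X) : |pairing X k F η| ≤ C * ∫ p in X, ‖η p‖ := by
  have hC := (norm_nonneg _).trans (hF 0)
  have h1 : |pairing X k F η| ≤ C * ∑ i ∈ cells X k, ∫ p in cell k i, ‖η p‖ := by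
    rw [mul_sum]
    refine (abs_sum_le_sum_abs _ _).trans (sum_le_sum fun i _ => ?_)
    refine (abs_real_inner_le_norm _ _).trans ?_
    exact mul_le_mul (norm_cavg_le hF i) (norm_integral_le_integral_norm _) (norm_nonneg _) hC
  refine h1.trans (mul_le_mul_of_nonneg_left ?_ hC)
  rw [← setIntegral_cellUnion (IntegrableOn.mono_set hη.norm (cellUnion_subset hX))]
  exact setIntegral_mono_set hη.norm (ae_of_all _ fun p => norm_nonneg _) (cellUnion_subset hX).eventuallyLE

lemma exists_scale (hr : 0 < r) (k : ℤ) :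
    ∃ n₀ : ℕ, ∀ n ≥ n₀, ∀ i : Idx d, ∀ p ∈ cell (k - n) i, ∀ q ∈ cell (k - n) i, dist p q < r := by
  have h1 : Tendsto (fun n : ℕ => 3 ^ (2 * (k - n)) + √d * 3 ^ (k - n)) atTop (𝓝 0) := by
    have e0 : Tendsto (fun n : ℕ => ((3 : ℝ)⁻¹) ^ n) atTop (𝓝 0) :=
      tendsto_pow_atTop_nhds_zero_of_lt_one (by norm_num) (by norm_num)
    have e1 : Tendsto (fun n : ℕ => (3 : ℝ) ^ (k - n)) atTop (𝓝 0) := by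
      have : (fun n : ℕ => 3 ^ (k - n)) = fun n : ℕ => 3 ^ k * ((3 : ℝ)⁻¹) ^ n := by
        ext n; rw [zpow_sub₀ (by norm_num), zpow_natCast, inv_pow, div_eq_mul_inv]
      rw [this]; simpa using e0.const_mul (3 ^ k)
    have e2 : Tendsto (fun n : ℕ => (3 : ℝ) ^ (2 * (k - n))) atTop (𝓝 0) := by
      have : (fun n : ℕ => 3 ^ (2 * (k - n))) = fun n : ℕ => (3 : ℝ) ^ (k - n) * 3 ^ (k - n) := by
        ext n; rw [← zpow_add₀ (by norm_num)]; congr 1; ring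
      rw [this]; simpa using e1.mul e1
    simpa using e2.add (e1.const_mul √d)
  obtain ⟨n₀, hn⟩ := (h1.eventually (gt_mem_nhds hr)).exists_forall_of_atTop
  refine ⟨n₀, fun n hn' i p hp q hq => lt_of_le_of_lt ?_ (hn n hn')⟩
  have a1 : dist p.1 q.1 ≤ 3 ^ (2 * (k - n)) := by
    have e1 := abs_lt.1 hp.1
    have e2 := abs_lt.1 hq.1
    exact abs_le.2 ⟨by linarith, by linarith⟩
  have a2 : dist p.2 q.2 ≤ √d * 3 ^ (k - n) := by
    rw [EuclideanSpace.dist_eq]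
    have : ∀ j, dist (p.2 j) (q.2 j) ^ 2 ≤ (3 ^ (k - n)) ^ 2 := fun j => by
      refine pow_le_pow_left₀ dist_nonneg ?_ 2
      have e1 := abs_lt.1 (hp.2 j)
      have e2 := abs_lt.1 (hq.2 j)
      exact abs_le.2 ⟨by linarith, by linarith⟩
    refine (sqrt_le_sqrt (sum_le_sum fun j _ => this j)).trans (le_of_eq ?_)
    rw [sum_const, Finset.card_univ, Fintype.card_fin, nsmul_eq_mul,
      sqrt_mul (Nat.cast_nonneg d), sqrt_sq (three_zpow_pos _).le]
  rw [Prod.dist_eq]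
  have b1 := three_zpow_pos (2 * (k - n))
  have b2 := mul_nonneg (sqrt_nonneg d) (three_zpow_pos (k - n)).le
  grind

lemma ae_eventually_mem_cellUnion (hX : IsBounded X) (hXo : IsOpen X) (k : ℤ) :
    ∀ᵐ p, p ∈ X → ∀ᶠ n : ℕ in atTop, p ∈ cellUnion X (k - n) := by
  have h1 : ∀ᵐ p : SpaceTime d, ∀ j : ℤ, ∃ i, p ∈ cell j i := by
    rw [ae_all_iff]; exact ae_exists_mem_cell
  filter_upwards [h1] with p hp hpX
  obtain ⟨r, hr, hb⟩ := Metric.isOpen_iff.1 hXo p hpX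
  obtain ⟨n₀, hn⟩ := exists_scale hr k
  filter_upwards [eventually_ge_atTop n₀] with n hn'
  obtain ⟨i, hi⟩ := hp (k - n)
  exact mem_cellUnion.2 ⟨i, (mem_cells hX).2 fun q hq => hb (hn n hn' i q hq p hi), hi⟩

lemma tendsto_setIntegral_cellUnion (hX : IsBounded X) (hXo : IsOpen X) (k : ℤ)
    {f : SpaceTime d → ℝ} (hf : IntegrableOn f X) :
    Tendsto (fun n : ℕ => ∫ p in cellUnion X (k - n), f p) atTop (𝓝 (∫ p in X, f p)) := by
  have h1 : ∀ n : ℕ, ∫ p in cellUnion X (k - n), f p = ∫ p in X, (cellUnion X (k - n)).indicator f p := fun n => by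
    rw [setIntegral_indicator isOpen_cellUnion.measurableSet, inter_eq_right.2 (cellUnion_subset hX)]
  simp [h1]
  refine tendsto_integral_of_dominated_convergence (fun p => ‖f p‖)
    (fun n => hf.1.indicator isOpen_cellUnion.measurableSet) hf.norm
    (fun n => ae_of_all _ fun p => norm_indicator_le_norm_self _ _) ?_
  rw [ae_restrict_iff' hXo.measurableSet]
  filter_upwards [ae_eventually_mem_cellUnion hX hXo k] with p hp hpX
  refine tendsto_const_nhds.congr' ?_
  filter_upwards [hp hpX] with n hn
  simp_all

lemma tendsto_pairing_of_continuous (hX : IsBounded X) (hXo : IsOpen X) (k : ℤ)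
    (hF : IntegrableOn F X) (hg : Continuous g) (hgs : HasCompactSupport g) :
    Tendsto (fun n : ℕ => pairing X (k - n) F g) atTop (𝓝 (∫ p in X, inner ℝ (F p) (g p))) := by
  obtain ⟨G, hG⟩ := hgs.exists_bound_of_continuous hg
  have hFg : IntegrableOn (fun p => inner ℝ (F p) (g p)) X := by
    refine (hF.norm.mul_const G).mono (hF.1.inner hg.aestronglyMeasurable) (ae_of_all _ fun p => ?_)
    refine (norm_inner_le_norm _ _).trans ((mul_le_mul_of_nonneg_left (hG p) (norm_nonneg _)).trans (le_abs_self _))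
  have huc := hgs.uniformContinuous_of_continuous hg
  have hsub : Tendsto (fun n : ℕ => pairing X (k - n) F g -
      ∫ p in cellUnion X (k - n), inner ℝ (F p) (g p)) atTop (𝓝 0) := by
    rw [Metric.tendsto_atTop]
    intro δ hδ
    set A := ∫ p in X, ‖F p‖ with hA
    obtain ⟨r, hr, hru⟩ := Metric.uniformContinuous_iff.1 huc (δ / (A + 1)) (by positivity)
    obtain ⟨n₀, hn⟩ := exists_scale hr k
    refine ⟨n₀, fun n hn' => ?_⟩
    set j := k - n with hj
    have hv := vol_pos (d := d) j
    rw [dist_zero_right, pairing, setIntegral_cellUnion (hFg.mono_set (cellUnion_subset hX)), ← sum_sub_distrib]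
    have hterm : ∀ i ∈ cells X j, ‖inner ℝ (cavg j i F) (∫ p in cell j i, g p) -
        ∫ p in cell j i, inner ℝ (F p) (g p)‖ ≤ δ / (A + 1) * ∫ p in cell j i, ‖F p‖ := fun i hi => by
      have hs := (mem_cells hX).1 hi
      have hFi := hF.mono_set hs
      have e1 : inner ℝ (cavg j i F) (∫ p in cell j i, g p) = ∫ p in cell j i, inner ℝ (F p) (cavg j i g) := by
        rw [cavg, inner_smul_left, cavg]
        have : ∀ v : Space d, ∫ p in cell j i, inner ℝ (F p) v = inner ℝ (∫ p in cell j i, F p) v := fun v => by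
          simp [real_inner_comm v]
          exact integral_inner hFi v
        rw [this, inner_smul_right]
        rfl
      have hint : IntegrableOn (fun p => inner ℝ (F p) (cavg j i g)) (cell j i) := hFi.inner_const _
      rw [e1, ← integral_sub hint (hFg.mono_set hs), ← integral_const_mul]
      refine (norm_integral_le_integral_norm _).trans ?_
      refine setIntegral_mono_on (hint.sub (hFg.mono_set hs)).norm (hFi.norm.const_mul _)
        (measurableSet_cell j i) fun p hp => ?_
      rw [← inner_sub_right, mul_comm]
      refine (norm_inner_le_norm _ _).trans (mul_le_mul_of_nonneg_left ?_ (norm_nonneg _))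
      have e2 : cavg j i g - g p = (vol d j)⁻¹ • ∫ q in cell j i, (g q - g p) := by
        rw [integral_sub (hg.integrable_of_hasCompactSupport hgs).integrableOn (integrableOn_const
          (isBounded_cell j i).measure_lt_top.ne), setIntegral_const, volume_real_cell, smul_sub,
          smul_smul, inv_mul_cancel₀ hv.ne', one_smul, cavg]
      have e3 := norm_setIntegral_le_of_norm_le_const (μ := volume)
        (isBounded_cell j i).measure_lt_top (C := δ / (A + 1)) (f := fun q => g q - g p)
        (fun q hq => by
          rw [← dist_eq_norm]
          grind)
      rw [volume_real_cell] at e3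
      rw [e2, norm_smul, norm_of_nonneg (inv_nonneg.2 hv.le), inv_mul_le_iff₀ hv]
      linarith
    refine ((norm_sum_le _ _).trans (sum_le_sum hterm)).trans_lt ?_
    rw [← mul_sum, ← setIntegral_cellUnion (IntegrableOn.mono_set hF.norm (cellUnion_subset hX))]
    have e4 : ∫ p in cellUnion X j, ‖F p‖ ≤ A := setIntegral_mono_set hF.norm
      (ae_of_all _ fun p => norm_nonneg _) (cellUnion_subset hX).eventuallyLE
    calc _ ≤ δ / (A + 1) * A := by gcongr
      _ < δ := by rw [div_mul_eq_mul_div, div_lt_iff₀ (by positivity)]; nlinarith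
  simpa using hsub.add (tendsto_setIntegral_cellUnion hX hXo k hFg)

/-- Convergence of the pairings, for fields that can be approximated by continuous ones. -/
lemma tendsto_pairing_of_approx (hX : IsBounded X) (hXo : IsOpen X) (k : ℤ)
    (hF : IntegrableOn F X) (hη : IntegrableOn η X)
    (hFη : IntegrableOn (fun p => inner ℝ (F p) (η p)) X)
    (happ : ∀ δ > 0, ∃ g, Continuous g ∧ HasCompactSupport g ∧ (∀ j, |pairing X j F (fun p => η p - g p)| ≤ δ) ∧
      |∫ p in X, inner ℝ (F p) (η p - g p)| ≤ δ) :
    Tendsto (fun n : ℕ => pairing X (k - n) F η) atTop (𝓝 (∫ p in X, inner ℝ (F p) (η p))) := by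
  rw [Metric.tendsto_atTop]
  intro δ hδ
  obtain ⟨g, hg, hgs, h1, h2⟩ := happ (δ / 4) (by positivity)
  obtain ⟨n₀, hn⟩ := Metric.tendsto_atTop.1 (tendsto_pairing_of_continuous hX hXo k hF hg hgs) (δ / 4) (by positivity)
  refine ⟨n₀, fun n hn' => ?_⟩
  have h3 := hn n hn'
  have h4 := h1 (k - n)
  rw [pairing_sub_right hX hη (hg.integrable_of_hasCompactSupport hgs).integrableOn] at h4
  obtain ⟨G, hG⟩ := hgs.exists_bound_of_continuous hg
  have hFg : IntegrableOn (fun p => inner ℝ (F p) (g p)) X := by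
    refine (hF.norm.mul_const G).mono (hF.1.inner hg.aestronglyMeasurable) (ae_of_all _ fun p => ?_)
    refine (norm_inner_le_norm _ _).trans ((mul_le_mul_of_nonneg_left (hG p) (norm_nonneg _)).trans (le_abs_self _))
  simp [inner_sub_right] at h2
  rw [integral_sub hFη hFg] at h2
  rw [dist_eq] at h3 ⊢
  rw [abs_lt] at h3 ⊢
  rw [abs_le] at h4 h2
  constructor <;> linarith

lemma tendsto_pairing_l2 (hX : IsBounded X) (hXo : IsOpen X) (k : ℤ) (hF : MemLp F 2 (𝓛 X)) (hη : MemLp η 2 (𝓛 X)) :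
    Tendsto (fun n : ℕ => pairing X (k - n) F η) atTop (𝓝 (∫ p in X, inner ℝ (F p) (η p))) := by
  have : IsFiniteMeasure (𝓛 X) := ⟨by simpa using hX.measure_lt_top⟩
  have hin : ∀ {g : VecField d}, MemLp g 2 (𝓛 X) → IntegrableOn (fun p => inner ℝ (F p) (g p)) X := fun {g} hg =>
    (integrable_norm_mul_norm hF hg).mono (hF.1.inner hg.1) (ae_of_all _ fun p =>
      (norm_inner_le_norm _ _).trans (le_abs_self _))
  refine tendsto_pairing_of_approx hX hXo k (hF.integrable (by norm_num))
    (hη.integrable (by norm_num)) (hin hη) fun δ hδ => ?_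
  set A := l2 (𝓛 X) F with hA
  have hA0 : 0 ≤ A := l2_nonneg _
  obtain ⟨g, hgs, hgle, hg, hgm⟩ := hη.exists_hasCompactSupport_eLpNorm_sub_le (by norm_num)
    (ε := ofReal (δ / (A + 1))) (by positivity)
  have hle : l2 (𝓛 X) (fun p => η p - g p) ≤ δ / (A + 1) := by
    have := toReal_mono ofReal_ne_top hgle
    rwa [toReal_ofReal (by positivity)] at this
  have hmul : A * l2 (𝓛 X) (fun p => η p - g p) ≤ δ := by
    calc _ ≤ A * (δ / (A + 1)) := by gcongr
      _ ≤ δ := by rw [mul_div_assoc', div_le_iff₀ (by positivity)]; nlinarith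
  refine ⟨g, hg, hgs, fun j => (abs_pairing_le_l2 hX hF (hη.sub hgm)).trans hmul, ?_⟩
  refine le_trans ?_ ((integral_norm_mul_norm_le hF (hη.sub hgm)).trans hmul)
  refine (abs_integral_le_integral_abs).trans ?_
  exact integral_mono (hin (hη.sub hgm)).abs (integrable_norm_mul_norm hF (hη.sub hgm))
    fun p => abs_real_inner_le_norm _ _

lemma tendsto_pairing_l1 (hX : IsBounded X) (hXo : IsOpen X) (k : ℤ)
    (hFm : AEStronglyMeasurable F (𝓛 X)) (hF : ∀ p, ‖F p‖ ≤ C)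
    (hη : IntegrableOn η X) :
    Tendsto (fun n : ℕ => pairing X (k - n) F η) atTop (𝓝 (∫ p in X, inner ℝ (F p) (η p))) := by
  have : IsFiniteMeasure (𝓛 X) := ⟨by simpa using hX.measure_lt_top⟩
  have hC := (norm_nonneg _).trans (hF 0)
  have hin : ∀ {g : VecField d}, IntegrableOn g X → IntegrableOn (fun p => inner ℝ (F p) (g p)) X := fun {g} hg =>
    (hg.norm.const_mul C).mono (hFm.inner hg.1) (ae_of_all _ fun p =>
      (norm_inner_le_norm _ _).trans ((mul_le_mul_of_nonneg_right (hF p) (norm_nonneg _)).trans (le_abs_self _)))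
  refine tendsto_pairing_of_approx hX hXo k (Integrable.of_bound hFm C (ae_of_all _ hF)) hη (hin hη) fun δ hδ => ?_
  obtain ⟨g, hgs, hgle, hg, hgm⟩ := Integrable.exists_hasCompactSupport_integral_sub_le hη
    (ε := δ / (C + 1)) (by positivity)
  have hmul : C * ∫ p in X, ‖η p - g p‖ ≤ δ := by
    calc _ ≤ C * (δ / (C + 1)) := by gcongr
      _ ≤ δ := by rw [mul_div_assoc', div_le_iff₀ (by positivity)]; nlinarith
  refine ⟨g, hg, hgs, fun j => (abs_pairing_le_l1 hX hF (hη.sub hgm)).trans hmul, ?_⟩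
  refine le_trans ?_ hmul
  rw [← integral_const_mul]
  refine (abs_integral_le_integral_abs).trans ?_
  exact integral_mono (hin (hη.sub hgm)).abs ((hη.sub hgm).norm.const_mul C)
    fun p => (abs_real_inner_le_norm _ _).trans (mul_le_mul_of_nonneg_right (hF p) (norm_nonneg _))

/-- Summation over the scales below `k` of the changes of the pairings: the Besov-type norm of `F`
against the negative Besov-type norm of `η`. -/
lemma abs_le_of_tendsto_pairing (hX : IsBounded X) (hη : IntegrableOn η X) {L : ℝ}
    (hlim : Tendsto (fun n : ℕ => pairing X (k - n) F η) atTop (𝓝 L)) (h0 : pairing X k F η = 0)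
    {β : ℤ → ℝ} (hβ : ∀ j, 0 ≤ β j) (hw : ∀ j, 0 < w j) (hR : 0 ≤ R)
    (hb : ∀ j < k, ∑ i ∈ cells X j, ‖∫ p in cell j i, η p‖ ^ 2 ≤ vol d j * β j * R ^ 2)
    (hM : ∀ A : Finset ℤ, (∀ j ∈ A, j < k) → ∑ j ∈ A, (w j)⁻¹ * oscSq X j F ≤ M)
    (hS : ∀ A : Finset ℤ, (∀ j ∈ A, j < k) → ∑ j ∈ A, w j * β j ≤ S) :
    |L| ≤ √M * √S * R := by
  refine le_of_tendsto hlim.abs (Eventually.of_forall fun n => ?_)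
  have htel : pairing X (k - n) F η = ∑ l ∈ Finset.range n,
      (pairing X (k - (l + 1 : ℕ)) F η - pairing X (k - l) F η) := by
    rw [Finset.sum_range_sub (fun l : ℕ => pairing X (k - l) F η) n]
    simp [h0]
  set A : Finset ℤ := (Finset.range n).image fun l : ℕ => k - ((l + 1)) with hA
  have hAk : ∀ j ∈ A, j < k := fun j hj => by
    obtain ⟨l, _, rfl⟩ := Finset.mem_image.1 hj
    omega
  have h1 : |pairing X (k - n) F η| ≤ ∑ j ∈ A, √(oscSq X j F) * √(β j) * R := by
    rw [htel, hA, sum_image (fun l _ l' _ h => by simp_all)]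
    refine (abs_sum_le_sum_abs _ _).trans (sum_le_sum fun l _ => ?_)
    have hk : k - l = k - ((l + 1)) + 1 := by ring
    rw [hk]
    exact abs_pairing_sub_le hX hη (hβ _) hR (hb _ (by simp))
  refine h1.trans ?_
  rw [← sum_mul]
  refine mul_le_mul_of_nonneg_right ?_ hR
  have h2 : ∀ j, √(oscSq X j F) * √(β j) = √((w j)⁻¹ * oscSq X j F) * √(w j * β j) := fun j => by
    rw [← sqrt_mul oscSq_nonneg, ← sqrt_mul (mul_nonneg (inv_nonneg.2 (hw j).le) oscSq_nonneg)]
    congr 1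
    have := (hw j).ne'
    field_simp
  simp [h2]
  refine (sum_le_sqrt_mul_sqrt _ _ _).trans ?_
  refine mul_le_mul (sqrt_le_sqrt ?_) (sqrt_le_sqrt ?_) (sqrt_nonneg _) (sqrt_nonneg _)
  · simp [sq_sqrt (mul_nonneg (inv_nonneg.2 (hw _).le) oscSq_nonneg)]
    exact hM A hAk
  · simp [sq_sqrt (mul_nonneg (hw _).le (hβ _))]
    exact hS A hAk
end

/-! ### Dirichlet and Neumann variations on unions of cubes -/

open Classical in
/-- A test function on a disjoint union of two open sets restricts to a test function on each. -/
lemma IsTest.indicator (h : IsTest O φ) (hV : IsOpen V) (hV' : IsOpen (O \ V)) : IsTest V (V.indicator φ) := by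
  have hsup : tsupport (V.indicator φ) ⊆ V := fun p hp => by
    have h1 : p ∈ tsupport φ := by
      refine closure_mono ?_ hp
      rw [Set.support_indicator]; exact inter_subset_right
    by_contra hpV
    have h2 : p ∈ closure V := closure_mono (by simp) hp
    obtain ⟨q, hq, hq'⟩ := mem_closure_iff.1 h2 _ hV' ⟨h.support h1, hpV⟩
    exact hq.2 hq'
  refine ⟨?_, h.compact.mono (by simp), hsup⟩
  rw [contDiff_iff_contDiffAt]
  intro p
  by_cases hp : p ∈ V
  · refine (h.smooth.contDiffAt).congr_of_eventuallyEq ?_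
    filter_upwards [hV.mem_nhds hp] with q hq
    simp_all
  · refine (contDiffAt_const (c := 0)).congr_of_eventuallyEq ?_
    exact notMem_tsupport_iff_eventuallyEq.1 (fun h => hp (hsup h))

lemma dx_congr_nhds (hφ : DifferentiableAt ℝ φ p) (h : φ =ᶠ[𝓝 p] ψ) : dx φ p = dx ψ p := by
  ext i
  rw [dx_apply hφ, dx_apply (hφ.congr_of_eventuallyEq h.symm), h.fderiv_eq]

lemma IsTest.setIntegral_dx_eq_zero (h : IsTest O φ) (hV : IsOpen V) (hV' : IsOpen (O \ V)) :
    ∫ p in V, dx φ p = 0 := by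
  have h1 := h.indicator hV hV'
  have h2 : ∫ p in V, dx φ p = ∫ p in V, dx (V.indicator φ) p := by
    refine setIntegral_congr_fun hV.measurableSet fun p hp => dx_congr_nhds (h.differentiable p) ?_
    filter_upwards [hV.mem_nhds hp] with q hq
    rw [indicator_of_mem hq]
  rw [h2, setIntegral_eq_integral_of_forall_compl_eq_zero fun p hp => h1.dx_zero_off hp, h1.integral_dx]

lemma isOpen_cellUnion_diff : IsOpen (cellUnion X k \ cell k i) := by
  have : cellUnion X k \ cell k i = ⋃ j ∈ {j | j ∈ cells X k ∧ j ≠ i}, cell k j := by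
    ext p
    simp only [Set.mem_sdiff, mem_cellUnion, mem_iUnion, mem_ofPred_eq, exists_prop]
    constructor
    · grind
    · rintro ⟨j, ⟨hj, hji⟩, hpj⟩
      exact ⟨⟨j, hj, hpj⟩, fun hp => hji (idx_eq_of_mem hpj hp)⟩
  rw [this]
  exact isOpen_biUnion fun j _ => isOpen_cell k j

lemma IsTest.setIntegral_cell_dx (h : IsTest (cellUnion X k) φ) (i : Idx d) : ∫ p in cell k i, dx φ p = 0 :=
  h.setIntegral_dx_eq_zero (isOpen_cell k i) isOpen_cellUnion_diff

/-- The gradient as a linear map on test functions. -/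
def dxLin (O : Set (SpaceTime d)) : TestSpace O →ₗ[ℝ] VecField d where
  toFun φ := dx φ.1
  map_add' φ ψ := funext fun p => dx_add (φ.2.differentiable p) (ψ.2.differentiable p)
  map_smul' c φ := funext fun p => dx_const_mul c (φ.2.differentiable p)

/-- A space of pairs on the union of the cubes of scale `k` inside `X`: it contains all test functions
with their gradients, and on every cube the field of a pair is the gradient of its function up to
a constant. -/
structure IsCellPair {W : Type*} [AddCommGroup W] [Module ℝ W] (a : MatField d)
    (X : Set (SpaceTime d)) (k : ℤ) (val : W →ₗ[ℝ] SpaceTime d → ℝ)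
    (grd : W →ₗ[ℝ] VecField d) : Prop extends IsPair a (cellUnion X k) val grd where
  exists_of_test : ∀ φ, IsTest (cellUnion X k) φ → ∃ v, val v = φ ∧ grd v = dx φ
  grd_eq : ∀ v, ∀ i ∈ cells X k, ∃ c : Space d, ∀ p ∈ cell k i, grd v p = dx (val v) p + c
  bounded : ∀ v, ∃ C, ∀ p, ‖grd v p‖ ≤ C

lemma exists_coord_bound [NeZero d] (hO : IsBounded O) : ∃ R, 0 ≤ R ∧ ∀ p ∈ O, |p.2 (0 : Fin d)| ≤ R := by
  obtain ⟨R, hR⟩ := hO.exists_norm_le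
  refine ⟨max R 0, le_max_right _ _, fun p hp => ?_⟩
  exact (PiLp.norm_apply_le p.2 0).trans ((norm_snd_le p).trans ((hR p hp).trans (le_max_left _ _)))

lemma IsCoefficientField.isPair_test [NeZero d] (h : IsCoefficientField a)
    (hO : IsBounded O) : IsPair a O (TestSpace O).subtype (dxLin O) where
  test φ := φ.2
  finE φ := by
    obtain ⟨C, _, hC⟩ := φ.2.bounded_dx
    exact h.finE_of_bounded hO φ.2.continuous_dx.aestronglyMeasurable hC
  poincare := by
    obtain ⟨R, hR0, hR⟩ := exists_coord_bound hO
    exact ⟨R, hR0, fun φ => integral_abs_le_dx 0 hR0 hR hO.measure_lt_top.ne φ.2⟩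

lemma IsCoefficientField.isCellPair_test [NeZero d] (h : IsCoefficientField a) (hX : IsBounded X) (k : ℤ) :
    IsCellPair a X k (TestSpace (cellUnion X k)).subtype (dxLin (cellUnion X k)) where
  toIsPair := h.isPair_test (isBounded_cellUnion hX)
  exists_of_test φ hφ := ⟨⟨φ, hφ⟩, rfl, rfl⟩
  grd_eq _ _ _ := ⟨0, fun p _ => (add_zero _).symm⟩
  bounded φ := by
    obtain ⟨C, _, hC⟩ := φ.2.bounded_dx
    exact ⟨C, hC⟩

/-- The field that is constant on the cubes of scale `k` inside `X` and vanishes elsewhere. -/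
def stepField (X : Set (SpaceTime d)) (k : ℤ) (c : Idx d → Space d)
    (p : SpaceTime d) : Space d := ∑ i ∈ cells X k, (cell k i).indicator (fun _ => c i) p

lemma stepField_eq (hi : i ∈ cells X k) (c : Idx d → Space d)
    (hp : p ∈ cell k i) : stepField X k c p = c i := by
  rw [stepField, Finset.sum_eq_single i]
  · rw [indicator_of_mem hp]
  · intro j _ hj
    rw [indicator_of_notMem fun h => hj (idx_eq_of_mem h hp)]
  simp_all

lemma measurable_stepField (c : Idx d → Space d) : Measurable (stepField X k c) :=
  Finset.measurable_fun_sum _ fun i _ => measurable_const.indicator (measurableSet_cell k i)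

lemma norm_stepField_le (c : Idx d → Space d) (p : SpaceTime d) : ‖stepField X k c p‖ ≤ ∑ i ∈ cells X k, ‖c i‖ :=
  (norm_sum_le _ _).trans (sum_le_sum fun _ _ => norm_indicator_le_norm_self _ _)

/-- The fields of Neumann variations: gradients of test functions plus fields that are constant on the
cubes. -/
def neumannGrd (X : Set (SpaceTime d)) (k : ℤ) :
    (TestSpace (cellUnion X k) × (Idx d → Space d)) →ₗ[ℝ] VecField d where
  toFun v := fun p => dx v.1.1 p + stepField X k v.2 p
  map_add' v w := by
    ext1 p
    have h1 : dx (v + w).1.1 p = dx v.1.1 p + dx w.1.1 p :=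
      dx_add (v.1.2.differentiable p) (w.1.2.differentiable p)
    have h2 : stepField X k (v + w).2 p = stepField X k v.2 p + stepField X k w.2 p := by
      simp only [stepField, ← sum_add_distrib]
      refine sum_congr rfl fun i _ => ?_
      by_cases hp : p ∈ cell k i <;> simp [hp]
    rw [h1, h2, Pi.add_apply]; abel
  map_smul' c v := by
    ext1 p
    have h1 : dx (c • v).1.1 p = c • dx v.1.1 p := dx_const_mul c (v.1.2.differentiable p)
    have h2 : stepField X k (c • v).2 p = c • stepField X k v.2 p := by
      simp only [stepField, Finset.smul_sum]
      refine sum_congr rfl fun i _ => ?_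
      by_cases hp : p ∈ cell k i <;> simp [hp]
    simp_all

/-- The functions of Neumann variations. -/
def neumannVal (X : Set (SpaceTime d)) (k : ℤ) :
    (TestSpace (cellUnion X k) × (Idx d → Space d)) →ₗ[ℝ] SpaceTime d → ℝ :=
  (TestSpace (cellUnion X k)).subtype ∘ₗ LinearMap.fst ℝ _ _

lemma neumannGrd_apply (v : TestSpace (cellUnion X k) × (Idx d → Space d)) (p : SpaceTime d) :
    neumannGrd X k v p = dx v.1.1 p + stepField X k v.2 p := rfl

lemma neumannGrd_bounded (v : TestSpace (cellUnion X k) × (Idx d → Space d)) :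
    ∃ C, ∀ p, ‖neumannGrd X k v p‖ ≤ C := by
  obtain ⟨C, _, hC⟩ := v.1.2.bounded_dx
  exact ⟨C + ∑ i ∈ cells X k, ‖v.2 i‖, fun p => (norm_add_le _ _).trans (add_le_add (hC p) (norm_stepField_le _ _))⟩

lemma neumannGrd_aesm (v : TestSpace (cellUnion X k) × (Idx d → Space d)) (μ : Measure (SpaceTime d)) :
    AEStronglyMeasurable (neumannGrd X k v) μ :=
  v.1.2.continuous_dx.aestronglyMeasurable.add (measurable_stepField v.2).aestronglyMeasurable

lemma IsCoefficientField.isCellPair_neumann [NeZero d] (h : IsCoefficientField a) (hX : IsBounded X) (k : ℤ) :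
    IsCellPair a X k (neumannVal X k) (neumannGrd X k) where
  test v := v.1.2
  finE v := by
    obtain ⟨C, hC⟩ := neumannGrd_bounded v
    exact h.finE_of_bounded (isBounded_cellUnion hX) (neumannGrd_aesm v _) hC
  exists_of_test φ hφ := ⟨(⟨φ, hφ⟩, 0), rfl, by
    ext1 p
    rw [neumannGrd_apply]
    simp [stepField]⟩
  grd_eq v i hi := ⟨v.2 i, fun p hp => by rw [neumannGrd_apply, stepField_eq hi _ hp]; rfl⟩
  bounded v := neumannGrd_bounded v
  poincare := by
    have hO := isBounded_cellUnion (k := k) hX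
    obtain ⟨R, hR0, hR⟩ := exists_coord_bound hO
    refine ⟨R * 2, by positivity, fun v => ?_⟩
    refine (integral_abs_le_dx 0 hR0 hR hO.measure_lt_top.ne v.1.2).trans ?_
    rw [mul_assoc]
    refine mul_le_mul_of_nonneg_left ?_ hR0
    obtain ⟨C, hC⟩ := neumannGrd_bounded v
    have hfin : IsFiniteMeasure (𝓛 (cellUnion X k)) := ⟨by simpa using hO.measure_lt_top⟩
    have hgi : IntegrableOn (neumannGrd X k v) (cellUnion X k) :=
      Integrable.of_bound (neumannGrd_aesm v _) C (ae_of_all _ hC)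
    have hsi : IntegrableOn (stepField X k v.2) (cellUnion X k) :=
      Integrable.of_bound (measurable_stepField _).aestronglyMeasurable _ (ae_of_all _ (norm_stepField_le v.2))
    have hdi : IntegrableOn (dx v.1.1) (cellUnion X k) := v.1.2.integrable_dx.integrableOn
    -- the constant on a cube is the average of the field over it
    have hstep : ∫ p in cellUnion X k, ‖stepField X k v.2 p‖ ≤ ∫ p in cellUnion X k, ‖neumannGrd X k v p‖ := by
      rw [setIntegral_cellUnion hsi.norm, setIntegral_cellUnion hgi.norm]
      refine sum_le_sum fun i hi => ?_
      have hs := cell_subset_cellUnion hi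
      have e1 : ∫ p in cell k i, neumannGrd X k v p = ∫ p in cell k i, stepField X k v.2 p := by
        have : ∫ p in cell k i, neumannGrd X k v p = ∫ p in cell k i, dx v.1.1 p + stepField X k v.2 p := rfl
        rw [this, integral_add (hdi.mono_set hs) (hsi.mono_set hs), v.1.2.setIntegral_cell_dx i, zero_add]
      have e2 : ∫ p in cell k i, ‖stepField X k v.2 p‖ = ‖∫ p in cell k i, stepField X k v.2 p‖ := by
        rw [setIntegral_congr_fun (measurableSet_cell k i) (fun p hp => by
            simp only [stepField_eq hi v.2 hp] : EqOn _ (fun _ => ‖v.2 i‖) _),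
          setIntegral_congr_fun (measurableSet_cell k i) (fun p hp => stepField_eq hi v.2 hp),
          setIntegral_const, setIntegral_const, volume_real_cell, norm_smul,
          norm_of_nonneg (vol_pos k).le, smul_eq_mul]
      rw [e2, ← e1]
      exact norm_integral_le_integral_norm _
    calc ∫ p in cellUnion X k, ‖dx v.1.1 p‖
        ≤ ∫ p in cellUnion X k, (‖neumannGrd X k v p‖ + ‖stepField X k v.2 p‖) := by
          refine integral_mono hdi.norm (hgi.norm.add hsi.norm) fun p => ?_
          have : dx v.1.1 p = neumannGrd X k v p - stepField X k v.2 p := by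
            rw [neumannGrd_apply]; abel
          simp only [this]
          exact norm_sub_le _ _
      _ = _ := integral_add hgi.norm hsi.norm
      _ ≤ _ := by linarith

/-! ### Coarse-grained matrices bound the averages of free solutions -/

/-- Solutions of `σ ∂_t u = ∇ · a ∇u` of finite energy; `σ = -1` is the adjoint equation when `a` is
replaced by its transpose. -/
structure IsFree (σ : ℝ) (a : MatField d) (Q : Set (SpaceTime d)) (u : SpaceTime d → ℝ)
    (Du : VecField d) : Prop where
  integrable : IntegrableOn u Q
  weakGradient : HasWeakGradient Q u Du
  finE : FinE a Q Du
  eqn : ∀ φ, IsTest Q φ → σ * ∫ p in Q, u p * dt φ p = ∫ p in Q, bil (a p) (dx φ p) (Du p)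

/-- The bound of the average gradient of free solutions by their energy. -/
def GradBound (σ : ℝ) (a : MatField d) (Q : Set (SpaceTime d)) (b : ℝ) : Prop :=
  ∀ u Du, IsFree σ a Q u Du → ‖∫ p in Q, Du p‖ ^ 2 ≤ volume.real Q * b * eN a Q Du ^ 2

/-- The flux `a ∇u`. -/
def flux (a : MatField d) (Du : VecField d) (p : SpaceTime d) : Space d :=
  WithLp.toLp 2 (a p *ᵥ (Du p).ofLp)

lemma inner_flux (v : Space d) (p : SpaceTime d) : inner ℝ v (flux a Du p) = bil (a p) v (Du p) := by
  rw [bil, flux, EuclideanSpace.inner_eq_star_dotProduct, dotProduct_comm]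
  simp

/-- The bound of the average flux of free solutions by their energy. -/
def FluxBound (a : MatField d) (Q : Set (SpaceTime d)) (b : ℝ) : Prop :=
  ∀ u Du, IsFree 1 a Q u Du → ‖∫ p in Q, flux a Du p‖ ^ 2 ≤ volume.real Q * b * eN a Q Du ^ 2

lemma flux_apply (p : SpaceTime d) (i : Fin d) : flux a Du p i = bil (a p) (stdVec i) (Du p) := by
  rw [← inner_flux, stdVec, inner_single_left]; simp

lemma integrable_const_smul {X E : Type*} [MeasurableSpace X] {μ : Measure X} [NormedAddCommGroup E]
    [NormedSpace ℝ E] (c : ℝ) {f : X → E} (hf : Integrable f μ) : Integrable (fun x => c • f x) μ :=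
  hf.smul c

lemma integral_apply {X : Type*} [MeasurableSpace X] {μ : Measure X} {f : X → Space d}
    (hf : Integrable f μ) (i : Fin d) : (∫ x, f x ∂μ) i = ∫ x, f x i ∂μ :=
  ((EuclideanSpace.proj i).integral_comp_comm hf).symm

lemma integral_smul_dx {f : SpaceTime d → ℝ} (hφ : IsTest O φ) (hO : IsOpen O)
    (hf : ContDiffOn ℝ ∞ f O) (h1 : IntegrableOn (fun p => f p • dx φ p) O)
    (h2 : IntegrableOn (fun p => φ p • dx f p) O) :
    ∫ p in O, f p • dx φ p = -∫ p in O, φ p • dx f p := by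
  ext i
  rw [PiLp.neg_apply, integral_apply h1, integral_apply h2]
  exact integral_mul_dx_coord hφ hO hf i

lemma IsTest.mul_integrableOn (hφ : IsTest Q φ) (hu : IntegrableOn u O) :
    IntegrableOn (fun p => u p * φ p) O := by
  obtain ⟨C, hC⟩ := hφ.bounded
  exact hu.mul_bdd hφ.continuous.aestronglyMeasurable (ae_of_all _ hC)

lemma IsTest.smul_dx_integrableOn (hφ : IsTest Q φ) (hu : IntegrableOn u O) :
    IntegrableOn (fun p => u p • dx φ p) O := by
  obtain ⟨C, _, hC⟩ := hφ.bounded_dx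
  exact Integrable.smul_bdd hu C hφ.continuous_dx.aestronglyMeasurable (ae_of_all _ hC)

lemma IsTest.smul_integrableOn (hφ : IsTest Q φ) (hu : IntegrableOn Du O) :
    IntegrableOn (fun p => φ p • Du p) O := by
  obtain ⟨C, hC⟩ := hφ.bounded
  exact Integrable.bdd_smul hu C hφ.continuous.aestronglyMeasurable (ae_of_all _ hC)

lemma setIntegral_test_eq_zero_dt (hφ : IsTest Q φ) : ∫ p in Q, dt φ p = 0 := by
  rw [setIntegral_eq_integral_of_forall_compl_eq_zero fun p hp => hφ.dt.zero_off hp, hφ.integral_dt]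

lemma setIntegral_test_eq_zero_dx (hφ : IsTest Q φ) : ∫ p in Q, dx φ p = 0 := by
  rw [setIntegral_eq_integral_of_forall_compl_eq_zero fun p hp => hφ.dx_zero_off hp, hφ.integral_dx]

lemma IsCoefficientField.finE_dx (h : IsCoefficientField a) (hO : IsBounded O) (hφ : IsTest Q φ) : FinE a O (dx φ) := by
  obtain ⟨C, _, hC⟩ := hφ.bounded_dx
  exact h.finE_of_bounded hO hφ.continuous_dx.aestronglyMeasurable hC

lemma HasWeakGradient.add {v : SpaceTime d → ℝ} {Dv : VecField d} (c : ℝ)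
    (hu : HasWeakGradient Q u Du) (hv : HasWeakGradient Q v Dv) (hui : IntegrableOn u Q)
    (hvi : IntegrableOn v Q) (hDu : IntegrableOn Du Q) (hDv : IntegrableOn Dv Q) :
    HasWeakGradient Q (fun p => u p + c * v p) (fun p => Du p + c • Dv p) := fun φ hφ => by
  simp [add_smul, smul_add, mul_smul, smul_comm _ c]
  rw [integral_add (hφ.smul_dx_integrableOn hui) (integrable_const_smul c (hφ.smul_dx_integrableOn hvi)),
    integral_add (hφ.smul_integrableOn hDu) (integrable_const_smul c (hφ.smul_integrableOn hDv)), integral_smul,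
    integral_smul, (hu φ hφ), (hv φ hφ)]
  simp only [smul_neg, neg_add]

namespace IsCoefficientField
variable (h : IsCoefficientField a)
include h

omit h in
lemma isFree_sub_const (hQ : IsBounded Q) (hu : IsFree σ a Q u Du) : IsFree σ a Q (fun p => u p - c) Du where
  integrable := hu.integrable.sub (integrableOn_const hQ.measure_lt_top.ne)
  weakGradient φ hφ := by
    have e1 := hu.weakGradient φ hφ
    simp only [sub_smul]
    rw [integral_sub (hφ.smul_dx_integrableOn hu.integrable) (integrable_const_smul c hφ.integrable_dx.integrableOn),
      integral_smul, setIntegral_test_eq_zero_dx hφ, smul_zero, sub_zero, e1]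
  finE := hu.finE
  eqn φ hφ := by
    rw [← hu.eqn φ hφ]
    simp only [sub_mul]
    rw [integral_sub (hφ.dt.mul_integrableOn hu.integrable)
      (hφ.dt.integrable.integrableOn.const_mul c), integral_const_mul, setIntegral_test_eq_zero_dt hφ]
    ring

/-- The bound of the average gradient passes to the adjoint equation: a solution of the adjoint
equation differs from a free solution by twice a function with zero lateral data and no larger
energy, whose gradient has zero average. -/
lemma gradBound_adjoint [NeZero d] (hQ : IsBounded Q) (hQo : IsOpen Q)
    (hb : GradBound 1 a Q b) (hb0 : 0 ≤ b) : GradBound (-1) (fun p => (a p)ᵀ) Q (9 * b) := fun u Du hu => by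
  have hfin := finE_transpose.1 hu.finE
  have hp := h.isPair_test hQ
  obtain ⟨M, hM0, hM⟩ := h.ellBdd hQ
  -- if `∂_t ζ - ∇ · a∇ζ = -∇ · s∇u` with zero data, then `u - 2ζ` is a free solution, as `a + aᵀ = 2s`
  let ℓ : TestSpace Q →ₗ[ℝ] ℝ :=
    { toFun := fun χ => ∫ p in Q, bil (symPart (a p)) (dxLin Q χ p) (Du p)
      map_add' := fun χ χ' => by
        simp [map_add, Pi.add_apply, bil_add_left]
        exact integral_add (h.integrable_bil_sym (hp.finE χ) hfin) (h.integrable_bil_sym (hp.finE χ') hfin)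
      map_smul' := fun c χ => by
        simp [map_smul, Pi.smul_apply, bil_smul_left]
        exact integral_const_mul _ _ }
  obtain ⟨ζ, Dζ, v, hζ, hDζ, hlim, hlimE, heq, hle⟩ := hp.solve h hQ 1 0 le_rfl ℓ (eN a Q Du) eN_nonneg
    (fun χ c hc hχ => hp.dual_of_le h le_rfl eN_nonneg hc (by
      simp [zero_mul, zero_add, sqrt_sq eN_nonneg]
      refine (h.abs_integral_bil_sym_le (hp.finE χ) hfin).trans (le_of_eq (mul_comm _ _))) hχ)
  have hval : ∀ n, IntegrableOn (v n).1 Q := fun n => (v n).2.integrable.integrableOn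
  have hgr : ∀ n, IntegrableOn (dxLin Q (v n)) Q := fun n => h.integrableOn hQ (hp.finE _)
  have hDζi := h.integrableOn hQ hDζ
  have hlim2 := h.tendsto_integral_norm_sub hQ (fun n => hp.finE (v n)) hDζ hlimE
  have hwg : HasWeakGradient Q ζ Dζ := fun φ hφ => by
    obtain ⟨C1, _, hC1⟩ := hφ.bounded_dx
    obtain ⟨C2, hC2⟩ := hφ.bounded
    have t1 := tendsto_integral_of_norm_sub_le hval hζ hlim
      (fun n => hφ.smul_dx_integrableOn (hval n)) (hφ.smul_dx_integrableOn hζ) C1 (fun n p => by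
        rw [← sub_smul, norm_smul, mul_comm]
        exact mul_le_mul_of_nonneg_right (hC1 p) (norm_nonneg _))
    have t2 := tendsto_integral_of_norm_sub_le hgr hDζi hlim2
      (fun n => hφ.smul_integrableOn (hgr n)) (hφ.smul_integrableOn hDζi) C2 (fun n p => by
        rw [← smul_sub, norm_smul]
        exact mul_le_mul_of_nonneg_right (hC2 p) (norm_nonneg _))
    refine tendsto_nhds_unique t1 (t2.neg.congr fun n => ?_)
    exact (integral_smul_dx hφ hQo (v n).2.smooth.contDiffOn (hφ.smul_dx_integrableOn (hval n))
      (hφ.smul_integrableOn (hgr n))).symm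
  have hzero : ∫ p in Q, Dζ p = 0 := by
    have t := tendsto_integral_of_norm_sub_le hgr hDζi hlim2 hgr hDζi 1 (fun n p => by simp)
    exact tendsto_nhds_unique t (tendsto_const_nhds.congr fun n => ((setIntegral_test_eq_zero_dx (v n).2).symm))
  have hDui := h.integrableOn hQ hfin
  have hfree : IsFree 1 a Q (fun p => u p + (-2) * ζ p) (fun p => Du p + (-2 : ℝ) • Dζ p) := by
    refine ⟨hu.integrable.add (hζ.const_mul _), hu.weakGradient.add (-2) hwg hu.integrable hζ hDui hDζi,
      h.finE_add hfin (finE_smul _ hDζ), fun φ hφ => ?_⟩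
    have g1 := hu.eqn φ hφ
    have g2 := heq ⟨φ, hφ⟩
    have g3 : ℓ ⟨φ, hφ⟩ = ∫ p in Q, bil (symPart (a p)) (dx φ p) (Du p) := rfl
    have g4 : ∀ p, dxLin Q ⟨φ, hφ⟩ p = dx φ p := fun p => rfl
    have fφ := h.finE_dx hQ hφ
    have i1 := h.integrable_bil hM fφ hfin
    have i3 := h.integrable_bil_sym fφ hfin
    have hT : IntegrableOn (fun p => bil (a p)ᵀ (dx φ p) (Du p)) Q := by
      simp [bil_transpose]; exact h.integrable_bil hM hfin fφ
    have g5 : ∫ p in Q, bil (symPart (a p)) (dx φ p) (Du p) =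
        1 / 2 * ((∫ p in Q, bil (a p) (dx φ p) (Du p)) + ∫ p in Q, bil (a p)ᵀ (dx φ p) (Du p)) := by
      rw [← integral_add i1 hT, ← integral_const_mul]
      congr 1; ext p
      rw [bil_symPart, bil_transpose]; ring
    simp [Submodule.subtype_apply, g4, zero_mul, add_zero, one_mul] at g2
    simp only [add_mul, mul_assoc, bil_add_right, bil_smul_right, one_mul]
    rw [integral_add (hφ.dt.mul_integrableOn hu.integrable)
      ((hφ.dt.mul_integrableOn hζ).const_mul _), integral_add i1 ((h.integrable_bil hM fφ hDζ).const_mul _),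
      integral_const_mul, integral_const_mul]
    linarith
  have key := hb _ _ hfree
  rw [integral_add hDui (integrable_const_smul (-2) hDζi), integral_smul, hzero, smul_zero, add_zero] at key
  rw [eN_transpose]
  have hE : eN a Q (fun p => Du p + (-2 : ℝ) • Dζ p) ≤ 3 * eN a Q Du := by
    refine (h.eN_add_le hfin (finE_smul _ hDζ)).trans ?_
    rw [eN_smul]
    norm_num
    linarith
  have hsq := pow_le_pow_left₀ (eN_nonneg) hE 2
  have hv : 0 ≤ volume.real Q * b := mul_nonneg measureReal_nonneg hb0
  nlinarith

end IsCoefficientField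

lemma integral_avgMeasure {X E : Type*} [MeasureSpace X] [NormedAddCommGroup E] [NormedSpace ℝ E]
    (V : Set X) (f : X → E) :
    ∫ x, f x ∂(avgMeasure V) = (volume.real V)⁻¹ • ∫ x in V, f x := by
  rw [avgMeasure, integral_smul_measure, ENNReal.toReal_inv]; rfl

/-- The functional maximised in the definition of `J`. -/
def jVal (a : MatField d) (Q : Set (SpaceTime d)) (p q : Space d)
    (Du : VecField d) : ℝ :=
  ∫ y, (-(1 / 2) * bil (symPart (a y)) (Du y) (Du y) - bil (a y) p (Du y)
      + inner ℝ q (Du y)) ∂(avgMeasure Q)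

lemma J_eq (p q : Space d) : J a Q p q = sSup {r | ∃ u Du, IsFreeSolution a Q u Du ∧ r = jVal a Q p q Du} := rfl

namespace IsCoefficientField

lemma isFree_smul (hu : IsFree 1 a Q u Du) (c : ℝ) : IsFree 1 a Q (fun p => c * u p) (fun p => c • Du p) where
  integrable := hu.integrable.const_mul c
  weakGradient φ hφ := by
    have := hu.weakGradient φ hφ
    simp only [mul_smul, smul_comm _ c]
    rw [integral_smul, integral_smul, this, smul_neg]
  finE := finE_smul c hu.finE
  eqn φ hφ := by
    simp only [mul_assoc, bil_smul_right]
    rw [integral_const_mul, integral_const_mul, ← hu.eqn φ hφ]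
    ring

lemma integral_flux_smul (t : ℝ) : ∫ y in Q, flux a (fun p => t • Du p) y = t • ∫ y in Q, flux a Du y := by
  rw [← integral_smul]
  congr 1; ext1 y
  simp [flux, Matrix.mulVec_smul]

variable (h : IsCoefficientField a)
include h

lemma finE_const (hQ : IsBounded Q) (e : Space d) : FinE a Q (fun _ => e) :=
  h.finE_of_bounded hQ aestronglyMeasurable_const fun _ => le_rfl

lemma integrable_flux (hQ : IsBounded Q) (hDu : FinE a Q Du) : IntegrableOn (flux a Du) Q := by
  obtain ⟨M, hM0, hM⟩ := h.ellBdd hQ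
  refine Integrable.of_eval_piLp fun i => ?_
  simp [flux_apply]
  exact h.integrable_bil hM (h.finE_const hQ _) hDu

lemma integral_bil_const (hQ : IsBounded Q) (hDu : FinE a Q Du) (e : Space d) :
    ∫ p in Q, bil (a p) e (Du p) = inner ℝ e (∫ p in Q, flux a Du p) := by
  simp [← inner_flux]
  exact integral_inner (h.integrable_flux hQ hDu) e

lemma jVal_eq (hQ : IsBounded Q) (hDu : FinE a Q Du) (p q : Space d) : jVal a Q p q Du =
    (volume.real Q)⁻¹ * (-(1 / 2) * eN a Q Du ^ 2 +
    (inner ℝ q (∫ y in Q, Du y) - inner ℝ p (∫ y in Q, flux a Du y))) := by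
  obtain ⟨M, hM0, hM⟩ := h.ellBdd hQ
  have i2 := h.integrable_bil hM (h.finE_const hQ p) hDu
  have i4 : IntegrableOn (fun y => -(1 / 2) * bil (symPart (a y)) (Du y) (Du y)) Q := (h.integrable_en hDu).const_mul _
  have i5 : IntegrableOn (fun y => -(1 / 2) * bil (symPart (a y)) (Du y) (Du y) - bil (a y) p (Du y)) Q := i4.sub i2
  rw [jVal, integral_avgMeasure, integral_add i5 ((h.integrableOn hQ hDu).const_inner q),
    integral_sub i4 i2, integral_const_mul, ← h.eN_sq hDu, h.integral_bil_const hQ hDu,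
    integral_inner (h.integrableOn hQ hDu), smul_eq_mul]
  ring

lemma dtDualNorm_lt_top (hQ : IsBounded Q) (hu : IsFree 1 a Q u Du) : dtDualNorm a Q u < ⊤ := by
  obtain ⟨M, hM0, hM⟩ := h.ellBdd hQ
  refine lt_of_le_of_lt (b := ofReal (M * (1 * eN a Q Du))) ?_ ofReal_lt_top
  refine iSup_le fun φ => iSup_le fun hφ => iSup_le fun hle => ofReal_le_ofReal ?_
  have e1 := hu.eqn φ hφ
  rw [one_mul] at e1
  rw [e1]
  have hf := h.finE_dx hQ hφ
  refine (h.abs_integral_bil_le hM0 hM hf hu.finE).trans ?_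
  refine mul_le_mul_of_nonneg_left (mul_le_mul_of_nonneg_right ?_ eN_nonneg) hM0
  have e2 : eN a Q (dx φ) ^ 2 ≤ 1 := by
    rw [h.eN_sq hf, integral_eq_lintegral_of_nonneg_ae (ae_of_all _ fun p => h.sym_nonneg p _) (h.integrable_en hf).1]
    simpa using (toReal_mono ENNReal.one_ne_top ((le_add_left le_rfl).trans hle))
  nlinarith

/-- A free solution, minus its mean, is admissible in the definition of `J`. -/
lemma isFreeSolution (hQ : IsBounded Q) (hQ0 : volume Q ≠ 0) (hu : IsFree 1 a Q u Du) :
    ∃ v, IsFreeSolution a Q v Du := by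
  set c := (volume.real Q)⁻¹ * ∫ p in Q, u p with hc
  have hv := isFree_sub_const (c := c) hQ hu
  refine ⟨_, hv.integrable, h.integrableOn hQ hv.finE, hv.weakGradient, h.integrable_en hv.finE, ?_,
    h.dtDualNorm_lt_top hQ hv, fun φ hφ => ?_⟩
  · rw [integral_sub hu.integrable (integrableOn_const hQ.measure_lt_top.ne), setIntegral_const,
      smul_eq_mul, hc, mul_inv_cancel_left₀ ((measureReal_ne_zero_iff hQ.measure_lt_top.ne).2 hQ0), sub_self]
  · rw [← hv.eqn φ hφ, one_mul]

lemma isFree_of_isFreeSolution (hu : IsFreeSolution a Q u Du) : IsFree 1 a Q u Du :=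
  ⟨hu.integrable, hu.weakGradient, h.finE_of_integrable hu.integrable_grad.1 hu.energy,
    fun φ hφ => by rw [one_mul, hu.eqn φ hφ]⟩

lemma bddAbove_jVal (hQ : IsBounded Q) (p q : Space d) :
    BddAbove {r | ∃ u Du, IsFreeSolution a Q u Du ∧ r = jVal a Q p q Du} := by
  obtain ⟨M, hM0, hM⟩ := h.ellBdd hQ
  obtain ⟨C, hC0, hC⟩ := h.integral_norm_le hQ
  set A := M * eN a Q (fun _ => p) + ‖q‖ * C with hA
  refine ⟨(volume.real Q)⁻¹ * (1 / 2 * A ^ 2), ?_⟩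
  rintro r ⟨u, Du, hu, rfl⟩
  have hfin := (h.isFree_of_isFreeSolution hu).finE
  rw [h.jVal_eq hQ hfin]
  refine mul_le_mul_of_nonneg_left ?_ (inv_nonneg.2 measureReal_nonneg)
  have e1 : inner ℝ q (∫ y in Q, Du y) ≤ ‖q‖ * (C * eN a Q Du) :=
    (real_inner_le_norm _ _).trans (mul_le_mul_of_nonneg_left
      ((norm_integral_le_integral_norm _).trans (hC _ hfin)) (norm_nonneg _))
  have e2 := h.abs_integral_bil_le hM0 hM (h.finE_const hQ p) hfin
  rw [h.integral_bil_const hQ hfin] at e2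
  have e3 := (abs_le.1 e2).1
  nlinarith [sq_nonneg (A - eN a Q Du)]

/-- Optimisation over multiples of one free solution. -/
lemma sq_le_J (hQ : IsBounded Q) (hQ0 : volume Q ≠ 0) (hu : IsFree 1 a Q u Du) (p q : Space d) :
    (inner ℝ q (∫ y in Q, Du y) - inner ℝ p (∫ y in Q, flux a Du y)) ^ 2 ≤
      2 * J a Q p q * (volume.real Q * eN a Q Du ^ 2) := by
  set x := inner ℝ q (∫ y in Q, Du y) - inner ℝ p (∫ y in Q, flux a Du y) with hx
  set E := eN a Q Du ^ 2 with hE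
  have hv0 := lt_of_le_of_ne measureReal_nonneg ((measureReal_ne_zero_iff hQ.measure_lt_top.ne).2 hQ0).symm
  have key : ∀ t : ℝ, -(1 / 2) * t ^ 2 * E + t * x ≤ volume.real Q * J a Q p q := fun t => by
    have ht := isFree_smul hu t
    obtain ⟨v, hv⟩ := h.isFreeSolution hQ hQ0 ht
    have hle := le_csSup (h.bddAbove_jVal hQ p q) ⟨v, _, hv, rfl⟩
    rw [← J_eq, h.jVal_eq hQ ht.finE, inv_mul_le_iff₀ hv0] at hle
    rw [eN_smul, integral_smul, integral_flux_smul, inner_smul_right, inner_smul_right, mul_pow, sq_abs] at hle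
    refine le_trans (le_of_eq ?_) hle
    ring
  have h1 := key (x / E)
  by_cases hz : E = 0
  · rw [hz] at key ⊢
    have hx0 : x = 0 := by
      by_contra hne
      have h3 := key ((volume.real Q * J a Q p q + 1) / x)
      rw [div_mul_cancel₀ _ hne] at h3
      linarith
    rw [hx0]; simp
  · have e5 : -(1 / 2) * (x / E) ^ 2 * E + x / E * x = x ^ 2 / (2 * E) := by field_simp; ring
    rw [e5, div_le_iff₀ (by positivity)] at h1
    linarith

/-- By polarisation `J(2p, 2q) = 4 J(p, q)`; the lower bound for the left-hand side is what the diagonal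
entries of the coarse-grained matrices need. -/
lemma four_mul_J_le (hQ : IsBounded Q) (hQ0 : volume Q ≠ 0) (hu : IsFree 1 a Q u Du) (p q : Space d) :
    4 * J a Q p q ≤ J a Q (p + p) (q + q) := by
  obtain ⟨v, hv⟩ := h.isFreeSolution hQ hQ0 hu
  have : J a Q p q ≤ J a Q (p + p) (q + q) / 4 := csSup_le ⟨_, v, Du, hv, rfl⟩ (by
    rintro r ⟨w, Dw, hw, rfl⟩
    have hf := h.isFree_of_isFreeSolution hw
    obtain ⟨z, hz⟩ := h.isFreeSolution hQ hQ0 (isFree_smul hf 2)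
    have := le_csSup (h.bddAbove_jVal hQ (p + p) (q + q)) ⟨z, _, hz, rfl⟩
    rw [← J_eq, h.jVal_eq hQ (finE_smul 2 hf.finE), eN_smul, integral_smul, integral_flux_smul, abs_two] at this
    change jVal a Q p q Dw ≤ _
    rw [h.jVal_eq hQ hf.finE, le_div_iff₀ (by norm_num)]
    simp [inner_add_left, inner_smul_right] at this
    linarith)
  linarith

omit h in
lemma diag_le_specNorm (A : Matrix (Fin d) (Fin d) ℝ) (i : Fin d) : A i i ≤ (specNorm A).toReal := by
  have h1 : A i i = inner ℝ (stdVec i) (Matrix.toEuclideanCLM (𝕜 := ℝ) A (stdVec i)) := by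
    rw [stdVec, inner_single_left]
    simp [Matrix.ofLp_toEuclideanCLM]
  have h2 : ‖(stdVec i)‖ = 1 := by simp [stdVec]
  rw [h1, specNorm, toReal_enorm]
  refine (real_inner_le_norm _ _).trans ?_
  rw [h2, one_mul]
  refine (ContinuousLinearMap.le_opNorm _ _).trans ?_
  simp_all

omit h in
lemma norm_sq_le_of_diag {A : Matrix (Fin d) (Fin d) ℝ} {x : Space d} {v E : ℝ} (hv : 0 ≤ v * E)
    (hx : ∀ i, x i ^ 2 ≤ A i i * (v * E)) : ‖x‖ ^ 2 ≤ v * (d * (specNorm A).toReal) * E := by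
  rw [EuclideanSpace.real_norm_sq_eq]
  refine (sum_le_sum fun i _ =>
    (hx i).trans (mul_le_mul_of_nonneg_right (diag_le_specNorm A i) hv)).trans (le_of_eq ?_)
  simp; ring

/-- The coarse-grained matrix `s_*⁻¹(Q)` controls average gradients of free solutions. -/
lemma gradBound_sStarInv (hQ : IsBounded Q) (hQ0 : volume Q ≠ 0) :
    GradBound 1 a Q (d * (specNorm (sStarInv a Q)).toReal) := fun u Du hu => by
  have hv : 0 ≤ volume.real Q * eN a Q Du ^ 2 := mul_nonneg measureReal_nonneg (sq_nonneg _)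
  refine norm_sq_le_of_diag hv fun i => ?_
  have e1 := h.sq_le_J hQ hQ0 hu 0 (stdVec i)
  have e2 := h.four_mul_J_le hQ hQ0 hu 0 (stdVec i)
  rw [inner_zero_left, sub_zero, stdVec, inner_single_left, map_one, one_mul] at e1
  refine e1.trans (mul_le_mul_of_nonneg_right ?_ hv)
  rw [add_zero] at e2
  simp [sStarInv, Matrix.of_apply, stdVec] at e2 ⊢
  linarith

/-- The coarse-grained matrix `b(Q)` controls average fluxes of free solutions. -/
lemma fluxBound_bMat (hQ : IsBounded Q) (hQ0 : volume Q ≠ 0) :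
    FluxBound a Q (d * (specNorm (bMat a Q)).toReal) := fun u Du hu => by
  have hv : 0 ≤ volume.real Q * eN a Q Du ^ 2 := mul_nonneg measureReal_nonneg (sq_nonneg _)
  refine norm_sq_le_of_diag hv fun i => ?_
  have e1 := h.sq_le_J hQ hQ0 hu (stdVec i) 0
  have e2 := h.four_mul_J_le hQ hQ0 hu (stdVec i) 0
  rw [inner_zero_left, zero_sub, neg_sq, stdVec, inner_single_left, map_one, one_mul] at e1
  refine e1.trans (mul_le_mul_of_nonneg_right ?_ hv)
  rw [add_zero] at e2
  simp [bMat, Matrix.of_apply, stdVec] at e2 ⊢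
  linarith

end IsCoefficientField

section
/-! ### Correctors on unions of cubes -/

variable {e : (SpaceTime d → ℝ) → ℝ} {W : Type*} [AddCommGroup W] [Module ℝ W]
  {val : W →ₗ[ℝ] SpaceTime d → ℝ} {grd : W →ₗ[ℝ] VecField d}

lemma exists_ancestor (hX : IsBounded X) (hj : j ≤ k)
    (hi : i ∈ cells (cellUnion X k) j) : ∃ i' ∈ cells X k, cell j i ⊆ cell k i' := by
  rw [mem_cells (isBounded_cellUnion hX)] at hi
  obtain ⟨i', hi', hp⟩ := mem_cellUnion.1 (hi (ctr_mem_cell j i))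
  obtain ⟨n, hn⟩ : ∃ n : ℕ, k = j + n := ⟨(k - j).toNat, by omega⟩
  have h1 := cell_subset_iterate j i n
  rw [← hn] at h1
  rw [idx_eq_of_mem hp (h1 (ctr_mem_cell j i))] at hi'
  grind

/-- `IsPair.solve` without a zeroth order term. -/
lemma IsPair.solve_energy (h : IsCoefficientField a) (hO : IsBounded O)
    (hp : IsPair a O val grd) (σ : ℝ) (ℓ : W →ₗ[ℝ] ℝ) (K : ℝ) (hK : 0 ≤ K)
    (hℓ : ∀ χ c, 0 ≤ c → (∀ v, |-(σ * ∫ p in O, val v p * dt (val χ) p)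
        + ∫ p in O, bil (a p) (grd χ p) (grd v p)| ≤ c * eN a O (grd v)) → |ℓ χ| ≤ K * c) :
    ∃ (w : SpaceTime d → ℝ) (Dw : VecField d) (v : ℕ → W), IntegrableOn w O ∧
      FinE a O Dw ∧ Tendsto (fun n => ∫ p in O, ‖val (v n) p - w p‖) atTop (𝓝 0) ∧
      Tendsto (fun n => eN a O (fun p => grd (v n) p - Dw p)) atTop (𝓝 0) ∧
      (∀ χ, -(σ * ∫ p in O, w p * dt (val χ) p) + ∫ p in O, bil (a p) (grd χ p) (Dw p) = ℓ χ) ∧ eN a O Dw ≤ K := by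
  have := hp.solve h hO σ 0 le_rfl ℓ K hK (fun χ c hc hχ => hℓ χ c hc (by
    simpa only [zero_mul, add_zero, zero_add, sqrt_sq eN_nonneg] using hχ))
  simpa only [zero_mul, add_zero] using this

lemma IsPair.eN_le (h : IsCoefficientField a) (hp : IsPair a O val grd) {χ : W}
    (hb : ∀ v, |-(σ * ∫ p in O, val v p * dt (val χ) p)
        + ∫ p in O, bil (a p) (grd χ p) (grd v p)| ≤ c * eN a O (grd v)) (hc : 0 ≤ c) :
    eN a O (grd χ) ≤ c := by
  have := hp.dual_of_le h le_rfl zero_le_one hc (by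
      rw [zero_mul, zero_add, sqrt_sq eN_nonneg, abs_of_nonneg eN_nonneg, one_mul]) (by
      simpa only [zero_mul, add_zero, zero_add, sqrt_sq eN_nonneg] using hb)
  rwa [one_mul, abs_of_nonneg eN_nonneg] at this

lemma contDiff_inner_snd (q : Space d) : ContDiff ℝ ∞ (fun p : SpaceTime d => (inner ℝ q p.2 : ℝ)) :=
  (contDiff_const).inner ℝ contDiff_snd

lemma dx_inner_snd (q : Space d) (p : SpaceTime d) : dx (fun p : SpaceTime d => (inner ℝ q p.2 : ℝ)) p = q := by
  have : HasGradientAt (fun y : Space d => (inner ℝ q y)) q p.2 := (InnerProductSpace.toDual ℝ (Space d) q).hasFDerivAt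
  exact this.gradient

lemma integrableOn_inner_snd (hO : IsBounded O) (q : Space d) :
    IntegrableOn (fun p : SpaceTime d => (inner ℝ q p.2 : ℝ)) O :=
  IntegrableOn.mono_set ((contDiff_inner_snd q).continuous.continuousOn.integrableOn_compact
    hO.isCompact_closure) subset_closure

lemma integral_inner_snd_mul_dt (hφ : IsTest O φ) (q : Space d) :
    ∫ p in O, (inner ℝ q p.2 : ℝ) * dt φ p = 0 := by
  rw [setIntegral_eq_integral_of_forall_compl_eq_zero fun p hp => by rw [hφ.dt.zero_off hp, mul_zero],
    integral_mul_dt hφ (contDiff_inner_snd q)]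
  simp [dt]

lemma integral_inner_snd_smul_dx (hφ : IsTest O φ) (hOo : IsOpen O)
    (hO : IsBounded O) (q : Space d) :
    ∫ p in O, (inner ℝ q p.2 : ℝ) • dx φ p = -∫ p in O, φ p • q := by
  have hdx := funext (dx_inner_snd q)
  have := integral_smul_dx hφ hOo (contDiff_inner_snd q).contDiffOn
    (hφ.smul_dx_integrableOn (integrableOn_inner_snd hO q)) (by
      rw [hdx]; exact hφ.smul_integrableOn (integrableOn_const hO.measure_lt_top.ne))
  rw [this, hdx]

/-- On every cube of scale `k` inside `X`, the field `Du` is the gradient of a solution of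
`σ ∂_t u - ∇ · a ∇u = e`. The function `u` may depend on the cube. -/
structure CellSol (σ : ℝ) (a : MatField d) (X : Set (SpaceTime d)) (k : ℤ)
    (e : (SpaceTime d → ℝ) → ℝ) (Du : VecField d) : Prop where
  finE : FinE a (cellUnion X k) Du
  exists_sol : ∀ i ∈ cells X k, ∃ u, IntegrableOn u (cell k i) ∧ HasWeakGradient (cell k i) u Du ∧
    ∀ φ, IsTest (cell k i) φ → -(σ * ∫ p in cell k i, u p * dt φ p)
      + ∫ p in cell k i, bil (a p) (dx φ p) (Du p) = e φ

lemma FinE.cell (hf : FinE a (cellUnion X k) Du) (hi : i ∈ cells X k) : FinE a (cell k i) Du :=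
  hf.mono (cell_subset_cellUnion hi)

namespace IsCoefficientField
variable (h : IsCoefficientField a)
include h

lemma exists_isFree_sub (hu : CellSol σ a X k e Du) (hy : CellSol σ a X k e Dy)
    (hi : i ∈ cells X k) : ∃ z, IsFree σ a (cell k i) z (fun p => Du p - Dy p) := by
  obtain ⟨u, hu1, hu2, hu3⟩ := hu.exists_sol i hi
  obtain ⟨y, hy1, hy2, hy3⟩ := hy.exists_sol i hi
  have hfu := hu.finE.cell hi
  have hfy := hy.finE.cell hi
  have hbd := isBounded_cell k i
  have e0 : (fun p => Du p - Dy p) = fun p => Du p + (-1 : ℝ) • Dy p := by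
    ext1 p; rw [neg_one_smul, sub_eq_add_neg]
  refine ⟨fun p => u p + (-1) * y p, hu1.add (hy1.const_mul _), ?_, h.finE_sub hfu hfy, fun φ hφ => ?_⟩
  · rw [e0]
    exact hu2.add (-1) hy2 hu1 hy1 (h.integrableOn hbd hfu) (h.integrableOn hbd hfy)
  · obtain ⟨M, hM0, hM⟩ := h.ellBdd hbd
    have i2 := h.integrable_bil hM (h.finE_dx hbd hφ) hfy
    have g1 := hu3 φ hφ
    have g2 := hy3 φ hφ
    simp only [add_mul, mul_assoc, bil_sub_right]
    rw [integral_add (hφ.dt.mul_integrableOn hu1) ((hφ.dt.mul_integrableOn hy1).const_mul _),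
      integral_sub (h.integrable_bil hM (h.finE_dx hbd hφ) hfu) i2, integral_const_mul]
    linarith

lemma eN_sq_cellUnion (hf : FinE a (cellUnion X k) Du) :
    eN a (cellUnion X k) Du ^ 2 = ∑ i ∈ cells X k, eN a (cell k i) Du ^ 2 := by
  rw [h.eN_sq hf, setIntegral_cellUnion (h.integrable_en hf)]
  exact sum_congr rfl fun i hi => (h.eN_sq (hf.cell hi)).symm

/-- Average gradients of two solutions of the same equation differ by those of free solutions. -/
lemma sum_grad_sub_le (hu : CellSol σ a X k e Du)
    (hy : CellSol σ a X k e Dy) (hy0 : ∀ i ∈ cells X k, ∫ p in cell k i, Dy p = 0)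
    (hb : ∀ i ∈ cells X k, GradBound σ a (cell k i) b) :
    ∑ i ∈ cells X k, ‖∫ p in cell k i, Du p‖ ^ 2 ≤ vol d k * b * eN a (cellUnion X k) (fun p => Du p - Dy p) ^ 2 := by
  rw [h.eN_sq_cellUnion (h.finE_sub hu.finE hy.finE), mul_sum]
  refine sum_le_sum fun i hi => ?_
  obtain ⟨z, hz⟩ := h.exists_isFree_sub hu hy hi
  have := hb i hi _ _ hz
  have hbd := isBounded_cell k i
  rwa [integral_sub (h.integrableOn hbd (hu.finE.cell hi)) (h.integrableOn hbd (hy.finE.cell hi)),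
    hy0 i hi, sub_zero, volume_real_cell] at this

lemma sum_flux_sub_le (hu : CellSol 1 a X k e Du)
    (hy : CellSol 1 a X k e Dy) (hy0 : ∀ i ∈ cells X k, ∫ p in cell k i, flux a Dy p = 0)
    (hb : ∀ i ∈ cells X k, FluxBound a (cell k i) b) :
    ∑ i ∈ cells X k, ‖∫ p in cell k i, flux a Du p‖ ^ 2 ≤
      vol d k * b * eN a (cellUnion X k) (fun p => Du p - Dy p) ^ 2 := by
  rw [h.eN_sq_cellUnion (h.finE_sub hu.finE hy.finE), mul_sum]
  refine sum_le_sum fun i hi => ?_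
  obtain ⟨z, hz⟩ := h.exists_isFree_sub hu hy hi
  have := hb i hi _ _ hz
  have hbd := isBounded_cell k i
  have e1 : ∀ p, flux a (fun p => Du p - Dy p) p = flux a Du p - flux a Dy p := fun p => by
    simp [flux, Matrix.mulVec_sub]
  simp [e1] at this
  rwa [integral_sub (h.integrable_flux hbd (hu.finE.cell hi)) (h.integrable_flux hbd (hy.finE.cell hi)),
    hy0 i hi, sub_zero, volume_real_cell] at this

/-- Limits of pairs have, on each cube, the weak gradient that they should have. -/
lemma hasWeakGradient_limit (hp : IsCellPair a X k val grd) {v : ℕ → W} {w : SpaceTime d → ℝ}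
    (hw : IntegrableOn w (cellUnion X k)) (hDw : FinE a (cellUnion X k) Dw)
    (hlim : Tendsto (fun n => ∫ p in cellUnion X k, ‖val (v n) p - w p‖) atTop (𝓝 0))
    (hlimE : Tendsto (fun n => eN a (cellUnion X k) (fun p => grd (v n) p - Dw p)) atTop (𝓝 0)) (hi : i ∈ cells X k) :
    HasWeakGradient (cell k i) (fun p => w p + inner ℝ (cavg k i Dw) p.2) Dw := by
  have hs := cell_subset_cellUnion hi
  have hbd := isBounded_cell k i
  have hgr : ∀ n, IntegrableOn (grd (v n)) (cell k i) := fun n => h.integrableOn hbd ((hp.finE _).mono hs)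
  have hval : ∀ n, IntegrableOn (val (v n)) (cell k i) := fun n => (hp.test _).integrable.integrableOn
  have hDwi := h.integrableOn hbd (hDw.mono hs)
  have hwi := hw.mono_set hs
  have hlim1 := squeeze_zero (fun n => integral_nonneg fun p => norm_nonneg _) (fun n => setIntegral_mono_set
      (((hp.test _).integrable.integrableOn.sub hw).norm) (ae_of_all _ fun p => norm_nonneg _)
      hs.eventuallyLE) hlim
  have hlimE1 := squeeze_zero (fun n => eN_nonneg) (fun n => eN_mono (h.finE_sub (hp.finE _) hDw) hs) hlimE
  have hlim2 := h.tendsto_integral_norm_sub hbd (fun n => (hp.finE (v n)).mono hs) (hDw.mono hs) hlimE1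
  choose c hc using fun n => hp.grd_eq (v n) i hi
  have hcav : ∀ n, cavg k i (grd (v n)) = c n := fun n => by
    have e1 : ∫ p in cell k i, grd (v n) p = vol d k • c n := by
      rw [setIntegral_congr_fun (measurableSet_cell k i) (hc n), integral_add (hp.test _).integrable_dx.integrableOn
          (integrableOn_const hbd.measure_lt_top.ne), (hp.test _).setIntegral_cell_dx i, zero_add,
        setIntegral_const, volume_real_cell]
    rw [cavg, e1, smul_smul, inv_mul_cancel₀ (vol_pos k).ne', one_smul]
  have hclim : Tendsto c atTop (𝓝 (cavg k i Dw)) := by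
    have := (tendsto_integral_of_norm_sub_le hgr hDwi hlim2 hgr hDwi 1 (fun n p => by simp)).const_smul (vol d k)⁻¹
    exact this.congr fun n => hcav n
  intro φ hφ
  obtain ⟨C1, _, hC1⟩ := hφ.bounded_dx
  obtain ⟨C2, hC2⟩ := hφ.bounded
  have t1 := tendsto_integral_of_norm_sub_le hval hwi hlim1
    (fun n => hφ.smul_dx_integrableOn (hval n)) (hφ.smul_dx_integrableOn hwi) C1 (fun n p => by
      rw [← sub_smul, norm_smul, mul_comm]
      exact mul_le_mul_of_nonneg_right (hC1 p) (norm_nonneg _))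
  have t2 := tendsto_integral_of_norm_sub_le hgr hDwi hlim2
    (fun n => hφ.smul_integrableOn (hgr n)) (hφ.smul_integrableOn hDwi) C2 (fun n p => by
      rw [← smul_sub, norm_smul]
      exact mul_le_mul_of_nonneg_right (hC2 p) (norm_nonneg _))
  have t3 : Tendsto (fun n => -∫ p in cell k i, φ p • c n) atTop (𝓝 (-∫ p in cell k i, φ p • cavg k i Dw)) := by
    simp only [integral_smul_const]
    exact (hclim.const_smul _).neg
  have e1 : ∀ n, (∫ p in cell k i, val (v n) p • dx φ p) + -∫ p in cell k i, φ p • c n =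
      -∫ p in cell k i, φ p • grd (v n) p := fun n => by
    have hdi : IntegrableOn (dx (val (v n))) (cell k i) := (hp.test _).integrable_dx.integrableOn
    rw [integral_smul_dx hφ (isOpen_cell k i) (hp.test _).smooth.contDiffOn
      (hφ.smul_dx_integrableOn (hval n)) (hφ.smul_integrableOn hdi), ← neg_add,
      ← integral_add (hφ.smul_integrableOn hdi) (hφ.smul_integrableOn (integrableOn_const hbd.measure_lt_top.ne))]
    congr 1
    refine setIntegral_congr_fun (measurableSet_cell k i) fun p hpi => ?_
    simp [hc n p hpi, smul_add]
  simp [add_smul]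
  rw [integral_add (hφ.smul_dx_integrableOn hwi)
    (hφ.smul_dx_integrableOn (integrableOn_inner_snd hbd _)), integral_inner_snd_smul_dx hφ (isOpen_cell k i) hbd]
  exact tendsto_nhds_unique (t1.add t3) (t2.neg.congr fun n => (e1 n).symm)

end IsCoefficientField
end

section
variable {e : (SpaceTime d → ℝ) → ℝ} {W : Type*} [AddCommGroup W] [Module ℝ W]
  {val : W →ₗ[ℝ] SpaceTime d → ℝ} {grd : W →ₗ[ℝ] VecField d}

/-- `e` is linear on the test functions of `O`. -/
structure IsLinearOn (O : Set (SpaceTime d)) (e : (SpaceTime d → ℝ) → ℝ) : Prop where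
  add : ∀ φ ψ, IsTest O φ → IsTest O ψ → e (φ + ψ) = e φ + e ψ
  smul : ∀ (c : ℝ) φ, IsTest O φ → e (c • φ) = c * e φ

/-- The linear form on the space of test functions given by `e`. -/
def IsLinearOn.toLinearMap (he : IsLinearOn O e) : TestSpace O →ₗ[ℝ] ℝ where
  toFun φ := e φ.1
  map_add' φ ψ := he.add _ _ φ.2 ψ.2
  map_smul' c φ := he.smul c _ φ.2

lemma IsTest.setIntegral_dt_eq (hφ : IsTest O φ) (hO : O ⊆ X) :
    ∫ p in X, u p * CGParabolic.dt φ p = ∫ p in O, u p * CGParabolic.dt φ p :=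
  IsTest.setIntegral_eq (fun p hp => by rw [hφ.dt.zero_off hp, mul_zero]) hO

lemma IsTest.setIntegral_bil_eq (hφ : IsTest O φ) (hO : O ⊆ X) :
    ∫ p in X, bil (a p) (dx φ p) (Du p) = ∫ p in O, bil (a p) (dx φ p) (Du p) :=
  IsTest.setIntegral_eq (fun p hp => by rw [hφ.dx_zero_off hp, bil_zero_left]) hO

namespace IsCoefficientField
variable (h : IsCoefficientField a)
include h

/-- The solutions given by `IsPair.solve_energy` solve the equation on every cube. -/
lemma cellSol_limit (hp : IsCellPair a X k val grd) {v : ℕ → W} {w : SpaceTime d → ℝ}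
    (hw : IntegrableOn w (cellUnion X k)) (hDw : FinE a (cellUnion X k) Dw)
    (hlim : Tendsto (fun n => ∫ p in cellUnion X k, ‖val (v n) p - w p‖) atTop (𝓝 0))
    (hlimE : Tendsto (fun n => eN a (cellUnion X k) (fun p => grd (v n) p - Dw p)) atTop (𝓝 0))
    (heq : ∀ φ, IsTest (cellUnion X k) φ → -(σ * ∫ p in cellUnion X k, w p * dt φ p)
      + ∫ p in cellUnion X k, bil (a p) (dx φ p) (Dw p) = e φ) : CellSol σ a X k e Dw where
  finE := hDw
  exists_sol i hi := by
    have hs := cell_subset_cellUnion hi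
    have hbd := isBounded_cell k i
    refine ⟨fun p => w p + inner ℝ (cavg k i Dw) p.2, (hw.mono_set hs).add (integrableOn_inner_snd hbd (cavg k i Dw)),
      h.hasWeakGradient_limit hp hw hDw hlim hlimE hi, fun φ hφ => ?_⟩
    have e1 := heq φ (hφ.mono hs)
    rw [hφ.setIntegral_dt_eq hs, hφ.setIntegral_bil_eq hs] at e1
    rw [← e1]
    simp only [add_mul]
    rw [integral_add (hφ.dt.mul_integrableOn (hw.mono_set hs))
      (hφ.dt.mul_integrableOn (integrableOn_inner_snd hbd _)), integral_inner_snd_mul_dt hφ, add_zero]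

/-- Limits of test functions have gradients of zero average on every cube. -/
lemma setIntegral_cell_limit [NeZero d] (hX : IsBounded X) {v : ℕ → TestSpace (cellUnion X k)}
    (hDw : FinE a (cellUnion X k) Dw)
    (hlimE : Tendsto (fun n => eN a (cellUnion X k) (fun p => dx (v n).1 p - Dw p)) atTop (𝓝 0))
        (hi : i ∈ cells X k) : ∫ p in cell k i, Dw p = 0 := by
  have hs := cell_subset_cellUnion hi
  have hbd := isBounded_cell k i
  have hfe := fun n => (h.isCellPair_test hX k).finE (v n)
  have hgr : ∀ n, IntegrableOn (dx (v n).1) (cell k i) := fun n => (v n).2.integrable_dx.integrableOn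
  have hlimE1 := squeeze_zero (fun n => eN_nonneg) (fun n => eN_mono (h.finE_sub (hfe n) hDw) hs) hlimE
  have hlim2 := h.tendsto_integral_norm_sub hbd (fun n => (hfe n).mono hs) (hDw.mono hs) hlimE1
  have t := tendsto_integral_of_norm_sub_le hgr (h.integrableOn hbd (hDw.mono hs)) hlim2 hgr
    (h.integrableOn hbd (hDw.mono hs)) 1 (fun n p => by simp)
  exact tendsto_nhds_unique t (tendsto_const_nhds.congr fun n => ((v n).2.setIntegral_cell_dx i).symm)

/-- A corrector with zero average gradients, for functionals bounded by the energy. -/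
lemma exists_corrector [NeZero d] (hX : IsBounded X) (σ : ℝ) (k : ℤ)
    (he : IsLinearOn (cellUnion X k) e) (hc : 0 ≤ c)
    (hec : ∀ φ, IsTest (cellUnion X k) φ → |e φ| ≤ c * eN a (cellUnion X k) (dx φ)) :
    ∃ Dy, CellSol σ a X k e Dy ∧ (∀ i ∈ cells X k, ∫ p in cell k i, Dy p = 0) ∧ eN a (cellUnion X k) Dy ≤ c := by
  have hp := h.isCellPair_test hX k
  obtain ⟨w, Dw, v, hw, hDw, hlim, hlimE, heq, hle⟩ := hp.solve_energy h (isBounded_cellUnion hX) σ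
    he.toLinearMap c hc (fun χ c' hc' hχ => by
      exact (hec χ.1 χ.2).trans (mul_le_mul_of_nonneg_left (hp.eN_le h hχ hc') hc))
  exact ⟨Dw, h.cellSol_limit hp hw hDw hlim hlimE (fun φ hφ => heq ⟨φ, hφ⟩),
    fun i hi => h.setIntegral_cell_limit hX hDw hlimE hi, hle⟩

/-- The averages over smaller cubes of the field of a pair `χ`, when `χ` has norm at most `c` as a
functional through the operator: `χ` solves the adjoint equation up to a functional of norm `c`. -/
lemma sum_adjoint_le [NeZero d] (hX : IsBounded X) (hp : IsCellPair a X k val grd)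
    (hj : j ≤ k) (hb0 : 0 ≤ b) (hb : ∀ i ∈ cells (cellUnion X k) j, GradBound 1 a (cell j i) b)
    {χ : W} (hc : 0 ≤ c)
    (hχ : ∀ v, |-(1 * ∫ p in cellUnion X k, val v p * dt (val χ) p)
        + ∫ p in cellUnion X k, bil (a p) (grd χ p) (grd v p)| ≤ c * eN a (cellUnion X k) (grd v)) :
    ∑ i ∈ cells (cellUnion X k) j, ‖∫ p in cell j i, grd χ p‖ ^ 2 ≤ vol d j * (36 * b) * c ^ 2 := by
  have hX' := isBounded_cellUnion (k := k) hX
  have hT := h.transpose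
  have hsub : cellUnion (cellUnion X k) j ⊆ cellUnion X k := cellUnion_subset hX'
  obtain ⟨M, hM0, hM⟩ := h.ellBdd hX'
  have hfχ := hp.finE χ
  set e : (SpaceTime d → ℝ) → ℝ := fun φ => -(∫ p in cellUnion X k, φ p * dt (val χ) p)
        + ∫ p in cellUnion X k, bil (a p) (grd χ p) (dx φ p) with he
  have hlin : IsLinearOn (cellUnion (cellUnion X k) j) e := by
    constructor
    · intro φ ψ hφ hψ
      have e1 : ∀ p, dx (φ + ψ) p = dx φ p + dx ψ p := fun p =>
        dx_add (hφ.differentiable p) (hψ.differentiable p)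
      simp [he, e1, Pi.add_apply, add_mul, bil_add_right]
      rw [integral_add (hφ.integrable_mul_test (hp.test χ).dt).integrableOn
        (hψ.integrable_mul_test (hp.test χ).dt).integrableOn,
        integral_add (h.integrable_bil hM hfχ (h.finE_dx hX' hφ)) (h.integrable_bil hM hfχ (h.finE_dx hX' hψ))]
      ring
    · intro r φ hφ
      have e1 : ∀ p, dx (r • φ) p = r • dx φ p := fun p => dx_const_mul r (hφ.differentiable p)
      simp [he, e1, Pi.smul_apply, smul_eq_mul, mul_assoc, bil_smul_right]
      rw [integral_const_mul, integral_const_mul]; ring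
  have hec : ∀ φ, IsTest (cellUnion (cellUnion X k) j) φ →
      |e φ| ≤ c * eN (fun p => (a p)ᵀ) (cellUnion (cellUnion X k) j) (dx φ) := by
    intro φ hφ
    obtain ⟨v, hv1, hv2⟩ := hp.exists_of_test φ (hφ.mono hsub)
    have h1 := hχ v
    rw [hv1, hv2, one_mul] at h1
    refine h1.trans (le_of_eq ?_)
    rw [eN_transpose]
    congr 1
    have hf1 := h.finE_dx hX' hφ
    have e2 : eN a (cellUnion X k) (dx φ) ^ 2 = eN a (cellUnion (cellUnion X k) j) (dx φ) ^ 2 := by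
      rw [h.eN_sq hf1, h.eN_sq (hf1.mono hsub)]
      exact IsTest.setIntegral_eq (fun p hp => by rw [hφ.dx_zero_off hp, bil_zero_left]) hsub
    exact (pow_left_inj₀ eN_nonneg eN_nonneg two_ne_zero).1 e2
  obtain ⟨Dy, hy, hy0, hyle⟩ := hT.exists_corrector hX' (-1) j hlin hc hec
  have hu : CellSol (-1) (fun p => (a p)ᵀ) (cellUnion X k) j e (grd χ) := by
    refine ⟨finE_transpose.2 (hfχ.mono hsub), fun i hi => ?_⟩
    obtain ⟨i', hi', hii⟩ := exists_ancestor hX hj hi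
    obtain ⟨q, hq⟩ := hp.grd_eq χ i' hi'
    have hbd := isBounded_cell j i
    have hs := hii.trans (cell_subset_cellUnion hi')
    have hvi : IntegrableOn (val χ) (cell j i) := (hp.test χ).integrable.integrableOn
    have hdi : IntegrableOn (dx (val χ)) (cell j i) := (hp.test χ).integrable_dx.integrableOn
    refine ⟨fun p => val χ p + inner ℝ q p.2, hvi.add (integrableOn_inner_snd hbd q), ?_, ?_⟩
    · intro φ hφ
      simp [add_smul]
      rw [integral_add (hφ.smul_dx_integrableOn hvi)
        (hφ.smul_dx_integrableOn (integrableOn_inner_snd hbd _)), integral_inner_snd_smul_dx hφ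
        (isOpen_cell j i) hbd, integral_smul_dx hφ (isOpen_cell j i) (hp.test _).smooth.contDiffOn
        (hφ.smul_dx_integrableOn hvi) (hφ.smul_integrableOn hdi), ← neg_add,
        ← integral_add (hφ.smul_integrableOn hdi) (hφ.smul_integrableOn (integrableOn_const hbd.measure_lt_top.ne))]
      congr 1
      refine setIntegral_congr_fun (measurableSet_cell j i) fun p hpi => ?_
      simp [hq p (hii hpi), smul_add]
    · intro φ hφ
      simp [add_mul, he]
      rw [integral_add (hφ.dt.mul_integrableOn hvi)
        (hφ.dt.mul_integrableOn (integrableOn_inner_snd hbd _)), integral_inner_snd_mul_dt hφ, add_zero]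
      have e3 : ∫ p in cellUnion X k, φ p * dt (val χ) p = -∫ p in cell j i, val χ p * dt φ p := by
        rw [(hφ.mono hs).integral_mul_dt_comm (hp.test χ), hφ.setIntegral_dt_eq hs]
      have e4 : ∫ p in cellUnion X k, bil (a p) (grd χ p) (dx φ p) =
          ∫ p in cell j i, bil (a p)ᵀ (dx φ p) (grd χ p) := by
        simp [bil_transpose]
        exact IsTest.setIntegral_eq (fun p hp => by rw [hφ.dx_zero_off hp, bil_zero_right]) hs
      linarith
  have key := hT.sum_grad_sub_le hu hy hy0 (fun i hi =>
    h.gradBound_adjoint (isBounded_cell j i) (isOpen_cell j i) (hb i hi) hb0)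
  refine key.trans ?_
  have e5 : eN (fun p => (a p)ᵀ) (cellUnion (cellUnion X k) j) (grd χ) ≤ c := by
    rw [eN_transpose]
    exact (eN_mono hfχ hsub).trans (hp.eN_le h hχ hc)
  have e6 := hT.eN_sub_le hu.finE hy.finE
  have e7 := eN_nonneg (a := fun p => (a p)ᵀ) (O := cellUnion (cellUnion X k) j) (ξ := fun p => grd χ p - Dy p)
  have e8 := pow_le_pow_left₀ e7 (show _ ≤ 2 * c by linarith) 2
  calc _ ≤ vol d j * (9 * b) * (2 * c) ^ 2 := mul_le_mul_of_nonneg_left e8 (mul_nonneg (vol_pos j).le (by positivity))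
    _ = _ := by ring

end IsCoefficientField
end

section
/-! ### Averages of solutions with a divergence-form right-hand side -/

variable {b : ℤ → ℝ} {e : (SpaceTime d → ℝ) → ℝ} {W : Type*} [AddCommGroup W] [Module ℝ W]
  {val : W →ₗ[ℝ] SpaceTime d → ℝ} {grd : W →ₗ[ℝ] VecField d}

/-- Bounds `b j` for the average gradients of free solutions in the cubes of scale `j` inside `X`,
summable against the weights `w j`. -/
structure GradScale (a : MatField d) (X : Set (SpaceTime d)) (w b : ℤ → ℝ) (S : ℝ) : Prop where
  pos : ∀ j, 0 < w j
  nonneg : ∀ j, 0 ≤ b j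
  bound : ∀ j, ∀ i ∈ cells X j, GradBound 1 a (cell j i) (b j)
  sum_le : ∀ A : Finset ℤ, ∑ j ∈ A, w j * b j ≤ S

/-- Bounds `b j` for the average fluxes of free solutions in the cubes of scale `j` inside `X`,
summable against the weights `w j`. -/
structure FluxScale (a : MatField d) (X : Set (SpaceTime d)) (w b : ℤ → ℝ) (S : ℝ) : Prop where
  pos : ∀ j, 0 < w j
  nonneg : ∀ j, 0 ≤ b j
  bound : ∀ j, ∀ i ∈ cells X j, FluxBound a (cell j i) (b j)
  sum_le : ∀ A : Finset ℤ, ∑ j ∈ A, w j * b j ≤ S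

/-- The weighted sum of the oscillations of the cube averages is at most `M`. -/
def OscBound (X : Set (SpaceTime d)) (w : ℤ → ℝ) (f : VecField d) (M : ℝ) : Prop :=
  ∀ A : Finset ℤ, ∑ j ∈ A, (w j)⁻¹ * oscSq X j f ≤ M

/-- The difference between a field and its cube averages at scale `k`. -/
def fluct (X : Set (SpaceTime d)) (k : ℤ) (f : VecField d)
    (p : SpaceTime d) : Space d :=
  f p - stepField X k (fun i => cavg k i f) p

lemma memLp_stepField (hO : IsBounded O) (c : Idx d → Space d) : MemLp (stepField X k c) 2 (𝓛 O) := by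
  have : IsFiniteMeasure (𝓛 O) := ⟨by simpa using hO.measure_lt_top⟩
  exact MemLp.of_bound (measurable_stepField c).aestronglyMeasurable _ (ae_of_all _ (norm_stepField_le c))

lemma memLp_fluct (hX : IsBounded X) (hf : MemLp f 2 (𝓛 X)) : MemLp (fluct X k f) 2 (𝓛 X) :=
  hf.sub (memLp_stepField hX _)

lemma integrableOn_of_memLp (hX : IsBounded X) (hf : MemLp f 2 (𝓛 X)) : IntegrableOn f X := by
  have : IsFiniteMeasure (𝓛 X) := ⟨by simpa using hX.measure_lt_top⟩
  exact hf.integrable (by norm_num)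

lemma cavg_sub_stepField (hi' : i' ∈ cells X k) (hs : cell j i ⊆ cell k i')
    (hf : IntegrableOn f (cell j i)) : cavg j i (fluct X k f) = cavg j i f - cavg k i' f := by
  have e1 : ∫ p in cell j i, fluct X k f p = (∫ p in cell j i, f p) - vol d j • cavg k i' f := by
    rw [setIntegral_congr_fun (measurableSet_cell j i) fun p hp => by simp [fluct]; rw [stepField_eq hi' _ (hs hp)],
      integral_sub hf (integrableOn_const (isBounded_cell j i).measure_lt_top.ne), setIntegral_const,
      volume_real_cell]
  rw [cavg, e1, smul_sub, smul_smul, inv_mul_cancel₀ (vol_pos j).ne', one_smul]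
  rfl

lemma cavg_fluct_self (hX : IsBounded X) (hf : IntegrableOn f X)
    (hi : i ∈ cells X k) : cavg k i (fluct X k f) = 0 := by
  rw [cavg_sub_stepField hi le_rfl (hf.mono_set ((mem_cells hX).1 hi)), sub_self]

lemma oscSq_fluct_le (hX : IsBounded X) (hf : IntegrableOn f X) (hj : j < k) :
    oscSq (cellUnion X k) j (fluct X k f) ≤ oscSq X j f := by
  refine le_trans (le_of_eq ?_) (Finset.sum_le_sum_of_subset_of_nonneg
    (cells_mono hX (cellUnion_subset (k := k) hX)) fun i _ _ => mul_nonneg (vol_pos j).le (sq_nonneg _))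
  refine sum_congr rfl fun i hi => ?_
  have hpar := par_mem_cells_cellUnion hX hj hi
  obtain ⟨i', hi', hs⟩ := exists_ancestor hX (show j + 1 ≤ k by omega) hpar
  have hpar' := cells_mono hX (cellUnion_subset hX) hpar
  have hs2 := (mem_cells hX).1 hpar'
  have hs1 := cell_subset_par j i
  rw [pavg, if_pos hpar, pavg, if_pos hpar', cavg_sub_stepField hi' hs (hf.mono_set hs2),
    cavg_sub_stepField hi' (hs1.trans hs) (hf.mono_set (hs1.trans hs2)), sub_sub_sub_cancel_right]

lemma integrable_inner_of_bounded {g : VecField d} (hf : IntegrableOn f O)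
    (hg : AEStronglyMeasurable g (𝓛 O)) (hC : ∀ p, ‖g p‖ ≤ C) :
    IntegrableOn (fun p => inner ℝ (f p) (g p)) O :=
  (hf.norm.mul_const C).mono (hf.1.inner hg) (ae_of_all _ fun p =>
    (norm_inner_le_norm _ _).trans ((mul_le_mul_of_nonneg_left (hC p) (norm_nonneg _)).trans (le_abs_self _)))

namespace IsCoefficientField
variable (h : IsCoefficientField a)
include h

/-- The corrected right-hand side is a functional of norm `6 √M √S` relative to the operator: its
pairing with a field is a sum over smaller scales, and the averages of the field over smaller
cubes are controlled because it solves the adjoint equation. -/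
lemma abs_integral_fluct_le [NeZero d] (hX : IsBounded X) (hp : IsCellPair a X k val grd)
    (hs : GradScale a X w b S) (hf : MemLp f 2 (𝓛 X)) (hM : OscBound X w f M)
    {χ : W} (hc : 0 ≤ c)
    (hχ : ∀ v, |-(1 * ∫ p in cellUnion X k, val v p * dt (val χ) p)
        + ∫ p in cellUnion X k, bil (a p) (grd χ p) (grd v p)| ≤ c * eN a (cellUnion X k) (grd v)) :
    |∫ p in cellUnion X k, inner ℝ (fluct X k f p) (grd χ p)| ≤ 6 * √M * √S * c := by
  have hX' := isBounded_cellUnion (k := k) hX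
  have hsub := cellUnion_subset (k := k) hX
  have hfi := integrableOn_of_memLp hX hf
  have hfin : IsFiniteMeasure (𝓛 (cellUnion X k)) := ⟨by simpa using hX'.measure_lt_top⟩
  obtain ⟨C, hC⟩ := hp.bounded χ
  have hη : MemLp (grd χ) 2 (𝓛 (cellUnion X k)) := MemLp.of_bound (hp.finE χ).meas C (ae_of_all _ hC)
  have hF : MemLp (fluct X k f) 2 (𝓛 (cellUnion X k)) :=
    (memLp_fluct hX hf).mono_measure (restrict_mono hsub le_rfl)
  have key := abs_le_of_tendsto_pairing (S := 36 * S) hX'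
    (integrableOn_of_memLp hX' hη) (tendsto_pairing_l2 hX' isOpen_cellUnion k hF hη)
    (sum_eq_zero fun i hi => by
      rw [cells_cellUnion hX] at hi
      rw [cavg_fluct_self hX hfi hi, inner_zero_left])
    (fun j => mul_nonneg (by norm_num) (hs.nonneg j)) hs.pos hc
    (fun j hj => h.sum_adjoint_le hX hp hj.le (hs.nonneg j) (fun i hi => hs.bound j i (cells_mono hX hsub hi)) hc hχ)
    (fun A hA => (sum_le_sum fun j hj => mul_le_mul_of_nonneg_left
      (oscSq_fluct_le hX hfi (hA j hj)) (inv_nonneg.2 (hs.pos j).le)).trans (hM A))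
    (fun A _ => by
      have := hs.sum_le A
      calc ∑ j ∈ A, w j * (36 * b j) = 36 * ∑ j ∈ A, w j * b j := by
            rw [mul_sum]; grind
        _ ≤ _ := by linarith)
  refine key.trans (le_of_eq ?_)
  rw [sqrt_mul (by norm_num), show (36 : ℝ) = 6 ^ 2 by norm_num, sqrt_sq (by norm_num)]
  ring

omit h in
lemma integral_fluct_dx (hX : IsBounded X) (hf : IntegrableOn f X) (hφ : IsTest (cellUnion X k) φ) :
    ∫ p in cellUnion X k, inner ℝ (fluct X k f p) (dx φ p) = ∫ p in X, inner ℝ (f p) (dx φ p) := by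
  have hX' := isBounded_cellUnion (k := k) hX
  have hsub := cellUnion_subset (k := k) hX
  obtain ⟨C, _, hC⟩ := hφ.bounded_dx
  have i1 := integrable_inner_of_bounded (hf.mono_set hsub) hφ.continuous_dx.aestronglyMeasurable hC
  have hsi : IntegrableOn (stepField X k fun i => cavg k i f) (cellUnion X k) :=
    integrableOn_of_memLp hX' (memLp_stepField hX' _)
  have i2 := integrable_inner_of_bounded hsi hφ.continuous_dx.aestronglyMeasurable hC
  have e1 : ∫ p in cellUnion X k, inner ℝ (stepField X k (fun i => cavg k i f) p) (dx φ p) = 0 := by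
    rw [setIntegral_cellUnion i2]
    refine sum_eq_zero fun i hi => ?_
    rw [setIntegral_congr_fun (g := fun p => inner ℝ (cavg k i f) (dx φ p)) (measurableSet_cell k i)
      fun p hp => by simp [stepField_eq hi _ hp], integral_inner hφ.integrable_dx.integrableOn,
      hφ.setIntegral_cell_dx i, inner_zero_right]
  simp [fluct, inner_sub_left]
  rw [integral_sub i1 i2, e1, sub_zero]
  exact (IsTest.setIntegral_eq (fun p hp => by rw [hφ.dx_zero_off hp, inner_zero_right]) hsub).symm

/-- Solvability with right-hand side in divergence form in a space of pairs on the cubes of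
scale `k`. -/
lemma exists_div_sol [NeZero d] (hX : IsBounded X) (hp : IsCellPair a X k val grd)
    (hs : GradScale a X w b S) (hf : MemLp f 2 (𝓛 X)) (hM : OscBound X w f M) :
    ∃ (z : SpaceTime d → ℝ) (Dz : VecField d) (v : ℕ → W), FinE a (cellUnion X k) Dz ∧
      CellSol 1 a X k (fun φ => -∫ p in X, inner ℝ (f p) (dx φ p)) Dz ∧
      Tendsto (fun n => eN a (cellUnion X k) (fun p => grd (v n) p - Dz p)) atTop (𝓝 0) ∧
      (∀ χ, -(1 * ∫ p in cellUnion X k, z p * dt (val χ) p) + ∫ p in cellUnion X k, bil (a p) (grd χ p) (Dz p) =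
          -∫ p in cellUnion X k, inner ℝ (fluct X k f p) (grd χ p)) ∧
      eN a (cellUnion X k) Dz ≤ 6 * √M * √S := by
  have hX' := isBounded_cellUnion (k := k) hX
  have hsub := cellUnion_subset (k := k) hX
  have hint : ∀ v, IntegrableOn (fun p => inner ℝ (fluct X k f p) (grd v p)) (cellUnion X k) := fun v => by
    obtain ⟨C, hC⟩ := hp.bounded v
    exact integrable_inner_of_bounded ((integrableOn_of_memLp hX (memLp_fluct hX hf)).mono_set hsub)
      (hp.finE v).meas hC
  let ℓ : W →ₗ[ℝ] ℝ :=
    { toFun := fun χ => -∫ p in cellUnion X k, inner ℝ (fluct X k f p) (grd χ p)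
      map_add' := fun χ χ' => by
        simp [map_add, Pi.add_apply, inner_add_right]
        rw [integral_add (hint χ) (hint χ')]; ring
      map_smul' := fun c χ => by
        simp only [map_smul, Pi.smul_apply, inner_smul_right, RingHom.id_apply]
        rw [integral_const_mul, smul_eq_mul]; ring }
  obtain ⟨z, Dz, v, hz, hDz, hlim, hlimE, heq, hle⟩ := hp.solve_energy h hX' 1 ℓ (6 * √M * √S)
    (by positivity) (fun χ c hc hχ => by
      have := h.abs_integral_fluct_le hX hp hs hf hM hc hχ
      rwa [← abs_neg] at this)
  refine ⟨z, Dz, v, hDz, h.cellSol_limit hp hz hDz hlim hlimE fun φ hφ => ?_, hlimE, heq, hle⟩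
  obtain ⟨χ, h1, h2⟩ := hp.exists_of_test φ hφ
  have := heq χ
  rw [h1, h2] at this
  rw [this, ← integral_fluct_dx hX (integrableOn_of_memLp hX hf) hφ, ← h2]
  rfl

lemma cellSol_add {e' : (SpaceTime d → ℝ) → ℝ} (hu : CellSol 1 a X k e Du) (hy : CellSol 1 a X k e' Dy) :
    CellSol 1 a X k (fun φ => e φ + e' φ) (fun p => Du p + Dy p) where
  finE := h.finE_add hu.finE hy.finE
  exists_sol i hi := by
    obtain ⟨u, hu1, hu2, hu3⟩ := hu.exists_sol i hi
    obtain ⟨y, hy1, hy2, hy3⟩ := hy.exists_sol i hi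
    have hbd := isBounded_cell k i
    obtain ⟨M, hM0, hM⟩ := h.ellBdd hbd
    have hfu := hu.finE.cell hi
    have hfy := hy.finE.cell hi
    have := hu2.add 1 hy2 hu1 hy1 (h.integrableOn hbd hfu) (h.integrableOn hbd hfy)
    simp only [one_mul, one_smul] at this
    refine ⟨fun p => u p + y p, hu1.add hy1, this, fun φ hφ => ?_⟩
    rw [← hu3 φ hφ, ← hy3 φ hφ]
    simp only [add_mul, bil_add_right]
    rw [integral_add (hφ.dt.mul_integrableOn hu1) (hφ.dt.mul_integrableOn hy1),
      integral_add (h.integrable_bil hM (h.finE_dx hbd hφ) hfu) (h.integrable_bil hM (h.finE_dx hbd hφ) hfy)]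
    ring

/-- Average gradients of solutions of `∂_t u - ∇ · a ∇u = ∇ · f + e`, given a corrector for `e`. -/
lemma sum_grad_le [NeZero d] (hX : IsBounded X) (hs : GradScale a X w b S)
    (hf : MemLp f 2 (𝓛 X)) (hM : OscBound X w f M) (hy : CellSol 1 a X k e Dy)
    (hy0 : ∀ i ∈ cells X k, ∫ p in cell k i, Dy p = 0)
    (hu : CellSol 1 a X k (fun φ => (-∫ p in X, inner ℝ (f p) (dx φ p)) + e φ) Du) :
    ∑ i ∈ cells X k, ‖∫ p in cell k i, Du p‖ ^ 2 ≤
      vol d k * b k * (eN a (cellUnion X k) Du + 6 * √M * √S + eN a (cellUnion X k) Dy) ^ 2 := by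
  obtain ⟨z, Dz, v, hDz, hz, hlimE, -, hle⟩ := h.exists_div_sol hX (h.isCellPair_test hX k) hs hf hM
  have hzy := h.cellSol_add hz hy
  have hz0 : ∀ i ∈ cells X k, ∫ p in cell k i, (Dz p + Dy p) = 0 := fun i hi => by
    have hbd := isBounded_cell k i
    rw [integral_add (h.integrableOn hbd (hDz.cell hi)) (h.integrableOn hbd (hy.finE.cell hi)), hy0 i hi, add_zero]
    exact h.setIntegral_cell_limit hX hDz hlimE hi
  refine (h.sum_grad_sub_le hu hzy hz0 (hs.bound k)).trans ?_
  refine mul_le_mul_of_nonneg_left (pow_le_pow_left₀ eN_nonneg ?_ 2) (mul_nonneg (vol_pos k).le (hs.nonneg k))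
  have e1 := h.eN_sub_le hu.finE hzy.finE
  have e2 := h.eN_add_le hDz hy.finE
  linarith

/-- Average fluxes of solutions of `∂_t u - ∇ · a ∇u = ∇ · f`. -/
lemma sum_flux_le [NeZero d] (hX : IsBounded X) (hs : GradScale a X w b S)
    {b' : ℤ → ℝ} {S' : ℝ} (hs' : FluxScale a X w b' S')
    (hf : MemLp f 2 (𝓛 X)) (hM : OscBound X w f M)
    (hu : CellSol 1 a X k (fun φ => -∫ p in X, inner ℝ (f p) (dx φ p)) Du) :
    ∑ i ∈ cells X k, ‖∫ p in cell k i, flux a Du p‖ ^ 2 ≤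
      vol d k * b' k * (eN a (cellUnion X k) Du + 6 * √M * √S) ^ 2 := by
  classical
  obtain ⟨z, Dz, v, hDz, hz, hlimE, heq, hle⟩ := h.exists_div_sol hX (h.isCellPair_neumann hX k) hs hf hM
  have hz0 : ∀ i ∈ cells X k, ∫ p in cell k i, flux a Dz p = 0 := fun i hi => by
    refine ext_inner_left ℝ fun q => ?_
    have e1 := heq (0, Pi.single i q)
    have e2 : ∀ p, neumannGrd X k (0, Pi.single i q) p = (cell k i).indicator (fun _ => q) p := fun p => by
      have : dx 0 p = 0 := dx_comp_fst 0 p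
      rw [neumannGrd_apply]
      simp [ZeroMemClass.coe_zero, this, zero_add, stepField]
      rw [Finset.sum_eq_single i (fun j _ hj => by
        rw [Pi.single_eq_of_ne hj]; simp) (fun hn => absurd hi hn), Pi.single_eq_same]
    have e3 : ∀ p, dt (neumannVal X k (0, Pi.single i q)) p = 0 := fun p => by simp [neumannVal, dt]
    simp [e2, e3, mul_zero, integral_zero, neg_zero, zero_add] at e1
    have e4 : ∀ p, bil (a p) ((cell k i).indicator (fun _ => q) p) (Dz p) =
        (cell k i).indicator (fun p => bil (a p) q (Dz p)) p := fun p => by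
      by_cases hp : p ∈ cell k i <;> simp [hp, bil_zero_left]
    have e5 : ∀ p, inner ℝ (fluct X k f p) ((cell k i).indicator (fun _ => q) p) =
        (cell k i).indicator (fun p => inner ℝ (fluct X k f p) q) p := fun p => by
      by_cases hp : p ∈ cell k i <;> simp [hp]
    have hfl : IntegrableOn (fluct X k f) (cell k i) :=
      (integrableOn_of_memLp hX (memLp_fluct hX hf)).mono_set ((mem_cells hX).1 hi)
    have e6 : ∫ p in cell k i, fluct X k f p = 0 := by
      have := cavg_fluct_self hX (integrableOn_of_memLp hX hf) hi
      rwa [cavg, smul_eq_zero_iff_right (inv_ne_zero (vol_pos k).ne')] at this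
    simp [e4, e5] at e1
    rw [setIntegral_indicator (measurableSet_cell k i), setIntegral_indicator (measurableSet_cell k i),
      inter_eq_right.2 (cell_subset_cellUnion hi), h.integral_bil_const (isBounded_cell k i) (hDz.cell hi)] at e1
    simp [real_inner_comm q] at e1
    rw [integral_inner hfl, e6, inner_zero_right, neg_zero] at e1
    simp_all
  refine (h.sum_flux_sub_le hu hz hz0 (hs'.bound k)).trans ?_
  refine mul_le_mul_of_nonneg_left (pow_le_pow_left₀ eN_nonneg ?_ 2) (mul_nonneg (vol_pos k).le (hs'.nonneg k))
  have e1 := h.eN_sub_le hu.finE hz.finE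
  linarith

end IsCoefficientField
end

section
variable {e : (SpaceTime d → ℝ) → ℝ}

/-- The exponential weight in time. -/
def expT (r : ℝ) (p : SpaceTime d) : ℝ := Real.exp (r * p.1)

lemma contDiff_expT (r : ℝ) : ContDiff ℝ ∞ (expT r : SpaceTime d → ℝ) :=
  Real.contDiff_exp.comp (contDiff_const.mul contDiff_fst)

lemma continuous_expT (r : ℝ) : Continuous (expT r : SpaceTime d → ℝ) := (contDiff_expT r).continuous

lemma expT_nonneg (r : ℝ) (p : SpaceTime d) : 0 ≤ expT r p := (Real.exp_pos _).le

lemma expT_mul_expT (r : ℝ) (p : SpaceTime d) : expT r p * expT (-r) p = 1 := by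
  rw [expT, expT, ← Real.exp_add]; simp

lemma abs_expT_le (hp : |p.1| ≤ R) : |expT r p| ≤ Real.exp (|r| * R) := by
  rw [abs_of_nonneg (expT_nonneg r p)]
  refine Real.exp_le_exp.2 ((le_abs_self _).trans ?_)
  rw [abs_mul]
  exact mul_le_mul_of_nonneg_left hp (abs_nonneg r)

lemma dx_expT_mul (r : ℝ) (hφ : DifferentiableAt ℝ φ p) :
    dx (fun q => expT r q * φ q) p = expT r p • dx φ p := by
  have h2 : dx (expT r) p = 0 := dx_comp_fst (fun t => Real.exp (r * t)) p
  rw [dx_mul ((contDiff_expT r).differentiable (by simp) p) hφ, h2, smul_zero, add_zero]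

lemma dt_expT_mul (r : ℝ) (hφ : DifferentiableAt ℝ φ p) :
    dt (fun q => expT r q * φ q) p = expT r p * (dt φ p + r * φ p) := by
  have h2 : dt (expT r) p = r * expT r p := by
    have : HasDerivAt (fun t : ℝ => Real.exp (r * t)) (Real.exp (r * p.1) * r) p.1 := by
      simpa using ((hasDerivAt_id p.1).const_mul r).exp
    exact this.deriv.trans (mul_comm _ _)
  rw [dt_mul ((contDiff_expT r).differentiable (by simp) p) hφ, h2]; ring

namespace IsCoefficientField
variable (h : IsCoefficientField a)
include h

lemma finE_mul (hO : MeasurableSet O) (hg : Continuous g) {G : ℝ}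
    (hG : ∀ p ∈ O, |g p| ≤ G) (hξ : FinE a O ξ) :
    FinE a O (fun p => g p • ξ p) ∧ eN a O (fun p => g p • ξ p) ≤ |G| * eN a O ξ := by
  have hn : ∀ᵐ p ∂(𝓛 O), ‖nrm a (fun p => g p • ξ p) p‖ ≤ ‖|G| * nrm a ξ p‖ := by
    filter_upwards [ae_restrict_mem hO] with p hp
    have : nrm a (fun p => g p • ξ p) p = |g p| * nrm a ξ p := nrm_smul (g p) p
    rw [norm_nrm, this, norm_of_nonneg (mul_nonneg (abs_nonneg _) (nrm_nonneg _))]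
    exact mul_le_mul_of_nonneg_right ((hG p hp).trans (le_abs_self G)) (nrm_nonneg _)
  have hm := hg.aestronglyMeasurable.smul hξ.meas
  refine ⟨⟨hm, (hξ.mem.const_mul |G|).mono (h.aesm_nrm hm) hn⟩, ?_⟩
  refine (l2_mono (hξ.mem.const_mul |G|) hn).trans (le_of_eq ?_)
  rw [l2_const_mul, abs_abs]; rfl

/-- A corrector with zero average gradients, for functionals bounded by the norm of `W_s^1`. A change
of unknown by an exponential weight in time produces the zeroth order term which makes the
equation coercive in that norm. -/
lemma exists_weighted_corrector [NeZero d] (hX : IsBounded X) :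
    ∃ C, 0 ≤ C ∧ ∀ (k : ℤ) (e : (SpaceTime d → ℝ) → ℝ) (c : ℝ), IsLinearOn (cellUnion X k) e → 0 ≤ c →
      (∀ φ, IsTest (cellUnion X k) φ →
        |e φ| ≤ c * √((∫ p in cellUnion X k, φ p * φ p) + eN a (cellUnion X k) (dx φ) ^ 2)) →
      ∃ Dy, CellSol 1 a X k e Dy ∧ (∀ i ∈ cells X k, ∫ p in cell k i, Dy p = 0) ∧ eN a (cellUnion X k) Dy ≤ C * c := by
  obtain ⟨R, hR⟩ := hX.exists_norm_le
  set G := Real.exp (1 / 2 * R) with hGdef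
  have hG0 : 0 < G := Real.exp_pos _
  refine ⟨G * (G * √2), by positivity, fun k e c he hc hec => ?_⟩
  have hX' := isBounded_cellUnion (k := k) hX
  have hOm : MeasurableSet (cellUnion X k) := isOpen_cellUnion.measurableSet
  have hGb : ∀ r : ℝ, |r| = 1 / 2 → ∀ p ∈ cellUnion X k, |expT r p| ≤ G := fun r hr p hp => by
    have := abs_expT_le (r := r) ((norm_fst_le p).trans (hR p (cellUnion_subset hX hp)))
    simp_all
  have hGp := hGb (1 / 2) (by norm_num)
  have hGm := hGb (-(1 / 2)) (by norm_num)
  have hp := h.isCellPair_test hX k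
  have hmul : ∀ r φ, IsTest (cellUnion X k) φ → IsTest (cellUnion X k) (fun p => expT r p * φ p) :=
    fun r φ hφ => hφ.mul_contDiff (contDiff_expT r)
  let ℓ : TestSpace (cellUnion X k) →ₗ[ℝ] ℝ :=
    { toFun := fun χ => e (fun p => expT (-(1 / 2)) p * χ.1 p)
      map_add' := fun χ χ' => by
        rw [← he.add _ _ (hmul _ _ χ.2) (hmul _ _ χ'.2)]
        congr 1; ext p
        simp [mul_add]
      map_smul' := fun r χ => by
        rw [RingHom.id_apply, smul_eq_mul, ← he.smul r _ (hmul _ _ χ.2)]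
        congr 1; ext p
        simp [mul_left_comm] }
  obtain ⟨w, Dw, v, hw, hDw, hlim, hlimE, heq, hle⟩ := hp.solve h hX' 1 (1 / 2) (by norm_num) ℓ
    (c * (G * √2)) (by positivity) (fun χ c' hc' hχ => by
      refine hp.dual_of_le h (by norm_num) (by positivity) hc' ?_ hχ
      have hφ := χ.2
      refine (hec _ (hmul (-(1 / 2)) _ hφ)).trans ?_
      rw [mul_assoc c]
      refine mul_le_mul_of_nonneg_left ?_ hc
      have e1 : dx (fun p => expT (-(1 / 2)) p * χ.1 p) = fun p => expT (-(1 / 2)) p • dx χ.1 p :=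
        funext fun p => dx_expT_mul _ (hφ.differentiable p)
      have e2 := (h.finE_mul hOm (continuous_expT _) hGm (hp.finE χ)).2
      have e3 : ∫ p in cellUnion X k, expT (-(1 / 2)) p * χ.1 p * (expT (-(1 / 2)) p * χ.1 p) ≤
          G ^ 2 * ∫ p in cellUnion X k, χ.1 p * χ.1 p := by
        rw [← integral_const_mul]
        refine setIntegral_mono_on ((hmul _ _ hφ).integrable_mul_test (hmul _ _ hφ)).integrableOn
          ((hφ.integrable_mul_test hφ).integrableOn.const_mul _) hOm fun p hpO => ?_
        have h1 := pow_le_pow_left₀ (abs_nonneg _) (hGm p hpO) 2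
        rw [sq_abs] at h1
        calc _ = expT (-(1 / 2)) p ^ 2 * (χ.1 p * χ.1 p) := by ring
          _ ≤ _ := (mul_le_mul_of_nonneg_right h1 (mul_self_nonneg (χ.1 p)))
      rw [abs_of_pos hG0] at e2
      have e4 := pow_le_pow_left₀ eN_nonneg e2 2
      rw [e1, mul_assoc, ← sqrt_mul (by norm_num)]
      refine sqrt_le_iff.2 ⟨by positivity, ?_⟩
      have hnn : 0 ≤ ∫ p in cellUnion X k, χ.1 p * χ.1 p := integral_nonneg fun p => mul_self_nonneg _
      have e5 : (TestSpace (cellUnion X k)).subtype χ = χ.1 := rfl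
      have e6 : (dxLin (cellUnion X k)) χ = dx χ.1 := rfl
      rw [e5, e6, mul_pow, sq_sqrt (by positivity)]
      rw [e6] at e4
      have e7 : 0 ≤ G ^ 2 * eN a (cellUnion X k) (dx χ.1) ^ 2 := by positivity
      linarith)
  have hDy := h.finE_mul hOm (continuous_expT (1 / 2)) hGp hDw
  have hdx : ∀ n p, dx (fun p => expT (1 / 2) p * (v n).1 p) p = expT (1 / 2) p • dx (v n).1 p :=
    fun n p => dx_expT_mul _ ((v n).2.differentiable p)
  let v' : ℕ → TestSpace (cellUnion X k) := fun n => ⟨_, hmul (1 / 2) _ (v n).2⟩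
  have hlimE' : Tendsto (fun n => eN a (cellUnion X k)
      (fun p => dx (v' n).1 p - expT (1 / 2) p • Dw p)) atTop (𝓝 0) := by
    refine squeeze_zero (fun n => eN_nonneg) (fun n => ?_) (by simpa using hlimE.const_mul |G|)
    have : (fun p => dx (v' n).1 p - expT (1 / 2) p • Dw p) = fun p => expT (1 / 2) p • (dx (v n).1 p - Dw p) := by
      ext1 p; rw [smul_sub, ← hdx n p]
    rw [this]
    exact (h.finE_mul hOm (continuous_expT (1 / 2)) hGp (h.finE_sub ((fun n => hp.finE (v n)) n) hDw)).2
  have hEw := hw.bdd_mul (continuous_expT _).aestronglyMeasurable ((ae_restrict_iff' hOm).2 (ae_of_all _ hGp))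
  have hlim' : Tendsto (fun n => ∫ p in cellUnion X k, ‖(v' n).1 p - expT (1 / 2) p * w p‖) atTop (𝓝 0) := by
    refine squeeze_zero (fun n => integral_nonneg fun p => norm_nonneg _) (fun n => ?_)
      (by simpa using hlim.const_mul G)
    rw [← integral_const_mul]
    refine setIntegral_mono_on ((v' n).2.integrable.integrableOn.sub hEw).norm
      ((((fun n => (v n).2.integrable.integrableOn) n).sub hw).norm.const_mul G) hOm fun p hpO => ?_
    have : (v' n).1 p - expT (1 / 2) p * w p = expT (1 / 2) p * ((v n).1 p - w p) := by ring
    rw [this, norm_mul]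
    exact mul_le_mul_of_nonneg_right (hGp p hpO) (norm_nonneg _)
  refine ⟨fun p => expT (1 / 2) p • Dw p, h.cellSol_limit (v := v') hp hEw hDy.1 hlim' hlimE' fun φ hφ => ?_,
    fun i hi => h.setIntegral_cell_limit hX hDy.1 hlimE' hi, ?_⟩
  · have e1 := heq ⟨_, hmul (1 / 2) φ hφ⟩
    have e2 : ℓ ⟨_, hmul (1 / 2) φ hφ⟩ = e φ := by
      change e (fun p => expT (-(1 / 2)) p * (expT (1 / 2) p * φ p)) = e φ
      congr 1; ext p
      rw [← mul_assoc, mul_comm (expT (-(1 / 2)) p), expT_mul_expT, one_mul]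
    have e3 : ∀ p, dxLin (cellUnion X k) ⟨_, hmul (1 / 2) φ hφ⟩ p = expT (1 / 2) p • dx φ p := fun p =>
      dx_expT_mul _ (hφ.differentiable p)
    rw [e2] at e1
    simp only [e3, Submodule.subtype_apply, dt_expT_mul _ (hφ.differentiable _), bil_smul_left] at e1
    simp [bil_smul_right]
    have e4 : ∫ p in cellUnion X k, w p * (expT (1 / 2) p * (dt φ p + 1 / 2 * φ p)) =
        (∫ p in cellUnion X k, expT (1 / 2) p * w p * dt φ p) +
          1 / 2 * ∫ p in cellUnion X k, expT (1 / 2) p * w p * φ p := by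
      rw [← integral_const_mul, ← integral_add (hφ.dt.mul_integrableOn hEw) ((hφ.mul_integrableOn hEw).const_mul _)]
      congr 1; ext p; ring
    have e5 : ∫ p in cellUnion X k, w p * (expT (1 / 2) p * φ p) =
        ∫ p in cellUnion X k, expT (1 / 2) p * w p * φ p := by
      congr 1; ext p; ring
    linarith
  · refine hDy.2.trans ?_
    rw [abs_of_pos hG0]
    calc G * eN a (cellUnion X k) Dw ≤ G * (c * (G * √2)) := mul_le_mul_of_nonneg_left hle hG0.le
      _ = _ := by ring

end IsCoefficientField

/-! ### The two coarse-grained matrices of a cube -/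

lemma cells_cell (k : ℤ) (i : Idx d) : cells (cell k i) k = {i} := by
  ext i'
  rw [mem_cells (isBounded_cell k i), Finset.mem_singleton]
  exact ⟨fun hs => idx_eq_of_mem (ctr_mem_cell k i') (hs (ctr_mem_cell k i')), fun h => h ▸ le_rfl⟩

lemma cellUnion_cell (k : ℤ) (i : Idx d) : cellUnion (cell k i) k = cell k i := by
  simp [cellUnion, cells_cell]

/-- The bounds for average gradients and average fluxes cannot both be small: some solution has a
prescribed average flux and an energy controlled by the bound for average gradients. -/
lemma IsCoefficientField.one_le_mul_bounds [NeZero d] (h : IsCoefficientField a)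
    {b' : ℝ} (hb0 : 0 ≤ b) (hb0' : 0 ≤ b') (hb : GradBound 1 a (cell k i) b)
    (hb' : FluxBound a (cell k i) b') : 1 ≤ 36 * b * b' := by
  classical
  have hbd := isBounded_cell k i
  have hv := vol_pos (d := d) k
  have hp := h.isCellPair_neumann hbd k
  have hcu := cellUnion_cell k i
  have hcells : cells (cellUnion (cell k i) k) k = {i} := by rw [cells_cellUnion hbd, cells_cell]
  have hi : i ∈ cells (cell k i) k := by rw [cells_cell]; simp
  let q : Space d := stdVec 0
  have hq : ‖q‖ = 1 := by simp [q, stdVec]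
  have hgi := fun v => by
    have := h.integrableOn (isBounded_cellUnion hbd) (hp.finE v)
    exact this.mono_set hcu.ge
  -- the solution with Neumann data `q` has average flux `q` and energy at most `36 b |Q|`
  let ℓ : (TestSpace (cellUnion (cell k i) k) × (Idx d → Space d)) →ₗ[ℝ] ℝ :=
    { toFun := fun χ => inner ℝ q (∫ p in cell k i, neumannGrd (cell k i) k χ p)
      map_add' := fun χ χ' => by
        simp
        rw [integral_add (hgi χ) (hgi χ'), inner_add_right]
      map_smul' := fun c χ => by
        simp only [map_smul, Pi.smul_apply, RingHom.id_apply]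
        rw [integral_smul, inner_smul_right, smul_eq_mul] }
  set K := √(vol d k * (36 * b)) with hK
  obtain ⟨z, Dz, v, hz, hDz, hlim, hlimE, heq, hle⟩ := hp.solve_energy h (isBounded_cellUnion hbd) 1 ℓ K
    (sqrt_nonneg _) (fun χ c hc hχ => by
      have h1 := h.sum_adjoint_le hbd hp le_rfl hb0 (fun i' hi' => by
        rw [hcells, Finset.mem_singleton] at hi'
        rw [hi']; exact hb) hc hχ
      rw [hcells, sum_singleton] at h1
      have h2 : |ℓ χ| ≤ ‖∫ p in cell k i, neumannGrd (cell k i) k χ p‖ := by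
        have := abs_real_inner_le_norm q (∫ p in cell k i, neumannGrd (cell k i) k χ p)
        rwa [hq, one_mul] at this
      refine h2.trans (abs_le_of_sq_le_sq' ?_ (by positivity)).2
      rw [mul_pow, hK, sq_sqrt (by positivity)]
      exact h1)
  have hsol : CellSol 1 a (cell k i) k (fun _ => 0) Dz := h.cellSol_limit hp hz hDz hlim hlimE fun φ hφ => by
    obtain ⟨χ, h1, h2⟩ := hp.exists_of_test φ hφ
    have h3 := heq χ
    rw [h1, h2] at h3
    rw [h3]
    change inner ℝ q (∫ p in cell k i, neumannGrd (cell k i) k χ p) = 0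
    rw [h2, hφ.setIntegral_cell_dx i, inner_zero_right]
  obtain ⟨u, hu1, hu2, hu3⟩ := hsol.exists_sol i hi
  rw [hcu] at hDz hle
  have hfree : IsFree 1 a (cell k i) u Dz := ⟨hu1, hu2, hDz, fun φ hφ => by
    have := hu3 φ hφ; linarith⟩
  have hflux : ∫ p in cell k i, flux a Dz p = vol d k • q := by
    refine ext_inner_left ℝ fun r => ?_
    have e1 := heq (0, Pi.single i r)
    have e2 : ∀ p, neumannGrd (cell k i) k (0, Pi.single i r) p = (cell k i).indicator (fun _ => r) p := fun p => by
      have : dx 0 p = 0 := dx_comp_fst 0 p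
      rw [neumannGrd_apply]
      simp [ZeroMemClass.coe_zero, this, zero_add, stepField, cells_cell, sum_singleton, Pi.single_eq_same]
    have e3 : ∀ p, dt (neumannVal (cell k i) k (0, Pi.single i r)) p = 0 := fun p => by
      simp [neumannVal, dt]
    have e7 : ℓ (0, Pi.single i r) = inner ℝ r (vol d k • q) := by
      change inner ℝ q (∫ p in cell k i, neumannGrd (cell k i) k (0, Pi.single i r) p) = _
      simp [e2]
      rw [setIntegral_indicator (measurableSet_cell k i), inter_self, setIntegral_const,
        volume_real_cell, inner_smul_right, inner_smul_right, real_inner_comm]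
    have e4 : ∀ p, bil (a p) ((cell k i).indicator (fun _ => r) p) (Dz p) =
        (cell k i).indicator (fun p => bil (a p) r (Dz p)) p := fun p => by
      by_cases hp : p ∈ cell k i <;> simp [hp, bil_zero_left]
    simp [e2, e3, mul_zero, integral_zero, neg_zero, zero_add, e4, hcu] at e1
    rwa [setIntegral_indicator (measurableSet_cell k i), inter_self, h.integral_bil_const hbd hDz, e7] at e1
  have h1 := hb' _ _ hfree
  rw [hflux, norm_smul, hq, mul_one, norm_of_nonneg hv.le, volume_real_cell] at h1
  have h2 := pow_le_pow_left₀ eN_nonneg hle 2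
  rw [hK, sq_sqrt (by positivity)] at h2
  have h4 : vol d k ^ 2 * 1 ≤ vol d k ^ 2 * (36 * b * b') := by
    calc _ = vol d k ^ 2 := mul_one _
      _ ≤ _ := h1.trans (mul_le_mul_of_nonneg_left h2 (mul_nonneg hv.le hb0'))
      _ = _ := by ring
  exact le_of_mul_le_mul_left h4 (by positivity)
end

/-! ### Regularity of Lipschitz domains at all scales -/

/-- The points of `U` at distance at most `δ` from the complement of `U`. -/
def bdryLayer (U : Set (Space d)) (δ : ℝ) : Set (Space d) := {y ∈ U | ∃ w ∉ U, dist y w ≤ δ}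

/-- Quantitative regularity of a domain up to the scale `R`: balls centred in `U` contain balls of
comparable size inside `U`, and boundary layers of thickness `δ` occupy at most a fraction of order
`δ / r` of a ball of radius `r`. -/
structure IsRegularDomain (U : Set (Space d)) (R C : ℝ) : Prop where
  corkscrew : ∀ x ∈ U, ∀ r, 0 < r → r ≤ R → ∃ y, ball y (r / C) ⊆ U ∩ ball x r
  layer : ∀ x δ r, 0 < δ → δ ≤ r → r ≤ R →
    volume (bdryLayer U δ ∩ ball x r) ≤ ofReal (C * (δ / r) * r ^ d)

lemma exists_mem_frontier_dist_le {y w : Space d} (hU : IsOpen U) (hy : y ∈ U) (hw : w ∉ U) :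
    ∃ v ∈ frontier U, dist y v ≤ dist y w := by
  by_contra! hcon
  have hsub : segment ℝ y w ⊆ U ∪ (closure U)ᶜ := fun v hv => by
    by_cases hvU : v ∈ closure U
    · refine Or.inl (by_contra fun h => ?_)
      have h1 := hcon v (⟨hvU, by rwa [hU.interior_eq]⟩)
      rw [segment_eq_image_lineMap] at hv
      obtain ⟨t, ht, rfl⟩ := hv
      rw [dist_left_lineMap, norm_of_nonneg ht.1] at h1
      nlinarith [ht.2, dist_nonneg (x := y) (y := w)]
    simp_all
  have h2 := (convex_segment y w).isPreconnected.subset_left_of_subset_union hU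
    isClosed_closure.isOpen_compl (disjoint_compl_right.mono_left subset_closure) hsub
    ⟨y, left_mem_segment ℝ y w, hy⟩
  exact hw (h2 (right_mem_segment ℝ y w))

/-- A slab of thickness `A` around a Lipschitz graph: its disjoint translates in the direction of the
graph variable show that it has small volume. -/
lemma volume_slab_le {e : Space d} (he : ‖e‖ = 1) {K : ℝ≥0} {γ : Space d → ℝ}
    (hγ : LipschitzWith K γ) (hγe : ∀ y (t : ℝ), γ (y + t • e) = γ y) (x : Space d)
    (hA : 0 < A) (hr : 0 < r) :
    volume ({y | γ y < inner ℝ e y ∧ inner ℝ e y ≤ γ y + A} ∩ ball x r) ≤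
      ofReal (A / r) * volume (ball x (2 * r + A)) := by
  set S := {y | γ y < inner ℝ e y ∧ inner ℝ e y ≤ γ y + A} ∩ ball x r with hS
  have hin : Continuous fun y : Space d => (inner ℝ e y) := continuous_const.inner continuous_id
  have hSm : MeasurableSet S := ((measurableSet_lt hγ.continuous.measurable hin.measurable).inter
      (measurableSet_le hin.measurable (hγ.continuous.add continuous_const).measurable)).inter
      Metric.isOpen_ball.measurableSet
  set N := ⌈r / A⌉₊ with hN
  have hN1 : r / A ≤ N := Nat.le_ceil _
  have hN2 : N < r / A + 1 := Nat.ceil_lt_add_one (by positivity)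
  let f : ℕ → Set (Space d) := fun n => (fun y => y + (-(n * A)) • e) ⁻¹' S
  have hfm : ∀ n, MeasurableSet (f n) := fun n => (measurable_add_const _) hSm
  have hfv : ∀ n, volume (f n) = volume S := fun n => measure_preimage_add_right _ _ _
  have hfi : ∀ n y, y ∈ f n → γ y + n * A < inner ℝ e y ∧ inner ℝ e y ≤ γ y + (n + 1) * A := fun n y hy => by
    have h1 := hy.1
    simp only [mem_ofPred_eq, hγe, inner_add_right, inner_smul_right, real_inner_self_eq_norm_sq, he] at h1
    constructor <;> linarith
  have hdis : Pairwise (Function.onFun Disjoint f) := fun n n' hne => by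
    refine Set.disjoint_left.2 fun y hy hy' => hne ?_
    have h1 := hfi n y hy
    have h2 := hfi n' y hy'
    have h3 : (n : ℝ) < n' + 1 := by by_contra hc; push Not at hc; nlinarith
    have h4 : (n' : ℝ) < n + 1 := by by_contra hc; push Not at hc; nlinarith [h1.2]
    have h5 : n < n' + 1 := by exact_mod_cast h3
    have h6 : n' < n + 1 := by exact_mod_cast h4
    omega
  have hsub : (⋃ n ∈ Finset.range N, f n) ⊆ ball x (2 * r + A) := by
    refine iUnion₂_subset fun n hn y hy => ?_
    have h1 : dist (y + (-(n * A)) • e) x < r := hy.2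
    have h2 : dist y (y + (-(n * A)) • e) = n * A := by
      rw [dist_self_add_right, norm_smul, he, mul_one, norm_eq_abs, abs_neg, abs_of_nonneg (by positivity)]
    have h3 : (n : ℝ) + 1 ≤ N := by exact_mod_cast Finset.mem_range.1 hn
    have h4 : n * A ≤ r := by
      have : n ≤ r / A := by linarith
      rwa [le_div_iff₀ hA] at this
    rw [mem_ball]
    linarith [dist_triangle y (y + (-(n * A)) • e) x]
  have h1 : N * volume S ≤ volume (ball x (2 * r + A)) := by
    calc N * volume S = ∑ n ∈ Finset.range N, volume (f n) := by simp [hfv]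
      _ = volume (⋃ n ∈ Finset.range N, f n) :=
        (measure_biUnion_finset (fun i _ j _ hij => hdis hij) fun n _ => hfm n).symm
      _ ≤ _ := measure_mono hsub
  calc volume S = ofReal (A / r) * (ofReal (r / A) * volume S) := by
        rw [← mul_assoc, ← ofReal_mul (by positivity)]
        have : A / r * (r / A) = 1 := by field_simp
        rw [this]; simp
    _ ≤ ofReal (A / r) * (N * volume S) := by
        gcongr
        simp_all
    _ ≤ _ := by gcongr

lemma exists_pos_forall_le {ι : Type*} (t : Finset ι) (f : ι → ℝ) (hf : ∀ i ∈ t, 0 < f i) :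
    ∃ δ, 0 < δ ∧ ∀ i ∈ t, δ ≤ f i := by
  classical
  induction t using Finset.induction_on with
  | empty => exact ⟨1, one_pos, by simp⟩
  | insert i t _ ih => grind

lemma volume_ball_space [NeZero d] (x : Space d) (hr : 0 ≤ r) : volume (ball x r) =
      ofReal (r ^ d * (volume (ball (0 : Space d) 1)).toReal) := by
  rw [Measure.addHaar_ball volume x hr, finrank_euclideanSpace_fin, ofReal_mul (by positivity),
    ofReal_toReal Metric.isBounded_ball.measure_lt_top.ne]

lemma IsLipschitzDomain.isRegularDomain [NeZero d] (hU : IsLipschitzDomain U) (hR : 0 < R) :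
    ∃ C, 1 ≤ C ∧ IsRegularDomain U R C := by
  classical
  have hcomp := hU.isBounded.isCompact_closure.of_isClosed_subset isClosed_frontier frontier_subset_closure
  have hch : ∀ x : Space d, ∃ (e : Space d) (r : ℝ) (K : ℝ≥0) (γ : Space d → ℝ), x ∈ frontier U →
      ‖e‖ = 1 ∧ 0 < r ∧ LipschitzWith K γ ∧ (∀ y (t : ℝ), γ (y + t • e) = γ y) ∧
      ∀ y ∈ ball x r, (y ∈ U ↔ γ y < inner ℝ e y) := fun x => by
    by_cases hx : x ∈ frontier U
    · obtain ⟨e, he, r, hr, K, γ, h1, h2, h3⟩ := hU.boundary x hx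
      exact ⟨e, r, K, γ, fun _ => ⟨he, hr, h1, h2, h3⟩⟩
    · simp_all
  choose e ρ K γ hch using hch
  obtain ⟨t, ht, hcov⟩ := hcomp.elim_nhds_subcover (fun x => ball x (ρ x / 2)) fun x hx =>
    Metric.ball_mem_nhds x (half_pos (hch x hx).2.1)
  obtain ⟨δ₀, hδ₀, hδρ⟩ := exists_pos_forall_le t (fun x => ρ x / 8) fun x hx => by simp_all
  set K₀ : ℝ≥0 := t.sup K with hK₀
  have hKK : ∀ x ∈ t, (K x) ≤ K₀ := fun x hx => by exact_mod_cast Finset.le_sup hx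
  have hLip : ∀ x ∈ t, ∀ y z, γ x y ≤ γ x z + K₀ * dist y z := fun x hx y z => by
    have h1 := (hch x (ht x hx)).2.2.1.dist_le_mul y z
    rw [dist_eq] at h1
    nlinarith [le_abs_self (γ x y - γ x z), hKK x hx, dist_nonneg (x := y) (y := z)]
  have hnear : ∀ y ∈ U, ∀ w ∉ U, dist y w ≤ δ₀ → ∃ x ∈ t, dist y x < ρ x / 2 + δ₀ := fun y hy w hw hyw => by
    obtain ⟨v, hv, hyv⟩ := exists_mem_frontier_dist_le hU.isOpen hy hw
    obtain ⟨x, hx, hvx⟩ := mem_iUnion₂.1 (hcov hv)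
    exact ⟨x, hx, by linarith [dist_triangle y v x, mem_ball.1 hvx]⟩
  have hinner : ∀ x ∈ t, ∀ y z, (inner ℝ (e x) y) ≤ inner ℝ (e x) z + dist y z := fun x hx y z => by
    have := real_inner_le_norm (e x) (y - z)
    rw [(hch x (ht x hx)).1, one_mul, inner_sub_right, ← dist_eq_norm] at this
    linarith
  set β := (volume (ball (0 : Space d) 1)).toReal with hβ
  set C1 : ℝ := (K₀ + 1) * (4 * R / δ₀ + 4) with hC1
  set C2 : ℝ := R / δ₀ * β with hC2
  set C3 : ℝ := t.card * ((K₀ + 1) * ((K₀ + 3) ^ d * β)) with hC3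
  have hC2' : 0 ≤ C2 := by positivity
  have hC3' : 0 ≤ C3 := by positivity
  have hC1' : 1 ≤ C1 := by
    have : 0 ≤ 4 * R / δ₀ := by positivity
    nlinarith
  refine ⟨C1 + C2 + C3, by linarith, fun x hx r hr hrR => ?_, fun x δ r hδ hδr hrR => ?_⟩
  · -- step `τ` into the domain, along the chart direction when the boundary is close
    set τ := r / (4 * R / δ₀ + 4) with hτ
    have hτ0 : 0 < τ := by positivity
    have hτr : 2 * τ ≤ r := by
      have : τ ≤ r / 4 := div_le_div_of_nonneg_left hr.le (by norm_num) (by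
        have : 0 ≤ 4 * R / δ₀ := by positivity
        linarith)
      linarith
    have hτδ : 4 * τ ≤ δ₀ := by
      have : τ ≤ r / (4 * R / δ₀) := div_le_div_of_nonneg_left hr.le (by positivity) (by linarith)
      have h2 : r / (4 * R / δ₀) = (r / R) * (δ₀ / 4) := by field_simp
      have h3 := (div_le_one hR).2 hrR
      nlinarith
    have hrad : r / (C1 + C2 + C3) ≤ τ / (K₀ + 1) := by
      rw [hτ, div_div]
      refine div_le_div_of_nonneg_left hr.le (by positivity) ?_
      linarith
    have hrad' : τ / (K₀ + 1) ≤ τ := div_le_self hτ0.le (by linarith)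
    by_cases hw : ∃ w ∉ U, dist x w < τ
    · obtain ⟨w, hw, hxw⟩ := hw
      obtain ⟨x₀, hx₀, hd⟩ := hnear x hx w hw (by linarith)
      have hρ := hδρ x₀ hx₀
      obtain ⟨he1, hρ0, -, hγe, hiff⟩ := hch x₀ (ht x₀ hx₀)
      refine ⟨x + τ • e x₀, fun z hz => ?_⟩
      have hz1 := lt_of_lt_of_le hz hrad
      have hz2 : dist (x + τ • e x₀) x = τ := by
        rw [dist_self_add_left, norm_smul, he1, mul_one, norm_of_nonneg hτ0.le]
      have hz3 : dist z x < 2 * τ := by linarith [dist_triangle z (x + τ • e x₀) x]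
      refine ⟨?_, by rw [mem_ball]; linarith⟩
      have hxb : x ∈ ball x₀ (ρ x₀) := by rw [mem_ball]; linarith
      have hzb : z ∈ ball x₀ (ρ x₀) := by rw [mem_ball]; linarith [dist_triangle z x x₀]
      have h1 := (hiff x hxb).1 hx
      refine (hiff z hzb).2 ?_
      have h2 := hLip x₀ hx₀ z (x + τ • e x₀)
      rw [hγe] at h2
      have h3 := hinner x₀ hx₀ (x + τ • e x₀) z
      rw [inner_add_right, inner_smul_right, real_inner_self_eq_norm_sq, he1, dist_comm] at h3
      rw [lt_div_iff₀ (by positivity)] at hz1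
      nlinarith
    · push Not at hw
      refine ⟨x, fun z hz => ?_⟩
      have hz1 := lt_of_lt_of_le hz (hrad.trans hrad')
      refine ⟨by_contra fun h => ?_, by rw [mem_ball]; linarith⟩
      have := hw z h
      rw [dist_comm] at this
      linarith
  · have hr := lt_of_lt_of_le hδ hδr
    by_cases hcase : δ ≤ δ₀
    · have hsub : bdryLayer U δ ∩ ball x r ⊆ ⋃ x₀ ∈ t,
          ({y | γ x₀ y < inner ℝ (e x₀) y ∧ inner ℝ (e x₀) y ≤ γ x₀ y + (K₀ + 1) * δ} ∩ ball x r) := by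
        rintro y ⟨⟨hy, w, hw, hyw⟩, hyr⟩
        obtain ⟨x₀, hx₀, hd⟩ := hnear y hy w hw (hyw.trans hcase)
        have hρ := hδρ x₀ hx₀
        obtain ⟨he1, hρ0, -, hγe, hiff⟩ := hch x₀ (ht x₀ hx₀)
        have hyb : y ∈ ball x₀ (ρ x₀) := by rw [mem_ball]; linarith
        have hwb : w ∈ ball x₀ (ρ x₀) := by
          rw [mem_ball]; linarith [dist_triangle w y x₀, dist_comm w y]
        refine mem_iUnion₂.2 ⟨x₀, hx₀, ⟨(hiff y hyb).1 hy, ?_⟩, hyr⟩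
        have h1 : ¬ γ x₀ w < inner ℝ (e x₀) w := fun h => hw ((hiff w hwb).2 h)
        have h2 := hLip x₀ hx₀ w y
        have h3 := hinner x₀ hx₀ y w
        rw [dist_comm] at h2
        push Not at h1
        nlinarith
      refine (measure_mono hsub).trans ((measure_biUnion_finset_le _ _).trans ?_)
      have hA : 0 < (K₀ + 1) * δ := by positivity
      have hone : ∀ x₀ ∈ t, volume ({y | γ x₀ y < inner ℝ (e x₀) y ∧
          inner ℝ (e x₀) y ≤ γ x₀ y + (K₀ + 1) * δ} ∩ ball x r) ≤
          ofReal ((K₀ + 1) * δ / r * (((K₀ + 3) * r) ^ d * β)) := fun x₀ hx₀ => by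
        obtain ⟨he1, -, hL, hγe, -⟩ := hch x₀ (ht x₀ hx₀)
        refine (volume_slab_le he1 hL hγe x hA hr).trans ?_
        rw [ofReal_mul (by positivity), hβ, ← volume_ball_space x (by positivity)]
        gcongr
        nlinarith
      refine (sum_le_sum hone).trans ?_
      rw [sum_const, nsmul_eq_mul, ← ofReal_natCast, ← ofReal_mul (by positivity)]
      refine ofReal_le_ofReal ?_
      calc t.card * ((K₀ + 1) * δ / r * (((K₀ + 3) * r) ^ d * β)) = C3 * (δ / r) * r ^ d := by rw [hC3, mul_pow]; ring
        _ ≤ _ := by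
          gcongr
          linarith
    · push Not at hcase
      refine (measure_mono inter_subset_right).trans ?_
      rw [volume_ball_space x hr.le]
      refine ofReal_le_ofReal ?_
      have h1 : 1 ≤ R / δ₀ * (δ / r) := by
        have e1 : R / δ₀ * (δ / r) = (R / r) * (δ / δ₀) := by ring
        rw [e1]
        exact one_le_mul_of_one_le_of_one_le ((one_le_div hr).2 hrR) ((one_le_div hδ₀).2 hcase.le)
      calc r ^ d * β ≤ (R / δ₀ * (δ / r)) * (r ^ d * β) := le_mul_of_one_le_left (by positivity) h1
        _ = C2 * (δ / r) * r ^ d := by ring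
        _ ≤ _ := by
          gcongr
          linarith

/-- Dilating a domain dilates the scale up to which it is regular. -/
lemma IsRegularDomain.smul (h : IsRegularDomain U R C) (hc : 0 < c) :
    IsRegularDomain (c • U) (c * R) C := by
  have hmem : ∀ y : Space d, y ∈ c • U ↔ c⁻¹ • y ∈ U := fun y => mem_smul_set_iff_inv_smul_mem₀ hc.ne' _ _
  have hdist : ∀ y z : Space d, dist (c⁻¹ • y) (c⁻¹ • z) = c⁻¹ * dist y z := fun y z => by
    rw [dist_smul₀, norm_of_nonneg (by positivity)]
  have hlt : ∀ {x r : ℝ}, c⁻¹ * x < c⁻¹ * r ↔ x < r := mul_lt_mul_iff_right₀ (by positivity)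
  refine ⟨fun x hx r hr hrR => ?_, fun x δ r hδ hδr hrR => ?_⟩
  · obtain ⟨y, hy⟩ := h.corkscrew _ ((hmem x).1 hx) (c⁻¹ * r) (by positivity) (by rw [inv_mul_le_iff₀ hc]; exact hrR)
    refine ⟨c • y, fun z hz => ?_⟩
    have hz1 : c⁻¹ • z ∈ ball y (c⁻¹ * r / C) := by
      have h1 := hdist z (c • y)
      rw [inv_smul_smul₀ hc.ne'] at h1
      rw [mem_ball, h1, mul_div_assoc, hlt]
      exact hz
    have h2 := hy hz1
    simp_all
  · have hset : bdryLayer (c • U) δ ∩ ball x r =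
        c • (bdryLayer U (c⁻¹ * δ) ∩ ball (c⁻¹ • x) (c⁻¹ * r)) := by
      ext y
      rw [mem_smul_set_iff_inv_smul_mem₀ hc.ne']
      simp only [bdryLayer, mem_inter_iff, mem_ofPred_eq, mem_ball, hdist, hlt, hmem]
      refine and_congr_left fun _ => and_congr_right fun _ => ⟨?_, ?_⟩
      · rintro ⟨w, hw, hyw⟩
        refine ⟨c⁻¹ • w, hw, ?_⟩
        simp_all
      · rintro ⟨w, hw, hyw⟩
        refine ⟨c • w, by rwa [inv_smul_smul₀ hc.ne'], ?_⟩
        have h1 := hdist y (c • w)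
        rw [inv_smul_smul₀ hc.ne'] at h1
        simp_all
    have h1 := h.layer (c⁻¹ • x) (c⁻¹ * δ) (c⁻¹ * r) (by positivity) (by gcongr)
      (by rw [inv_mul_le_iff₀ hc]; exact hrR)
    rw [hset, Measure.addHaar_smul, finrank_euclideanSpace_fin, abs_of_pos (by positivity)]
    refine (mul_le_mul_right h1 _).trans ?_
    rw [← ofReal_mul (by positivity)]
    refine ofReal_le_ofReal (le_of_eq ?_)
    rw [mul_pow, inv_pow]
    field_simp

lemma IsRegularDomain.mono {R' C' : ℝ} (h : IsRegularDomain U R C) (hR : R' ≤ R) (hC : 1 ≤ C)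
    (hCC : C ≤ C') : IsRegularDomain U R' C' := by
  refine ⟨fun x hx r hr hrR => ?_, fun x δ r hδ hδr hrR => (h.layer x δ r hδ hδr (hrR.trans hR)).trans ?_⟩
  · obtain ⟨y, hy⟩ := h.corkscrew x hx r hr (hrR.trans hR)
    exact ⟨y, (Metric.ball_subset_ball (div_le_div_of_nonneg_left hr.le (by linarith) hCC)).trans hy⟩
  · have  := lt_of_lt_of_le hδ hδr
    gcongr

/-- The scale-invariant quantitative information about the cylinder `(0,T) × U` and its triadic
scale `m` on which all constants depend. -/
structure IsRegularCylinder (T : ℝ) (U : Set (Space d)) (m : ℤ) (C : ℝ) : Prop where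
  pos : 0 < T
  one_le : 1 ≤ C
  isOpen : IsOpen U
  isConnected : IsConnected U
  isBounded : IsBounded U
  regular : IsRegularDomain U (9 * (d + 1) * 3 ^ m) C
  time : (3 : ℝ) ^ (2 * m) ≤ C * T
  sub : cyl T U ⊆ cube 0 m

lemma exists_isRegularCylinder [NeZero d] {T₀ : ℝ} (hT₀ : 0 < T₀) {U₀ : Set (Space d)}
    (hU₀ : IsLipschitzDomain U₀) : ∃ C, ∀ (k : ℤ) (T : ℝ) (U : Set (Space d)),
      T = (3 : ℝ) ^ (2 * k) * T₀ → U = ((3 : ℝ) ^ k) • U₀ →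
      ∀ m : ℤ, IsLeast {n : ℤ | cyl T U ⊆ cube 0 n} m → IsRegularCylinder T U m C := by
  obtain ⟨ρ, hρ⟩ := hU₀.isBounded.exists_norm_le
  set B : ℝ := √(18 * T₀ + 36 * ρ ^ 2) with hB
  have hBp : 0 < 18 * T₀ + 36 * ρ ^ 2 := by positivity
  obtain ⟨C, hC, hreg⟩ := hU₀.isRegularDomain (R := 9 * (d + 1) * B) (by positivity)
  refine ⟨C + B ^ 2 / T₀, fun k T U hT hU m hm => ?_⟩
  have h3k := three_zpow_pos k
  have hT0 : 0 < T := by rw [hT]; positivity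
  have h9 : ∀ n : ℤ, (3 : ℝ) ^ (2 * n) = (3 ^ n) ^ 2 := fun n => by
    rw [mul_comm, zpow_mul]; norm_cast
  have hm3 : (3 : ℝ) ^ m = 3 * 3 ^ (m - 1) := by rw [zpow_sub_one₀ (by norm_num)]; ring
  have hkey : (3 ^ m) ^ 2 ≤ (B * 3 ^ k) ^ 2 := by
    have h1 : ¬ cyl T U ⊆ cube 0 (m - 1) := fun h => by have := hm.2 h; omega
    obtain ⟨p, hp, hp'⟩ := Set.not_subset.1 h1
    rw [mul_pow, hB, sq_sqrt hBp.le]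
    simp only [cube, mem_ofPred_eq, not_and_or, not_lt, not_forall] at hp'
    rcases hp' with hp' | ⟨i, hi⟩
    · have h4 : |p.1 - (0 : SpaceTime d).1| = p.1 := by
        rw [Prod.fst_zero, sub_zero, abs_of_pos hp.1.1]
      rw [h4, h9] at hp'
      have h5 := hp.1.2
      rw [hT, h9] at h5
      rw [hm3]
      nlinarith
    · have h4 : |p.2 i - (0 : SpaceTime d).2 i| ≤ 3 ^ k * ρ := by
        have hpU := hp.2
        rw [hU, mem_smul_set] at hpU
        obtain ⟨x, hx, hxp⟩ := hpU
        rw [Prod.snd_zero, PiLp.zero_apply, sub_zero, ← hxp, PiLp.smul_apply, smul_eq_mul, abs_mul, abs_of_pos h3k]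
        exact mul_le_mul_of_nonneg_left ((PiLp.norm_apply_le x i).trans (hρ x hx)) h3k.le
      rw [hm3]
      have h5 : 3 * 3 ^ (m - 1) ≤ 6 * (3 ^ k * ρ) := by linarith
      have h6 := pow_le_pow_left₀ (by positivity) h5 2
      grind
  have hkey' := (abs_le_of_sq_le_sq' hkey (by positivity)).2
  have hCC : C ≤ C + B ^ 2 / T₀ := by
    have : 0 ≤ B ^ 2 / T₀ := by positivity
    linarith
  refine ⟨hT0, hC.trans hCC, ?_, ?_, ?_, ?_, ?_, hm.1⟩
  · rw [hU]; exact hU₀.isOpen.smul₀ h3k.ne'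
  · rw [hU]
    exact hU₀.isConnected.image _ (continuous_const_smul _).continuousOn
  · rw [hU]; exact hU₀.isBounded.smul₀ _
  · rw [hU]
    refine (hreg.smul h3k).mono ?_ hC hCC
    calc 9 * (d + 1) * 3 ^ m ≤ 9 * (d + 1) * (B * 3 ^ k) := by gcongr
      _ = _ := by ring
  · rw [h9]
    refine hkey.trans ?_
    have : (B * 3 ^ k) ^ 2 = B ^ 2 / T₀ * T := by rw [hT, h9]; field_simp
    rw [this]
    exact mul_le_mul_of_nonneg_right (by linarith) hT0.le

/-! ### Cubes and cylinders -/

lemma cube_subset_cube {w : SpaceTime d}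
    (h1 : |z.1 - w.1| + (3 : ℝ) ^ (2 * k) / 2 ≤ (3 : ℝ) ^ (2 * l) / 2)
    (h2 : ∀ i, |z.2 i - w.2 i| + (3 : ℝ) ^ k / 2 ≤ (3 : ℝ) ^ l / 2) : cube z k ⊆ cube w l := fun p hp => by
  refine ⟨?_, fun i => ?_⟩
  · linarith [hp.1, abs_sub_le p.1 z.1 w.1]
  · linarith [hp.2 i, h2 i, abs_sub_le (p.2 i) (z.2 i) (w.2 i)]

lemma three_zpow_add_one (k : ℤ) : (3 : ℝ) ^ (k + 1) = 3 * 3 ^ k := by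
  rw [zpow_add_one₀ (by norm_num), mul_comm]

lemma nine_zpow_add_one (k : ℤ) : (3 : ℝ) ^ (2 * (k + 1)) = 9 * 3 ^ (2 * k) := by
  rw [show 2 * (k + 1) = 2 * k + 1 + 1 by ring, three_zpow_add_one, three_zpow_add_one]; ring

lemma vol_add_one (k : ℤ) : vol d (k + 1) = 9 * 3 ^ d * vol d k := by
  rw [vol, vol, nine_zpow_add_one, three_zpow_add_one, mul_pow]; ring

/-- A cube contains the cubes of the previous scale centred at nearby points. -/
lemma cube_subset_cube_add_one {w : SpaceTime d} (h : w ∈ closure (cube z k)) :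
    cube w k ⊆ cube z (k + 1) := by
  have hcl : closure (cube z k) ⊆ {p | |p.1 - z.1| ≤ 3 ^ (2 * k) / 2 ∧ ∀ i, |p.2 i - z.2 i| ≤ 3 ^ k / 2} := by
    refine closure_minimal (fun p hp => ⟨hp.1.le, fun i => (hp.2 i).le⟩) ?_
    have c1 : Continuous fun p : SpaceTime d => |p.1 - z.1| := by fun_prop
    simp [ofPred_and, ofPred_forall]
    exact (isClosed_le c1 continuous_const).inter
      (isClosed_iInter fun i => isClosed_le ((fun i => by fun_prop) i) continuous_const)
  have h1 := hcl h
  have h3 := three_zpow_pos k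
  have h9 := three_zpow_pos (2 * k)
  refine cube_subset_cube ?_ fun i => ?_
  · rw [nine_zpow_add_one]; linarith [h1.1]
  · rw [three_zpow_add_one]; linarith [h1.2 i]

lemma isBounded_cyl (hU : IsBounded U) : IsBounded (cyl T U) := (isBounded_Ioo _ _).prod hU

lemma isOpen_cyl (hU : IsOpen U) : IsOpen (cyl T U) := isOpen_Ioo.prod hU

lemma norm_sub_lt_of_mem_cube {q : SpaceTime d} [NeZero d] (hp : p ∈ cube z l)
    (hq : q ∈ cube z l) : |p.1 - q.1| < 3 ^ (2 * l) ∧ dist p.2 q.2 < (d + 1) * 3 ^ l := by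
  have h3 := three_zpow_pos l
  constructor
  · have := abs_sub_le p.1 z.1 q.1
    rw [abs_sub_comm z.1] at this
    linarith [hp.1, hq.1]
  · have h1 : ∀ i, |p.2 i - q.2 i| ≤ 3 ^ l := fun i => by
      have := abs_sub_le (p.2 i) (z.2 i) (q.2 i)
      rw [abs_sub_comm (z.2 i)] at this
      linarith [hp.2 i, hq.2 i]
    rw [EuclideanSpace.dist_eq]
    have h2 : √(∑ i, dist (p.2 i) (q.2 i) ^ 2) ≤ √((d * 3 ^ l) ^ 2) := by
      refine sqrt_le_sqrt ?_
      calc ∑ i, dist (p.2 i) (q.2 i) ^ 2 ≤ ∑ _i : Fin d, (3 ^ l) ^ 2 :=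
            sum_le_sum fun i _ => pow_le_pow_left₀ dist_nonneg (h1 i) 2
        _ = d * (3 ^ l) ^ 2 := by simp
        _ ≤ _ := by
          have : (1 : ℝ) ≤ d := by exact_mod_cast NeZero.one_le
          rw [mul_pow]
          exact mul_le_mul_of_nonneg_right (by nlinarith) (by positivity)
    rw [sqrt_sq (by positivity)] at h2
    nlinarith

/-! ### Volumes in a regular cylinder -/

/-- The constant in the lower volume bound for cubes centred in a regular cylinder. -/
def densConst (d : ℕ) (C : ℝ) : ℝ :=
  (1 / (2 * C)) ^ (d + 1) * (volume (ball (0 : Space d) 1)).toReal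

lemma densConst_pos (hC : 1 ≤ C) : 0 < densConst d C := by
  have : 0 < (volume (ball (0 : Space d) 1)).toReal :=
    toReal_pos (Metric.measure_ball_pos volume _ one_pos).ne' Metric.isBounded_ball.measure_lt_top.ne
  unfold densConst; positivity

namespace IsRegularCylinder

variable (h : IsRegularCylinder T U m C)
include h

lemma densConst_le [NeZero d] (hp : p ∈ cyl T U) (hl : l ≤ m) :
    densConst d C * vol d l ≤ volume.real (cube p l ∩ cyl T U) := by
  have hC := h.one_le
  have hle3 : (3 : ℝ) ^ l ≤ 3 ^ m := zpow_le_zpow_right₀ (by norm_num) hl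
  set α := 3 ^ (2 * l) / (2 * C) with hα
  have hα0 : 0 < α := by positivity
  have hαT : α ≤ T / 2 := by
    rw [hα, div_le_iff₀ (by positivity)]
    calc _ ≤ C * T := (zpow_le_zpow_right₀ (by norm_num) (by omega)).trans h.time
      _ = _ := by ring
  have hα9 : α ≤ 3 ^ (2 * l) / 2 := div_le_div_of_nonneg_left (three_zpow_pos (2 * l)).le (by norm_num) (by linarith)
  obtain ⟨t, ht⟩ : ∃ t, Ioo t (t + α) ⊆ Ioo 0 T ∩ Ioo (p.1 - 3 ^ (2 * l) / 2) (p.1 + 3 ^ (2 * l) / 2) := by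
    obtain ⟨hp1, hp2⟩ := hp.1
    by_cases hc : p.1 ≤ T / 2
    · exact ⟨p.1, fun t ht => ⟨⟨by linarith [ht.1], by linarith [ht.2]⟩, by linarith [ht.1], by linarith [ht.2]⟩⟩
    · push Not at hc
      exact ⟨p.1 - α, fun t ht => ⟨⟨by linarith [ht.1], by linarith [ht.2]⟩, by linarith [ht.1],
        by linarith [ht.2]⟩⟩
  obtain ⟨y, hy⟩ := h.regular.corkscrew p.2 hp.2 (3 ^ l / 2) (by positivity) (by nlinarith [three_zpow_pos m])
  have hsub : Ioo t (t + α) ×ˢ ball y (3 ^ l / 2 / C) ⊆ cube p l ∩ cyl T U := by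
    rintro q ⟨hq1, hq2⟩
    have e2 := hy hq2
    refine ⟨⟨?_, fun i => ?_⟩, (ht hq1).1, e2.1⟩
    · grind
    · have := PiLp.norm_apply_le (q.2 - p.2) i
      exact this.trans_lt e2.2
  have hfin : volume (cube p l ∩ cyl T U) ≠ ⊤ := ((isBounded_cube p l).subset inter_subset_left).measure_lt_top.ne
  refine le_trans (le_of_eq ?_) (measureReal_mono hsub hfin)
  rw [measureReal_def, volume_eq_prod, prod_prod, volume_Ioo,
    volume_ball_space y (by positivity), toReal_mul, toReal_ofReal (by linarith),
    toReal_ofReal (by positivity), densConst, vol]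
  have e1 : t + α - t = 1 / (2 * C) * 3 ^ (2 * l) := by ring
  have e2 : 3 ^ l / 2 / C = 1 / (2 * C) * 3 ^ l := by field_simp
  ring

lemma vol_le [NeZero d] : vol d m ≤ (densConst d C)⁻¹ * volume.real (cyl T U) := by
  obtain ⟨x, hx⟩ := h.isConnected.nonempty
  have h1 := h.densConst_le (p := (T / 2, x)) ⟨⟨by linarith [h.pos], by linarith [h.pos]⟩, hx⟩ le_rfl
  rw [← div_eq_inv_mul, le_div_iff₀ (densConst_pos h.one_le), mul_comm]
  exact h1.trans (measureReal_mono inter_subset_right (isBounded_cyl h.isBounded).measure_lt_top.ne)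

end IsRegularCylinder

/-- The points of `(0,T) × U` at parabolic distance of order `3 ^ j` from the boundary of
`(t₁,t₂) × U`. -/
def cylLayer (T : ℝ) (U : Set (Space d)) (t₁ t₂ : ℝ) (j : ℤ) : Set (SpaceTime d) :=
  {p | p ∈ cyl T U ∧ (|p.1 - t₁| ≤ 9 * (d + 1) * 3 ^ (2 * j) ∨ |p.1 - t₂| ≤ 9 * (d + 1) * 3 ^ (2 * j) ∨
    ∃ w ∉ U, dist p.2 w ≤ 9 * (d + 1) * 3 ^ j)}

lemma IsRegularCylinder.volume_cylLayer_le [NeZero d] (h : IsRegularCylinder T U m C) (t₁ t₂ : ℝ)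
    (z : SpaceTime d) (hjl : j ≤ l) (hl : l ≤ m) :
    volume.real (cylLayer T U t₁ t₂ j ∩ cube z l) ≤
      (36 * (d + 1) + C * (9 * (d + 1)) ^ d) * 3 ^ (j - l) * vol d l := by
  set M : ℝ := 9 * (d + 1) with hM
  have hM0 : 0 < M := by positivity
  have hC := h.one_le
  have h9 := three_zpow_pos (2 * l)
  have hle3 : (3 : ℝ) ^ l ≤ 3 ^ m := zpow_le_zpow_right₀ (by norm_num) hl
  have hj3 : (3 : ℝ) ^ j ≤ 3 ^ l := zpow_le_zpow_right₀ (by norm_num) hjl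
  set B : Set (Space d) := WithLp.ofLp ⁻¹' (univ.pi fun i => Ioo (z.2 i - 3 ^ l / 2) (z.2 i + 3 ^ l / 2)) with hB
  have hBv : volume B = ofReal ((3 ^ l) ^ d) := by
    rw [hB, (PiLp.volume_preserving_ofLp (Fin d)).measure_preimage
      (MeasurableSet.univ_pi fun _ => measurableSet_Ioo).nullMeasurableSet, volume_pi, pi_pi]
    simp only [volume_Ioo]
    rw [ofReal_pow (three_zpow_pos l).le, Finset.prod_congr rfl fun j _ => by
      rw [show z.2 j + 3 ^ l / 2 - (z.2 j - 3 ^ l / 2) = 3 ^ l by ring]]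
    simp
  have hsub : cylLayer T U t₁ t₂ j ∩ cube z l ⊆ (Icc (t₁ - M * 3 ^ (2 * j)) (t₁ + M * 3 ^ (2 * j)) ×ˢ B ∪
        Icc (t₂ - M * 3 ^ (2 * j)) (t₂ + M * 3 ^ (2 * j)) ×ˢ B) ∪
      Ioo (z.1 - 3 ^ (2 * l) / 2) (z.1 + 3 ^ (2 * l) / 2) ×ˢ
        (bdryLayer U (M * 3 ^ j) ∩ ball z.2 (M * 3 ^ l)) := by
    rintro p ⟨⟨hpΩ, hp⟩, hpz⟩
    have hpz' := hpz
    rw [(cube_eq_prod z l)] at hpz'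
    rcases hp with hp | hp | ⟨w, hw, hpw⟩
    · rw [abs_le] at hp
      exact Or.inl (Or.inl ⟨⟨by linarith, by linarith⟩, hpz'.2⟩)
    · rw [abs_le] at hp
      exact Or.inl (Or.inr ⟨⟨by linarith, by linarith⟩, hpz'.2⟩)
    · refine Or.inr ⟨hpz'.1, ⟨hpΩ.2, w, hw, hpw⟩, ?_⟩
      have := (norm_sub_lt_of_mem_cube hpz (mem_cube_self z l)).2
      rw [mem_ball, hM]
      have : (0 : ℝ) < (d + 1) * 3 ^ l := by positivity
      linarith
  have hlay := h.regular.layer z.2 (M * 3 ^ j) (M * 3 ^ l) (by positivity) (by gcongr) (by gcongr)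
  have hIcc : ∀ t : ℝ, volume (Icc (t - M * 3 ^ (2 * j)) (t + M * 3 ^ (2 * j)) ×ˢ B) =
      ofReal (2 * M * 3 ^ (2 * j) * (3 ^ l) ^ d) := fun t => by
    rw [volume_eq_prod, prod_prod, Real.volume_Icc, hBv,
      ← ofReal_mul (by have := three_zpow_pos (2 * j); nlinarith)]
    congr 1; ring
  have hlast : volume (Ioo (z.1 - 3 ^ (2 * l) / 2) (z.1 + 3 ^ (2 * l) / 2) ×ˢ
        (bdryLayer U (M * 3 ^ j) ∩ ball z.2 (M * 3 ^ l))) ≤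
      ofReal (C * M ^ d * 3 ^ (j - l) * vol d l) := by
    rw [volume_eq_prod, prod_prod, volume_Ioo]
    refine (mul_le_mul_right hlay _).trans ?_
    rw [← ofReal_mul (by linarith)]
    refine ofReal_le_ofReal (le_of_eq ?_)
    rw [vol, zpow_sub₀ (by norm_num), mul_pow]
    field_simp
    ring
  have h9le : (3 : ℝ) ^ (2 * j) ≤ 3 ^ (j - l) * 3 ^ (2 * l) := by
    rw [← zpow_add₀ (by norm_num)]
    exact zpow_le_zpow_right₀ (by norm_num) (by omega)
  have htot : volume (cylLayer T U t₁ t₂ j ∩ cube z l) ≤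
      ofReal ((36 * (d + 1) + C * M ^ d) * 3 ^ (j - l) * vol d l) := by
    refine (measure_mono hsub).trans ((measure_union_le _ _).trans ?_)
    refine (add_le_add (measure_union_le _ _) hlast).trans ?_
    rw [hIcc, hIcc, ← ofReal_add (by positivity) (by positivity),
      ← ofReal_add (by positivity) (by have := vol_pos (d := d) l; positivity)]
    refine ofReal_le_ofReal ?_
    have e1 : 2 * M * 3 ^ (2 * j) * (3 ^ l) ^ d ≤ 2 * M * (3 ^ (j - l) * 3 ^ (2 * l)) * (3 ^ l) ^ d := by
      gcongr
    calc _ ≤ 2 * (2 * M * (3 ^ (j - l) * 3 ^ (2 * l)) * (3 ^ l) ^ d) + C * M ^ d * 3 ^ (j - l) * vol d l := by linarith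
      _ = _ := by rw [vol, hM]; ring
  exact ENNReal.toReal_le_of_le_ofReal (by have := vol_pos (d := d) l; positivity) htot

/-! ### Counting cubes -/

lemma card_mul_vol_le {A : Finset (Idx d)} {Y : Set (SpaceTime d)}
    (hY : IsBounded Y) (hA : ∀ i ∈ A, cell k i ⊆ Y) : A.card * vol d k ≤ volume.real Y := by
  have h1 : volume.real (⋃ i ∈ A, cell k i) = ∑ i ∈ A, volume.real (cell k i) :=
    measureReal_biUnion_finset (fun i _ j _ hij => disjoint_cell hij) (fun i _ => measurableSet_cell k i)
      (fun i _ => (isBounded_cell k i).measure_lt_top.ne)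
  have h2 : volume.real (⋃ i ∈ A, cell k i) ≤ volume.real Y :=
    measureReal_mono (iUnion₂_subset hA) hY.measure_lt_top.ne
  rw [h1] at h2
  simpa [volume_real_cell] using h2

open Classical in
/-- The labels of the cubes of scale `k` that meet the bounded set `X`. -/
def meets (X : Set (SpaceTime d)) (k : ℤ) : Finset (Idx d) :=
  if h : {i : Idx d | (cell k i ∩ X).Nonempty}.Finite then h.toFinset else ∅

lemma cell_subset_cube_of_meets (hX : X ⊆ cube 0 m) (hk : k ≤ m) (hi : (cell k i ∩ X).Nonempty) :
    cell k i ⊆ cube 0 (m + 1) := by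
  obtain ⟨p, hp, hpX⟩ := hi
  have h0 := hX hpX
  have h3 : (3 : ℝ) ^ k ≤ 3 ^ m := zpow_le_zpow_right₀ (by norm_num) hk
  have h9 : (3 : ℝ) ^ (2 * k) ≤ 3 ^ (2 * m) := zpow_le_zpow_right₀ (by norm_num) (by omega)
  refine cube_subset_cube ?_ fun j => ?_
  · have := abs_sub_le (ctr k i).1 p.1 (0 : SpaceTime d).1
    rw [abs_sub_comm (ctr k i).1 p.1] at this
    rw [nine_zpow_add_one]
    linarith [hp.1, h0.1, three_zpow_pos (2 * m)]
  · have := abs_sub_le ((ctr k i).2 j) (p.2 j) ((0 : SpaceTime d).2 j)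
    rw [abs_sub_comm ((ctr k i).2 j) (p.2 j)] at this
    rw [three_zpow_add_one]
    linarith [hp.2 j, h0.2 j]

lemma mem_meets (hX : X ⊆ cube 0 m) (hk : k ≤ m) : i ∈ meets X k ↔ (cell k i ∩ X).Nonempty := by
  have hfin : {i : Idx d | (cell k i ∩ X).Nonempty}.Finite :=
    (finite_cells (isBounded_cube 0 (m + 1)) k).subset fun i hi => cell_subset_cube_of_meets hX hk hi
  rw [meets, dif_pos hfin]; simp

lemma card_meets_mul_vol_le (hX : X ⊆ cube 0 m) (hk : k ≤ m) :
    (meets X k).card * vol d k ≤ vol d (m + 1) := by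
  have h1 := card_mul_vol_le (isBounded_cube 0 (m + 1))
    fun i hi => cell_subset_cube_of_meets hX hk ((mem_meets hX hk).1 hi)
  rwa [measureReal_def, volume_cube, toReal_ofReal (vol_pos _).le] at h1

/-- The enlarged cubes around the cubes of scale `k` have bounded overlap. -/
lemma sum_setIntegral_cube_le (A : Finset (Idx d))
    (k : ℤ) {f : SpaceTime d → ℝ} (hf : IntegrableOn f X) (hf0 : ∀ p, 0 ≤ f p) :
    ∑ i ∈ A, ∫ p in cube (ctr k i) (k + 1) ∩ X, f p ≤ (81 * 9 ^ d) * ∫ p in X, f p := by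
  classical
  have hcm : ∀ i : Idx d, MeasurableSet (cube (ctr k i) (k + 1)) := fun i => (isOpen_cube _ _).measurableSet
  have h1 : ∀ i ∈ A, ∫ p in cube (ctr k i) (k + 1) ∩ X, f p =
      ∫ p in X, (cube (ctr k i) (k + 1)).indicator f p := fun i _ => by
    rw [setIntegral_indicator (hcm i), inter_comm]
  rw [sum_congr rfl h1, ← integral_finsetSum A fun i _ => hf.indicator (hcm i), ← integral_const_mul]
  refine integral_mono (integrable_finsetSum A fun i _ => hf.indicator (hcm i)) (hf.const_mul _) fun p => ?_
  have h2 : ∑ i ∈ A, (cube (ctr k i) (k + 1)).indicator f p =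
      (A.filter fun i => p ∈ cube (ctr k i) (k + 1)).card * f p := by
    rw [← nsmul_eq_mul, ← sum_const, sum_filter]
    simp [indicator_apply]
  have h3 : ((A.filter fun i => p ∈ cube (ctr k i) (k + 1)).card : ℝ) * vol d k ≤ vol d (k + 2) := by
    have h4 := card_mul_vol_le (A := A.filter fun i => p ∈ cube (ctr k i) (k + 1)) (k := k)
      (isBounded_cube p (k + 2)) fun i hi => by
        have h5 := (mem_filter.1 hi).2
        have a3 := three_zpow_pos k
        have a9 := three_zpow_pos (2 * k)
        have b3 := three_zpow_add_one k
        have b9 := nine_zpow_add_one k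
        have c3 := three_zpow_add_one (k + 1)
        have c9 := nine_zpow_add_one (k + 1)
        rw [add_assoc, one_add_one_eq_two] at c3 c9
        refine cube_subset_cube ?_ fun j => ?_
        · rw [abs_sub_comm]; linarith [h5.1]
        · rw [abs_sub_comm]; linarith [h5.2 j]
    rwa [measureReal_def, volume_cube, toReal_ofReal (vol_pos _).le] at h4
  have h5 : vol d (k + 2) = (81 * 9 ^ d) * vol d k := by
    rw [show k + 2 = k + 1 + 1 by ring, vol_add_one, vol_add_one,
      show (9 : ℝ) ^ d = 3 ^ d * 3 ^ d by rw [← mul_pow]; norm_num]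
    ring
  rw [h5] at h3
  change ∑ i ∈ A, (cube (ctr k i) (k + 1)).indicator f p ≤ 81 * 9 ^ d * f p
  rw [h2]
  exact mul_le_mul_of_nonneg_right (le_of_mul_le_mul_right h3 (vol_pos k)) (hf0 p)

/-! ### The Besov norm and sums over cubes -/

lemma eLpNorm_two_sq {X E : Type*} [MeasurableSpace X] [NormedAddCommGroup E] {μ : Measure X}
    (f : X → E) : eLpNorm f 2 μ ^ 2 = ∫⁻ x, ‖f x‖ₑ ^ 2 ∂μ := by
  simpa using (eLpNorm_nnreal_pow_eq_lintegral (p := 2) (by norm_num))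

/-- The part in `X` of the cube of scale `l` whose centre is that of a cube of scale `l - 1`. -/
def patch (X : Set (SpaceTime d)) (l : ℤ) (i : Idx d) : Set (SpaceTime d) := cube (ctr (l - 1) i) l ∩ X

/-- The average over a patch. -/
def patchMean (X : Set (SpaceTime d)) (l : ℤ) (i : Idx d) (F : VecField d) :
    Space d := ∫ y, F y ∂(avgMeasure (patch X l i))

/-- The sum of the squared oscillations over the patches of scale `l`. -/
def patchOsc (X : Set (SpaceTime d)) (l : ℤ) (F : VecField d) : ℝ :=
  ∑ i ∈ meets X (l - 1), ∫ p in patch X l i, ‖F p - patchMean X l i F‖ ^ 2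

lemma patchOsc_nonneg (X : Set (SpaceTime d)) (l : ℤ) (F : VecField d) : 0 ≤ patchOsc X l F :=
  sum_nonneg fun _ _ => integral_nonneg fun _ => sq_nonneg _

lemma ctr_injective (k : ℤ) : Function.Injective (ctr k : Idx d → SpaceTime d) := fun i i' h =>
  idx_eq_of_mem (ctr_mem_cell k i) (by rw [h]; exact ctr_mem_cell k i')

lemma exists_ctr_eq {k : ℤ} (hz : z ∈ lattice d k) : ∃ i : Idx d, ctr k i = z := by
  obtain ⟨⟨n, hn⟩, hz2⟩ := hz
  choose N hN using hz2
  refine ⟨(n, N), Prod.ext hn.symm ?_⟩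
  ext j
  exact (hN j).symm

open Classical in
lemma lattice_meets_eq {X : Set (SpaceTime d)} {k : ℤ} (hX : X ⊆ cube 0 m) (hk : k ≤ m) :
    {z ∈ lattice d k | (cube z k ∩ X).Nonempty} =
      (((meets X k).image (ctr k) : Finset (SpaceTime d)) : Set (SpaceTime d)) := by
  ext z
  simp only [mem_ofPred_eq, Finset.coe_image, mem_image, Finset.mem_coe, mem_meets hX hk]
  constructor
  · rintro ⟨h1, h2⟩
    obtain ⟨i, rfl⟩ := exists_ctr_eq h1
    exact ⟨i, h2, rfl⟩
  · rintro ⟨i, h1, rfl⟩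
    exact ⟨ctr_mem_lattice k i, h1⟩

lemma sum_le_card_mul_avgSum {X : Set (SpaceTime d)} {k : ℤ} (hX : X ⊆ cube 0 m) (hk : k ≤ m)
    (G : SpaceTime d → ℝ≥0∞) : ∑ i ∈ meets X k, G (ctr k i) ≤
      (meets X k).card * avgSum {z ∈ lattice d k | (cube z k ∩ X).Nonempty} G := by
  classical
  rw [lattice_meets_eq hX hk, avgSum, Set.encard_coe_eq_coe_finsetCard,
    Finset.card_image_of_injective _ (ctr_injective k)]
  have h1 : ∑' z : (((meets X k).image (ctr k)) : Set (SpaceTime d)), G z = ∑ i ∈ meets X k, G (ctr k i) := by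
    rw [Finset.tsum_subtype' ((meets X k).image (ctr k)) G, sum_image fun i _ i' _ h => ctr_injective k h]
  rw [h1]
  rcases Nat.eq_zero_or_pos (meets X k).card with h0 | h0
  · simp_all
  · refine (ENNReal.mul_div_cancel ?_ ?_).ge
    · positivity
    · simp

lemma lintegral_patch_le {X : Set (SpaceTime d)} (i : Idx d) (G : VecField d) : ∫⁻ p in patch X l i, ‖G p‖ₑ ^ 2 ≤
      ofReal (vol d l) * eLpNorm G 2 (avgMeasure (cube (ctr (l - 1) i) l ∩ X)) ^ 2 := by
  have hfin : volume (patch X l i) ≠ ⊤ :=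
    ((isBounded_cube (ctr (l - 1) i) l).subset inter_subset_left).measure_lt_top.ne
  rw [eLpNorm_two_sq, avgMeasure, lintegral_smul_measure]
  change _ ≤ _ * ((volume (patch X l i))⁻¹ * ∫⁻ p in patch X l i, ‖G p‖ₑ ^ 2)
  by_cases h0 : volume (patch X l i) = 0
  · rw [Measure.restrict_eq_zero.2 h0]; simp
  · rw [← mul_assoc]
    have h1 : volume (patch X l i) ≤ ofReal (vol d l) := by
      rw [← volume_cube (ctr (l - 1) i) l]; exact measure_mono inter_subset_left
    have h2 : 1 ≤ ofReal (vol d l) * (volume (patch X l i))⁻¹ := by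
      rw [← ENNReal.mul_inv_cancel h0 hfin]; gcongr
    exact le_mul_of_one_le_left' h2

/-- The constant that compares sums over patches with the Besov seminorm. -/
def besovConst (d : ℕ) (C : ℝ) : ℝ := (9 * 3 ^ d) ^ 2 * (densConst d C)⁻¹

lemma besovConst_pos (hC : 1 ≤ C) : 0 < besovConst d C := by
  have := densConst_pos (d := d) hC
  unfold besovConst; positivity

namespace IsRegularCylinder

variable (h : IsRegularCylinder T U m C)
include h

lemma sum_lintegral_patch_le [NeZero d] (A : Finset ℤ) (hA : ∀ l ∈ A, l ≤ m) :
    ∑ l ∈ A, ofReal ((3 : ℝ) ^ (-(2 * s * (l : ℝ)))) * ∑ i ∈ meets (cyl T U) (l - 1),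
      ∫⁻ p in patch (cyl T U) l i, ‖F p - patchMean (cyl T U) l i F‖ₑ ^ 2 ≤
    ofReal (besovConst d C * volume.real (cyl T U)) * besovSemi s m (cyl T U) F ^ 2 := by
  classical
  set B := ofReal (besovConst d C * volume.real (cyl T U)) with hB
  let G := fun l z => eLpNorm (fun p => F p - ∫ y, F y ∂(avgMeasure (cube z l ∩ cyl T U))) 2
      (avgMeasure (cube z l ∩ cyl T U)) ^ 2
  let g : ℤ → ℝ≥0∞ := fun l => ofReal (3 ^ (-(2 * s * l))) *
    avgSum {z ∈ lattice d (l - 1) | (cube z (l - 1) ∩ cyl T U).Nonempty} (G l)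
  have hsemi : besovSemi s m (cyl T U) F ^ 2 = ∑' k : ℕ, g (m - k) := by
    rw [besovSemi, ← ENNReal.rpow_natCast, ← ENNReal.rpow_mul,
      show ((1 / 2) * ((2 : ℕ) : ℝ)) = 1 by norm_num, rpow_one]
  have hone : ∀ l ≤ m, ∑ i ∈ meets (cyl T U) (l - 1),
      ∫⁻ p in patch (cyl T U) l i, ‖F p - patchMean (cyl T U) l i F‖ₑ ^ 2 ≤
      B * avgSum {z ∈ lattice d (l - 1) | (cube z (l - 1) ∩ cyl T U).Nonempty} (G l) := fun l hl => by
    have hl1 : l - 1 ≤ m := by omega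
    refine (sum_le_sum fun i _ => lintegral_patch_le i _).trans ?_
    rw [← mul_sum]
    refine (mul_le_mul_right (sum_le_card_mul_avgSum h.sub hl1 (G l)) _).trans ?_
    rw [← mul_assoc]
    gcongr
    rw [← ofReal_natCast, ← ofReal_mul (vol_pos l).le, hB]
    refine ofReal_le_ofReal ?_
    have h2 : vol d l = 9 * 3 ^ d * vol d (l - 1) := by rw [← vol_add_one]; congr 1; ring
    have h3 := h.vol_le
    have h4 : (0 : ℝ) < 9 * 3 ^ d := by positivity
    calc vol d l * (meets (cyl T U) (l - 1)).card
        = 9 * 3 ^ d * ((meets (cyl T U) (l - 1)).card * vol d (l - 1)) := by rw [h2]; ring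
      _ ≤ 9 * 3 ^ d * (9 * 3 ^ d * ((densConst d C)⁻¹ * volume.real (cyl T U))) := by
        refine mul_le_mul_of_nonneg_left ((card_meets_mul_vol_le h.sub hl1).trans ?_) h4.le
        rw [vol_add_one]
        simp_all
      _ = _ := by rw [besovConst]; ring
  calc _ ≤ ∑ l ∈ A, B * g l := sum_le_sum fun l hl => by
        refine (mul_le_mul_right (hone l (hA l hl)) _).trans (le_of_eq ?_)
        ring
    _ = B * ∑ l ∈ A, g l := by rw [mul_sum]
    _ ≤ _ := by
      rw [hsemi]
      gcongr
      have hinj : InjOn (fun l : ℤ => (m - l).toNat) A := fun l hl l' hl' hll => by grind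
      have h1 : ∑ l ∈ A, g l = ∑ k ∈ A.image fun l : ℤ => (m - l).toNat, g (m - k) := by
        rw [sum_image hinj]
        refine sum_congr rfl fun l hl => ?_
        have := hA l hl
        congr 1; omega
      rw [h1]
      exact ENNReal.sum_le_tsum _

variable (hF : AEStronglyMeasurable F (𝓛 (cyl T U))) (hB : besovSemi s m (cyl T U) F < ⊤)
include hF hB

lemma memLp_patch [NeZero d] (hl : l ≤ m) (hi : i ∈ meets (cyl T U) (l - 1)) :
    MemLp (fun p => F p - patchMean (cyl T U) l i F) 2 (𝓛 (patch (cyl T U) l i)) := by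
  refine ⟨(hF.mono_measure (restrict_mono inter_subset_right le_rfl)).sub aestronglyMeasurable_const, ?_⟩
  have h1 := h.sum_lintegral_patch_le (s := s) (F := F) {l} (by simpa using hl)
  rw [sum_singleton] at h1
  have h2 := h1.trans_lt (ENNReal.mul_lt_top ofReal_lt_top (pow_lt_top hB))
  have h3 : ofReal (3 ^ (-(2 * s * l))) ≠ 0 := by positivity
  have h5 := lt_of_le_of_lt (single_le_sum (f := fun i => ∫⁻ p in patch (cyl T U) l i,
        ‖F p - patchMean (cyl T U) l i F‖ₑ ^ 2) (fun _ _ => zero_le) hi) (ENNReal.lt_top_of_mul_ne_top_right h2.ne h3)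
  simp [← eLpNorm_two_sq] at h5
  simp_all

lemma sum_patchOsc_le [NeZero d] (A : Finset ℤ) (hA : ∀ l ∈ A, l ≤ m) :
    ∑ l ∈ A, (3 : ℝ) ^ (-(2 * s * (l : ℝ))) * patchOsc (cyl T U) l F ≤
      besovConst d C * volume.real (cyl T U) * (besovSemi s m (cyl T U) F).toReal ^ 2 := by
  have hC := besovConst_pos (d := d) h.one_le
  have h1 := h.sum_lintegral_patch_le (s := s) (F := F) A hA
  have h2 : ∑ l ∈ A, ofReal (3 ^ (-(2 * s * l))) * ∑ i ∈ meets (cyl T U) (l - 1),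
      ∫⁻ p in patch (cyl T U) l i, ‖F p - patchMean (cyl T U) l i F‖ₑ ^ 2 =
      ofReal (∑ l ∈ A, 3 ^ (-(2 * s * l)) * patchOsc (cyl T U) l F) := by
    rw [ENNReal.ofReal_sum_of_nonneg fun l _ => mul_nonneg (by positivity) (patchOsc_nonneg _ _ _)]
    refine sum_congr rfl fun l hl => ?_
    rw [ofReal_mul (by positivity), patchOsc,
      ENNReal.ofReal_sum_of_nonneg fun i _ => integral_nonneg fun _ => sq_nonneg _]
    congr 1
    refine sum_congr rfl fun i hi => ?_
    have h3 := h.memLp_patch hF hB (hA l hl) hi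
    rw [← l2_sq h3, ← eLpNorm_two_sq, l2, ofReal_pow toReal_nonneg, ofReal_toReal h3.2.ne]
  rw [h2, ← ofReal_toReal (pow_lt_top hB).ne, toReal_pow, ← ofReal_mul (by positivity)] at h1
  exact (ENNReal.ofReal_le_ofReal_iff (by positivity)).1 h1

end IsRegularCylinder

/-! ### Averages on overlapping patches -/

section averages

variable {V W X : Set (SpaceTime d)}

lemma memLp_of_sub_const (hV : volume V ≠ ⊤) {c : Space d}
    (h : MemLp (fun p => F p - c) 2 (𝓛 V)) : MemLp F 2 (𝓛 V) := by
  have := isFiniteMeasure_restrict.2 hV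
  have := h.add (memLp_const c)
  refine this.ae_eq (ae_of_all _ fun p => ?_)
  simp

lemma memLp_sub_const (hV : volume V ≠ ⊤) (h : MemLp F 2 (𝓛 V)) (c : Space d) :
    MemLp (fun p => F p - c) 2 (𝓛 V) := by
  have := isFiniteMeasure_restrict.2 hV
  exact h.sub (memLp_const c)

lemma integrableOn_norm_sub_sq (hV : volume V ≠ ⊤) (h : MemLp F 2 (𝓛 V)) (c : Space d) :
    IntegrableOn (fun p => ‖F p - c‖ ^ 2) V :=
  (memLp_sub_const hV h c).integrable_norm_pow (by norm_num)

lemma integrableOn_norm_sq (h : MemLp F 2 (𝓛 V)) :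
    IntegrableOn (fun p => ‖F p‖ ^ 2) V := h.integrable_norm_pow (by norm_num)

lemma integrableOn_of_memLp_two (hV : volume V ≠ ⊤) (h : MemLp F 2 (𝓛 V)) : IntegrableOn F V := by
  have := isFiniteMeasure_restrict.2 hV
  exact h.integrable (by norm_num)

lemma measureReal_mul_avg_sub_sq_le (hV : volume V ≠ ⊤) (h : MemLp F 2 (𝓛 V))
    (c : Space d) : volume.real V * ‖(∫ y, F y ∂(avgMeasure V)) - c‖ ^ 2 ≤ ∫ p in V, ‖F p - c‖ ^ 2 := by
  have := isFiniteMeasure_restrict.2 hV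
  rcases eq_or_lt_of_le (measureReal_nonneg) with h0 | h0
  · rw [← h0, zero_mul]; positivity
  · have h1 := norm_setIntegral_sq_le hV (memLp_sub_const hV h c)
    have h2 : ∫ p in V, (F p - c) = volume.real V • ((∫ y, F y ∂(avgMeasure V)) - c) := by
      rw [integral_sub (integrableOn_of_memLp_two hV h) (integrable_const c), setIntegral_const,
        integral_avgMeasure, smul_sub, smul_smul, mul_inv_cancel₀ h0.ne', one_smul]
    rw [h2, norm_smul, mul_pow, norm_of_nonneg h0.le, sq, mul_assoc] at h1
    simp_all

lemma measureReal_mul_avg_sq_le (hV : volume V ≠ ⊤) (h : MemLp F 2 (𝓛 V)) :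
    volume.real V * ‖∫ y, F y ∂(avgMeasure V)‖ ^ 2 ≤ ∫ p in V, ‖F p‖ ^ 2 := by
  simpa using measureReal_mul_avg_sub_sq_le hV h 0

lemma norm_add_sq_le_two (x y : Space d) : ‖x + y‖ ^ 2 ≤ 2 * ‖x‖ ^ 2 + 2 * ‖y‖ ^ 2 := by
  nlinarith [norm_add_le x y, norm_nonneg (x + y), sq_nonneg (‖x‖ - ‖y‖)]

lemma setIntegral_norm_sub_sq_le (hV : volume V ≠ ⊤) (h : MemLp F 2 (𝓛 V)) (c c' : Space d) :
    ∫ p in V, ‖F p - c'‖ ^ 2 ≤ 2 * (∫ p in V, ‖F p - c‖ ^ 2) + 2 * volume.real V * ‖c - c'‖ ^ 2 := by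
  have := isFiniteMeasure_restrict.2 hV
  have h1 := integrableOn_norm_sub_sq hV h c
  calc ∫ p in V, ‖F p - c'‖ ^ 2 ≤ ∫ p in V, (2 * ‖F p - c‖ ^ 2 + 2 * ‖c - c'‖ ^ 2) :=
        integral_mono (integrableOn_norm_sub_sq hV h c') ((h1.const_mul 2).add (integrable_const _)) fun p => by
            have := norm_add_sq_le_two (F p - c) (c - c')
            simp_all
    _ = _ := by
      rw [integral_add (h1.const_mul 2) (integrable_const _), integral_const_mul, setIntegral_const, smul_eq_mul]
      ring

lemma setIntegral_le_sum {ι : Type*} {A : Finset ι} {P : ι → Set (SpaceTime d)} {f : SpaceTime d → ℝ}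
    (hX : MeasurableSet X) (hP : ∀ i ∈ A, MeasurableSet (P i)) (hf : IntegrableOn f X)
    (hfP : ∀ i ∈ A, IntegrableOn f (P i)) (hf0 : ∀ p, 0 ≤ f p) (hsub : X ⊆ ⋃ i ∈ A, P i) :
    ∫ p in X, f p ≤ ∑ i ∈ A, ∫ p in P i, f p := by
  rw [← integral_indicator hX, sum_congr rfl fun i hi => (integral_indicator (hP i hi)).symm,
    ← integral_finsetSum A fun i hi => (hfP i hi).integrable_indicator (hP i hi)]
  refine integral_mono (hf.integrable_indicator hX)
    (integrable_finsetSum A fun i hi => (hfP i hi).integrable_indicator (hP i hi)) fun p => ?_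
  have h0 : ∀ i ∈ A, 0 ≤ (P i).indicator f p := fun i _ => indicator_nonneg (fun p _ => hf0 p) p
  by_cases hp : p ∈ X
  · obtain ⟨i, hi, hpi⟩ := mem_iUnion₂.1 (hsub hp)
    have h1 := single_le_sum h0 hi
    simp_all
  · rw [indicator_of_notMem hp]
    exact sum_nonneg h0

end averages

section cover

variable {X : Set (SpaceTime d)} {k : ℤ}

lemma exists_mem_closure_cell (hXo : IsOpen X) (hX : X ⊆ cube 0 m) (hk : k ≤ m)
    (hp : p ∈ X) : ∃ i ∈ meets X k, p ∈ closure (cell k i) := by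
  have h2 : X ∩ {p | ∃ i, p ∈ cell k i} ⊆ ⋃ i ∈ meets X k, cell k i := by
    rintro q ⟨hq, i, hi⟩
    exact mem_iUnion₂.2 ⟨i, (mem_meets hX hk).2 ⟨q, hi, hq⟩, hi⟩
  have h3 := closure_mono h2 ((Measure.dense_of_ae (ae_exists_mem_cell k)).open_subset_closure_inter hXo hp)
  simp_all

/-- A connected set cannot be cut along the closed cubes of a given scale. -/
lemma exists_adjacent (hXo : IsOpen X) (hc : IsPreconnected X) (hX : X ⊆ cube 0 m) (hk : k ≤ m)
    {R : Finset (Idx d)} (hR : R ⊆ meets X k) (hne : R.Nonempty) (hR' : R ≠ meets X k) :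
    ∃ i ∈ R, ∃ i' ∈ meets X k, i' ∉ R ∧ ∃ p ∈ X, p ∈ closure (cell k i) ∧ p ∈ closure (cell k i') := by
  classical
  obtain ⟨i₁, hi₁, hi₁R⟩ : ∃ i ∈ meets X k, i ∉ R := by grind
  obtain ⟨i₀, hi₀⟩ := hne
  have hcl : ∀ A : Finset (Idx d), IsClosed (⋃ i ∈ A, closure (cell k i)) := fun A =>
    A.finite_toSet.isClosed_biUnion fun _ _ => isClosed_closure
  have hmem : ∀ i ∈ meets X k, ∀ A : Finset (Idx d), i ∈ A →
      (X ∩ ⋃ i ∈ A, closure (cell k i)).Nonempty := fun i hi A hA => by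
    obtain ⟨p, hp, hpX⟩ := (mem_meets hX hk).1 hi
    exact ⟨p, hpX, mem_iUnion₂.2 ⟨i, hA, subset_closure hp⟩⟩
  obtain ⟨p, hpX, hp1, hp2⟩ := isPreconnected_closed_iff.1 hc _ _ (hcl R) (hcl (meets X k \ R)) (fun p hp => by
      obtain ⟨i, hi, hpi⟩ := exists_mem_closure_cell hXo hX hk hp
      by_cases hiR : i ∈ R
      · exact Or.inl (mem_iUnion₂.2 ⟨i, hiR, hpi⟩)
      · exact Or.inr (mem_iUnion₂.2 ⟨i, Finset.mem_sdiff.2 ⟨hi, hiR⟩, hpi⟩))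
    (hmem i₀ (hR hi₀) R hi₀) (hmem i₁ hi₁ _ (Finset.mem_sdiff.2 ⟨hi₁, hi₁R⟩))
  obtain ⟨i, hi, hpi⟩ := mem_iUnion₂.1 hp1
  obtain ⟨i', hi', hpi'⟩ := mem_iUnion₂.1 hp2
  rw [Finset.mem_sdiff] at hi'
  exact ⟨i, hi, i', hi'.1, hi'.2, p, hpX, hpi, hpi'⟩

lemma mem_patch_of_mem_closure
    (hpi : p ∈ closure (cell (l - 1) i)) : cube p (l - 1) ∩ X ⊆ patch X l i := by
  have := cube_subset_cube_add_one hpi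
  rw [sub_add_cancel] at this
  exact inter_subset_inter_left _ this

lemma subset_iUnion_patch (hXo : IsOpen X) (hX : X ⊆ cube 0 m) (hl : l ≤ m) :
    X ⊆ ⋃ i ∈ meets X (l - 1), patch X l i := fun p hp => by
  obtain ⟨i, hi, hpi⟩ := exists_mem_closure_cell (k := l - 1) hXo hX (by omega) hp
  exact mem_iUnion₂.2 ⟨i, hi, mem_patch_of_mem_closure hpi ⟨mem_cube_self p _, hp⟩⟩

lemma volume_patch_ne_top (i : Idx d) : volume (patch X l i) ≠ ⊤ :=
    ((isBounded_cube (ctr (l - 1) i) l).subset inter_subset_left).measure_lt_top.ne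

lemma measurableSet_patch (hXo : IsOpen X) (i : Idx d) : MeasurableSet (patch X l i) :=
  ((isOpen_cube _ _).inter hXo).measurableSet

end cover

namespace IsRegularCylinder

variable (h : IsRegularCylinder T U m C)
include h

lemma isOpen_cyl : IsOpen (cyl T U) := CGParabolic.isOpen_cyl h.isOpen

lemma isPreconnected_cyl : IsPreconnected (cyl T U) := isPreconnected_Ioo.prod h.isConnected.isPreconnected

lemma volume_cyl_ne_top : volume (cyl T U) ≠ ⊤ := (isBounded_cyl h.isBounded).measure_lt_top.ne

lemma densConst_mul_le_patch [NeZero d] (hl : l ≤ m) (hi : i ∈ meets (cyl T U) (l - 1)) :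
    densConst d C * vol d (l - 1) ≤ volume.real (patch (cyl T U) l i) := by
  obtain ⟨p, hp, hpX⟩ := (mem_meets h.sub (by omega)).1 hi
  exact (h.densConst_le hpX (by omega)).trans
    (measureReal_mono (mem_patch_of_mem_closure (subset_closure hp)) (volume_patch_ne_top i))

lemma memLp_of_patch (hl : l ≤ m) (hF : ∀ i ∈ meets (cyl T U) (l - 1),
    MemLp F 2 (𝓛 (patch (cyl T U) l i))) (hm : AEStronglyMeasurable F (𝓛 (cyl T U))) :
    MemLp F 2 (𝓛 (cyl T U)) := by
  rw [memLp_two_iff_integrable_sq_norm hm]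
  have h1 := integrableOn_finset_iUnion.2 fun i hi => integrableOn_norm_sq (hF i hi)
  exact h1.mono_set (subset_iUnion_patch h.isOpen_cyl h.sub hl)

end IsRegularCylinder

/-- The number of cubes of scale `m - 1` in a cube of scale `m + 1`. -/
def numConst (d : ℕ) : ℝ := 81 * 9 ^ d

/-- The constant in the Poincaré inequality on overlapping patches at the top scale. -/
def chainConst (d : ℕ) (C : ℝ) : ℝ :=
  2 + 8 * numConst d ^ 3 * (9 * 3 ^ d) * (densConst d C)⁻¹

/-- Chaining through overlapping patches, the oscillation at the top scale controls the distance in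
`L²` to a constant. -/
lemma IsRegularCylinder.exists_const_le [NeZero d] (h : IsRegularCylinder T U m C) (hF : MemLp F 2 (𝓛 (cyl T U))) :
    ∃ c, ∫ p in cyl T U, ‖F p - c‖ ^ 2 ≤ chainConst d C * patchOsc (cyl T U) m F := by
  classical
  have hX := h.sub
  have hk : m - 1 ≤ m := by omega
  set Ω := cyl T U with hΩ
  set D := patchOsc Ω m F with hD
  have hD0 : 0 ≤ D := patchOsc_nonneg _ _ _
  set A := meets Ω (m - 1) with hA
  have hc0 := densConst_pos (d := d) h.one_le
  set c₀ := densConst d C with hc₀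
  have hv := vol_pos (d := d) (m - 1)
  have hFp : ∀ i, MemLp F 2 (𝓛 (patch Ω m i)) := fun i =>
    hF.mono_measure (restrict_mono inter_subset_right le_rfl)
  have hDi : ∀ i ∈ A, ∫ p in patch Ω m i, ‖F p - patchMean Ω m i F‖ ^ 2 ≤ D := fun i hi =>
    single_le_sum (f := fun i => ∫ p in patch Ω m i, ‖F p - patchMean Ω m i F‖ ^ 2)
      (fun _ _ => integral_nonneg fun _ => sq_nonneg _) hi
  set κ := √(4 * D / (c₀ * vol d (m - 1))) with hκ
  have hadj : ∀ i ∈ A, ∀ i' ∈ A, ∀ p ∈ Ω, p ∈ closure (cell (m - 1) i) → p ∈ closure (cell (m - 1) i') →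
      ‖patchMean Ω m i F - patchMean Ω m i' F‖ ≤ κ := fun i hi i' hi' p hp hpi hpi' => by
    set V := cube p (m - 1) ∩ Ω with hV
    have hVi : V ⊆ patch Ω m i := mem_patch_of_mem_closure hpi
    have hVf : volume V ≠ ⊤ := ((isBounded_cube p (m - 1)).subset inter_subset_left).measure_lt_top.ne
    have hVF : MemLp F 2 (𝓛 V) := hF.mono_measure (restrict_mono inter_subset_right le_rfl)
    have := isFiniteMeasure_restrict.2 hVf
    have e1 : ∀ i, V ⊆ patch Ω m i → i ∈ A → ∫ p in V, ‖F p - patchMean Ω m i F‖ ^ 2 ≤ D := fun i hVi hi =>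
      (setIntegral_mono_set (integrableOn_norm_sub_sq (volume_patch_ne_top i) (hFp i) _)
        (ae_of_all _ fun _ => sq_nonneg _) (LE.le.eventuallyLE hVi)).trans (hDi i hi)
    have e2 : volume.real V * ‖patchMean Ω m i F - patchMean Ω m i' F‖ ^ 2 ≤ 4 * D := by
      have i1 := (integrableOn_norm_sub_sq hVf hVF (patchMean Ω m i F)).const_mul 2
      have i2 := (integrableOn_norm_sub_sq hVf hVF (patchMean Ω m i' F)).const_mul 2
      calc volume.real V * ‖patchMean Ω m i F - patchMean Ω m i' F‖ ^ 2
          = ∫ _p in V, ‖patchMean Ω m i F - patchMean Ω m i' F‖ ^ 2 := by simp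
        _ ≤ ∫ p in V, (2 * ‖F p - patchMean Ω m i F‖ ^ 2 + 2 * ‖F p - patchMean Ω m i' F‖ ^ 2) := by
          refine integral_mono (integrable_const _) (i1.add i2) fun p => ?_
          have := norm_add_sq_le_two (patchMean Ω m i F - F p) (F p - patchMean Ω m i' F)
          rwa [sub_add_sub_cancel, norm_sub_rev (patchMean Ω m i F) (F p)] at this
        _ = 2 * (∫ p in V, ‖F p - patchMean Ω m i F‖ ^ 2) + 2 * ∫ p in V, ‖F p - patchMean Ω m i' F‖ ^ 2 := by
          rw [integral_add i1 i2, integral_const_mul, integral_const_mul]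
        _ ≤ _ := by linarith [e1 i hVi hi, e1 i' (mem_patch_of_mem_closure hpi') hi']
    refine Real.le_sqrt_of_sq_le ?_
    rw [le_div_iff₀ (by positivity), mul_comm]
    exact (mul_le_mul_of_nonneg_right (h.densConst_le hp hk) (sq_nonneg _)).trans e2
  -- every patch mean is reached from a fixed one in at most as many steps as there are patches
  obtain ⟨a₀, ha₀⟩ : A.Nonempty := by
    obtain ⟨x, hx⟩ := h.isConnected.nonempty
    obtain ⟨i, hi, -⟩ := exists_mem_closure_cell (p := (T / 2, x)) h.isOpen_cyl hX hk
      ⟨⟨by linarith [h.pos], by linarith [h.pos]⟩, hx⟩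
    grind
  let R : ℕ → Finset (Idx d) := fun n => A.filter fun i => ‖patchMean Ω m i F - patchMean Ω m a₀ F‖ ≤ n * κ
  have hκ0 : 0 ≤ κ := sqrt_nonneg _
  have hRA : ∀ n, R n ⊆ A := fun n => Finset.filter_subset _ _
  have hR0 : ∀ n, a₀ ∈ R n := fun n => mem_filter.2 ⟨ha₀, by simp; positivity⟩
  have hRcard : ∀ n, R n = A ∨ n + 1 ≤ (R n).card := fun n => by
    induction n with
    | zero => exact Or.inr (Finset.card_pos.2 ⟨a₀, hR0 0⟩)
    | succ n ih =>
      have hmono : R n ⊆ R (n + 1) := fun i hi => by grind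
      rcases ih with ih | ih
      · grind
      · by_cases hn : R n = A
        · grind
        · obtain ⟨i, hi, i', hi', hi'R, p, hp, hpi, hpi'⟩ :=
            exists_adjacent h.isOpen_cyl h.isPreconnected_cyl hX hk (hRA n) ⟨a₀, hR0 n⟩ hn
          have h1 := hadj i (hRA n hi) i' hi' p hp hpi hpi'
          have h2 : i' ∈ R (n + 1) := by
            refine mem_filter.2 ⟨hi', ?_⟩
            have h3 := (mem_filter.1 hi).2
            have h4 := norm_sub_le_norm_sub_add_norm_sub (patchMean Ω m i' F) (patchMean Ω m i F) (patchMean Ω m a₀ F)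
            rw [norm_sub_rev (patchMean Ω m i' F) (patchMean Ω m i F)] at h4
            push_cast
            linarith
          have h5 := Finset.card_lt_card ⟨hmono, fun hs => hi'R (hs h2)⟩
          grind
  have hRN : R A.card = A := by
    rcases hRcard A.card with h1 | h1
    · exact h1
    · grind
  have hN : A.card ≤ numConst d := by
    have h1 := card_meets_mul_vol_le hX hk
    have h2 : vol d (m + 1) = numConst d * vol d (m - 1) := by
      have h3 : vol d m = 9 * 3 ^ d * vol d (m - 1) := by rw [← vol_add_one, sub_add_cancel]
      rw [vol_add_one, h3, numConst, show (9 : ℝ) ^ d = 3 ^ d * 3 ^ d by rw [← mul_pow]; norm_num]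
      ring
    rw [h2] at h1
    exact le_of_mul_le_mul_right h1 hv
  have hmean : ∀ i ∈ A, ‖patchMean Ω m i F - patchMean Ω m a₀ F‖ ^ 2 ≤
      numConst d ^ 2 * (4 * D / (c₀ * vol d (m - 1))) := fun i hi => by
    rw [← hRN] at hi
    have h1 := (mem_filter.1 hi).2
    have h2 : ‖patchMean Ω m i F - patchMean Ω m a₀ F‖ ≤ numConst d * κ := h1.trans (mul_le_mul_of_nonneg_right hN hκ0)
    have h3 := pow_le_pow_left₀ (norm_nonneg _) h2 2
    rwa [mul_pow, hκ, sq_sqrt (by positivity)] at h3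
  have hpv : ∀ i : Idx d, volume.real (patch Ω m i) ≤ 9 * 3 ^ d * vol d (m - 1) := fun i => by
    rw [← vol_add_one, sub_add_cancel]
    have h1 : volume.real (cube (ctr (m - 1) i) m) = vol d m := by
      rw [measureReal_def, volume_cube, toReal_ofReal (vol_pos _).le]
    rw [← h1]
    exact measureReal_mono inter_subset_left (isBounded_cube _ _).measure_lt_top.ne
  refine ⟨patchMean Ω m a₀ F, ?_⟩
  refine (setIntegral_le_sum h.isOpen_cyl.measurableSet (fun i _ => measurableSet_patch h.isOpen_cyl i)
    (integrableOn_norm_sub_sq h.volume_cyl_ne_top hF _)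
    (fun i _ => integrableOn_norm_sub_sq (volume_patch_ne_top i) (hFp i) _) (fun _ => sq_nonneg _)
    (subset_iUnion_patch h.isOpen_cyl hX le_rfl)).trans ?_
  have hterm : ∀ i ∈ A, ∫ p in patch Ω m i, ‖F p - patchMean Ω m a₀ F‖ ^ 2 ≤
      2 * (∫ p in patch Ω m i, ‖F p - patchMean Ω m i F‖ ^ 2) + 8 * numConst d ^ 2 * (9 * 3 ^ d) * c₀⁻¹ * D := by
    intro i hi
    refine (setIntegral_norm_sub_sq_le (volume_patch_ne_top i) (hFp i) (patchMean Ω m i F) _).trans ?_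
    have h1 : volume.real (patch Ω m i) * ‖patchMean Ω m i F - patchMean Ω m a₀ F‖ ^ 2 ≤
        (9 * 3 ^ d * vol d (m - 1)) * (numConst d ^ 2 * (4 * D / (c₀ * vol d (m - 1)))) :=
      mul_le_mul (hpv i) (hmean i hi) (sq_nonneg _) (by positivity)
    have h2 : (9 * 3 ^ d * vol d (m - 1)) * (numConst d ^ 2 * (4 * D / (c₀ * vol d (m - 1)))) =
        4 * numConst d ^ 2 * (9 * 3 ^ d) * c₀⁻¹ * D := by
      field_simp
    rw [h2] at h1
    linarith
  refine (sum_le_sum hterm).trans ?_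
  rw [sum_add_distrib, ← mul_sum, sum_const, nsmul_eq_mul]
  have h1 : (A.card : ℝ) * (8 * numConst d ^ 2 * (9 * 3 ^ d) * c₀⁻¹ * D) ≤
      numConst d * (8 * numConst d ^ 2 * (9 * 3 ^ d) * c₀⁻¹ * D) :=
    mul_le_mul_of_nonneg_right hN (by positivity)
  calc _ ≤ 2 * D + numConst d * (8 * numConst d ^ 2 * (9 * 3 ^ d) * c₀⁻¹ * D) := add_le_add le_rfl h1
    _ = _ := by rw [chainConst]; ring

lemma chainConst_pos (hC : 1 ≤ C) : 0 < chainConst d C := by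
  have := densConst_pos (d := d) hC
  unfold chainConst numConst; positivity

lemma IsRegularCylinder.integral_norm_sq_le [NeZero d] (h : IsRegularCylinder T U m C)
    (hF : MemLp F 2 (𝓛 (cyl T U))) :
    ∫ p in cyl T U, ‖F p‖ ^ 2 ≤ 6 * chainConst d C * patchOsc (cyl T U) m F +
      4 * volume.real (cyl T U) * ‖∫ y, F y ∂(avgMeasure (cyl T U))‖ ^ 2 := by
  obtain ⟨c, hc⟩ := h.exists_const_le hF
  have hV := h.volume_cyl_ne_top
  have h1 := setIntegral_norm_sub_sq_le hV hF c 0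
  have h2 := measureReal_mul_avg_sub_sq_le hV hF c
  simp at h1
  have h3 := norm_add_sq_le_two (c - ∫ y, F y ∂(avgMeasure (cyl T U))) (∫ y, F y ∂(avgMeasure (cyl T U)))
  rw [sub_add_cancel, norm_sub_rev] at h3
  have h4 := mul_le_mul_of_nonneg_left h3 (measureReal_nonneg (μ := volume) (s := cyl T U))
  linarith

/-! ### A Hardy inequality in boundary layers -/

lemma measurableSet_cylLayer (hU : IsOpen U) : MeasurableSet (cylLayer T U t₁ t₂ j) := by
  have hcl : ∀ δ : ℝ, IsClosed {x : Space d | ∃ w ∉ U, dist x w ≤ δ} := fun δ => by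
    rcases (Uᶜ).eq_empty_or_nonempty with h0 | h0
    · simp_all
    · have : {x : Space d | ∃ w ∉ U, dist x w ≤ δ} = {x | Metric.infDist x Uᶜ ≤ δ} := by
        ext x
        constructor
        · rintro ⟨w, hw, hxw⟩
          exact (Metric.infDist_le_dist_of_mem hw).trans hxw
        · intro hx
          obtain ⟨w, hw, hxw⟩ := hU.isClosed_compl.exists_infDist_eq_dist h0 x
          exact ⟨w, hw, by simp_all⟩
      rw [this]
      exact isClosed_le (Metric.continuous_infDist_pt _) continuous_const
  have c1 : ∀ t : ℝ, Measurable fun p : SpaceTime d => |p.1 - t| := fun t =>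
    (by fun_prop : Continuous fun p : SpaceTime d => |p.1 - t|).measurable
  exact (isOpen_cyl hU).measurableSet.inter ((measurableSet_le (c1 t₁) measurable_const).union
    ((measurableSet_le (c1 t₂) measurable_const).union
      ((hcl (9 * (d + 1) * 3 ^ j)).preimage continuous_snd).measurableSet))

lemma cylLayer_subset : cylLayer T U t₁ t₂ j ⊆ cyl T U := fun _ hp => hp.1

/-- The constant in the comparison of boundary layers at two scales. -/
def layerConst (d : ℕ) (C : ℝ) : ℝ :=
  2 * numConst d * ((36 * (d + 1) + C * (9 * (d + 1)) ^ d) * (9 * 3 ^ d) * (densConst d C)⁻¹)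

/-- Mass in a thin boundary layer is controlled by the mass in a thicker one, up to oscillations: a
thin layer fills a small fraction of a patch. -/
lemma IsRegularCylinder.layer_le [NeZero d] (h : IsRegularCylinder T U m C)
    (hF : MemLp F 2 (𝓛 (cyl T U))) (hjl : j < l) (hl : l ≤ m) :
    ∫ p in cylLayer T U t₁ t₂ j, ‖F p‖ ^ 2 ≤ 2 * patchOsc (cyl T U) l F +
      layerConst d C * 3 ^ (j - l) * ∫ p in cylLayer T U t₁ t₂ l, ‖F p‖ ^ 2 := by
  classical
  set Ω := cyl T U with hΩ
  set L := cylLayer T U t₁ t₂ j with hL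
  set L' := cylLayer T U t₁ t₂ l with hL'
  have hLm : MeasurableSet L := measurableSet_cylLayer h.isOpen
  have hLm' : MeasurableSet L' := measurableSet_cylLayer h.isOpen
  have hc0 := densConst_pos (d := d) h.one_le
  have hC := h.one_le
  set c₀ := densConst d C with hc₀
  set C₁ : ℝ := 36 * (d + 1) + C * (9 * (d + 1)) ^ d with hC₁
  have hC1 : 0 < C₁ := by positivity
  have hv' : vol d l = 9 * 3 ^ d * vol d (l - 1) := by rw [← vol_add_one, sub_add_cancel]
  have hFs : ∀ S, S ⊆ Ω → MemLp F 2 (𝓛 S) := fun S hS => hF.mono_measure (restrict_mono hS le_rfl)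
  set ρ : ℝ := C₁ * (9 * 3 ^ d) * c₀⁻¹ * 3 ^ (j - l) with hρ
  have hρ0 : 0 < ρ := by positivity
  have hP : ∀ i, patch Ω l i ⊆ Ω := fun i => inter_subset_right
  -- a patch that meets the thin layer lies in the thick one, and at most the fraction `ρ` of it is thin
  have hterm : ∀ i ∈ meets Ω (l - 1), ∫ p in L ∩ patch Ω l i, ‖F p‖ ^ 2 ≤
      2 * (∫ p in patch Ω l i, ‖F p - patchMean Ω l i F‖ ^ 2) +
        2 * ρ * ∫ p in cube (ctr (l - 1) i) (l - 1 + 1) ∩ L', ‖F p‖ ^ 2 := fun i hi => by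
    have hPf := volume_patch_ne_top (X := Ω) (l := l) i
    have hFp := hFs _ (hP i)
    rcases (L ∩ patch Ω l i).eq_empty_or_nonempty with h0 | ⟨p, hpL, hpP⟩
    · rw [h0, setIntegral_empty]
      positivity
    · have hsub : patch Ω l i ⊆ cube (ctr (l - 1) i) (l - 1 + 1) ∩ L' := by
        intro q hq
        refine ⟨by rw [sub_add_cancel]; exact hq.1, hq.2, ?_⟩
        obtain ⟨n1, n2⟩ := norm_sub_lt_of_mem_cube hq.1 hpP.1
        have e3 : (3 : ℝ) ^ l = 3 * 3 ^ (l - 1) := by rw [← three_zpow_add_one, sub_add_cancel]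
        have e9 : (3 : ℝ) ^ (2 * l) = 9 * 3 ^ (2 * (l - 1)) := by rw [← nine_zpow_add_one, sub_add_cancel]
        have f3 : (3 : ℝ) ^ j ≤ 3 ^ (l - 1) := zpow_le_zpow_right₀ (by norm_num) (by omega)
        have f9 : (3 : ℝ) ^ (2 * j) ≤ 3 ^ (2 * (l - 1)) := zpow_le_zpow_right₀ (by norm_num) (by omega)
        have g3 := three_zpow_pos (l - 1)
        have g9 := three_zpow_pos (2 * (l - 1))
        rcases hpL.2 with hp1 | hp1 | ⟨w, hw, hpw⟩
        · refine Or.inl ?_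
          have := abs_sub_le q.1 p.1 t₁
          nlinarith
        · refine Or.inr (Or.inl ?_)
          have := abs_sub_le q.1 p.1 t₂
          nlinarith
        · refine Or.inr (Or.inr ⟨w, hw, ?_⟩)
          have := dist_triangle q.2 p.2 w
          nlinarith
      have j1 : ∫ p in L ∩ patch Ω l i, ‖F p‖ ^ 2 ≤ 2 * (∫ p in L ∩ patch Ω l i, ‖F p - patchMean Ω l i F‖ ^ 2) +
            2 * volume.real (L ∩ patch Ω l i) * ‖patchMean Ω l i F‖ ^ 2 := by
        have := setIntegral_norm_sub_sq_le (V := L ∩ patch Ω l i)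
          (ne_top_of_le_ne_top hPf (measure_mono inter_subset_right))
          (hFs _ (inter_subset_right.trans (hP i))) (patchMean Ω l i F) 0
        simpa using this
      have j2 : ∫ p in L ∩ patch Ω l i, ‖F p - patchMean Ω l i F‖ ^ 2 ≤
          ∫ p in patch Ω l i, ‖F p - patchMean Ω l i F‖ ^ 2 :=
        setIntegral_mono_set (integrableOn_norm_sub_sq hPf hFp _) (ae_of_all _ fun _ => sq_nonneg _)
          (LE.le.eventuallyLE inter_subset_right)
      have j3 : volume.real (L ∩ patch Ω l i) ≤ ρ * volume.real (patch Ω l i) := by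
        have k1 : volume.real (L ∩ patch Ω l i) ≤ volume.real (L ∩ cube (ctr (l - 1) i) l) :=
          measureReal_mono (inter_subset_inter_right _ inter_subset_left)
            ((isBounded_cube _ _).subset inter_subset_right).measure_lt_top.ne
        refine k1.trans ((h.volume_cylLayer_le t₁ t₂ (ctr (l - 1) i) hjl.le hl).trans ?_)
        calc C₁ * 3 ^ (j - l) * vol d l = ρ * (c₀ * vol d (l - 1)) := by
              grind
          _ ≤ _ := mul_le_mul_of_nonneg_left (h.densConst_mul_le_patch hl hi) hρ0.le
      have j5 : ∫ p in patch Ω l i, ‖F p‖ ^ 2 ≤ ∫ p in cube (ctr (l - 1) i) (l - 1 + 1) ∩ L', ‖F p‖ ^ 2 :=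
        setIntegral_mono_set (integrableOn_norm_sq (hFs _ (inter_subset_right.trans cylLayer_subset)))
          (ae_of_all _ fun _ => sq_nonneg _) (LE.le.eventuallyLE hsub)
      have j6 : volume.real (L ∩ patch Ω l i) * ‖patchMean Ω l i F‖ ^ 2 ≤
          ρ * ∫ p in cube (ctr (l - 1) i) (l - 1 + 1) ∩ L', ‖F p‖ ^ 2 := by
        calc _ ≤ ρ * volume.real (patch Ω l i) * ‖patchMean Ω l i F‖ ^ 2 := mul_le_mul_of_nonneg_right j3 (sq_nonneg _)
          _ = ρ * (volume.real (patch Ω l i) * ‖patchMean Ω l i F‖ ^ 2) := mul_assoc _ _ _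
          _ ≤ _ := mul_le_mul_of_nonneg_left ((measureReal_mul_avg_sq_le hPf hFp).trans j5) hρ0.le
      linarith
  have hcov : L ⊆ ⋃ i ∈ meets Ω (l - 1), L ∩ patch Ω l i := fun p hp => by
    obtain ⟨i, hi, hpi⟩ := mem_iUnion₂.1 (subset_iUnion_patch h.isOpen_cyl h.sub hl hp.1)
    exact mem_iUnion₂.2 ⟨i, hi, hp, hpi⟩
  refine (setIntegral_le_sum hLm (fun i _ => hLm.inter (measurableSet_patch h.isOpen_cyl i))
    (integrableOn_norm_sq (hFs _ cylLayer_subset))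
    (fun i _ => integrableOn_norm_sq (hFs _ (inter_subset_left.trans cylLayer_subset)))
    (fun _ => sq_nonneg _) hcov).trans ((sum_le_sum hterm).trans ?_)
  rw [sum_add_distrib, ← mul_sum, ← mul_sum]
  have h5 := sum_setIntegral_cube_le (X := L') (meets Ω (l - 1)) (l - 1)
    (integrableOn_norm_sq (hFs _ cylLayer_subset)) fun _ => sq_nonneg _
  refine add_le_add le_rfl ((mul_le_mul_of_nonneg_left h5 (by positivity)).trans (le_of_eq ?_))
  rw [layerConst, numConst, hρ]
  ring

/-- Iterating the comparison of two scales bounds the weighted sum of the masses of all boundary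
layers; the weights are summable against the thickness because `2 s < 1`. -/
lemma IsRegularCylinder.sum_layer_le [NeZero d] (h : IsRegularCylinder T U m C) (hs : 0 < s)
    (hF : MemLp F 2 (𝓛 (cyl T U))) {K : ℕ} (hK : 0 < K)
    (hK2 : layerConst d C * 3 ^ (-(K : ℤ)) * 3 ^ (2 * s * K) ≤ 1 / 2)
    (hY : ∀ A : Finset ℤ, (∀ l ∈ A, l ≤ m) →
      ∑ l ∈ A, (3 : ℝ) ^ (-(2 * s * (l : ℝ))) * patchOsc (cyl T U) l F ≤ Y) (n : ℤ) :
    ∑ j ∈ Finset.Icc n m, (3 : ℝ) ^ (-(2 * s * (j : ℝ))) * ∫ p in cylLayer T U t₁ t₂ j, ‖F p‖ ^ 2 ≤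
      2 * (3 : ℝ) ^ (2 * s * K) * (2 * Y + K * ((3 : ℝ) ^ (-(2 * s * (m : ℝ))) * ∫ p in cyl T U, ‖F p‖ ^ 2)) := by
  classical
  set W : ℤ → ℝ := fun j => 3 ^ (-(2 * s * j)) with hW
  have hW0 : ∀ j, 0 < W j := fun j => by positivity
  set κ : ℝ := 3 ^ (2 * s * K) with hκ
  set G : ℤ → ℝ := fun j => ∫ p in cylLayer T U t₁ t₂ j, ‖F p‖ ^ 2 with hG
  have hG0 : ∀ j, 0 ≤ G j := fun j => integral_nonneg fun _ => sq_nonneg _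
  set E := ∫ p in cyl T U, ‖F p‖ ^ 2 with hE
  have hWK : ∀ j, W j = κ * W (j + K) := fun j => by
    simp [hW, hκ]
    rw [← rpow_add (by norm_num)]
    congr 1; ring
  have hWm : ∀ j, m < j + K → W j ≤ κ * W m := fun j hj => by
    simp [hW, hκ]
    rw [← rpow_add (by norm_num)]
    refine Real.rpow_le_rpow_of_exponent_le (by norm_num) ?_
    have : (m : ℝ) ≤ j + K := by exact_mod_cast hj.le
    nlinarith
  have hGE : ∀ j, G j ≤ E := fun j => setIntegral_mono_set (integrableOn_norm_sq hF)
    (ae_of_all _ fun _ => sq_nonneg _) (LE.le.eventuallyLE cylLayer_subset)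
  have hstep : ∀ j ∈ Finset.Icc n m, W j * G j ≤
      (if j + K ≤ m then 2 * κ * (W (j + K) * patchOsc (cyl T U) (j + K) F) + 1 / 2 * (W (j + K) * G (j + K))
        else 0) + if j + K ≤ m then 0 else κ * (W m * E) := fun j _ => by
    split_ifs with hj
    · have h1 := h.layer_le (t₁ := t₁) (t₂ := t₂) hF (j := j) (by omega) hj
      rw [show j - (j + K) = -K by ring] at h1
      have h2 := mul_le_mul_of_nonneg_left h1 (hW0 j).le
      have h3 : W j * (layerConst d C * 3 ^ (-(K : ℤ)) * G (j + K)) ≤ 1 / 2 * (W (j + K) * G (j + K)) := by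
        rw [hWK j]
        calc _ = (layerConst d C * 3 ^ (-(K : ℤ)) * κ) * (W (j + K) * G (j + K)) := by ring
          _ ≤ _ := mul_le_mul_of_nonneg_right hK2 (mul_nonneg (hW0 _).le (hG0 _))
      have h4 : W j * (2 * patchOsc (cyl T U) (j + K) F) = 2 * κ * (W (j + K) * patchOsc (cyl T U) (j + K) F) := by
        rw [hWK j]; ring
      rw [mul_add] at h2
      rw [add_zero, ← h4]
      exact h2.trans (add_le_add le_rfl h3)
    · calc W j * G j ≤ κ * W m * E := mul_le_mul (hWm j (by omega)) (hGE j) (hG0 j) (by positivity)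
        _ = _ := by ring
  have hsub : ((Finset.Icc n m).filter fun j => j + K ≤ m).image (fun j : ℤ => j + K) ⊆ Finset.Icc n m := by
    intro l hl
    obtain ⟨j, hj, rfl⟩ := Finset.mem_image.1 hl
    rw [mem_filter, Finset.mem_Icc] at hj
    rw [Finset.mem_Icc]; omega
  have hshift : ∀ g : ℤ → ℝ, (∀ j, 0 ≤ g j) →
      ∑ j ∈ (Finset.Icc n m).filter (fun j => j + K ≤ m), g (j + K) ≤ ∑ j ∈ Finset.Icc n m, g j := fun g hg => by
    rw [← sum_image (fun j _ j' _ hjj => by simpa using hjj)]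
    exact Finset.sum_le_sum_of_subset_of_nonneg hsub fun j _ _ => hg j
  have hfew : (((Finset.Icc n m).filter fun j => ¬ j + K ≤ m).card : ℝ) ≤ K := by
    have h1 : ((Finset.Icc n m).filter fun j => ¬ j + K ≤ m) ⊆ Finset.Ioc (m - K) m := fun j hj => by
      rw [mem_filter, Finset.mem_Icc] at hj
      rw [Finset.mem_Ioc]; omega
    have h2 := Finset.card_le_card h1
    rw [Int.card_Ioc] at h2
    have h3 : ((Finset.Icc n m).filter fun j => ¬ j + K ≤ m).card ≤ K := by omega
    exact_mod_cast h3
  have hmain : ∑ j ∈ Finset.Icc n m, W j * G j ≤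
      2 * κ * Y + 1 / 2 * (∑ j ∈ Finset.Icc n m, W j * G j) + K * (κ * (W m * E)) := by
    refine (sum_le_sum hstep).trans ?_
    rw [sum_add_distrib]
    refine add_le_add ?_ ?_
    · rw [← sum_filter, sum_add_distrib, ← mul_sum, ← mul_sum]
      refine add_le_add (mul_le_mul_of_nonneg_left ((hshift (fun j => W j * patchOsc (cyl T U) j F)
        fun j => mul_nonneg (hW0 j).le (patchOsc_nonneg _ _ _)).trans (hY _ fun l hl =>
          (Finset.mem_Icc.1 hl).2)) (by positivity))
        (mul_le_mul_of_nonneg_left (hshift (fun j => W j * G j) fun j => mul_nonneg (hW0 j).le (hG0 j)) (by norm_num))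
    · have h1 : ∑ j ∈ Finset.Icc n m, (if j + K ≤ m then 0 else κ * (W m * E)) =
          ((Finset.Icc n m).filter fun j => ¬ j + K ≤ m).card * (κ * (W m * E)) := by
        rw [← nsmul_eq_mul, ← sum_const, sum_filter]
        refine sum_congr rfl fun j _ => ?_
        by_cases hj : j + K ≤ m <;> simp [hj]
      rw [h1]
      exact mul_le_mul_of_nonneg_right hfew (by positivity)
  linarith

/-! ### Changes of cube averages -/

lemma subset_cyl (h1 : 0 ≤ t₁) (h2 : t₂ ≤ T) : Ioo t₁ t₂ ×ˢ U ⊆ cyl T U := prod_mono (Ioo_subset_Ioo h1 h2) le_rfl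

lemma IsRegularCylinder.lt_of_cell_subset (h : IsRegularCylinder T U m C)
    (hi : cell j i ⊆ cyl T U) : j < m := by
  have h9 := three_zpow_pos (2 * j)
  have hmem : ∀ r : ℝ, |r| < 1 / 2 → (((ctr j i).1 + r * 3 ^ (2 * j), (ctr j i).2)) ∈ cell j i := fun r hr => by
    refine ⟨?_, fun i' => by simp; positivity⟩
    simp
    nlinarith
  have e2 := h.sub (hi (hmem (2 / 5) (by norm_num [abs_of_pos])))
  have e3 : 0 < (ctr j i).1 + -2 / 5 * 3 ^ (2 * j) := (hi (hmem (-2 / 5) (by norm_num))).1.1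
  have e4 : |(ctr j i).1 + 2 / 5 * 3 ^ (2 * j) - 0| < 3 ^ (2 * m) / 2 := e2.1
  rw [sub_zero, abs_lt] at e4
  have e5 : (3 : ℝ) ^ (2 * j) < 3 ^ (2 * m) := by linarith
  simp_all

lemma avg_cell_eq_cavg (k : ℤ) (i : Idx d) : ∫ y, F y ∂(avgMeasure (cell k i)) = cavg k i F := by
  rw [integral_avgMeasure, volume_real_cell, cavg]

lemma IsRegularCylinder.oscSq_le [NeZero d] (h : IsRegularCylinder T U m C)
    (hF : MemLp F 2 (𝓛 (cyl T U))) (h1 : 0 ≤ t₁) (h2 : t₂ ≤ T) (j : ℤ) :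
    oscSq (Ioo t₁ t₂ ×ˢ U) j F ≤ (if j + 2 ≤ m then 4 * patchOsc (cyl T U) (j + 2) F else 0) +
      if j ≤ m then ∫ p in cylLayer T U t₁ t₂ j, ‖F p‖ ^ 2 else 0 := by
  classical
  set Ω := cyl T U with hΩ
  set X := Ioo t₁ t₂ ×ˢ U with hX
  have hXΩ : X ⊆ Ω := subset_cyl h1 h2
  have hXb : IsBounded X := (isBounded_cyl h.isBounded).subset hXΩ
  have hFs : ∀ S, S ⊆ Ω → MemLp F 2 (𝓛 S) := fun S hS => hF.mono_measure (restrict_mono hS le_rfl)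
  have hcf : ∀ (k : ℤ) (i : Idx d), volume (cell k i) ≠ ⊤ := fun k i => (isBounded_cell k i).measure_lt_top.ne
  rw [oscSq, ← Finset.sum_filter_add_sum_filter_not _ fun i => par i ∈ cells X (j + 1)]
  refine add_le_add ?_ ?_
  · -- the parent cube is contained in the cylinder
    by_cases hne : (cells X (j + 1)).Nonempty
    swap
    · rw [Finset.not_nonempty_iff_eq_empty] at hne
      rw [hne, Finset.filter_false_of_mem fun i _ => Finset.notMem_empty _, sum_empty]
      have := patchOsc_nonneg Ω (j + 2) F
      positivity
    have hjm : j + 2 ≤ m := by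
      obtain ⟨i, hi⟩ := hne
      have := h.lt_of_cell_subset (((mem_cells hXb).1 hi).trans hXΩ)
      omega
    rw [if_pos hjm]
    have hl : j + 1 = j + 2 - 1 := by ring
    rw [← Finset.sum_fiberwise_of_maps_to fun i hi => (mem_filter.1 hi).2]
    have hsub : cells X (j + 1) ⊆ meets Ω (j + 2 - 1) := fun i hi => by
      rw [mem_meets h.sub (by omega), ← hl]
      exact ⟨ctr (j + 1) i, ctr_mem_cell _ _, hXΩ ((mem_cells hXb).1 hi (ctr_mem_cell _ _))⟩
    have hone : ∀ i' ∈ cells X (j + 1), ∑ i ∈ ((cells X j).filter fun i => par i ∈ cells X (j + 1)) with par i = i',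
          vol d j * ‖cavg j i F - pavg X j i F‖ ^ 2 ≤
        4 * ∫ p in patch Ω (j + 2) i', ‖F p - patchMean Ω (j + 2) i' F‖ ^ 2 := fun i' hi' => by
      have hcs : cell (j + 1) i' ⊆ X := (mem_cells hXb).1 hi'
      have hFc := hFs _ (hcs.trans hXΩ)
      set c := cavg (j + 1) i' F with hc
      set c' := patchMean Ω (j + 2) i' F with hc'
      have k1 : ∑ i ∈ ((cells X j).filter fun i => par i ∈ cells X (j + 1)) with par i = i',
          vol d j * ‖cavg j i F - pavg X j i F‖ ^ 2 ≤ ∫ p in cell (j + 1) i', ‖F p - c‖ ^ 2 := by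
        calc _ ≤ ∑ i ∈ ((cells X j).filter fun i => par i ∈ cells X (j + 1)) with par i = i',
              ∫ p in cell j i, ‖F p - c‖ ^ 2 := by
              refine sum_le_sum fun i hi => ?_
              rw [mem_filter, mem_filter] at hi
              rw [pavg, if_pos hi.1.2, hi.2, ← avg_cell_eq_cavg, ← volume_real_cell j i]
              exact measureReal_mul_avg_sub_sq_le (hcf j i) (hFs _ (((mem_cells hXb).1 hi.1.1).trans hXΩ)) _
          _ = ∫ p in ⋃ i ∈ ((cells X j).filter fun i => par i ∈ cells X (j + 1)).filter
                fun i => par i = i', cell j i, ‖F p - c‖ ^ 2 :=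
            (integral_biUnion_finset _ (fun i _ => measurableSet_cell j i)
              (fun i _ i₁ _ hne => disjoint_cell hne) fun i hi => by
                rw [mem_filter, mem_filter] at hi
                exact integrableOn_norm_sub_sq (hcf j i) (hFs _ (((mem_cells hXb).1 hi.1.1).trans hXΩ)) _).symm
          _ ≤ _ := by
            refine setIntegral_mono_set (integrableOn_norm_sub_sq (hcf _ _) hFc _)
              (ae_of_all _ fun _ => sq_nonneg _) (LE.le.eventuallyLE ?_)
            refine iUnion₂_subset fun i hi => ?_
            rw [mem_filter] at hi
            rw [← hi.2]; exact cell_subset_par j i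
      have k2 := setIntegral_norm_sub_sq_le (hcf (j + 1) i') hFc c' c
      have k3 := measureReal_mul_avg_sub_sq_le (hcf (j + 1) i') hFc c'
      rw [avg_cell_eq_cavg, norm_sub_rev] at k3
      have k4 : ∫ p in cell (j + 1) i', ‖F p - c'‖ ^ 2 ≤ ∫ p in patch Ω (j + 2) i', ‖F p - c'‖ ^ 2 := by
        refine setIntegral_mono_set (integrableOn_norm_sub_sq (volume_patch_ne_top _)
          (hFs _ inter_subset_right) _) (ae_of_all _ fun _ => sq_nonneg _) (LE.le.eventuallyLE ?_)
        intro p hp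
        have := mem_patch_of_mem_closure (X := Ω) (p := ctr (j + 1) i')
          (subset_closure (by rw [← hl]; exact ctr_mem_cell _ _))
        rw [← hl] at this
        exact this ⟨hp, hXΩ (hcs hp)⟩
      linarith
    refine (sum_le_sum hone).trans ?_
    rw [← mul_sum, patchOsc]
    refine mul_le_mul_of_nonneg_left ?_ (by norm_num)
    exact Finset.sum_le_sum_of_subset_of_nonneg hsub fun _ _ _ => integral_nonneg fun _ => sq_nonneg _
  · -- the parent cube leaves the cylinder, so that the cube lies in a boundary layer
    set B := (cells X j).filter fun i => par i ∉ cells X (j + 1) with hB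
    rcases B.eq_empty_or_nonempty with h0 | ⟨i₀, hi₀⟩
    · rw [h0, sum_empty]
      positivity
    rw [if_pos ((h.lt_of_cell_subset (((mem_cells hXb).1 (mem_filter.1 hi₀).1).trans hXΩ)).le)]
    calc _ ≤ ∑ i ∈ B, ∫ p in cell j i, ‖F p‖ ^ 2 := by
          refine sum_le_sum fun i hi => ?_
          rw [hB, mem_filter] at hi
          rw [pavg, if_neg hi.2, sub_zero, ← avg_cell_eq_cavg, ← volume_real_cell j i]
          exact measureReal_mul_avg_sq_le (hcf j i) (hFs _ (((mem_cells hXb).1 hi.1).trans hXΩ))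
      _ = ∫ p in ⋃ i ∈ B, cell j i, ‖F p‖ ^ 2 := (integral_biUnion_finset _ (fun i _ => measurableSet_cell j i)
          (fun i _ i₁ _ hne => disjoint_cell hne) fun i hi =>
            integrableOn_norm_sq (hFs _ (((mem_cells hXb).1 (mem_filter.1 hi).1).trans hXΩ))).symm
      _ ≤ _ := by
        refine setIntegral_mono_set (integrableOn_norm_sq (hFs _ cylLayer_subset))
          (ae_of_all _ fun _ => sq_nonneg _) (LE.le.eventuallyLE ?_)
        refine iUnion₂_subset fun i hi p hp => ?_
        rw [hB, mem_filter, mem_cells hXb, mem_cells hXb, Set.not_subset] at hi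
        obtain ⟨hic, q, hq, hqX⟩ := hi
        have hpX := hic hp
        refine ⟨hXΩ hpX, ?_⟩
        obtain ⟨n1, n2⟩ := norm_sub_lt_of_mem_cube (cell_subset_par j i hp) hq
        rw [nine_zpow_add_one] at n1
        rw [three_zpow_add_one] at n2
        have g3 := three_zpow_pos j
        have d9 : 0 ≤ (d : ℝ) * 3 ^ (2 * j) := by positivity
        obtain ⟨⟨hp1, hp2⟩, hp3⟩ := hpX
        by_cases hqU : q.2 ∈ U
        · by_cases hq1 : t₁ < q.1
          · have hq2 : t₂ ≤ q.1 := by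
              by_contra hcon
              exact hqX ⟨⟨hq1, not_le.1 hcon⟩, hqU⟩
            refine Or.inr (Or.inl ?_)
            rw [abs_lt] at n1
            rw [abs_le]; constructor <;> nlinarith
          grind
        · exact Or.inr (Or.inr ⟨q.2, hqU, by nlinarith⟩)

/-- The changes of the cube averages from scale to scale, including those at the boundary of a
subcylinder, are controlled by the oscillations over patches and the norm in `L²`. -/
lemma exists_oscBound (d : ℕ) [NeZero d] (hs : s ∈ Ioo (0 : ℝ) (1 / 2)) :
    ∃ H, 0 ≤ H ∧ ∀ (T : ℝ) (U : Set (Space d)) (m : ℤ), IsRegularCylinder T U m C →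
      ∀ (F : VecField d), MemLp F 2 (𝓛 (cyl T U)) → ∀ Y : ℝ,
      (∀ A : Finset ℤ, (∀ l ∈ A, l ≤ m) → ∑ l ∈ A, (3 : ℝ) ^ (-(2 * s * (l : ℝ))) * patchOsc (cyl T U) l F ≤ Y) →
      ∀ t₁ t₂ : ℝ, 0 ≤ t₁ → t₂ ≤ T → OscBound (Ioo t₁ t₂ ×ˢ U) (fun j => (3 : ℝ) ^ (2 * s * (j : ℝ))) F
        (H * (Y + (3 : ℝ) ^ (-(2 * s * (m : ℝ))) * ∫ p in cyl T U, ‖F p‖ ^ 2)) := by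
  obtain ⟨K, hK, hK2⟩ : ∃ K : ℕ, 0 < K ∧ layerConst d C * 3 ^ (-(K : ℤ)) * 3 ^ (2 * s * K) ≤ 1 / 2 := by
    set r : ℝ := 3 ^ (2 * s - 1) with hr
    have hr1 : r < 1 := Real.rpow_lt_one_of_one_lt_of_neg (by norm_num) (by linarith [hs.2])
    have hr0 : 0 ≤ r := by positivity
    have hlim := (tendsto_pow_atTop_nhds_zero_of_lt_one hr0 hr1).const_mul (layerConst d C)
    rw [mul_zero] at hlim
    obtain ⟨K, hK1, hK2⟩ := ((hlim.eventually_le_const (by norm_num : (0 : ℝ) < 1 / 2)).and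
      (eventually_gt_atTop 0)).exists
    refine ⟨K, hK2, le_trans (le_of_eq ?_) hK1⟩
    rw [hr, ← rpow_natCast, ← rpow_mul (by norm_num), mul_assoc, ← Real.rpow_intCast,
      ← rpow_add (by norm_num)]
    congr 2; push_cast; ring
  set κ : ℝ := 3 ^ (2 * s * K) with hκ
  refine ⟨4 * 3 ^ (4 * s) + 2 * κ * (2 + K), by positivity, fun T U m h F hF Y hY t₁ t₂ h1 h2 A => ?_⟩
  set W : ℤ → ℝ := fun j => 3 ^ (-(2 * s * j)) with hW
  have hW0 : ∀ j, 0 < W j := fun j => by positivity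
  set E := ∫ p in cyl T U, ‖F p‖ ^ 2 with hE
  have hY0 : 0 ≤ Y := by simpa using hY ∅ (by simp)
  set G : ℤ → ℝ := fun j => ∫ p in cylLayer T U t₁ t₂ j, ‖F p‖ ^ 2 with hG
  have hG0 : ∀ j, 0 ≤ G j := fun j => integral_nonneg fun _ => sq_nonneg _
  have hstep : ∀ j ∈ A, (3 ^ (2 * s * j))⁻¹ * oscSq (Ioo t₁ t₂ ×ˢ U) j F ≤
      (if j + 2 ≤ m then 4 * 3 ^ (4 * s) * (W (j + 2) * patchOsc (cyl T U) (j + 2) F) else 0) +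
        if j ≤ m then W j * G j else 0 := fun j _ => by
    have e2 : W j = 3 ^ (4 * s) * W (j + 2) := by
      simp [hW]
      rw [← rpow_add (by norm_num)]
      congr 1; ring
    rw [((Real.rpow_neg (by norm_num) _).symm)]
    refine (mul_le_mul_of_nonneg_left (h.oscSq_le hF h1 h2 j) (hW0 j).le).trans (le_of_eq ?_)
    rw [mul_add, mul_ite, mul_ite, mul_zero]
    congr 2
    rw [e2]; ring
  refine (sum_le_sum hstep).trans ?_
  rw [sum_add_distrib, ← sum_filter, ← sum_filter, ← mul_sum]
  have p1 : ∑ j ∈ A with j + 2 ≤ m, W (j + 2) * patchOsc (cyl T U) (j + 2) F ≤ Y := by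
    rw [← sum_image (f := fun j => W j * patchOsc (cyl T U) j F) (fun j _ j' _ hjj => by simpa using hjj)]
    refine hY _ fun l hl => ?_
    obtain ⟨j, hj, rfl⟩ := Finset.mem_image.1 hl
    exact (mem_filter.1 hj).2
  have p2 : ∑ j ∈ A with j ≤ m, W j * G j ≤ 2 * κ * (2 * Y + K * (W m * E)) := by
    obtain ⟨n, hn⟩ : ∃ n, ∀ j ∈ A, n ≤ j := by
      obtain ⟨n, hn⟩ := A.bddBelow
      exact ⟨n, fun j hj => hn hj⟩
    refine le_trans (Finset.sum_le_sum_of_subset_of_nonneg (fun j hj => ?_)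
      fun j _ _ => mul_nonneg (hW0 j).le (hG0 j)) (h.sum_layer_le hs.1 hF hK hK2 hY n)
    rw [mem_filter] at hj
    exact Finset.mem_Icc.2 ⟨hn j hj.1, hj.2⟩
  have p3 : 4 * 3 ^ (4 * s) * (∑ j ∈ A with j + 2 ≤ m, W (j + 2) * patchOsc (cyl T U) (j + 2) F) ≤
      4 * 3 ^ (4 * s) * Y := mul_le_mul_of_nonneg_left p1 (by positivity)
  have p6 : 0 ≤ 4 * 3 ^ (4 * s) * (W m * E) := by positivity
  have p7 : 0 ≤ κ * (K * Y + 2 * (W m * E)) := by positivity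
  linarith

/-! ### Radial truncation -/

/-- The nearest point of the ball of radius `R`. -/
def ballProj (R : ℝ) (x : Space d) : Space d := min 1 (R / ‖x‖) • x

lemma ballProj_eq_self {x : Space d} (hx : ‖x‖ ≤ R) : ballProj R x = x := by
  rcases eq_or_ne x 0 with rfl | h0
  · simp [ballProj]
  · rw [ballProj, min_eq_left ((one_le_div (norm_pos_iff.2 h0)).2 hx), one_smul]

lemma norm_ballProj_le_self (hR : 0 ≤ R) (x : Space d) : ‖ballProj R x‖ ≤ ‖x‖ := by
  rw [ballProj, norm_smul, norm_of_nonneg (le_min zero_le_one (by positivity))]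
  exact mul_le_of_le_one_left (norm_nonneg _) (min_le_left _ _)

lemma norm_ballProj_le (hR : 0 ≤ R) (x : Space d) : ‖ballProj R x‖ ≤ R := by
  rcases le_total ‖x‖ R with h | h
  · exact (norm_ballProj_le_self hR x).trans h
  · rcases eq_or_ne x 0 with rfl | h0
    · simpa [ballProj] using hR
    · rw [ballProj, norm_smul, norm_of_nonneg (le_min zero_le_one (by positivity))]
      calc _ ≤ R / ‖x‖ * ‖x‖ := mul_le_mul_of_nonneg_right (min_le_right _ _) (norm_nonneg _)
        _ = R := div_mul_cancel₀ _ (norm_pos_iff.2 h0).ne'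

lemma inner_sub_ballProj_le (x : Space d) {z : Space d} (hz : ‖z‖ ≤ R) :
    inner ℝ (x - ballProj R x) (z - ballProj R x) ≤ 0 := by
  rcases le_total ‖x‖ R with h | h
  · rw [ballProj_eq_self h, sub_self, inner_zero_left]
  · rcases eq_or_ne x 0 with rfl | h0
    · simp [ballProj]
    · have hx := norm_pos_iff.2 h0
      have hθ := min_eq_right ((div_le_one hx).2 h)
      have e1 : x - ballProj R x = (1 - R / ‖x‖) • x := by rw [ballProj, hθ, sub_smul, one_smul]
      rw [e1, inner_smul_left, inner_sub_right, ballProj, hθ, inner_smul_right, real_inner_self_eq_norm_sq]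
      have e2 : R / ‖x‖ * ‖x‖ ^ 2 = R * ‖x‖ := by field_simp
      have e3 : inner ℝ x z ≤ R * ‖x‖ := (real_inner_le_norm x z).trans (by rw [mul_comm]; simp_all)
      have e4 : 0 ≤ 1 - R / ‖x‖ := by linarith [(div_le_one hx).2 h]
      exact mul_nonpos_of_nonneg_of_nonpos e4 (by linarith)

lemma norm_ballProj_sub_le (hR : 0 ≤ R) (x y : Space d) : ‖ballProj R x - ballProj R y‖ ≤ ‖x - y‖ := by
  have h1 := inner_sub_ballProj_le x (norm_ballProj_le hR y)
  have h2 := inner_sub_ballProj_le y (norm_ballProj_le hR x)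
  have h3 : ‖ballProj R x - ballProj R y‖ ^ 2 ≤ inner ℝ (x - y) (ballProj R x - ballProj R y) := by
    rw [← real_inner_self_eq_norm_sq]
    simp only [inner_sub_left, inner_sub_right] at h1 h2 ⊢
    linarith
  have h4 := h3.trans (real_inner_le_norm _ _)
  rcases eq_or_lt_of_le (norm_nonneg (ballProj R x - ballProj R y)) with h0 | h0
  · rw [← h0]; simp
  · rw [sq] at h4
    simp_all

lemma continuous_ballProj (hR : 0 ≤ R) : Continuous (ballProj R : Space d → Space d) :=
  LipschitzWith.continuous (LipschitzWith.of_dist_le_mul fun x y => by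
    rw [NNReal.coe_one, one_mul, dist_eq_norm, dist_eq_norm]; exact norm_ballProj_sub_le hR x y)

lemma memLp_ballProj (hR : 0 ≤ R) (hF : MemLp F 2 (𝓛 V)) :
    MemLp (fun p => ballProj R (F p)) 2 (𝓛 V) :=
  hF.mono ((continuous_ballProj hR).comp_aestronglyMeasurable hF.1)
    (ae_of_all _ fun p => norm_ballProj_le_self hR (F p))

lemma patchOsc_ballProj_le (hR : 0 ≤ R) (hF : MemLp F 2 (𝓛 X)) (l : ℤ) :
    patchOsc X l (fun p => ballProj R (F p)) ≤ 4 * patchOsc X l F := by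
  rw [patchOsc, patchOsc, mul_sum]
  refine sum_le_sum fun i _ => ?_
  have hV := volume_patch_ne_top (X := X) (l := l) i
  have hFi := hF.mono_measure (restrict_mono (inter_subset_right : patch X l i ⊆ X) le_rfl)
  have hGi := memLp_ballProj hR hFi
  set c := ballProj R (patchMean X l i F) with hc
  have h1 := setIntegral_norm_sub_sq_le hV hGi c (patchMean X l i fun p => ballProj R (F p))
  have h2 := measureReal_mul_avg_sub_sq_le hV hGi c
  rw [norm_sub_rev] at h2
  change volume.real (patch X l i) * ‖c - patchMean X l i fun p => ballProj R (F p)‖ ^ 2 ≤ _ at h2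
  have h3 := integral_mono (integrableOn_norm_sub_sq hV hGi c) (integrableOn_norm_sub_sq hV hFi _)
      fun p => pow_le_pow_left₀ (norm_nonneg _) (norm_ballProj_sub_le hR _ _) 2
  linarith

/-! ### Fields with finite Besov norm -/

/-- What is used of a field with Besov norm at most `β` in the cylinder: bounds in `L²` and for the
changes of its cube averages, the latter also for its truncations. -/
structure BesovData (T : ℝ) (U : Set (Space d)) (m : ℤ) (s : ℝ) (H : ℝ) (F : VecField d)
    (β : ℝ) : Prop where
  memLp : MemLp F 2 (𝓛 (cyl T U))
  l2_le : l2 (𝓛 (cyl T U)) F ≤ H * √(volume.real (cyl T U)) * 3 ^ (s * m) * β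
  osc : ∀ t₁ t₂ : ℝ, 0 ≤ t₁ → t₂ ≤ T → OscBound (Ioo t₁ t₂ ×ˢ U) (fun j => (3 : ℝ) ^ (2 * s * (j : ℝ))) F
    (H ^ 2 * volume.real (cyl T U) * β ^ 2)
  osc_trunc : ∀ R : ℝ, 0 ≤ R → ∀ t₁ t₂ : ℝ, 0 ≤ t₁ → t₂ ≤ T →
    OscBound (Ioo t₁ t₂ ×ˢ U) (fun j => (3 : ℝ) ^ (2 * s * (j : ℝ))) (fun p => ballProj R (F p))
      (H ^ 2 * volume.real (cyl T U) * β ^ 2)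

lemma exists_besovData (d : ℕ) [NeZero d] (hC : 1 ≤ C) (hs : s ∈ Ioo (0 : ℝ) (1 / 2)) :
    ∃ H, 0 ≤ H ∧ ∀ (T : ℝ) (U : Set (Space d)) (m : ℤ), IsRegularCylinder T U m C →
      ∀ (F : VecField d), AEStronglyMeasurable F (𝓛 (cyl T U)) →
      besovNorm s m (cyl T U) F < ⊤ →
      BesovData T U m s H F (besovNorm s m (cyl T U) F).toReal := by
  obtain ⟨H₀, hH₀, hosc⟩ := exists_oscBound d hs
  set B := besovConst d C with hB
  have hB0 : 0 < B := besovConst_pos hC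
  set L := chainConst d C with hL
  have hL0 : 0 < L := chainConst_pos hC
  set L₂ := 6 * L * B + 4 with hL₂
  have hL₂0 : 0 < L₂ := by positivity
  set H₁ := H₀ * (4 * B + L₂) with hH₁
  have hH₁0 : 0 ≤ H₁ := by positivity
  refine ⟨√L₂ + √H₁, by positivity, fun T U m h F hFm hfin => ?_⟩
  set Ω := cyl T U with hΩ
  set v := volume.real Ω with hv
  set β := (besovNorm s m Ω F).toReal with hβ
  have hsemi := lt_of_le_of_lt le_add_self hfin
  have hsβ := toReal_mono hfin.ne le_add_self
  have hmβ : 3 ^ (-(s * m)) * ‖∫ y, F y ∂(avgMeasure Ω)‖ ≤ β := by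
    have h2 := toReal_mono hfin.ne le_self_add
    rwa [toReal_mul, toReal_ofReal (by positivity), toReal_enorm] at h2
  have hFL : MemLp F 2 (𝓛 Ω) := by
    refine h.memLp_of_patch le_rfl (fun i hi => ?_) hFm
    exact memLp_of_sub_const (volume_patch_ne_top i) (h.memLp_patch hFm hsemi le_rfl hi)
  have hY : ∀ A : Finset ℤ, (∀ l ∈ A, l ≤ m) →
      ∑ l ∈ A, 3 ^ (-(2 * s * l)) * patchOsc Ω l F ≤ B * v * β ^ 2 := fun A hA => by
    refine (h.sum_patchOsc_le hFm hsemi A hA).trans ?_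
    exact mul_le_mul_of_nonneg_left (pow_le_pow_left₀ toReal_nonneg hsβ 2) (by positivity)
  set W : ℝ := 3 ^ (-(2 * s * m)) with hW
  have hW0 : 0 < W := by positivity
  have hWsq : (3 ^ (-(s * m))) ^ 2 = W := by
    rw [hW, ← rpow_natCast, ← rpow_mul (by norm_num)]
    congr 1; ring
  have hWinv : W * (3 ^ (s * m)) ^ 2 = 1 := by
    rw [← hWsq, ← mul_pow, ← rpow_add (by norm_num)]; simp
  have hE : W * ∫ p in Ω, ‖F p‖ ^ 2 ≤ L₂ * v * β ^ 2 := by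
    have h2 := hY {m} (by simp)
    rw [sum_singleton] at h2
    have h3 := pow_le_pow_left₀ (by positivity) hmβ 2
    rw [mul_pow, hWsq] at h3
    calc W * ∫ p in Ω, ‖F p‖ ^ 2 ≤ W * (6 * L * patchOsc Ω m F +
          4 * v * ‖∫ y, F y ∂(avgMeasure Ω)‖ ^ 2) := mul_le_mul_of_nonneg_left (h.integral_norm_sq_le hFL) hW0.le
      _ = 6 * L * (W * patchOsc Ω m F) + 4 * v * (W * ‖∫ y, F y ∂(avgMeasure Ω)‖ ^ 2) := by ring
      _ ≤ 6 * L * (B * v * β ^ 2) + 4 * v * β ^ 2 := add_le_add (mul_le_mul_of_nonneg_left h2 (by positivity))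
          (mul_le_mul_of_nonneg_left h3 (by positivity))
      _ = _ := by linarith
  have hle : ∀ {M : ℝ}, M ≤ H₁ * v * β ^ 2 → M ≤ (√L₂ + √H₁) ^ 2 * v * β ^ 2 := fun hM => by
    refine hM.trans ?_
    have h1 : H₁ ≤ (√L₂ + √H₁) ^ 2 := by nlinarith [sq_sqrt hH₁0, sqrt_nonneg L₂, sqrt_nonneg H₁]
    gcongr
  refine ⟨hFL, ?_, fun t₁ t₂ h1 h2 A => ?_, fun R hR t₁ t₂ h1 h2 A => ?_⟩
  · have h1 : l2 (𝓛 Ω) F ≤ √(L₂ * v * β ^ 2 * (3 ^ (s * m)) ^ 2) := by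
      rw [l2_eq_sqrt hFL]
      refine sqrt_le_sqrt ?_
      calc ∫ p in Ω, ‖F p‖ ^ 2 = (W * ∫ p in Ω, ‖F p‖ ^ 2) * (3 ^ (s * m)) ^ 2 := by
            grind
        _ ≤ _ := mul_le_mul_of_nonneg_right hE (sq_nonneg _)
    rw [Real.sqrt_mul' _ (sq_nonneg _), Real.sqrt_mul' _ (sq_nonneg _), sqrt_sq toReal_nonneg,
      sqrt_sq (by positivity), sqrt_mul hL₂0.le] at h1
    have h2 : 0 ≤ √H₁ * √v * 3 ^ (s * m) * β := by positivity
    nlinarith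
  · refine (hosc T U m h F hFL _ hY t₁ t₂ h1 h2 A).trans (hle ?_)
    have : H₀ * (B * v * β ^ 2 + W * ∫ p in Ω, ‖F p‖ ^ 2) ≤ H₀ * (B * v * β ^ 2 + L₂ * v * β ^ 2) :=
      mul_le_mul_of_nonneg_left (by linarith) hH₀
    have h3 : 0 ≤ H₀ * (3 * B * v * β ^ 2) := by positivity
    linarith
  · refine (hosc T U m h _ (memLp_ballProj hR hFL) (4 * (B * v * β ^ 2)) (fun A hA => ?_) t₁ t₂ h1 h2 A).trans (hle ?_)
    · refine le_trans ?_ (mul_le_mul_of_nonneg_left (hY A hA) (by norm_num))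
      rw [mul_sum]
      refine sum_le_sum fun l _ => ?_
      have := mul_le_mul_of_nonneg_left (patchOsc_ballProj_le hR hFL l) (by positivity : 0 ≤ (3 : ℝ) ^ (-(2 * s * l)))
      linarith
    · have h3 := integral_mono (integrableOn_norm_sq (memLp_ballProj hR hFL)) (integrableOn_norm_sq hFL)
          fun p => pow_le_pow_left₀ (norm_nonneg _) (norm_ballProj_le_self hR _) 2
      have h4 := (mul_le_mul_of_nonneg_left h3 hW0.le).trans hE
      refine (mul_le_mul_of_nonneg_left (add_le_add le_rfl h4) hH₀).trans (le_of_eq ?_)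
      linarith

/-! ### Ellipticity constants and scales -/

/-- The sum over scales in the definition of the ellipticity constants. -/
def ellSum (G : Set (SpaceTime d) → Matrix (Fin d) (Fin d) ℝ) (s : ℝ) (m : ℤ) : ℝ≥0∞ :=
  ∑' j : ℕ, ofReal ((3 : ℝ) ^ (-(s * 2 * j))) *
    ⨆ z ∈ lattice d (m - j) ∩ cube 0 m, specNorm (G (cube z (m - j))) ^ ((2 : ℝ) / 2)

lemma ellSum_anti {G : Set (SpaceTime d) → Matrix (Fin d) (Fin d) ℝ} {s' : ℝ} (hs : s' ≤ s) :
    ellSum G s m ≤ ellSum G s' m :=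
  ENNReal.tsum_le_tsum fun j => mul_le_mul_left (ofReal_le_ofReal
    (Real.rpow_le_rpow_of_exponent_le (by norm_num) (by nlinarith))) _

lemma exists_ellSum_bounds {G : Set (SpaceTime d) → Matrix (Fin d) (Fin d) ℝ} (hG : ellSum G s m ≠ ⊤) :
    ∃ b : ℤ → ℝ, (∀ j, 0 ≤ b j) ∧ (∀ j ≤ m, ∀ i, cell j i ⊆ cube 0 m → d * (specNorm (G (cell j i))).toReal ≤ b j) ∧
      ∀ A : Finset ℤ, ∑ j ∈ A, (3 : ℝ) ^ (2 * s * (j : ℝ)) * b j ≤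
        d * 3 ^ (2 * s * (m : ℝ)) * (ellSum G s m).toReal := by
  set σ : ℕ → ℝ≥0∞ := fun j =>
    ⨆ z ∈ lattice d (m - j) ∩ cube 0 m, specNorm (G (cube z (m - j))) ^ ((2 : ℝ) / 2) with hσ
  have hterm : ∀ j : ℕ, ofReal (3 ^ (-(s * 2 * j))) * σ j ≠ ⊤ := ENNReal.ne_top_of_tsum_ne_top hG
  have hσ0 : ∀ j, σ j ≠ ⊤ := fun j hj => hterm j (by
    rw [hj, ENNReal.mul_top]
    positivity)
  refine ⟨fun j => if j ≤ m then d * (σ (m - j).toNat).toReal else 0, fun j => ?_, fun j hj i hi => ?_, fun A => ?_⟩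
  · positivity
  · dsimp only
    rw [if_pos hj]
    refine mul_le_mul_of_nonneg_left (toReal_mono (hσ0 _) ?_) d.cast_nonneg
    have e1 : m - ((m - j).toNat) = j := by omega
    have e2 := le_iSup₂ (f := fun z (_ : z ∈ lattice d (m - ((m - j).toNat)) ∩ cube 0 m) =>
      specNorm (G (cube z (m - ((m - j).toNat)))) ^ ((2 : ℝ) / 2)) (ctr j i)
      ⟨by rw [e1]; exact ctr_mem_lattice j i, hi (ctr_mem_cell j i)⟩
    simp only [div_self (two_ne_zero (α := ℝ)), rpow_one, e1] at e2
    simp only [hσ, div_self (two_ne_zero (α := ℝ)), rpow_one, e1]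
    exact e2
  · rw [ellSum, ENNReal.tsum_toReal_eq hterm, mul_assoc]
    have hinj : InjOn (fun j : ℤ => (m - j).toNat) (A.filter (· ≤ m)) := fun x hx y hy hxy => by
      simp at hx hy
      dsimp only at hxy
      omega
    have h1 := (ENNReal.summable_toReal hG).sum_le_tsum ((A.filter (· ≤ m)).image fun j : ℤ => (m - j).toNat)
      fun _ _ => toReal_nonneg
    rw [sum_image hinj] at h1
    refine le_trans (le_of_eq ?_) (mul_le_mul_of_nonneg_left (mul_le_mul_of_nonneg_left h1
      (by positivity)) d.cast_nonneg)
    rw [mul_sum, mul_sum, sum_filter]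
    refine sum_congr rfl fun j _ => ?_
    by_cases hj : j ≤ m
    · simp only [if_pos hj]
      have e1 : (((m - j).toNat)) = (m : ℝ) - j := by
        have : (((m - j).toNat)) = m - j := by omega
        exact_mod_cast congrArg Int.cast this
      rw [toReal_mul, toReal_ofReal (by positivity), e1, ← mul_assoc (_ ^ _) (_ ^ _),
        ← rpow_add (by norm_num), show 2 * s * m + -(s * 2 * (m - j)) = 2 * s * j by ring]
      exact mul_left_comm _ _ _
    grind

lemma GradBound.mono {b' : ℝ} (h : GradBound σ a Q b) (hb : b ≤ b') :
    GradBound σ a Q b' := fun u Du hu => (h u Du hu).trans <|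
  mul_le_mul_of_nonneg_right (mul_le_mul_of_nonneg_left hb measureReal_nonneg) (sq_nonneg _)

lemma FluxBound.mono {b' : ℝ} (h : FluxBound a Q b) (hb : b ≤ b') :
    FluxBound a Q b' := fun u Du hu => (h u Du hu).trans <|
  mul_le_mul_of_nonneg_right (mul_le_mul_of_nonneg_left hb measureReal_nonneg) (sq_nonneg _)

/-- The scales given by the ellipticity constants. The last bound is that of `one_le_mul_bounds` in
the largest cube. -/
lemma IsRegularCylinder.exists_scales [NeZero d] (h : IsRegularCylinder T U m C)
    (ha : IsCoefficientField a) (h1 : ellSum (sStarInv a) s m ≠ ⊤) (h2 : ellSum (bMat a) s m ≠ ⊤) :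
    (∃ b b' : ℤ → ℝ, ∀ t₁ t₂, 0 ≤ t₁ → t₂ ≤ T → GradScale a (Ioo t₁ t₂ ×ˢ U) (fun j => 3 ^ (2 * s * (j : ℝ))) b
        (d * 3 ^ (2 * s * (m : ℝ)) * (ellSum (sStarInv a) s m).toReal) ∧
      FluxScale a (Ioo t₁ t₂ ×ˢ U) (fun j => 3 ^ (2 * s * (j : ℝ))) b'
        (d * 3 ^ (2 * s * (m : ℝ)) * (ellSum (bMat a) s m).toReal)) ∧
    1 ≤ 36 * (d * (ellSum (sStarInv a) s m).toReal) * (d * (ellSum (bMat a) s m).toReal) := by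
  obtain ⟨b, hb0, hb, hbS⟩ := exists_ellSum_bounds h1
  obtain ⟨b', hb0', hb', hbS'⟩ := exists_ellSum_bounds h2
  have hv : ∀ j (i : Idx d), volume (cell j i) ≠ 0 := fun j i =>
    ((isOpen_cell j i).measure_pos volume ⟨_, ctr_mem_cell j i⟩).ne'
  have hg := fun j hj i hi => (ha.gradBound_sStarInv (isBounded_cell j i) (hv j i)).mono (hb j hj i hi)
  have hf := fun j hj i hi => (ha.fluxBound_bMat (isBounded_cell j i) (hv j i)).mono (hb' j hj i hi)
  refine ⟨⟨b, b', fun t₁ t₂ ht ht' => ?_⟩, ?_⟩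
  · have hX := subset_cyl (U := U) ht ht'
    have hXb := (isBounded_cyl h.isBounded).subset hX
    exact ⟨⟨fun j => by positivity, hb0, fun j i hi => by
        have hi' := ((mem_cells hXb).1 hi).trans hX
        exact hg j (h.lt_of_cell_subset hi').le i (hi'.trans h.sub), hbS⟩,
      ⟨fun j => by positivity, hb0', fun j i hi => by
        have hi' := ((mem_cells hXb).1 hi).trans hX
        exact hf j (h.lt_of_cell_subset hi').le i (hi'.trans h.sub), hbS'⟩⟩
  · have h0 : cell m (0 : Idx d) = cube 0 m := by
      have : ctr m (0 : Idx d) = 0 := by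
        simp [ctr]
        ext; simp
      rw [cell, this]
    have e1 := ha.one_le_mul_bounds (hb0 m) (hb0' m) (hg m le_rfl 0 h0.le) (hf m le_rfl 0 h0.le)
    have hw : (0 : ℝ) < 3 ^ (2 * s * m) := by positivity
    have hle : ∀ {x y : ℝ}, 3 ^ (2 * s * m) * x ≤ d * 3 ^ (2 * s * m) * y → x ≤ d * y := fun hxy =>
      le_of_mul_le_mul_left (hxy.trans (by linarith)) hw
    have e2 := hle (by simpa only [sum_singleton] using hbS {m})
    have e3 := hle (by simpa only [sum_singleton] using hbS' {m})
    have e4 := mul_le_mul_of_nonneg_left e2 (by norm_num : (0 : ℝ) ≤ 36)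
    exact e1.trans (mul_le_mul e4 e3 (hb0' m) ((mul_nonneg (by norm_num) (hb0 m)).trans e4))

/-! ### The inverse Laplacian of the time derivative -/

lemma lintegral_enorm_sq {X E : Type*} [MeasurableSpace X] [NormedAddCommGroup E] {μ : Measure X}
    {f : X → E} (hf : MemLp f 2 μ) : ∫⁻ x, ‖f x‖ₑ ^ 2 ∂μ = ofReal (∫ x, ‖f x‖ ^ 2 ∂μ) := by
  rw [← eLpNorm_two_sq, ← l2_sq hf, ofReal_pow (l2_nonneg _), l2, ofReal_toReal hf.2.ne]

lemma bil_one (v : Space d) : bil (symPart (1 : Matrix (Fin d) (Fin d) ℝ)) v v = ‖v‖ ^ 2 := by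
  rw [symPart, Matrix.transpose_one, ← two_smul ℝ, smul_smul, bil, norm_sq_eq]
  norm_num [dotProduct, sq]

lemma lintegral_bil_one (V : Set (SpaceTime d)) (F : VecField d) :
    ∫⁻ p in V, ofReal (bil (symPart (1 : Matrix (Fin d) (Fin d) ℝ)) (F p) (F p)) = eLpNorm F 2 (𝓛 V) ^ 2 := by
  simp only [bil_one, eLpNorm_two_sq]
  simp

lemma IsTest.memLp (h : IsTest V φ) (μ : Measure (SpaceTime d)) [IsLocallyFiniteMeasure μ] :
    MemLp φ 2 μ := h.continuous.memLp_of_hasCompactSupport h.compact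

lemma IsTest.memLp_dx (h : IsTest V φ) (μ : Measure (SpaceTime d)) [IsLocallyFiniteMeasure μ] :
    MemLp (dx φ) 2 μ := h.continuous_dx.memLp_of_hasCompactSupport h.hasCompactSupport_dx

lemma tendsto_l2_of_sq {X E : Type*} [MeasurableSpace X] [NormedAddCommGroup E] {μ : Measure X}
    {f : ℕ → X → E} (h : Tendsto (fun n => eLpNorm (f n) 2 μ ^ 2) atTop (𝓝 0)) :
    Tendsto (fun n => l2 μ (f n)) atTop (𝓝 0) := by
  have h1 := ((ENNReal.tendsto_toReal zero_ne_top).comp h).sqrt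
  simp only [Function.comp_def, toReal_pow, ENNReal.toReal_zero, Real.sqrt_zero] at h1
  exact h1.congr fun n => sqrt_sq (l2_nonneg _)

lemma add_sq_le_four (x y : ℝ≥0∞) : (x + y) ^ 2 ≤ 4 * (x ^ 2 + y ^ 2) := by
  have h : x + y ≤ 2 * max x y := by
    rw [two_mul]; exact add_le_add (le_max_left _ _) (le_max_right _ _)
  calc (x + y) ^ 2 ≤ (2 * max x y) ^ 2 := by gcongr
    _ = 4 * max x y ^ 2 := by grind
    _ ≤ _ := by
      gcongr
      rcases le_total x y with hxy | hxy
      · rw [max_eq_right hxy]; exact le_add_self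
      simp_all

namespace IsRegularCylinder
variable (h : IsRegularCylinder T U m C)
include h

lemma abs_coord_le (hp : p ∈ cyl T U) (i : Fin d) : |p.2 i| ≤ 3 ^ m / 2 := by
  have := (h.sub hp).2 i
  simp at this
  exact this.le

lemma le_nine_zpow : T ≤ 3 ^ (2 * m) := by
  obtain ⟨x, hx⟩ := h.isConnected.nonempty
  by_contra! hT
  have h9 := three_zpow_pos (2 * m)
  have := (h.sub (show (3 ^ (2 * m), x) ∈ cyl T U from ⟨⟨h9, hT⟩, hx⟩)).1
  rw [Prod.fst_zero, sub_zero, abs_of_pos h9] at this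
  linarith

lemma volume_real_cyl : volume.real (cyl T U) = T * volume.real U := by
  rw [measureReal_def, cyl, volume_eq_prod, prod_prod, volume_Ioo, toReal_mul,
    sub_zero, toReal_ofReal h.pos.le, measureReal_def]

lemma volume_real_pos : 0 < volume.real U := by
  exact toReal_pos (h.isOpen.measure_pos volume h.isConnected.nonempty).ne' h.isBounded.measure_lt_top.ne

lemma volume_rpow_le [NeZero d] : volume.real U ^ (-(1 / (d : ℝ))) ≤
    densConst d C ^ (-(1 / (d : ℝ))) * (3 ^ m)⁻¹ := by
  have hd : (0 : ℝ) < d := Nat.cast_pos.2 (NeZero.pos d)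
  have hD := densConst_pos (d := d) h.one_le
  have h1 := h.vol_le
  rw [h.volume_real_cyl, vol, ← div_eq_inv_mul, le_div_iff₀ hD] at h1
  have h2 : densConst d C * (3 ^ m) ^ (d : ℝ) ≤ volume.real U := by
    rw [rpow_natCast]
    refine le_of_mul_le_mul_left ?_ (three_zpow_pos (2 * m))
    have := mul_le_mul_of_nonneg_right h.le_nine_zpow h.volume_real_pos.le
    nlinarith
  refine (Real.rpow_le_rpow_of_nonpos (by positivity) h2 (by simp)).trans (le_of_eq ?_)
  rw [Real.mul_rpow hD.le (by positivity), ← rpow_mul (three_zpow_pos m).le, mul_neg, mul_one_div_cancel hd.ne',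
    Real.rpow_neg_one]

lemma l2H1NormSq_le [NeZero d] (hφ : IsTest (cyl T U) φ) : l2H1NormSq T U φ ≤
    ofReal (4 * ((densConst d C ^ (-(1 / (d : ℝ)))) ^ 2 + 1) *
    ((volume.real (cyl T U))⁻¹ * ∫ p in cyl T U, ‖dx φ p‖ ^ 2)) := by
  set D := densConst d C ^ (-(1 / (d : ℝ))) with hDdef
  have hU := h.volume_real_pos
  set α := volume.real U ^ (-(1 / (d : ℝ))) with hα
  have hα0 : 0 ≤ α := by positivity
  have hαe : volume U ^ (-(1 / (d : ℝ))) = ofReal α := by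
    rw [hα, ← ENNReal.ofReal_rpow_of_pos hU, measureReal_def, ofReal_toReal h.isBounded.measure_lt_top.ne]
  have hI : ∀ {E : Type} [NormedAddCommGroup E] {F : SpaceTime d → E}, Continuous F → ∫⁻ t,
      eLpNorm (fun x => F (t, x)) 2 (avgMeasure U) ^ 2 ∂(avgMeasure (Ioo 0 T)) =
      (volume (Ioo 0 T))⁻¹ * ((volume U)⁻¹ * ∫⁻ p in cyl T U, ‖F p‖ₑ ^ 2) := by
    intro E _ F hF
    simp [eLpNorm_two_sq, avgMeasure, lintegral_smul_measure, smul_eq_mul]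
    rw [lintegral_const_mul' _ _ (ENNReal.inv_ne_top.2
      (h.isOpen.measure_pos volume h.isConnected.nonempty).ne'), cyl, volume_eq_prod,
      ← prod_restrict, lintegral_prod _ ((hF.enorm.measurable).pow_const 2).aemeasurable]
  have h1 : l2H1NormSq T U φ ≤ 4 * (ofReal α ^ 2 *
      ((volume (Ioo 0 T))⁻¹ * ((volume U)⁻¹ * ∫⁻ p in cyl T U, ‖φ p‖ₑ ^ 2)) +
      (volume (Ioo 0 T))⁻¹ * ((volume U)⁻¹ * ∫⁻ p in cyl T U, ‖dx φ p‖ₑ ^ 2)) := by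
    rw [← hI hφ.continuous, ← hI (hφ.continuous_dx), l2H1NormSq]
    have hmm : Measurable fun t => eLpNorm (fun x => φ (t, x)) 2 (avgMeasure U) ^ 2 := by
      simp [eLpNorm_two_sq, avgMeasure, lintegral_smul_measure, smul_eq_mul]
      exact ((hφ.continuous.enorm.measurable.pow_const 2).lintegral_prod_right').const_mul _
    refine (lintegral_mono fun t => add_sq_le_four _ _).trans ?_
    rw [lintegral_const_mul' _ _ (by norm_num)]
    simp only [mul_pow, hαe]
    rw [lintegral_add_left (hmm.const_mul _), lintegral_const_mul _ hmm]
  refine h1.trans ?_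
  have hvol : (volume (Ioo 0 T))⁻¹ = ofReal T⁻¹ := by
    rw [volume_Ioo, sub_zero, ofReal_inv_of_pos h.pos]
  have hvolU : (volume U)⁻¹ = ofReal (volume.real U)⁻¹ := by
    rw [ofReal_inv_of_pos hU, measureReal_def, ofReal_toReal h.isBounded.measure_lt_top.ne]
  rw [lintegral_enorm_sq (hφ.memLp _), lintegral_enorm_sq (hφ.memLp_dx _), hvol, hvolU]
  have hT := h.pos
  rw [← ofReal_pow hα0, ← ofReal_mul (by positivity), ← ofReal_mul (by positivity),
    ← ofReal_mul (by positivity), ← ofReal_mul (by positivity), ← ofReal_mul (by positivity),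
    ← ofReal_add (by positivity) (by positivity), show 4 =
    ofReal 4 by simp, ← ofReal_mul (by norm_num)]
  refine ofReal_le_ofReal ?_
  have hP : ∫ p in cyl T U, ‖φ p‖ ^ 2 ≤ (3 ^ m) ^ 2 * ∫ p in cyl T U, ‖dx φ p‖ ^ 2 := by
    have := integral_sq_le_dx 0 (fun p hp => h.abs_coord_le hp 0) hφ
    have e2 : ∫ p in cyl T U, (dx φ p 0) ^ 2 = ∫ p, (dx φ p 0) ^ 2 :=
      setIntegral_eq_integral_of_forall_compl_eq_zero fun p hp => by rw [hφ.dx_zero_off hp]; simp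
    rw [← (setIntegral_eq_integral_of_forall_compl_eq_zero fun p hp => by rw [hφ.zero_off hp]; ring), ← e2] at this
    simp
    refine this.trans ?_
    rw [show (4 : ℝ) * (3 ^ m / 2) ^ 2 = (3 ^ m) ^ 2 by ring]
    refine mul_le_mul_of_nonneg_left (integral_mono_of_nonneg (ae_of_all _ fun p => sq_nonneg _)
      ((memLp_two_iff_integrable_sq_norm (hφ.memLp_dx _).1).1 (hφ.memLp_dx _)) (ae_of_all _ fun p =>
      ?_)) (by positivity)
    dsimp only
    rw [← sq_abs]
    exact pow_le_pow_left₀ (abs_nonneg _) (PiLp.norm_apply_le (dx φ p) 0) 2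
  have hαP : α ^ 2 * ∫ p in cyl T U, ‖φ p‖ ^ 2 ≤ D ^ 2 * ∫ p in cyl T U, ‖dx φ p‖ ^ 2 := by
    refine (mul_le_mul (pow_le_pow_left₀ hα0 h.volume_rpow_le 2) hP (by positivity) (by positivity)).trans (le_of_eq ?_)
    rw [mul_pow, inv_pow, ← mul_assoc, mul_assoc (D ^ 2), inv_mul_cancel₀ (by positivity), mul_one]
  rw [h.volume_real_cyl, mul_inv]
  have hTU : 0 ≤ T⁻¹ * (volume.real U)⁻¹ := by positivity
  nlinarith

/-- A bound for the gradient of `Δ_U⁻¹ ∂_t g`, by duality. -/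
lemma l2_invLaplacian_le [NeZero d] (hψ : IsInvLaplacianDt T U g ψ Dψ) (hN : dtL2Hm1Norm T U g < ⊤)
    (hD : MemLp Dψ 2 (𝓛 (cyl T U))) : l2 (𝓛 (cyl T U)) Dψ ≤
    √(4 * ((densConst d C ^ (-(1 / (d : ℝ)))) ^ 2 + 1)) * √(volume.real (cyl T U)) *
    (dtL2Hm1Norm T U g).toReal := by
  set K := 4 * ((densConst d C ^ (-(1 / (d : ℝ)))) ^ 2 + 1) with hK
  have hK0 : 0 < K := by positivity
  set Ω := cyl T U with hΩ
  set μ := 𝓛 Ω with hμ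
  set N := (dtL2Hm1Norm T U g).toReal with hNdef
  have hv : 0 < volume.real Ω := by rw [h.volume_real_cyl]; exact mul_pos h.pos h.volume_real_pos
  set v := volume.real Ω with hvdef
  have hN0 : 0 ≤ N := toReal_nonneg
  have key : ∀ φ, IsTest Ω φ → ∫ p in Ω, inner ℝ (Dψ p) (dx φ p) ≤ √K * √v * N * l2 μ (dx φ) := fun φ hφ => by
    rw [hψ.2 φ hφ]
    refine le_of_forall_pos_le_add fun δ hδ => ?_
    -- the summand with `δ` keeps `c` positive when `dx φ` vanishes
    set c := √K * l2 μ (dx φ) / √v + δ / (v * (N + 1)) with hc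
    have hb0 : 0 ≤ √K * l2 μ (dx φ) / √v := div_nonneg (mul_nonneg (sqrt_nonneg _) (l2_nonneg _)) (sqrt_nonneg _)
    have hc0 : 0 < c := by positivity
    have hφc := hφ.const_mul c⁻¹
    have hdxc : ∀ p, dx (fun p => c⁻¹ * φ p) p = c⁻¹ • dx φ p := fun p => dx_const_mul _ (hφ.differentiable p)
    have hdtc : ∀ p, dt (fun p => c⁻¹ * φ p) p = c⁻¹ * dt φ p := fun p => dt_const_mul _ (hφ.differentiable p)
    have h1 : l2H1NormSq T U (fun p => c⁻¹ * φ p) ≤ 1 := by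
      refine (h.l2H1NormSq_le hφc).trans ?_
      rw [← ofReal_one]
      refine ofReal_le_ofReal ?_
      simp only [hdxc, norm_smul, mul_pow]
      rw [integral_const_mul, ← l2_sq (hφ.memLp_dx _), norm_inv, norm_of_nonneg hc0.le, inv_pow]
      have h2 : K * (v⁻¹ * l2 μ (dx φ) ^ 2) ≤ c ^ 2 := by
        refine le_trans (le_of_eq ?_) (pow_le_pow_left₀ hb0 (le_add_of_nonneg_right (by positivity)) 2)
        rw [div_pow, mul_pow, sq_sqrt hK0.le, sq_sqrt hv.le]; ring
      calc K * (v⁻¹ * ((c ^ 2)⁻¹ * l2 μ (dx φ) ^ 2)) = (c ^ 2)⁻¹ * (K * (v⁻¹ * l2 μ (dx φ) ^ 2)) := by ring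
        _ ≤ (c ^ 2)⁻¹ * c ^ 2 := by gcongr
        _ = 1 := inv_mul_cancel₀ (by positivity)
    have h2 := (le_iSup₂_of_le (f := fun φ (_) => ⨆ (_ : l2H1NormSq T U φ ≤ 1), ofReal |∫ p,
      g p * dt φ p ∂(avgMeasure (cyl T U))|)
      _ hφc (le_iSup_of_le h1 le_rfl))
    have h3 := (ENNReal.ofReal_le_iff_le_toReal hN.ne).1 h2
    rw [integral_avgMeasure] at h3
    simp only [hdtc, mul_left_comm _ c⁻¹] at h3
    rw [integral_const_mul, smul_eq_mul, abs_mul, abs_mul, abs_of_pos (inv_pos.2 hc0), abs_inv,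
      abs_of_pos hv, ← div_eq_inv_mul, ← div_eq_inv_mul, div_div, div_le_iff₀ (by positivity)] at h3
    refine (le_abs_self _).trans (h3.trans ?_)
    have h5 := sqrt_pos.2 hv
    have h6 : N * (c * v) = √K * √v * N * l2 μ (dx φ) + δ * (N / (N + 1)) := by
      rw [hc]; field_simp; linear_combination (N * √K * l2 μ (dx φ) * (N + 1)) * ((Real.mul_self_sqrt hv.le).symm)
    have h7 : N / (N + 1) ≤ 1 := (div_le_one (by positivity)).2 (by linarith)
    nlinarith
  obtain ⟨φ, hφ, hlim⟩ := hψ.1.approx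
  have hd : ∀ n, MemLp (fun p => Dψ p - dx (φ n) p) 2 μ := fun n => hD.sub ((hφ n).memLp_dx _)
  have hl : Tendsto (fun n => l2 μ (fun p => Dψ p - dx (φ n) p)) atTop (𝓝 0) := by
    have h1 : Tendsto (fun n => (eLpNorm (fun p => Dψ p - dx (φ n) p) 2 μ) ^ 2) atTop (𝓝 0) :=
        tendsto_of_tendsto_of_tendsto_of_le_of_le tendsto_const_nhds hlim (fun _ => zero_le)
        fun n => by
        rw [← lintegral_bil_one]; exact le_add_self
    exact tendsto_l2_of_sq h1
  have hle : ∀ n, l2 μ Dψ ^ 2 ≤ √K * √v * N * (l2 μ Dψ + l2 μ (fun p => Dψ p - dx (φ n) p)) +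
      l2 μ Dψ * l2 μ (fun p => Dψ p - dx (φ n) p) := fun n => by
    have hin : ∀ {F : VecField d}, MemLp F 2 μ → Integrable (fun p => inner ℝ (Dψ p) (F p)) μ :=
      fun hF => (integrable_norm_mul_norm hD hF).mono (hD.1.inner hF.1) (ae_of_all _ fun p =>
      (norm_inner_le_norm _ _).trans (le_abs_self _))
    have e1 : l2 μ Dψ ^ 2 = ∫ p, inner ℝ (Dψ p) (dx (φ n) p) ∂μ + ∫ p, inner ℝ (Dψ p) (Dψ p - dx (φ n) p) ∂μ := by
      rw [← integral_add (hin ((hφ n).memLp_dx _)) (hin (hd n)), l2_sq hD]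
      exact integral_congr_ae (ae_of_all _ fun p => by
        dsimp only; rw [← inner_add_right, add_sub_cancel, real_inner_self_eq_norm_sq])
    have e2 := (integral_mono (hin (hd n)) (integrable_norm_mul_norm hD (hd n)) fun p =>
      real_inner_le_norm _ _).trans (integral_norm_mul_norm_le hD (hd n))
    have e3 : l2 μ (dx (φ n)) ≤ l2 μ Dψ + l2 μ (fun p => Dψ p - dx (φ n) p) := by
      have := l2_add_le hD (hd n).neg
      rw [show (Dψ + -fun p => Dψ p - dx (φ n) p) = dx (φ n) by ext1 p; simp] at this
      refine this.trans (le_of_eq ?_)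
      rw [l2, l2, l2, eLpNorm_neg]
    have e4 := mul_le_mul_of_nonneg_left e3 (by positivity : 0 ≤ √K * √v * N)
    linarith [key _ (hφ n)]
  have hlim2 := ge_of_tendsto' (((hl.const_add (l2 μ Dψ)).const_mul (√K * √v * N)).add (hl.const_mul (l2 μ Dψ))) hle
  rw [add_zero, mul_zero, add_zero, sq] at hlim2
  rcases (l2_nonneg Dψ).eq_or_lt with h0 | h0
  · rw [← h0]; positivity
  · exact le_of_mul_le_mul_right hlim2 h0

end IsRegularCylinder

section
variable {H : VecField d} {e : (SpaceTime d → ℝ) → ℝ} {b : ℤ → ℝ} {K : ℝ}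

/-! ### Approximate solutions and their pairings with fields of finite Besov norm -/

lemma integrable_inner {Y E : Type*} [MeasurableSpace Y] [NormedAddCommGroup E] [InnerProductSpace ℝ E]
    {μ : Measure Y} {f g : Y → E} (hf : MemLp f 2 μ) (hg : MemLp g 2 μ) :
    Integrable (fun p => inner ℝ (f p) (g p)) μ :=
  (integrable_norm_mul_norm hf hg).mono (hf.1.inner hg.1) (ae_of_all _ fun _ =>
    (norm_inner_le_norm _ _).trans (le_abs_self _))

lemma abs_integral_inner_le {Y E : Type*} [MeasurableSpace Y] [NormedAddCommGroup E] [InnerProductSpace ℝ E]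
    {μ : Measure Y} {f g : Y → E} (hf : MemLp f 2 μ) (hg : MemLp g 2 μ) :
    |∫ p, inner ℝ (f p) (g p) ∂μ| ≤ l2 μ f * l2 μ g :=
  abs_integral_le_integral_abs.trans <| (integral_mono (integrable_inner hf hg).abs
    (integrable_norm_mul_norm hf hg) fun _ => abs_real_inner_le_norm _ _).trans (integral_norm_mul_norm_le hf hg)

/-- The norm of `W_s^1(Q)` as a real number. -/
def wN (a : MatField d) (Q : Set (SpaceTime d)) (φ : SpaceTime d → ℝ) : ℝ :=
  √((∫ p in Q, φ p * φ p) + eN a Q (dx φ) ^ 2)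

lemma IsTest.l2_sq_add_eN_sq (hφ : IsTest X φ) :
    l2 (𝓛 Q) φ ^ 2 + eN a Q (dx φ) ^ 2 = wN a Q φ ^ 2 := by
  have h0 : 0 ≤ ∫ p in Q, φ p * φ p := integral_nonneg fun p => mul_self_nonneg _
  rw [wN, sq_sqrt (by positivity), l2_sq (hφ.memLp _)]
  simp [norm_eq_abs, sq_abs, ← sq]

namespace IsCoefficientField
variable (h : IsCoefficientField a)
include h

lemma wNormSq_eq : wNormSq a Q u Du = eLpNorm u 2 (𝓛 Q) ^ 2 + eLpNorm (nrm a Du) 2 (𝓛 Q) ^ 2 := by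
  simp [wNormSq, eLpNorm_two_sq]
  congr 1 <;> refine lintegral_congr fun p => ?_
  · rw [← sq_abs, ofReal_pow (abs_nonneg _), ← norm_eq_abs, ofReal_norm]
  · rw [← h.nrm_sq, ofReal_pow (nrm_nonneg p), ← norm_nrm (a := a) p, ofReal_norm, norm_nrm]

lemma memLp_finE_of_wNormSq (hu : AEStronglyMeasurable u (𝓛 Q))
    (hD : AEStronglyMeasurable Du (𝓛 Q)) (hf : wNormSq a Q u Du < ⊤) :
    MemLp u 2 (𝓛 Q) ∧ FinE a Q Du := by
  rw [h.wNormSq_eq, ENNReal.add_lt_top] at hf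
  exact ⟨⟨hu, (ENNReal.pow_lt_top_iff.1 hf.1).resolve_right two_ne_zero⟩, hD, h.aesm_nrm hD,
    (ENNReal.pow_lt_top_iff.1 hf.2).resolve_right two_ne_zero⟩

lemma tendsto_of_wNormSq {u : ℕ → SpaceTime d → ℝ} {Du : ℕ → VecField d}
    (hlim : Tendsto (fun n => wNormSq a Q (u n) (Du n)) atTop (𝓝 0)) :
    Tendsto (fun n => l2 (𝓛 Q) (u n)) atTop (𝓝 0) ∧ Tendsto (fun n => eN a Q (Du n)) atTop (𝓝 0) := by
  simp [h.wNormSq_eq] at hlim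
  exact ⟨tendsto_l2_of_sq (tendsto_of_tendsto_of_tendsto_of_le_of_le tendsto_const_nhds hlim
    (fun _ => zero_le) fun _ => le_self_add), tendsto_l2_of_sq (tendsto_of_tendsto_of_tendsto_of_le_of_le
      tendsto_const_nhds hlim (fun _ => zero_le) fun _ => le_add_self)⟩

lemma abs_integral_mul_dt_le (hQ : IsBounded Q) (hu : dtDualNorm a Q u ≠ ⊤) (hφ : IsTest Q φ) :
    |∫ p in Q, u p * dt φ p| ≤ (dtDualNorm a Q u).toReal * wN a Q φ := by
  refine le_of_forall_pos_le_add fun δ hδ => ?_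
  set N := (dtDualNorm a Q u).toReal
  have hb0 : 0 ≤ wN a Q φ := sqrt_nonneg _
  set r := wN a Q φ + δ / (N + 1) with hr
  have hr0 : 0 < r := by positivity
  have hφr := hφ.const_mul r⁻¹
  have h1 : wNormSq a Q (fun p => r⁻¹ * φ p) (dx fun p => r⁻¹ * φ p) ≤ 1 := by
    have e1 : eLpNorm (fun p => r⁻¹ * φ p) 2 (𝓛 Q) = ofReal (r⁻¹ * l2 (𝓛 Q) φ) := by
      rw [← ofReal_toReal (hφr.memLp (𝓛 Q)).2.ne]
      congr 1
      exact (l2_const_mul _ _).trans (by grind)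
    have e2 : eLpNorm (nrm a (dx fun p => r⁻¹ * φ p)) 2 (𝓛 Q) = ofReal (r⁻¹ * eN a Q (dx φ)) := by
      rw [← ofReal_toReal (h.finE_dx hQ hφr).mem.2.ne]
      congr 1
      have : (dx fun p => r⁻¹ * φ p) = fun p => r⁻¹ • dx φ p := funext fun p => dx_const_mul _ (hφ.differentiable p)
      rw [this]
      exact (eN_smul _).trans (by grind)
    have p1 : 0 ≤ r⁻¹ * l2 (𝓛 Q) φ := mul_nonneg (by positivity) (l2_nonneg _)
    have p2 : 0 ≤ r⁻¹ * eN a Q (dx φ) := mul_nonneg (by positivity) eN_nonneg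
    rw [h.wNormSq_eq, e1, e2, ← ofReal_pow p1, ← ofReal_pow p2, ← ofReal_add (by positivity)
      (by positivity), ENNReal.ofReal_le_one, mul_pow, mul_pow, ← mul_add, hφ.l2_sq_add_eN_sq, inv_pow,
      inv_mul_le_iff₀ (by positivity), mul_one]
    exact pow_le_pow_left₀ hb0 (le_add_of_nonneg_right (by positivity)) 2
  have h2 := (le_iSup₂_of_le (f := fun φ (_) =>
    ⨆ (_ : wNormSq a Q φ (dx φ) ≤ 1), ofReal |∫ p in Q, u p * dt φ p|) _ hφr (le_iSup_of_le h1 le_rfl))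
  have h3 := (ENNReal.ofReal_le_iff_le_toReal hu).1 h2
  simp [fun p => dt_const_mul r⁻¹ (hφ.differentiable p), mul_left_comm _ r⁻¹] at h3
  rw [integral_const_mul, abs_mul, abs_of_pos (inv_pos.2 hr0), inv_mul_le_iff₀ hr0, hr] at h3
  have h7 : N / (N + 1) ≤ 1 := (div_le_one (by positivity)).2 (by linarith)
  have h8 : δ / (N + 1) * N = δ * (N / (N + 1)) := by ring
  nlinarith

end IsCoefficientField

lemma HasWeakGradient.of_tendsto {u : ℕ → SpaceTime d → ℝ} {Du : ℕ → VecField d}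
    {v : SpaceTime d → ℝ} {Dv : VecField d} (hu : ∀ n, HasWeakGradient Q (u n) (Du n))
    (hui : ∀ n, IntegrableOn (u n) Q) (hDui : ∀ n, IntegrableOn (Du n) Q) (hv : IntegrableOn v Q)
    (hDv : IntegrableOn Dv Q) (h1 : Tendsto (fun n => ∫ p in Q, ‖u n p - v p‖) atTop (𝓝 0))
    (h2 : Tendsto (fun n => ∫ p in Q, ‖Du n p - Dv p‖) atTop (𝓝 0)) : HasWeakGradient Q v Dv := fun φ hφ => by
  obtain ⟨C, hC⟩ := hφ.bounded
  obtain ⟨C', _, hC'⟩ := hφ.bounded_dx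
  have t1 := tendsto_integral_of_norm_sub_le hui hv h1 (fun n => hφ.smul_dx_integrableOn (hui n))
    (hφ.smul_dx_integrableOn hv) C' (fun n p => by
      rw [← sub_smul, norm_smul, mul_comm]
      exact mul_le_mul_of_nonneg_right (hC' p) (norm_nonneg _))
  have t2 := tendsto_integral_of_norm_sub_le hDui hDv h2 (fun n => hφ.smul_integrableOn (hDui n))
    (hφ.smul_integrableOn hDv) C (fun n p => by
      rw [← smul_sub, norm_smul]
      exact mul_le_mul_of_nonneg_right (hC p) (norm_nonneg _))
  exact tendsto_nhds_unique t1 (t2.neg.congr fun n => (hu n φ hφ).symm)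

/-- `u`, with gradient `Du` of finite energy, solves `∂_t u - ∇ · a ∇u = ∇ · f + e` in `Q`. -/
structure SolvesOn (a : MatField d) (Q : Set (SpaceTime d)) (f : VecField d)
    (e : (SpaceTime d → ℝ) → ℝ) (u : SpaceTime d → ℝ) (Du : VecField d) : Prop where
  integrable : IntegrableOn u Q
  finE : FinE a Q Du
  weakGradient : HasWeakGradient Q u Du
  eqn : ∀ φ, IsTest Q φ → -(∫ p in Q, u p * dt φ p) + ∫ p in Q, bil (a p) (dx φ p) (Du p) =
    (-∫ p in Q, inner ℝ (f p) (dx φ p)) + e φ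

lemma HasWeakGradient.mono (hu : HasWeakGradient Q u Du) (hX : X ⊆ Q) : HasWeakGradient X u Du := fun φ hφ => by
    rw [← IsTest.setIntegral_eq (fun p hp => by rw [hφ.dx_zero_off hp, smul_zero]) hX,
      ← IsTest.setIntegral_eq (fun p hp => by rw [hφ.zero_off hp, zero_smul]) hX]
    exact hu φ (hφ.mono hX)

lemma SolvesOn.cellSol (hu : SolvesOn a Q f e u Du) (hX : X ⊆ Q) (hXb : IsBounded X) (k : ℤ) :
    CellSol 1 a X k (fun φ => (-∫ p in X, inner ℝ (f p) (dx φ p)) + e φ) Du where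
  finE := hu.finE.mono ((cellUnion_subset hXb).trans hX)
  exists_sol i hi := by
    have hc := (mem_cells hXb).1 hi
    refine ⟨u, hu.integrable.mono_set (hc.trans hX), hu.weakGradient.mono (hc.trans hX), fun φ hφ => ?_⟩
    have e1 := hu.eqn φ (hφ.mono (hc.trans hX))
    have e2 : ∀ {Y}, cell k i ⊆ Y → ∫ p in Y, inner ℝ (f p) (dx φ p) = ∫ p in cell k i, inner ℝ (f p) (dx φ p) :=
      fun hY => IsTest.setIntegral_eq (fun p hp => by rw [hφ.dx_zero_off hp, inner_zero_right]) hY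
    rw [hφ.setIntegral_dt_eq (hc.trans hX), hφ.setIntegral_bil_eq (hc.trans hX), e2 (hc.trans hX)] at e1
    simp_all

lemma IsTest.wN_eq (h : IsCoefficientField a) (hQ : IsBounded Q) (hX : X ⊆ Q) (hφ : IsTest X φ) : wN
    a Q φ = wN a X φ := by
  have hf := h.finE_dx hQ hφ
  rw [wN, wN, h.eN_sq hf, h.eN_sq (hf.mono hX), IsTest.setIntegral_eq (fun p hp => by rw [hφ.zero_off hp, zero_mul]) hX]
  congr 2
  exact IsTest.setIntegral_eq (fun p hp => by rw [hφ.dx_zero_off hp, bil_zero_left]) hX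

namespace IsCoefficientField
variable [NeZero d] (h : IsCoefficientField a)
include h

/-- The pairing of the gradient of an approximate solution with a field of finite Besov norm. -/
lemma exists_abs_integral_grad_le (hQ : IsBounded Q) (hX : X ⊆ Q) (hXo : IsOpen X)
    (hs : GradScale a X w b S) (hm : cells X m = ∅)
    (hf : MemLp f 2 (𝓛 X)) (hM : OscBound X w f M) :
    ∃ C, 0 ≤ C ∧ ∀ H K, MemLp H 2 (𝓛 X) → OscBound X w H K → ∀ e c u Du, SolvesOn a Q f e u Du →
      MemLp Du 2 (𝓛 X) → IsLinearOn Q e → 0 ≤ c → (∀ φ, IsTest Q φ → |e φ| ≤ c * wN a Q φ) →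
      |∫ p in X, inner ℝ (H p) (Du p)| ≤ √K * √S * (eN a X Du + 6 * √M * √S + C * c) := by
  have hXb := hQ.subset hX
  obtain ⟨C, hC0, hC⟩ := h.exists_weighted_corrector hXb
  refine ⟨C, hC0, fun H K hH hK e c u Du hu hDu he hc hec => ?_⟩
  refine abs_le_of_tendsto_pairing hXb (integrableOn_of_memLp hXb hDu) (tendsto_pairing_l2 hXb hXo m hH hDu)
    (by simp [pairing, hm]) hs.nonneg hs.pos ?_ (fun j _ => ?_) (fun A _ => hK A) (fun A _ => hs.sum_le A)
  · have := eN_nonneg (a := a) (O := X) (ξ := Du)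
    positivity
  · have hj : cellUnion X j ⊆ Q := (cellUnion_subset hXb).trans hX
    obtain ⟨Dy, hy, hy0, hyle⟩ := hC j e c ⟨fun φ ψ hφ hψ => he.add φ ψ (hφ.mono hj) (hψ.mono hj),
      fun r φ hφ => he.smul r φ (hφ.mono hj)⟩ hc (fun φ hφ => by
        have := hec φ (hφ.mono hj)
        rwa [hφ.wN_eq h hQ hj] at this)
    refine (h.sum_grad_le hXb hs hf hM hy hy0 (hu.cellSol hX hXb j)).trans ?_
    have h0 := eN_nonneg (a := a) (O := cellUnion X j) (ξ := Du)
    have h1 := eN_nonneg (a := a) (O := cellUnion X j) (ξ := Dy)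
    have h2 := eN_mono (hu.finE.mono hX) (cellUnion_subset (k := j) hXb)
    exact mul_le_mul_of_nonneg_left (pow_le_pow_left₀ (by positivity) (by linarith) 2)
      (mul_nonneg (vol_pos j).le (hs.nonneg j))

/-- The pairing of the flux of a solution with a field of finite Besov norm. The field is truncated
since the flux is only integrable. -/
lemma abs_integral_flux_le (hQ : IsBounded Q) (hX : X ⊆ Q) (hXo : IsOpen X)
    (hs : GradScale a X w b S) {b' : ℤ → ℝ} {S' : ℝ} (hs' : FluxScale a X w b' S') (hm : cells X m = ∅)
    (hf : MemLp f 2 (𝓛 X)) (hM : OscBound X w f M)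
    (hu : SolvesOn a Q f (fun _ => 0) u Du) (hH : FinE a Q H)
    (hK : ∀ R : ℝ, 0 ≤ R → OscBound X w (fun p => ballProj R (H p)) K) :
    |∫ p in X, bil (a p) (H p) (Du p)| ≤ √K * √S' * (eN a X Du + 6 * √M * √S) := by
  have hXb := hQ.subset hX
  obtain ⟨N, _, hN⟩ := h.ellBdd hXb
  have hfl := h.integrable_flux hXb (hu.finE.mono hX)
  have hHi := h.integrable_bil hN (hH.mono hX) (hu.finE.mono hX)
  have key : ∀ n : ℕ, |∫ p in X, inner ℝ (ballProj n (H p)) (flux a Du p)| ≤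
      √K * √S' * (eN a X Du + 6 * √M * √S) := fun n => by
    refine abs_le_of_tendsto_pairing hXb hfl (tendsto_pairing_l1 hXb hXo m
      ((continuous_ballProj n.cast_nonneg).comp_aestronglyMeasurable (hH.mono hX).meas)
      (fun p => norm_ballProj_le n.cast_nonneg _) hfl)
      (by simp [pairing, hm]) hs'.nonneg hs'.pos ?_ (fun j _ => ?_) (fun A _ => hK n n.cast_nonneg A)
      (fun A _ => hs'.sum_le A)
    · have := eN_nonneg (a := a) (O := X) (ξ := Du)
      positivity
    · refine (h.sum_flux_le hXb hs hs' hf hM (by simpa only [add_zero] using hu.cellSol hX hXb j)).trans ?_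
      have h0 := eN_nonneg (a := a) (O := cellUnion X j) (ξ := Du)
      have h2 := eN_mono (hu.finE.mono hX) (cellUnion_subset (k := j) hXb)
      exact mul_le_mul_of_nonneg_left (pow_le_pow_left₀ (by positivity) (by linarith) 2)
        (mul_nonneg (vol_pos j).le (hs'.nonneg j))
  simp [inner_flux] at key
  refine le_of_tendsto (Tendsto.abs (tendsto_integral_of_dominated_convergence
    (F := fun n p => bil (a p) (ballProj n (H p)) (Du p)) (fun p => |bil (a p) (H p) (Du p)|)
    (fun n => ?_) hHi.abs (fun n => ae_of_all _ fun p => ?_) (ae_of_all _ fun p => ?_))) (Eventually.of_forall key)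
  · exact aestronglyMeasurable_bil h.measurable ((continuous_ballProj n.cast_nonneg).comp_aestronglyMeasurable
      (hH.mono hX).meas) (hu.finE.mono hX).meas
  · have h0 : |min 1 (n / ‖H p‖)| ≤ 1 := by
      rw [abs_of_nonneg (le_min zero_le_one (by positivity))]; exact min_le_left _ _
    rw [ballProj, bil_smul_left, norm_eq_abs, abs_mul]
    exact mul_le_of_le_one_left (abs_nonneg _) h0
  · obtain ⟨n, hn⟩ := exists_nat_ge ‖H p‖
    refine tendsto_const_nhds.congr' ((eventually_ge_atTop n).mono fun k hk => ?_)
    dsimp only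
    rw [ballProj_eq_self (hn.trans (Nat.cast_le.2 hk))]

end IsCoefficientField
end

section
variable {e : (SpaceTime d → ℝ) → ℝ}

/-! ### The energy inequality between two times -/

lemma IsTest.continuous_slice (hφ : IsTest (univ ×ˢ U) φ) (t : ℝ) : Continuous fun x => φ (t, x) :=
  hφ.continuous.comp (Continuous.prodMk_right t)

lemma IsTest.integrableOn_slice_sq (hφ : IsTest (univ ×ˢ U) φ) (hU : IsBounded U) (t : ℝ) :
    IntegrableOn (fun x => φ (t, x) ^ 2) U :=
  (((hφ.continuous_slice t).pow 2).continuousOn.integrableOn_compact hU.isCompact_closure).mono_set subset_closure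

lemma IsTest.setIntegral_mul_dt_self (hφ : IsTest (univ ×ˢ U) φ) (hU : IsBounded U) (ht : t₁ ≤ t₂) :
    ∫ p in Ioo t₁ t₂ ×ˢ U, φ p * CGParabolic.dt φ p =
      1 / 2 * (∫ x in U, φ (t₂, x) ^ 2) - 1 / 2 * ∫ x in U, φ (t₁, x) ^ 2 := by
  have hi' := (hφ.integrable_mul_test hφ.dt).integrableOn (s := Ioo t₁ t₂ ×ˢ U)
  rw [IntegrableOn, volume_eq_prod, ← prod_restrict] at hi'
  rw [volume_eq_prod, ← prod_restrict, integral_prod_symm _ hi', ← integral_const_mul,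
    ← integral_const_mul, ← integral_sub ((hφ.integrableOn_slice_sq hU _).const_mul _)
      ((hφ.integrableOn_slice_sq hU _).const_mul _)]
  refine integral_congr_ae (ae_of_all _ fun x => ?_)
  dsimp only
  rw [← integral_Ioc_eq_integral_Ioo, ← intervalIntegral.integral_of_le ht]
  have hd : ∀ t, HasDerivAt (fun t => φ (t, x)) (CGParabolic.dt φ (t, x)) t := fun t =>
    ((hφ.differentiable (t, x)).comp t (differentiableAt_id.prodMk (differentiableAt_const x))).hasDerivAt
  refine intervalIntegral.integral_eq_sub_of_hasDerivAt (f := fun t => 1 / 2 * φ (t, x) ^ 2) (fun t _ => ?_) ?_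
  · exact (((hd t).pow 2).const_mul (1 / 2)).congr_deriv (by ring)
  · exact ((hφ.continuous.mul hφ.dt.continuous).comp (Continuous.prodMk_left x)).intervalIntegrable _ _

/-- Testing the equation of `φ` with `φ`, multiplied by smooth approximations of the indicator
function of `(t₁,t₂)`. -/
lemma IsCoefficientField.energy_le (h : IsCoefficientField a) (hU : IsOpen U) (hUb : IsBounded U)
    (ht₁ : 0 < t₁) (ht : t₁ < t₂) (ht₂ : t₂ < T) (hφ : IsTest (univ ×ˢ U) φ)
    (hξ : FinE a (cyl T U) ξ)
    (hF : IntegrableOn F (cyl T U)) (hc : 0 ≤ c) (hec : ∀ χ, IsTest (cyl T U) χ → |e χ| ≤ c * wN a (cyl T U) χ)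
    (heq : ∀ χ, IsTest (cyl T U) χ → -(∫ p in cyl T U, φ p * dt χ p) + ∫ p in cyl T U,
      bil (a p) (dx χ p) (ξ p) = (-∫ p in cyl T U, inner ℝ (F p) (dx χ p)) + e χ) :
    (∫ p in Ioo t₁ t₂ ×ˢ U, bil (a p) (dx φ p) (ξ p)) + ∫ p in Ioo t₁ t₂ ×ˢ U,
        inner ℝ (F p) (dx φ p) ≤ 1 / 2 * (∫ x in U, φ (t₁, x) ^ 2) - 1 / 2 * (∫ x in U,
        φ (t₂, x) ^ 2) + c * wN a (cyl T U) φ := by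
  set Ω := cyl T U with hΩ
  set X := Ioo t₁ t₂ ×ˢ U with hX
  have hΩb : IsBounded Ω := isBounded_cyl hUb
  have hXΩ : X ⊆ Ω := subset_cyl ht₁.le ht₂.le
  obtain ⟨M, hM0, hM⟩ := h.ellBdd hΩb
  obtain ⟨B, hB0, hB⟩ := hφ.bounded_dx
  have hfφ := h.finE_dx hΩb hφ
  have i1 := hφ.integrable_mul_test hφ.dt
  have i2 := h.integrable_bil hM hfφ hξ
  have i3 := integrable_inner_of_bounded hF hφ.continuous_dx.aestronglyMeasurable hB
  have hadd : ∀ {f₁ f₂ f₃ : SpaceTime d → ℝ} {Y : Set (SpaceTime d)}, IntegrableOn f₁ Y →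
      IntegrableOn f₂ Y → IntegrableOn f₃ Y → ∫ p in Y, (f₁ p + f₂ p + f₃ p) = (∫ p in Y, f₁ p) +
      (∫ p in Y, f₂ p) + ∫ p in Y, f₃ p := fun {f₁ f₂ f₃ Y} h1 h2 h3 => by
    rw [integral_add (f := fun p => f₁ p + f₂ p) (h1.add h2) h3, integral_add h1 h2]
  -- bumps in time that converge to the indicator function of `(t₁, t₂)`
  let κ : ℕ → ContDiffBump ((t₁ + t₂) / 2) := fun n => ⟨(t₂ - t₁) / 2 * ((n + 1) / (n + 2)),
    (t₂ - t₁) / 2, mul_pos (by linarith) (by positivity), mul_lt_of_lt_one_right (by linarith)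
    ((div_lt_one (by positivity)).2 (by linarith))⟩
  have hκs : ∀ n, ContDiff ℝ ∞ fun p : SpaceTime d => κ n p.1 := fun n => (κ n).contDiff.comp contDiff_fst
  have hκ1 : ∀ n (t : ℝ), |κ n t| ≤ 1 := fun n t => by
    rw [abs_of_nonneg (κ n).nonneg]; exact (κ n).le_one
  have hχ : ∀ n, IsTest Ω fun p => κ n p.1 * φ p := fun n => by
    have h1 := hφ.mul_contDiff (hκs n)
    refine ⟨h1.smooth, h1.compact, fun p hp => ⟨?_, (h1.support hp).2⟩⟩
    have h2 : p.1 ∈ tsupport (κ n) := tsupport_comp_subset_preimage (κ n) continuous_fst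
      (closure_mono (Function.support_mul_subset_left _ _) hp)
    rw [(κ n).tsupport_eq, Metric.mem_closedBall, dist_eq, abs_le] at h2
    change -((t₂ - t₁) / 2) ≤ _ ∧ _ ≤ (t₂ - t₁) / 2 at h2
    exact ⟨by linarith, by linarith⟩
  have hdχ : ∀ n p, dx (fun p => κ n p.1 * φ p) p = κ n p.1 • dx φ p := fun n p => by
    rw [dx_mul ((hκs n).differentiable (by simp) p) (hφ.differentiable p), dx_comp_fst (κ n) p, smul_zero]
    simp
  let G := fun p => φ p * dt φ p + bil (a p) (dx φ p) (ξ p) + inner ℝ (F p) (dx φ p)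
  have hG := (i1.integrableOn.add i2).add i3
  have hle : ∀ n, ∫ p in Ω, κ n p.1 * G p ≤ c * wN a Ω φ := fun n => by
    have e1 := heq _ (hχ n)
    have e2 : ∫ p in Ω, φ p * dt (fun p => κ n p.1 * φ p) p = -∫ p in Ω, κ n p.1 * (φ p * dt φ p) := by
      rw [setIntegral_eq_integral_of_forall_compl_eq_zero fun p hp =>
        by rw [(hχ n).dt.zero_off hp, mul_zero], integral_mul_dt (hχ n) hφ.smooth]
      simp [← mul_assoc]
      rw [setIntegral_eq_integral_of_forall_compl_eq_zero fun p hp => by rw [(hχ n).zero_off hp, zero_mul]]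
    have hk : ∀ {f : SpaceTime d → ℝ}, IntegrableOn f Ω → IntegrableOn (fun p => κ n p.1 * f p) Ω :=
      fun hf => hf.bdd_mul (hκs n).continuous.aestronglyMeasurable (ae_of_all _ fun p => hκ1 n p.1)
    have e3 : ∫ p in Ω, κ n p.1 * G p = e fun p => κ n p.1 * φ p := by
      simp [hdχ, bil_smul_left, real_inner_smul_right] at e1
      simp [G, mul_add]
      rw [hadd (hk i1.integrableOn) (hk i2) (hk i3)]
      linarith
    rw [e3]
    refine (le_abs_self _).trans ((hec _ (hχ n)).trans (mul_le_mul_of_nonneg_left ?_ hc))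
    refine (pow_le_pow_iff_left₀ (sqrt_nonneg _) (sqrt_nonneg _) two_ne_zero).1 ?_
    rw [← wN, ← wN, ← (hχ n).l2_sq_add_eN_sq, ← hφ.l2_sq_add_eN_sq]
    refine add_le_add (pow_le_pow_left₀ (l2_nonneg _) (l2_mono (hφ.memLp _) (ae_of_all _ fun p =>
      ?_)) 2) (pow_le_pow_left₀ eN_nonneg (l2_mono hfφ.mem (ae_of_all _ fun p => ?_)) 2)
    · rw [norm_mul]
      exact mul_le_of_le_one_left (norm_nonneg _) (hκ1 n p.1)
    · rw [norm_nrm, norm_nrm, funext (hdχ n), nrm, bil_smul_left, bil_smul_right, ← mul_assoc,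
        sqrt_mul (mul_self_nonneg _), Real.sqrt_mul_self_eq_abs]
      exact mul_le_of_le_one_left (nrm_nonneg p) (hκ1 n p.1)
  have hlim : Tendsto (fun n => ∫ p in Ω, κ n p.1 * G p) atTop (𝓝 (∫ p in Ω, X.indicator G p)) := by
    refine tendsto_integral_of_dominated_convergence (fun p => |G p|) (fun n =>
      (hκs n).continuous.aestronglyMeasurable.mul hG.1) hG.abs (fun n => ae_of_all _ fun p => ?_)
      ((ae_restrict_iff' (isOpen_cyl hU).measurableSet).2 (ae_of_all _ fun p hp => ?_))
    · rw [norm_eq_abs, abs_mul]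
      exact mul_le_of_le_one_left (abs_nonneg _) (hκ1 n p.1)
    · by_cases hpX : p ∈ X
      · rw [indicator_of_mem hpX]
        have hpt : |p.1 - (t₁ + t₂) / 2| < (t₂ - t₁) / 2 := by
          rw [abs_lt]; constructor <;> linarith [hpX.1.1, hpX.1.2]
        have hl : Tendsto (fun n : ℕ => (t₂ - t₁) / 2 * ((n + 1) / (n + 2))) atTop (𝓝 ((t₂ - t₁) / 2)) := by
          have := (tendsto_const_nhds (x := 1)).sub
            ((tendsto_one_div_add_atTop_nhds_zero_nat (𝕜 := ℝ)).comp (tendsto_add_atTop_nat 1))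
          have := this.const_mul ((t₂ - t₁) / 2)
          rw [sub_zero, mul_one] at this
          refine this.congr fun n => ?_
          simp only [Function.comp_apply]; push_cast; field_simp; ring
        refine tendsto_const_nhds.congr' ((hl.eventually (lt_mem_nhds hpt)).mono fun n hn => ?_)
        dsimp only
        rw [(κ n).one_of_mem_closedBall (hn.le), one_mul]
      · rw [indicator_of_notMem hpX]
        refine tendsto_const_nhds.congr fun n => ?_
        rw [(κ n).zero_of_le_dist, zero_mul]
        by_contra! hlt
        rw [dist_eq, abs_lt] at hlt
        change -((t₂ - t₁) / 2) < _ ∧ _ < (t₂ - t₁) / 2 at hlt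
        exact (fun hh => hpX ⟨hh, hp.2⟩) ⟨by linarith, by linarith⟩
  have hfin := le_of_tendsto' hlim hle
  rw [setIntegral_indicator (isOpen_Ioo.prod hU).measurableSet, inter_eq_right.2 hXΩ] at hfin
  rw [hadd i1.integrableOn (i2.mono_set hXΩ) (i3.mono_set hXΩ), hφ.setIntegral_mul_dt_self hUb ht.le] at hfin
  linarith
end

section
variable {v : SpaceTime d → ℝ} {Dv : VecField d}

/-! ### Approximation by smooth functions in the parabolic energy space -/

lemma restrict_cyl (T : ℝ) (U : Set (Space d)) : (𝓛 (cyl T U) : Measure (SpaceTime d)) =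
    (𝓛 (Ioo 0 T)).prod (𝓛 U) := by
  rw [cyl, volume_eq_prod, prod_restrict]

lemma ae_memLp_slice (hv : MemLp v 2 (𝓛 (cyl T U))) : ∀ᵐ t ∂(𝓛 (Ioo 0 T)), MemLp (fun x => v (t, x)) 2 (𝓛 U) := by
  have h1 := hv.integrable_sq
  have h2 := hv.1
  rw [restrict_cyl] at h1 h2
  filter_upwards [h1.prod_right_ae, h2.prodMk_left] with t ht ht'
  exact (memLp_two_iff_integrable_sq ht').2 ht

lemma integrable_l2_slice (hv : MemLp v 2 (𝓛 (cyl T U))) :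
    Integrable (fun t => l2 (𝓛 U) (fun x => v (t, x)) ^ 2) (𝓛 (Ioo 0 T)) ∧
      ∫ t in Ioo 0 T, l2 (𝓛 U) (fun x => v (t, x)) ^ 2 = l2 (𝓛 (cyl T U)) v ^ 2 := by
  have h1 := hv.integrable_sq
  rw [restrict_cyl] at h1
  have hae : (fun t => l2 (𝓛 U) (fun x => v (t, x)) ^ 2) =ᵐ[𝓛 (Ioo 0 T)] fun t => ∫ x in U, v (t, x) ^ 2 := by
    filter_upwards [ae_memLp_slice hv] with t ht
    rw [l2_sq ht]
    simp
  refine ⟨h1.integral_prod_left.congr hae.symm, ?_⟩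
  rw [integral_congr_ae hae, l2_sq hv, restrict_cyl]
  simp
  rw [integral_prod _ h1]

lemma abs_l2_sub_l2_le {X : Type*} [MeasurableSpace X] {μ : Measure X} {f g : X → ℝ} (hf : MemLp f 2 μ)
    (hg : MemLp g 2 μ) : |l2 μ f - l2 μ g| ≤ l2 μ (fun x => g x - f x) := by
  have h1 := l2_add_le hf (hg.sub hf)
  have h2 := l2_add_le hg (hf.sub hg)
  rw [add_sub_cancel] at h1 h2
  have h3 : l2 μ (f - g) = l2 μ (g - f) := by rw [l2, l2, eLpNorm_sub_comm]
  change _ ≤ l2 μ (g - f)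
  rw [abs_le]
  constructor <;> linarith

/-- Approximating sequences, which converge also in `L²(U)` at almost every time. -/
lemma MemParabolic0.exists_approx (ha : IsCoefficientField a) (hU : IsBounded U) (hv : MemParabolic0 a T U v Dv) :
    MemLp v 2 (𝓛 (cyl T U)) ∧ FinE a (cyl T U) Dv ∧
    ∃ φ : ℕ → SpaceTime d → ℝ, (∀ n, IsTest (univ ×ˢ U) (φ n)) ∧
      Tendsto (fun n => l2 (𝓛 (cyl T U)) (fun p => v p - φ n p)) atTop (𝓝 0) ∧
      Tendsto (fun n => eN a (cyl T U) (fun p => dx (φ n) p - Dv p)) atTop (𝓝 0) ∧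
      (∀ n, dtDualNorm a (cyl T U) (fun p => v p - φ n p) ≠ ⊤) ∧
      Tendsto (fun n => (dtDualNorm a (cyl T U) (fun p => v p - φ n p)).toReal) atTop (𝓝 0) ∧
      ∀ᵐ t ∂(𝓛 (Ioo 0 T)), MemLp (fun x => v (t, x)) 2 (𝓛 U) ∧ Tendsto (fun n => l2 (𝓛 U) (fun x => φ n (t, x))) atTop
          (𝓝 (l2 (𝓛 U) (fun x => v (t, x)))) := by
  obtain ⟨φ, hφ, h1, h2⟩ := hv.approx
  obtain ⟨N, hN⟩ := eventually_atTop.1 ((h1.eventually_lt_const zero_lt_top).and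
    (h2.eventually_lt_const zero_lt_top))
  have hm : ∀ n, N ≤ n → MemLp (fun p => v p - φ n p) 2 (𝓛 (cyl T U)) ∧
      FinE a (cyl T U) (fun p => Dv p - dx (φ n) p) := fun n hn =>
    ha.memLp_finE_of_wNormSq (hv.meas.sub (hφ n).continuous.aestronglyMeasurable)
      (hv.meas_grad.sub (hφ n).continuous_dx.aestronglyMeasurable) (hN n hn).1
  have hvL : MemLp v 2 (𝓛 (cyl T U)) := by
    have := (hm N le_rfl).1.add ((hφ N).memLp _)
    rwa [show ((fun p => v p - φ N p) + φ N) = v by ext1 p; simp] at this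
  have hDv : FinE a (cyl T U) Dv := by
    simpa using ha.finE_add (hm N le_rfl).2 (ha.finE_dx (isBounded_cyl hU) (hφ N))
  obtain ⟨l1, l2'⟩ := ha.tendsto_of_wNormSq h1
  have hd : ∀ n, MemLp (fun p => v p - φ n p) 2 (𝓛 (cyl T U)) := fun n => hvL.sub ((hφ n).memLp _)
  have hmeas : TendstoInMeasure (𝓛 (Ioo 0 T))
      (fun n t => l2 (𝓛 U) (fun x => v (t, x) - φ n (t, x)) ^ 2) atTop (fun _ => 0) := by
    refine tendstoInMeasure_of_tendsto_eLpNorm one_ne_zero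
      (fun n => (integrable_l2_slice (hd n)).1.1) aestronglyMeasurable_const ?_
    have : ∀ n, eLpNorm ((fun t => l2 (𝓛 U) (fun x => v (t, x) - φ n (t, x)) ^ 2) - fun _ => 0) 1
        (𝓛 (Ioo 0 T)) = ofReal (l2 (𝓛 (cyl T U)) (fun p => v p - φ n p) ^ 2) := fun n => by
      rw [← (integrable_l2_slice (hd n)).2, eLpNorm_one_eq_lintegral_enorm,
        ofReal_integral_eq_lintegral_ofReal (integrable_l2_slice (hd n)).1 (ae_of_all _ fun t => sq_nonneg _)]
      refine lintegral_congr fun t => ?_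
      rw [Pi.sub_apply, sub_zero, Real.enorm_eq_ofReal (sq_nonneg _)]
    simp [this]
    simpa using (ENNReal.tendsto_ofReal (l1.pow 2))
  obtain ⟨ns, hns, hae⟩ := hmeas.exists_seq_tendsto_ae
  have hk : Tendsto (fun n => ns (n + N)) atTop atTop := hns.tendsto_atTop.comp (tendsto_add_atTop_nat N)
  have hkN : ∀ n, N ≤ ns (n + N) := fun n => (Nat.le_add_left _ _).trans (hns.id_le _)
  refine ⟨hvL, hDv, fun n => φ (ns (n + N)), fun n => hφ _, l1.comp hk, ?_, fun n => (hN _ (hkN n)).2.ne,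
    ((ENNReal.tendsto_toReal zero_ne_top).comp (h2.comp hk)), ?_⟩
  · simp [eN_sub_comm (η := Dv)]
    exact l2'.comp hk
  · filter_upwards [hae, ae_memLp_slice hvL] with t ht hvt
    refine ⟨hvt, ?_⟩
    have h3 := (ht.comp (tendsto_add_atTop_nat N)).sqrt
    simp [Real.sqrt_zero, sqrt_sq (l2_nonneg _)] at h3
    rw [tendsto_iff_norm_sub_tendsto_zero]
    refine squeeze_zero (fun n => norm_nonneg _) (fun n => ?_) h3
    refine abs_l2_sub_l2_le ?_ hvt
    have : IsFiniteMeasure (𝓛 U) := ⟨by simpa using hU.measure_lt_top⟩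
    obtain ⟨B, hB⟩ := (hφ (ns (n + N))).bounded
    exact MemLp.of_bound ((hφ _).continuous_slice t).aestronglyMeasurable B (ae_of_all _ fun x => hB _)
end

section
variable {b b' : ℤ → ℝ} {S' Mf Mg Mψ : ℝ}

/-! ### The energy inequality for solutions -/

/-- The energy inequality between almost all times `t₁ < t₂`, for the difference of the solution and
the boundary data. It is proved for the approximations `φ n + g` of `u`, which solve the equation up
to a functional `e n` that tends to zero. -/
lemma IsRegularCylinder.energy_inequality [NeZero d] (h : IsRegularCylinder T U m C)
    (ha : IsCoefficientField a) (hsol : IsSolution a T U f u₀ g Dg u Du)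
    (hwg : HasWeakGradient (cyl T U) g Dg)
    (hψ : ∀ φ, IsTest (cyl T U) φ → ∫ p in cyl T U, inner ℝ (Dψ p) (dx φ p) = ∫ p in cyl T U, g p * dt φ p)
    (hf : MemLp f 2 (𝓛 (cyl T U))) (hDg : MemLp Dg 2 (𝓛 (cyl T U)))
    (hDψ : MemLp Dψ 2 (𝓛 (cyl T U)))
    (hX : ∀ t₁ t₂, 0 ≤ t₁ → t₂ ≤ T → GradScale a (Ioo t₁ t₂ ×ˢ U) w b S ∧
      FluxScale a (Ioo t₁ t₂ ×ˢ U) w b' S' ∧ OscBound (Ioo t₁ t₂ ×ˢ U) w f Mf ∧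
      OscBound (Ioo t₁ t₂ ×ˢ U) w Dψ Mψ ∧
      ∀ R : ℝ, 0 ≤ R → OscBound (Ioo t₁ t₂ ×ˢ U) w (fun p => ballProj R (Dg p)) Mg) :
    FinE a (cyl T U) Du ∧ ∃ P : ℝ → Prop, (∀ᵐ t ∂(𝓛 (Ioo 0 T)), P t) ∧
      (∀ t, P t → MemLp (fun x => u (t, x) - g (t, x)) 2 (𝓛 U)) ∧
      ∀ t₁ t₂, 0 < t₁ → t₁ < t₂ → t₂ < T → P t₁ → P t₂ → eN a (Ioo t₁ t₂ ×ˢ U) Du ^ 2 +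
        1 / 2 * l2 (𝓛 U) (fun x => u (t₂, x) - g (t₂, x)) ^ 2 ≤ 1 / 2 * l2 (𝓛 U) (fun x =>
        u (t₁, x) - g (t₁, x)) ^ 2 +
          (√Mg * √S' + √Mf * √S + √Mψ * √S) * (eN a (Ioo t₁ t₂ ×ˢ U) Du + 6 * (√Mf * √S)) +
          (l2 (𝓛 (cyl T U)) f + l2 (𝓛 (cyl T U)) Dψ) * l2 (𝓛 (cyl T U)) Dg := by
  have hΩb : IsBounded (cyl T U) := isBounded_cyl h.isBounded
  obtain ⟨hvL, hDv, φ, hφ, hφ1, hφ2, hφ3, hφ4, hae⟩ := hsol.lateral.exists_approx ha h.isBounded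
  obtain ⟨huL, hDu⟩ := ha.memLp_finE_of_wNormSq hsol.mem.meas hsol.mem.meas_grad hsol.mem.finite
  set Ω := cyl T U with hΩ
  set μ := 𝓛 Ω with hμ
  have hΩf : IsFiniteMeasure μ := ⟨by simpa [hμ] using hΩb.measure_lt_top⟩
  obtain ⟨M, hM0, hM⟩ := ha.ellBdd hΩb
  have hgL : MemLp g 2 μ := by
    have := huL.sub hvL
    rwa [show u - (fun p => u p - g p) = g by ext1 p; simp] at this
  have hDgE : FinE a Ω Dg := by simpa using ha.finE_sub hDu hDv
  have hdφ := fun n => ha.finE_dx hΩb (hφ n)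
  have hi : ∀ {F : SpaceTime d → ℝ}, MemLp F 2 μ → IntegrableOn F Ω := fun hF => hF.integrable (by norm_num)
  have hrel := fun n => ha.finE_sub (hdφ n) hDv
  have hdL : ∀ n, MemLp (fun p => u p - g p - φ n p) 2 μ := fun n => hvL.sub ((hφ n).memLp _)
  let ξ := fun n p => dx (φ n) p + Dg p
  have hξ := fun n => ha.finE_add (hdφ n) hDgE
  have hξL : ∀ n, MemLp (ξ n) 2 μ := fun n => ((hφ n).memLp_dx _).add hDg
  -- the error in the equation when `u - g` is replaced by its smooth approximation `φ n`
  let e := fun n χ => (∫ p in Ω, (u p - g p - φ n p) * dt χ p) + ∫ p in Ω,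
    bil (a p) (dx χ p) (dx (φ n) p - (Du p - Dg p))
  set δ : ℕ → ℝ := fun n => eN a Ω (fun p => dx (φ n) p - (Du p - Dg p)) with hδ
  set c : ℕ → ℝ := fun n => (dtDualNorm a Ω (fun p => u p - g p - φ n p)).toReal + M * δ n with hc
  have hδ0 : ∀ n, 0 ≤ δ n := fun n => eN_nonneg
  have hc0 : ∀ n, 0 ≤ c n := fun n => add_nonneg toReal_nonneg (mul_nonneg hM0 (hδ0 n))
  have he : ∀ n, IsLinearOn Ω (e n) := fun n => by
    refine ⟨fun χ χ' hχ hχ' => ?_, fun r χ hχ => ?_⟩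
    · have e1 : ∀ p, dt (χ + χ') p = dt χ p + dt χ' p := fun p => dt_add (hχ.differentiable p) (hχ'.differentiable p)
      have e2 : ∀ p, dx (χ + χ') p = dx χ p + dx χ' p := fun p => dx_add (hχ.differentiable p) (hχ'.differentiable p)
      simp [e, e1, e2, mul_add, bil_add_left]
      rw [integral_add (hχ.dt.mul_integrableOn (hi (hdL n))) (hχ'.dt.mul_integrableOn (hi (hdL n))),
        integral_add (ha.integrable_bil hM (ha.finE_dx hΩb hχ) (hrel n))
        (ha.integrable_bil hM (ha.finE_dx hΩb hχ') (hrel n))]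
      ring
    · have e1 : ∀ p, dt (r • χ) p = r * dt χ p := fun p => dt_const_mul r (hχ.differentiable p)
      have e2 : ∀ p, dx (r • χ) p = r • dx χ p := fun p => dx_const_mul r (hχ.differentiable p)
      simp [e, e1, e2, mul_left_comm _ r, bil_smul_left]
      rw [integral_const_mul, integral_const_mul, mul_add]
  have hec : ∀ n χ, IsTest Ω χ → |e n χ| ≤ c n * wN a Ω χ := fun n χ hχ => by
    refine (abs_add_le _ _).trans ?_
    have e1 := ha.abs_integral_mul_dt_le hΩb (hφ3 n) hχ
    have e2 := ha.abs_integral_bil_le hM0 hM (ha.finE_dx hΩb hχ) (hrel n)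
    have e3 : eN a Ω (dx χ) ≤ wN a Ω χ := Real.le_sqrt_of_sq_le
      (le_add_of_nonneg_left (integral_nonneg fun p => mul_self_nonneg _))
    have e4 := mul_le_mul_of_nonneg_left (mul_le_mul_of_nonneg_right e3 (hδ0 n)) hM0
    nlinarith
  have hw : ∀ n, HasWeakGradient Ω (φ n) (dx (φ n)) := fun n χ hχ =>
    integral_smul_dx hχ h.isOpen_cyl (hφ n).smooth.contDiffOn (hχ.smul_dx_integrableOn
    (hφ n).integrable.integrableOn) (hχ.smul_integrableOn (hφ n).integrable_dx.integrableOn)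
  have hwv : HasWeakGradient Ω (fun p => u p - g p) (fun p => Du p - Dg p) := by
    refine HasWeakGradient.of_tendsto hw (fun n => (hφ n).integrable.integrableOn) (fun n =>
      (hφ n).integrable_dx.integrableOn) (hi hvL) (ha.integrableOn hΩb hDv) ?_
      (ha.tendsto_integral_norm_sub hΩb hdφ hDv hφ2)
    refine squeeze_zero (fun n => integral_nonneg fun p => norm_nonneg _) (fun n => ?_)
      (by simpa using hφ1.mul_const (l2 μ fun _ => (1 : ℝ)))
    have := integral_norm_mul_norm_le (hdL n) (memLp_const (1 : ℝ))
    simp at this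
    simp [norm_sub_rev (φ n _)]
    exact this
  have hadd : ∀ {y : SpaceTime d → ℝ} {Dy : VecField d}, HasWeakGradient Ω y Dy → IntegrableOn y Ω →
      IntegrableOn Dy Ω → HasWeakGradient Ω (fun p => y p + g p) (fun p => Dy p + Dg p) :=
      fun hy h1 h2 => by
    simpa only [one_mul, one_smul] using hy.add 1 hwg h1 (hi hgL) h2 (ha.integrableOn hΩb hDgE)
  have hin : ∀ {F G : VecField d}, MemLp F 2 μ → MemLp G 2 μ →
    IntegrableOn (fun p => inner ℝ (F p) (G p)) Ω := fun hF hG => integrable_inner hF hG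
  have hueq : ∀ χ, IsTest Ω χ → -(∫ p in Ω, u p * dt χ p) + ∫ p in Ω, bil (a p) (dx χ p) (Du p) =
      -∫ p in Ω, inner ℝ (f p) (dx χ p) := fun χ hχ => by
    rw [hsol.eqn χ hχ, integral_add (ha.integrable_bil hM (ha.finE_dx hΩb hχ) hDu) (hin hf (hχ.memLp_dx _))]
    ring
  have hSu : SolvesOn a Ω f (fun _ => 0) u Du := by
    refine ⟨hi huL, hDu, ?_, fun χ hχ => by rw [hueq χ hχ, add_zero]⟩
    simpa only [sub_add_cancel] using hadd hwv (hi hvL) (ha.integrableOn hΩb hDv)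
  have hSn : ∀ n, SolvesOn a Ω f (e n) (fun p => φ n p + g p) (ξ n) := fun n => by
    refine ⟨(hφ n).integrable.integrableOn.add (hi hgL), hξ n,
      hadd (hw n) (hφ n).integrable.integrableOn (hφ n).integrable_dx.integrableOn, fun χ hχ => ?_⟩
    have e1 : ∀ p, (φ n p + g p) * dt χ p = u p * dt χ p - (u p - g p - φ n p) * dt χ p := fun p => by ring
    have e2 : ∀ p, bil (a p) (dx χ p) (ξ n p) = bil (a p) (dx χ p) (Du p) +
        bil (a p) (dx χ p) (dx (φ n) p - (Du p - Dg p)) := fun p => by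
      rw [← bil_add_right]; congr 1; simp only [ξ]; abel
    simp only [e1, e2]
    rw [integral_sub (hχ.dt.mul_integrableOn (hi huL)) (hχ.dt.mul_integrableOn (hi (hdL n))),
      integral_add (ha.integrable_bil hM (ha.finE_dx hΩb hχ) hDu)
      (ha.integrable_bil hM (ha.finE_dx hΩb hχ) (hrel n)),
      ← hueq χ hχ]
    simp only [e]; ring
  have hfψ : MemLp (fun p => f p - Dψ p) 2 μ := hf.sub hDψ
  have heq : ∀ n χ, IsTest Ω χ → -(∫ p in Ω, φ n p * dt χ p) + ∫ p in Ω,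
      bil (a p) (dx χ p) (ξ n p) = (-∫ p in Ω, inner ℝ (f p - Dψ p) (dx χ p)) + e n χ :=
      fun n χ hχ => by
    have e1 := (hSn n).eqn χ hχ
    simp only [add_mul, inner_sub_left] at e1 ⊢
    rw [integral_add (hχ.dt.mul_integrableOn (hφ n).integrable.integrableOn)
      (hχ.dt.mul_integrableOn (hi hgL)), ← hψ χ hχ] at e1
    rw [integral_sub (hin hf (hχ.memLp_dx _)) (hin hDψ (hχ.memLp_dx _))]
    linarith
  refine ⟨hDu, _, hae, fun t ht => ht.1, fun t₁ t₂ ht₁ ht ht₂ hP₁ hP₂ => ?_⟩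
  obtain ⟨hs, hs', hMf, hMψ, hMg⟩ := hX t₁ t₂ ht₁.le ht₂.le
  set X := Ioo t₁ t₂ ×ˢ U with hXdef
  have hXΩ : X ⊆ Ω := subset_cyl ht₁.le ht₂.le
  have hXo : IsOpen X := isOpen_Ioo.prod h.isOpen
  have hXm : cells X m = ∅ := Finset.eq_empty_of_forall_notMem fun i hi =>
    (h.lt_of_cell_subset (((mem_cells (hΩb.subset hXΩ)).1 hi).trans hXΩ)).false
  have hres : 𝓛 X ≤ μ := restrict_mono hXΩ le_rfl
  obtain ⟨K, hK0, hK⟩ := ha.exists_abs_integral_grad_le hΩb hXΩ hXo hs hXm (hf.mono_measure hres) hMf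
  have hN : ∀ n, wN a Ω (φ n) ≤ l2 μ (φ n) + eN a Ω (dx (φ n)) := fun n => by
    have e1 := (hφ n).l2_sq_add_eN_sq (a := a) (Q := Ω)
    have e2 := l2_nonneg (μ := μ) (φ n)
    have e3 := eN_nonneg (a := a) (O := Ω) (ξ := dx (φ n))
    exact (pow_le_pow_iff_left₀ (sqrt_nonneg _) (by positivity) two_ne_zero).1 (by rw [← wN, ← e1]; nlinarith)
  have hmain : ∀ n, eN a X (ξ n) ^ 2 + 1 / 2 * l2 (𝓛 U) (fun x => φ n (t₂, x)) ^ 2 ≤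
    1 / 2 * l2 (𝓛 U) (fun x => φ n (t₁, x)) ^ 2 +
      (√Mg * √S' * (eN a X Du + 6 * √Mf * √S) + M * (eN a X Dg * δ n)) +
      (√Mf * √S + √Mψ * √S) * (eN a X (ξ n) + 6 * √Mf * √S + K * c n) + (l2 μ f + l2 μ Dψ) * l2 μ Dg +
      c n * (l2 μ (φ n) + eN a Ω (dx (φ n))) := fun n => by
    have e1 := ha.energy_le h.isOpen h.isBounded ht₁ ht ht₂ (hφ n) (hξ n)
      (hfψ.integrable (by norm_num)) (hc0 n) (hec n) (heq n)
    have hMX := IsCoefficientField.ellBdd_mono hM hXΩ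
    have hξX := (hξ n).mono hXΩ
    have hin' : ∀ {F G : VecField d}, MemLp F 2 μ → MemLp G 2 μ →
      IntegrableOn (fun p => inner ℝ (F p) (G p)) X := fun hF hG => (hin hF hG).mono_set hXΩ
    have e2 : ∫ p in X, bil (a p) (dx (φ n) p) (ξ n p) =
        eN a X (ξ n) ^ 2 - ((∫ p in X, bil (a p) (Dg p) (Du p)) + ∫ p in X,
        bil (a p) (Dg p) (dx (φ n) p - (Du p - Dg p))) := by
      have q1 := ha.integrable_bil hMX (hDgE.mono hXΩ) (hDu.mono hXΩ)
      have q2 := ha.integrable_bil hMX (hDgE.mono hXΩ) ((hrel n).mono hXΩ)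
      have q : ∀ p, bil (a p) (dx (φ n) p) (ξ n p) = bil (symPart (a p)) (ξ n p) (ξ n p) -
          (bil (a p) (Dg p) (Du p) + bil (a p) (Dg p) (dx (φ n) p - (Du p - Dg p))) := fun p => by
        rw [← bil_add_right, bil_symPart_self, show Du p + (dx (φ n) p - (Du p - Dg p)) =
          ξ n p by simp [ξ]; abel, ← bil_sub_left]
        simp [ξ]
      rw [ha.eN_sq hξX, ← integral_add q1 q2, integral_congr_ae (ae_of_all _ q)]
      exact integral_sub (ha.integrable_en hξX) (q1.add q2)
    have e3 : ∫ p in X, inner ℝ (f p - Dψ p) (dx (φ n) p) =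
        ((∫ p in X, inner ℝ (f p) (ξ n p)) - ∫ p in X, inner ℝ (Dψ p) (ξ n p)) -
        ((∫ p in X, inner ℝ (f p) (Dg p)) - ∫ p in X, inner ℝ (Dψ p) (Dg p)) := by
      have q : ∀ p, inner ℝ (f p - Dψ p) (dx (φ n) p) =
          (inner ℝ (f p) (ξ n p) - inner ℝ (Dψ p) (ξ n p)) - (inner ℝ (f p) (Dg p) - inner ℝ (Dψ p)
          (Dg p)) := fun p => by
        simp [ξ, inner_add_right, inner_sub_left]; ring
      rw [← integral_sub (hin' hf hDg) (hin' hDψ hDg), ← integral_sub (hin' hf (hξL n))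
        (hin' hDψ (hξL n)), integral_congr_ae (ae_of_all _ q)]
      exact integral_sub ((hin' hf (hξL n)).sub (hin' hDψ (hξL n))) ((hin' hf hDg).sub (hin' hDψ hDg))
    have hl2 : ∀ {F : VecField d}, MemLp F 2 μ → l2 (𝓛 X) F ≤ l2 μ F := fun hF => l2_mono_measure hF hres
    have hDgm := hDg.mono_measure hres
    have e4 := (abs_integral_inner_le (hf.mono_measure hres) hDgm).trans
      (mul_le_mul (hl2 hf) (hl2 hDg) (l2_nonneg _) (l2_nonneg _))
    have e5 := (abs_integral_inner_le (hDψ.mono_measure hres) hDgm).trans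
      (mul_le_mul (hl2 hDψ) (hl2 hDg) (l2_nonneg _) (l2_nonneg _))
    have e8 := (ha.abs_integral_bil_le hM0 hMX (hDgE.mono hXΩ) ((hrel n).mono hXΩ)).trans
      (mul_le_mul_of_nonneg_left (mul_le_mul_of_nonneg_left (eN_mono (hrel n) hXΩ) eN_nonneg) hM0)
    have e9 := mul_le_mul_of_nonneg_left (hN n) (hc0 n)
    have e10 : ∀ t, l2 (𝓛 U) (fun x => φ n (t, x)) ^ 2 = ∫ x in U, φ n (t, x) ^ 2 := fun t => by
      have : IsFiniteMeasure (𝓛 U) := ⟨by simpa using h.isBounded.measure_lt_top⟩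
      obtain ⟨B, hB⟩ := (hφ n).bounded
      rw [l2_sq (MemLp.of_bound ((hφ n).continuous_slice t).aestronglyMeasurable B (ae_of_all _ fun x => hB _))]
      simp
    rw [e10, e10]
    have f1 := (abs_le.1 e4).2
    have f2 := (abs_le.1 e5).1
    have f3 := (abs_le.1 (hK f Mf (hf.mono_measure hres) hMf _ _ _ _ (hSn n)
      ((hξL n).mono_measure hres) (he n) (hc0 n) (hec n))).1
    have f4 := (abs_le.1 (hK Dψ Mψ (hDψ.mono_measure hres) hMψ _ _ _ _ (hSn n)
      ((hξL n).mono_measure hres) (he n) (hc0 n) (hec n))).2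
    have f5 := (abs_le.1 e8).2
    have f6 := (abs_le.1 (ha.abs_integral_flux_le hΩb hXΩ hXo hs hs' hXm (hf.mono_measure hres) hMf hSu hDgE hMg)).2
    linarith
  have hδl := hφ2
  have hcl : Tendsto c atTop (𝓝 0) := by simpa using hφ4.add (hδl.const_mul M)
  have hEl : Tendsto (fun n => eN a X (ξ n)) atTop (𝓝 (eN a X Du)) := by
    refine ha.tendsto_eN (fun n => (hξ n).mono hXΩ) (hDu.mono hXΩ) (squeeze_zero (fun n => eN_nonneg) (fun n => ?_) hδl)
    rw [show (fun p => ξ n p - Du p) = fun p => dx (φ n) p - (Du p - Dg p) by ext1 p; simp [ξ]; abel]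
    exact eN_mono (hrel n) hXΩ
  have hNl : Tendsto (fun n => l2 μ (φ n) + eN a Ω (dx (φ n))) atTop (𝓝 (l2 μ (fun p => u p - g p) +
      eN a Ω (fun p => Du p - Dg p))) := by
    refine Tendsto.add ?_ (ha.tendsto_eN hdφ hDv hφ2)
    rw [tendsto_iff_norm_sub_tendsto_zero]
    exact squeeze_zero (fun n => norm_nonneg _) (fun n => abs_l2_sub_l2_le ((hφ n).memLp _) hvL) hφ1
  have hlim := le_of_tendsto_of_tendsto' ((hEl.pow 2).add ((hP₂.2.pow 2).const_mul (1 / 2)))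
    ((((((hP₁.2.pow 2).const_mul (1 / 2)).add ((tendsto_const_nhds).add
    ((hδl.const_mul (eN a X Dg)).const_mul M))).add (((hEl.add_const (6 * √Mf * √S)).add
      (hcl.const_mul K)).const_mul (√Mf * √S + √Mψ * √S))).add_const ((l2 μ f + l2 μ Dψ) * l2 μ Dg)).add
      (hcl.mul hNl)) hmain
  linarith
end

/-! ### Passage to the initial and final times -/

lemma exists_mem_Ioo_of_ae {x y : ℝ} (hxy : x < y) {P : ℝ → Prop} (hP : ∀ᵐ t ∂(𝓛 (Ioo x y)), P t) :
    ∃ t ∈ Ioo x y, P t := by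
  have : (ae (𝓛 (Ioo x y))).NeBot := ae_restrict_neBot.2 (by simp [hxy])
  obtain ⟨t, h1, h2⟩ := ((ae_restrict_mem measurableSet_Ioo).and hP).exists
  grind

lemma IsCoefficientField.eN_le_of_forall (ha : IsCoefficientField a) (hU : IsOpen U) (hT : 0 < T)
    (hDu : FinE a (cyl T U) Du) {B : ℝ} (hB : 0 ≤ B)
    (h : ∀ t₁ t₂, 0 < t₁ → t₁ < t₂ → t₂ < T → eN a (Ioo t₁ t₂ ×ˢ U) Du ≤ B) : eN a (cyl T U) Du ≤ B := by
  let X : ℕ → Set (SpaceTime d) := fun n => Ioo (T / (n + 3)) (T - T / (n + 3)) ×ˢ U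
  have hpos : ∀ n : ℕ, 0 < T / (n + 3) := fun n => by positivity
  have hle : ∀ n : ℕ, T / (n + 3) ≤ T / 3 := fun n => div_le_div_of_nonneg_left hT.le (by norm_num) (by simp)
  have hX : ∀ n, X n ⊆ cyl T U := fun n => subset_cyl (hpos n).le (by grind)
  have hmono : Monotone X := fun n k hnk => by
    have : T / (k + 3) ≤ T / (n + 3) := by gcongr
    exact prod_mono (Ioo_subset_Ioo this (by linarith)) le_rfl
  have hun : ⋃ n, X n = cyl T U := by
    refine subset_antisymm (iUnion_subset hX) fun p hp => mem_iUnion.2 ?_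
    obtain ⟨n, hn⟩ := exists_nat_gt (T / min p.1 (T - p.1))
    have h2 : T / (n + 3) < min p.1 (T - p.1) := by
      rw [div_lt_iff₀ (lt_min hp.1.1 (by linarith [hp.1.2]))] at hn
      rw [div_lt_iff₀ (by positivity)]
      nlinarith
    exact ⟨n, ⟨h2.trans_le (min_le_left _ _), by grind⟩, hp.2⟩
  have hlim := tendsto_setIntegral_of_monotone (fun n => (isOpen_Ioo.prod hU).measurableSet) hmono
    (by rw [hun]; exact ha.integrable_en hDu)
  rw [hun, ← ha.eN_sq hDu] at hlim
  refine (pow_le_pow_iff_left₀ eN_nonneg hB two_ne_zero).1 (le_of_tendsto' hlim fun n => ?_)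
  rw [← ha.eN_sq (hDu.mono (hX n))]
  exact pow_le_pow_left₀ eN_nonneg (h _ _ (hpos n) (by grind) (by simp_all)) 2

/-- The bounds for the energy and for almost all times, from the energy inequality between almost all
times and the initial condition. -/
lemma IsCoefficientField.bounds_of_energy_inequality (ha : IsCoefficientField a) (hU : IsOpen U) (hT : 0 < T)
    (hum : AEStronglyMeasurable u (𝓛 (cyl T U)))
    (hgm : AEStronglyMeasurable g (𝓛 (cyl T U))) (hu₀ : MemLp u₀ 2 (𝓛 U))
    (hinit : Tendsto (fun t => eLpNorm (fun x => u (t, x) - u₀ x) 2 (𝓛 U)) (𝓝[>] 0 ⊓ ae volume) (𝓝 0))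
    (hγ : 0 ≤ γ) (hg : ∀ᵐ t ∂(𝓛 (Ioo 0 T)), eLpNorm (fun x => g (t, x)) 2 (𝓛 U) ≤ ofReal γ)
    (hDu : FinE a (cyl T U) Du) (hA : 0 ≤ A) (hAY : A ≤ Y) (hD : 0 ≤ D) {P : ℝ → Prop}
    (hP : ∀ᵐ t ∂(𝓛 (Ioo 0 T)), P t)
    (hPm : ∀ t, P t → MemLp (fun x => u (t, x) - g (t, x)) 2 (𝓛 U))
    (hE : ∀ t₁ t₂, 0 < t₁ → t₁ < t₂ → t₂ < T → P t₁ → P t₂ →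
      eN a (Ioo t₁ t₂ ×ˢ U) Du ^ 2 + 1 / 2 * l2 (𝓛 U) (fun x => u (t₂, x) - g (t₂, x)) ^ 2 ≤
        1 / 2 * l2 (𝓛 U) (fun x => u (t₁, x) - g (t₁, x)) ^ 2 + Y * (eN a (Ioo t₁ t₂ ×ˢ U) Du + 6 * A) + D) :
    eN a (cyl T U) Du ≤ l2 (𝓛 U) u₀ + γ + √(14 * Y ^ 2 + 2 * D) ∧
    ∀ᵐ t ∂(𝓛 (Ioo 0 T)), eLpNorm (fun x => u (t, x)) 2 (𝓛 U) ≤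
      ofReal (l2 (𝓛 U) u₀ + γ + √(14 * Y ^ 2 + 2 * D) + γ) := by
  set W := l2 (𝓛 U) u₀ + γ with hW
  set Z := 14 * Y ^ 2 + 2 * D with hZ
  have hW0 : 0 ≤ W := add_nonneg (l2_nonneg _) hγ
  have hZ0 : 0 ≤ Z := by positivity
  rw [restrict_cyl] at hum hgm
  have hYE : ∀ t₁ t₂, 0 < t₁ → t₁ < t₂ → t₂ < T → P t₁ → P t₂ → eN a (Ioo t₁ t₂ ×ˢ U) Du ^ 2 +
      l2 (𝓛 U) (fun x => u (t₂, x) - g (t₂, x)) ^ 2 ≤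
        l2 (𝓛 U) (fun x => u (t₁, x) - g (t₁, x)) ^ 2 + Z := fun t₁ t₂ h1 h2 h3 h4 h5 => by
    have := hE t₁ t₂ h1 h2 h3 h4 h5
    nlinarith [mul_le_mul_of_nonneg_left hAY (hA.trans hAY)]
  have hstart : ∀ δ > 0, ∀ τ, 0 < τ → τ ≤ T → ∃ t ∈ Ioo 0 τ, P t ∧
      l2 (𝓛 U) (fun x => u (t, x) - g (t, x)) ≤ W + δ := fun δ hδ τ hτ hτT => by
    obtain ⟨s₁, hs₁, s₂, hs₂, hs⟩ := mem_inf_iff_superset.1 (hinit.eventually_lt_const (ENNReal.ofReal_pos.2 hδ))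
    obtain ⟨r, hr, hrs⟩ := mem_nhdsGT_iff_exists_Ioo_subset.1 hs₁
    have hsub : Ioo 0 (min r τ) ⊆ Ioo 0 T := Ioo_subset_Ioo_right ((min_le_right _ _).trans hτT)
    have hall := ((hP.and hg).and (hum.prodMk_left.and hgm.prodMk_left)).filter_mono
      (ae_mono (restrict_mono hsub le_rfl))
    obtain ⟨t, ht, ⟨⟨hPt, hgt⟩, hut, hgmt⟩, hts⟩ := exists_mem_Ioo_of_ae (lt_min hr hτ)
      (hall.and (ae_restrict_of_ae hs₂))
    have hlt := hs ⟨hrs ⟨ht.1, ht.2.trans_le (min_le_left _ _)⟩, hts⟩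
    refine ⟨t, ⟨ht.1, ht.2.trans_le (min_le_right _ _)⟩, hPt, ENNReal.toReal_le_of_le_ofReal (by positivity) ?_⟩
    have e1 : (fun x => u (t, x) - g (t, x)) = (fun x => u (t, x) - u₀ x) + u₀ - fun x => g (t, x) := by ext1 x; simp
    rw [e1]
    refine (eLpNorm_sub_le ((hut.sub hu₀.1).add hu₀.1) hgmt (by norm_num)).trans ?_
    refine (add_le_add (eLpNorm_add_le (hut.sub hu₀.1) hu₀.1 (by norm_num)) hgt).trans ?_
    rw [hW, ofReal_add (add_nonneg (l2_nonneg _) hγ) hδ.le, ofReal_add (l2_nonneg _) hγ, l2,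
      ofReal_toReal hu₀.2.ne]
    refine (add_le_add (add_le_add hlt.le le_rfl) le_rfl).trans (le_of_eq (by ring))
  have hfrom0 : ∀ t₁ t₂, 0 < t₁ → t₁ < t₂ → t₂ < T → P t₂ → eN a (Ioo t₁ t₂ ×ˢ U) Du ^ 2 +
      l2 (𝓛 U) (fun x => u (t₂, x) - g (t₂, x)) ^ 2 ≤ W ^ 2 + Z := fun t₁ t₂ h1 h2 h3 h5 => by
    have hl := ((tendsto_one_div_add_atTop_nhds_zero_nat.const_add W).pow 2).add_const Z
    rw [add_zero] at hl
    refine ge_of_tendsto' hl fun n => ?_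
    obtain ⟨t, ht, hPt, htle⟩ := hstart (1 / (n + 1)) (by positivity) t₁ h1 (h2.trans h3).le
    have e1 := hYE t t₂ ht.1 (ht.2.trans h2) h3 hPt h5
    have e2 := pow_le_pow_left₀ (l2_nonneg _) htle 2
    have e3 := pow_le_pow_left₀ eN_nonneg (eN_mono (hDu.mono (subset_cyl ht.1.le h3.le))
      (prod_mono (Ioo_subset_Ioo ht.2.le le_rfl) le_rfl)) 2
    linarith
  have hroot : ∀ {x : ℝ}, 0 ≤ x → x ^ 2 ≤ W ^ 2 + Z → x ≤ W + √Z := fun {x} hx hxle => by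
    refine (pow_le_pow_iff_left₀ hx (by positivity) two_ne_zero).1 (hxle.trans ?_)
    nlinarith [sq_sqrt hZ0, mul_nonneg hW0 (sqrt_nonneg Z)]
  constructor
  · refine ha.eN_le_of_forall hU hT hDu (by positivity) fun t₁ t₂ h1 h2 h3 => ?_
    obtain ⟨t, ht, hPt⟩ := exists_mem_Ioo_of_ae h3 (hP.filter_mono
      (ae_mono (restrict_mono (Ioo_subset_Ioo_left (h1.trans h2).le) le_rfl)))
    have e1 := hfrom0 t₁ t h1 (h2.trans ht.1) ht.2 hPt
    refine (eN_mono (hDu.mono (subset_cyl h1.le ht.2.le)) (prod_mono (Ioo_subset_Ioo le_rfl ht.1.le) le_rfl)).trans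
      (hroot eN_nonneg ?_)
    linarith [sq_nonneg (l2 (𝓛 U) (fun x => u (t, x) - g (t, x)))]
  · filter_upwards [hP, hg, hgm.prodMk_left, ae_restrict_mem measurableSet_Ioo] with t hPt hgt hgmt ht
    have e1 := hfrom0 (t / 2) t (by linarith [ht.1]) (by linarith [ht.1]) ht.2 hPt
    have e2 := hroot (l2_nonneg _) (by linarith [sq_nonneg (eN a (Ioo (t / 2) t ×ˢ U) Du)])
    have e3 : (fun x => u (t, x)) = (fun x => u (t, x) - g (t, x)) + fun x => g (t, x) := by ext1 x; simp
    rw [e3, ofReal_add (by positivity) hγ]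
    refine (eLpNorm_add_le (hPm t hPt).1 hgmt (by norm_num)).trans (add_le_add ?_ hgt)
    rw [← ofReal_toReal (hPm t hPt).2.ne]
    exact ofReal_le_ofReal e2

section
variable {βf βg βψ : ℝ}

/-! ### The energy estimate -/

lemma eLpNorm_avgMeasure {X E : Type*} [MeasureSpace X] [NormedAddCommGroup E] {V : Set X}
    (hV : 0 < volume.real V) (F : X → E) :
    eLpNorm F 2 (avgMeasure V) = ofReal (√(volume.real V))⁻¹ * eLpNorm F 2 (𝓛 V) := by
  have h0 : volume V = ofReal (volume.real V) := by
    rw [measureReal_def, ofReal_toReal fun h => by simp [measureReal_def, h] at hV]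
  rw [avgMeasure, eLpNorm_smul_measure_of_ne_top (by norm_num), smul_eq_mul, h0, ← ofReal_inv_of_pos hV,
    ENNReal.ofReal_rpow_of_pos (by positivity), Real.inv_rpow hV.le, Real.sqrt_eq_rpow]
  norm_num

lemma ofReal_l2 {X E : Type*} [MeasurableSpace X] [NormedAddCommGroup E] {μ : Measure X} {F : X → E}
    (hF : MemLp F 2 μ) : ofReal (l2 μ F) = eLpNorm F 2 μ := ofReal_toReal hF.2.ne

lemma IsCoefficientField.energyNorm_eq (ha : IsCoefficientField a)
    (hQ : 0 < volume.real Q) (hD : FinE a Q Du) :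
    energyNorm a Q Du = ofReal ((√(volume.real Q))⁻¹ * eN a Q Du) := by
  have h1 : ∫⁻ p, ofReal (bil (symPart (a p)) (Du p) (Du p)) ∂(avgMeasure Q) =
      eLpNorm (nrm a Du) 2 (avgMeasure Q) ^ 2 := by
    rw [eLpNorm_two_sq]
    refine lintegral_congr fun p => ?_
    rw [← ha.nrm_sq, ofReal_pow (nrm_nonneg p), ← norm_nrm p, ofReal_norm, norm_nrm]
  rw [energyNorm, h1, eLpNorm_avgMeasure hQ, ← ENNReal.rpow_natCast, ← ENNReal.rpow_mul,
    ofReal_mul (by positivity), eN, ofReal_l2 hD.mem]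
  norm_num

lemma sqrt_energy_data_le {G B K x y z : ℝ} (hA : 0 ≤ A) (hG : 0 ≤ G) (hB : 0 ≤ B) (hyK : y * z ≤ K)
    (hx : x * z ≤ 6 * (A * G)) (hy : 0 ≤ y * z) :
    √(14 * (G + A + B) ^ 2 + 2 * ((x + y) * z)) ≤ 6 * (G + A + B) + 3 / 2 * √K := by
  refine sqrt_le_iff.2 ⟨by positivity, ?_⟩
  have e4 : 0 ≤ (G + A + B) * √K := by positivity
  nlinarith [sq_sqrt (hy.trans hyK)]

/-- The energy estimate in real numbers, up to the normalisation of the norms. -/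
lemma IsRegularCylinder.energy_bounds [NeZero d] (h : IsRegularCylinder T U m C) (hH : 0 ≤ H)
    (ha : IsCoefficientField a) (h1 : ellSum (sStarInv a) s m ≠ ⊤) (h2 : ellSum (bMat a) s m ≠ ⊤)
    (hf : BesovData T U m s H f βf) (hDg : BesovData T U m s H Dg βg)
    (hDψ : BesovData T U m s H Dψ βψ) (hβf : 0 ≤ βf) (hβg : 0 ≤ βg) (hβψ : 0 ≤ βψ)
    (hu₀ : MemLp u₀ 2 (𝓛 U)) (hgm : AEStronglyMeasurable g (𝓛 (cyl T U)))
    (hwg : HasWeakGradient (cyl T U) g Dg)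
    (hψ : IsInvLaplacianDt T U g ψ Dψ) (hN : dtL2Hm1Norm T U g < ⊤) (hγ : 0 ≤ γ)
    (hg : ∀ᵐ t ∂(𝓛 (Ioo 0 T)), eLpNorm (fun x => g (t, x)) 2 (𝓛 U) ≤ ofReal γ)
    (hsol : IsSolution a T U f u₀ g Dg u Du) :
    ∃ B, FinE a (cyl T U) Du ∧ eN a (cyl T U) Du ≤ B ∧
        (∀ᵐ t ∂(𝓛 (Ioo 0 T)), eLpNorm (fun x => u (t, x)) 2 (𝓛 U) ≤ ofReal (B + γ)) ∧ B ≤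
        l2 (𝓛 U) u₀ + γ + 6 * (H * √d * √(volume.real (cyl T U)) *
        (3 ^ (s * m) * (√(ellSum (sStarInv a) s m).toReal * βf + √(ellSum (bMat a) s m).toReal *
        βg + √(ellSum (sStarInv a) s m).toReal * βψ))) +
        3 / 2 * √(√(4 * ((densConst d C ^ (-(1 / (d : ℝ)))) ^ 2 + 1)) * √(volume.real (cyl T U)) *
        (dtL2Hm1Norm T U g).toReal * l2 (𝓛 (cyl T U)) Dg) := by
  obtain ⟨⟨b, b', hb⟩, hone⟩ := h.exists_scales ha h1 h2
  have hE := h.energy_inequality ha hsol hwg hψ.2 hf.memLp hDg.memLp hDψ.memLp (fun t₁ t₂ ht₁ ht₂ =>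
    ⟨(hb t₁ t₂ ht₁ ht₂).1, (hb t₁ t₂ ht₁ ht₂).2, hf.osc t₁ t₂ ht₁ ht₂, hDψ.osc t₁ t₂ ht₁ ht₂,
    fun R hR => hDg.osc_trunc R hR t₁ t₂ ht₁ ht₂⟩)
  obtain ⟨hDu, P, hP, hPm, hE⟩ := hE
  set lam := (ellSum (sStarInv a) s m).toReal
  set Lam := (ellSum (bMat a) s m).toReal
  set μ := 𝓛 (cyl T U) with hμ
  set V := volume.real (cyl T U) with hV
  set t : ℝ := 3 ^ (s * m) with ht
  have ht0 : 0 < t := by positivity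
  have htt : 3 ^ (2 * s * m) = t ^ 2 := by
    rw [ht, ← rpow_natCast, ← rpow_mul (by norm_num)]; congr 1; ring
  have hc0 : ∀ {x y z : ℝ}, 0 ≤ x → 0 ≤ y → 0 ≤ z → 0 ≤ H * √d * √V * (x * (y * z)) := fun hx hy hz => by positivity
  have hroot : ∀ {β l : ℝ}, 0 ≤ β → √(H ^ 2 * V * β ^ 2) * √(d * 3 ^ (2 * s * m) * l) =
      H * √d * √V * (t * (√l * β)) := fun {β l} hβ => by
    rw [htt, sqrt_mul (by positivity), sqrt_mul (by positivity), sqrt_mul (by positivity),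
      sqrt_mul (by positivity), sqrt_sq hH, sqrt_sq hβ, sqrt_sq ht0.le]
    ring
  rw [hroot hβf, hroot hβg, hroot hβψ] at hE
  set A := H * √d * √V * (t * (√lam * βf)) with hA
  set G := H * √d * √V * (t * (√Lam * βg)) with hG
  set B := H * √d * √V * (t * (√lam * βψ)) with hB
  have hA0 : 0 ≤ A := hc0 ht0.le (sqrt_nonneg _) hβf
  have hG0 : 0 ≤ G := hc0 ht0.le (sqrt_nonneg _) hβg
  have hB0 : 0 ≤ B := hc0 ht0.le (sqrt_nonneg _) hβψ
  have hl : ∀ {F : VecField d}, 0 ≤ l2 μ F := fun {F} => l2_nonneg _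
  obtain ⟨r1, r2⟩ := ha.bounds_of_energy_inequality h.isOpen h.pos hsol.mem.meas hgm hu₀
    hsol.initial hγ hg hDu hA0 (by linarith) (mul_nonneg (add_nonneg hl hl) hl) hP hPm hE
  refine ⟨_, hDu, r1, r2, ?_⟩
  set K := √(4 * ((densConst d C ^ (-(1 / (d : ℝ)))) ^ 2 + 1)) * √V * (dtL2Hm1Norm T U g).toReal * l2 μ Dg with hK
  -- The product of the two ellipticity constants is bounded below, so this term is controlled by `A * G`.
  have hone' : 1 ≤ 6 * d * (√lam * √Lam) := by
    refine (one_le_sq_iff₀ (by positivity)).1 ?_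
    rw [mul_pow, mul_pow √lam, sq_sqrt toReal_nonneg, sq_sqrt toReal_nonneg]
    linarith
  have hfg : l2 μ f * l2 μ Dg ≤ 6 * (A * G) := by
    refine (mul_le_mul hf.l2_le hDg.l2_le hl (hl.trans hf.l2_le)).trans ?_
    have e1 : 6 * (A * G) = (H * √V * t * βf) * (H * √V * t * βg) * (6 * d * (√lam * √Lam)) := by
      linear_combination 6 * H ^ 2 * V * t ^ 2 * √lam * √Lam * βf * βg *
        (sq_sqrt (Nat.cast_nonneg d)) + 6 * H ^ 2 * t ^ 2 * √lam * √Lam * βf * βg * ((√d) ^ 2 - d) *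
        sq_sqrt measureReal_nonneg
    rw [e1]
    exact le_mul_of_one_le_right (by positivity) hone'
  have hZ := sqrt_energy_data_le hA0 hG0 hB0 (mul_le_mul_of_nonneg_right
    (h.l2_invLaplacian_le hψ hN hDψ.memLp) hl) hfg (mul_nonneg hl hl)
  linarith
end

lemma upperEll_rpow_half : upperEll a s 2 m ^ (1 / 2 : ℝ) = ellSum (bMat a) s m ^ (1 / 2 : ℝ) := by
  change (ellSum (bMat a) s m ^ (2 / 2)) ^ (1 / 2) = _
  simp

lemma lowerEll_rpow_neg_half : lowerEll a s 2 m ^ (-(1 / 2) : ℝ) = ellSum (sStarInv a) s m ^ (1 / 2 : ℝ) := by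
  change (ellSum (sStarInv a) s m ^ (-(2 / 2))) ^ (-(1 / 2)) = _
  rw [← ENNReal.rpow_mul]; norm_num

lemma rpow_half_eq_ofReal_sqrt {x : ℝ≥0∞} (hx : x ≠ ⊤) : x ^ (1 / 2 : ℝ) = ofReal (√x.toReal) := by
  rw [Real.sqrt_eq_rpow, ENNReal.toReal_rpow, ofReal_toReal (ENNReal.rpow_ne_top_of_nonneg (by norm_num) hx)]

lemma ofReal_rpow_neg_half (hT : 0 ≤ T) : T ^ (-(1 / 2) : ℝ) = (√T)⁻¹ := by
  rw [Real.rpow_neg hT, Real.sqrt_eq_rpow]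

end CGParabolic

open CGParabolic

theorem proposition5p2 (d : ℕ) [NeZero d] (s ε : ℝ) (hs : s ∈ Set.Ioo (0 : ℝ) (1 / 2))
    (hε : ε ∈ Set.Ioo 0 s) (T₀ : ℝ) (hT₀ : 0 < T₀) (U₀ : Set (Space d))
    (hU₀ : IsLipschitzDomain U₀) :
    ∃ C : ℝ≥0, ∀ (k : ℤ) (T : ℝ) (U : Set (Space d)),
      T = (3 : ℝ) ^ (2 * k) * T₀ → U = ((3 : ℝ) ^ k) • U₀ →
      ∀ m : ℤ, IsLeast {n : ℤ | cyl T U ⊆ cube 0 n} m →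
      ∀ a : MatField d, IsCoefficientField a →
      lowerEll a (s - ε) 2 m ≠ 0 → upperEll a s 2 m ≠ ⊤ →
      ∀ f : SpaceTime d → Space d, AEStronglyMeasurable f (volume.restrict (cyl T U)) →
      besovNorm s m (cyl T U) f < ⊤ →
      ∀ u₀ : Space d → ℝ, MemLp u₀ 2 (volume.restrict U) →
      ∀ (g : SpaceTime d → ℝ) (Dg : SpaceTime d → Space d)
        (ψ : SpaceTime d → ℝ) (Dψ : SpaceTime d → Space d),
      AEStronglyMeasurable g (volume.restrict (cyl T U)) →
      AEStronglyMeasurable Dg (volume.restrict (cyl T U)) →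
      HasWeakGradient (cyl T U) g Dg →
      IsInvLaplacianDt T U g ψ Dψ →
      supL2 T U g < ⊤ →
      besovNorm s m (cyl T U) Dg < ⊤ →
      besovNorm s m (cyl T U) Dψ < ⊤ →
      dtL2Hm1Norm T U g < ⊤ →
      ∀ (u : SpaceTime d → ℝ) (Du : SpaceTime d → Space d), IsSolution a T U f u₀ g Dg u Du →
      ENNReal.ofReal (T ^ (-(1 / 2) : ℝ)) * supL2 T U u + energyNorm a (cyl T U) Du ≤
        C * ENNReal.ofReal ((3 : ℝ) ^ (s * m)) * lowerEll a (s - ε) 2 m ^ (-(1 / 2) : ℝ)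
            * besovNorm s m (cyl T U) f
          + C * ENNReal.ofReal (T ^ (-(1 / 2) : ℝ)) * eLpNorm u₀ 2 (avgMeasure U)
          + C * ENNReal.ofReal (T ^ (-(1 / 2) : ℝ)) * supL2 T U g
          + C * ENNReal.ofReal ((3 : ℝ) ^ (s * m)) * upperEll a s 2 m ^ (1 / 2 : ℝ)
            * besovNorm s m (cyl T U) Dg
          + C * ENNReal.ofReal ((3 : ℝ) ^ (s * m)) * lowerEll a s 2 m ^ (-(1 / 2) : ℝ)
            * besovNorm s m (cyl T U) Dψ
          + C * eLpNorm Dg 2 (avgMeasure (cyl T U)) ^ (1 / 2 : ℝ)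
            * dtL2Hm1Norm T U g ^ (1 / 2 : ℝ) := by

  obtain ⟨C₀, hC₀⟩ := exists_isRegularCylinder hT₀ hU₀
  by_cases hC : 1 ≤ C₀
  swap
  · exact ⟨0, fun k T U hT hU m hm => absurd (hC₀ k T U hT hU m hm).one_le hC⟩
  obtain ⟨H, hH, hB⟩ := exists_besovData d hC hs
  obtain ⟨c, hc⟩ : ∃ c : ℝ≥0, 3 + 12 * (H * √d) +
    3 * √√(4 * ((densConst d C₀ ^ (-(1 / (d : ℝ)))) ^ 2 + 1)) ≤ c := ⟨_, Real.le_coe_toNNReal _⟩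
  refine ⟨c, fun k T U hT hU m hm a ha h1 h2 f hfm hf u₀ hu₀ g Dg ψ Dψ hgm hDgm hwg hψ hg hDg hDψ hN u Du hsol => ?_⟩
  have h := hC₀ k T U hT hU m hm
  replace hB := hB T U m h
  clear hT hU hm hC₀
  have hU := h.volume_real_pos
  rw [ofReal_rpow_neg_half h.pos.le]
  have hV : 0 < volume.real (cyl T U) := by rw [h.volume_real_cyl]; exact mul_pos h.pos hU
  have e1 : ellSum (sStarInv a) (s - ε) m ≠ ⊤ := fun hT => h1 (by
    change ellSum (sStarInv a) (s - ε) m ^ (-(2 / 2)) = 0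
    simp_all)
  have e2 : ellSum (bMat a) s m ≠ ⊤ := fun hT => h2 (by
    change ellSum (bMat a) s m ^ (2 / 2) = ⊤
    simp_all)
  have e3 : ellSum (sStarInv a) s m ≤ ellSum (sStarInv a) (s - ε) m := ellSum_anti (by grind)
  have e4 := ne_top_of_le_ne_top e1 e3
  set γ := (supL2 T U g).toReal * √(volume.real U) with hγ
  have hγ0 : 0 ≤ γ := by positivity
  have hUm : ∀ F : Space d → ℝ, eLpNorm F 2 (𝓛 U) = ofReal √(volume.real U) * eLpNorm F 2 (avgMeasure U) := fun F => by
    rw [eLpNorm_avgMeasure hU, ← mul_assoc, ← ofReal_mul (by positivity),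
      mul_inv_cancel₀ (sqrt_pos.2 hU).ne', ofReal_one, one_mul]
  have hgγ : ∀ᵐ t ∂(𝓛 (Ioo 0 T)), eLpNorm (fun x => g (t, x)) 2 (𝓛 U) ≤ ofReal γ := by
    filter_upwards [ENNReal.ae_le_essSup (fun t => eLpNorm (fun x => g (t, x)) 2 (avgMeasure U))] with t ht
    rw [hUm, hγ, mul_comm, ofReal_mul (by positivity), ofReal_toReal hg.ne]
    exact mul_le_mul_left ht _
  obtain ⟨B, hDu, hE, hut, hBle⟩ := h.energy_bounds hH ha e4 e2 (hB f hfm hf) (hB Dg hDgm hDg)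
    (hB Dψ (hψ.1.meas_grad) hDψ) toReal_nonneg toReal_nonneg toReal_nonneg hu₀ hgm hwg hψ hN hγ0 hgγ
    hsol
  have hB0 := eN_nonneg.trans hE
  set ν := (√(volume.real U))⁻¹ with hν
  set τ := (√T)⁻¹ with hτ
  have hν0 : 0 ≤ ν := by positivity
  have hτ0 : 0 ≤ τ := by positivity
  have hρ : (√(volume.real (cyl T U)))⁻¹ = τ * ν := by
    rw [h.volume_real_cyl, sqrt_mul h.pos.le, mul_inv]
  have hsup : supL2 T U u ≤ ofReal (ν * (B + γ)) := by
    refine essSup_le_of_ae_le _ (hut.mono fun t ht => ?_)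
    dsimp only
    rw [eLpNorm_avgMeasure hU, ofReal_mul hν0]
    exact mul_le_mul_right ht _
  have hsupg : supL2 T U g = ofReal (ν * γ) := by
    rw [hν, hγ, mul_comm _ √(volume.real U), inv_mul_cancel_left₀ (sqrt_pos.2 hU).ne', ofReal_toReal hg.ne]
  have hu₀n : eLpNorm u₀ 2 (avgMeasure U) = ofReal (ν * l2 (𝓛 U) u₀) := by
    rw [eLpNorm_avgMeasure hU, ofReal_mul hν0, ofReal_l2 hu₀]
  have hDgn : eLpNorm Dg 2 (avgMeasure (cyl T U)) = ofReal (τ * ν * l2 (𝓛 (cyl T U)) Dg) := by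
    rw [eLpNorm_avgMeasure hV, hρ, ofReal_mul (mul_nonneg hτ0 hν0), ofReal_l2 (hB Dg hDgm hDg).memLp]
  have hl0 : 0 ≤ l2 (𝓛 U) u₀ := l2_nonneg _
  have hG0 : 0 ≤ l2 (𝓛 (cyl T U)) Dg := l2_nonneg _
  have hlow : ofReal √(ellSum (sStarInv a) s m).toReal ≤ lowerEll a (s - ε) 2 m ^ (-(1 / 2) : ℝ) := by
    rw [lowerEll_rpow_neg_half, ← rpow_half_eq_ofReal_sqrt e4]
    exact ENNReal.rpow_le_rpow e3 (by norm_num)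
  have hc0 : (0 : ℝ) ≤ c := c.2
  rw [ha.energyNorm_eq hV hDu, hρ, upperEll_rpow_half, lowerEll_rpow_neg_half (s := s),
    rpow_half_eq_ofReal_sqrt e4, rpow_half_eq_ofReal_sqrt e2, hsupg, hu₀n, hDgn,
    rpow_half_eq_ofReal_sqrt ofReal_ne_top, toReal_ofReal (by positivity),
    rpow_half_eq_ofReal_sqrt hN.ne, ((ENNReal.ofReal_coe_nnreal).symm)]
  set lam := (ellSum (sStarInv a) s m).toReal
  set Lam := (ellSum (bMat a) s m).toReal
  set G := l2 (𝓛 (cyl T U)) Dg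
  set W := l2 (𝓛 U) u₀
  set N := (dtL2Hm1Norm T U g).toReal with hNdef
  rw [← ofReal_toReal hf.ne, ← ofReal_toReal hDg.ne, ← ofReal_toReal hDψ.ne]
  set βf := (besovNorm s m (cyl T U) f).toReal
  set βg := (besovNorm s m (cyl T U) Dg).toReal
  set βψ := (besovNorm s m (cyl T U) Dψ).toReal
  have hβf : 0 ≤ βf := toReal_nonneg
  have hβg : 0 ≤ βg := toReal_nonneg
  have hβψ : 0 ≤ βψ := toReal_nonneg
  set k := √(4 * ((densConst d C₀ ^ (-(1 / (d : ℝ)))) ^ 2 + 1))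
  have hk0 : 0 ≤ k := sqrt_nonneg _
  set t : ℝ := 3 ^ (s * m)
  have ht0 : 0 ≤ t := Real.rpow_nonneg (by norm_num) _
  set R := √(volume.real (cyl T U)) with hR
  have hRp : 0 < R := sqrt_pos.2 hV
  clear_value lam Lam G W N βf βg βψ k t R γ τ ν
  have hroot : τ * ν * √(k * R * N * G) = √k * (√(τ * ν * G) * √N) := by
    rw [← hρ, ← sqrt_sq (inv_pos.2 hRp).le, ← sqrt_mul (by positivity), ← sqrt_mul (by positivity),
      ← sqrt_mul hk0, sqrt_sq (inv_pos.2 hRp).le]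
    congr 1
    field_simp
  have hmain : τ * (ν * (B + γ)) + τ * ν * B ≤ c * t * √lam * βf + c * τ * (ν * W) +
      c * τ * (ν * γ) + c * t * √Lam * βg + c * t * √lam * βψ + c * √(τ * ν * G) * √N := by
    have hτν : 0 ≤ τ * ν := mul_nonneg hτ0 hν0
    have q := mul_le_mul_of_nonneg_left hBle hτν
    have q1 : τ * ν * R = 1 := by rw [← hρ, inv_mul_cancel₀ hRp.ne']
    set X := t * (√lam * βf + √Lam * βg + √lam * βψ) with hX
    have hX0 : 0 ≤ X := by positivity
    have q2 : τ * ν * (W + γ + 6 * (H * √d * R * X) + 3 / 2 * √(k * R * N * G)) = τ * ν * W +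
        τ * ν * γ + 6 * (H * √d) * X + 3 / 2 * (√k * (√(τ * ν * G) * √N)) := by
      linear_combination 6 * (H * √d) * X * q1 + 3 / 2 * hroot
    have hHd : 0 ≤ H * √d := by positivity
    have hk' := sqrt_nonneg k
    have c1 : 3 ≤ (c : ℝ) := by linarith
    have c2 : 12 * (H * √d) ≤ c := by linarith
    have c3 : 3 * √k ≤ c := by linarith
    have p1 := mul_le_mul_of_nonneg_right c1 (mul_nonneg hτν hl0)
    have p2 := mul_le_mul_of_nonneg_right c1 (mul_nonneg hτν hγ0)
    have p3 := mul_le_mul_of_nonneg_right c2 hX0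
    have p4 := mul_le_mul_of_nonneg_right c3 (mul_nonneg (sqrt_nonneg (τ * ν * G)) (sqrt_nonneg N))
    have p5 := mul_nonneg hτν hl0
    linarith
  refine (add_le_add_left (mul_le_mul_right hsup _) _).trans ?_
  rw [← ofReal_mul hτ0, ← ofReal_add (by positivity) (mul_nonneg (by positivity) eN_nonneg)]
  refine (ofReal_le_ofReal ((add_le_add_right (mul_le_mul_of_nonneg_left hE (by positivity)) _).trans hmain)).trans ?_
  have hterm : ofReal (c * t * √lam * βf) ≤ ofReal c * ofReal t * lowerEll a (s - ε) 2 m ^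
      (-(1 / 2) : ℝ) * ofReal βf := by
    rw [ofReal_mul (by positivity), ofReal_mul (by positivity), ofReal_mul hc0]
    gcongr
  repeat rw [ofReal_add (by positivity) (by positivity)]
  refine add_le_add (add_le_add (add_le_add (add_le_add (add_le_add hterm ?_) ?_) ?_) ?_) ?_ <;>
  · repeat rw [← ofReal_mul (by positivity)]
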